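/- Work in the piecewise linear category, with $S^3=\mathbb R^3\cup\{\infty\}$. **Setting.** Let $F_s\subset S^3$ be a slice surface description with a handle decomposition having at least one 0-handle. That is, $F_s$ consists of a ribbon-immersed surface $F_r$ formed by pairwise disjoint embedded 0-handles $m_i$ and pairwise disjoint embedded 1-handles $h_j$, all of whose ribbon singularities arise from 1-handles passing transversely through the interiors of 0-handles (the properly embedded arcs lie in the 1-handles and separate their two attaching arcs; the interior arcs lie in the 0-handles), together with pairwise disjoint embedded disks $d_i$ (the 2-handles), each bounded by a component of $\partial F_r$, otherwise disjoint from $\partial F_r$, and in general position with respect to $F_r$. In particular $\Gamma_i=d_i\cap F_r\supset\partial d_i$ is a graph whose interior vertices are 4-valent and are the transverse intersections of $d_i$ with ribbon singularities, and whose boundary vertices are 3-valent and are endpoints of ribbon singularities or pinch points. **Cellular disoriented complex.** A disorientation of $h_j$ is an orientation of the subarcs into which the ribbon singularities cut the core of $h_j$, such that consecutive subarcs are oppositely oriented; this gives the disoriented core $c_j$. A disorientation of $d_i$ is an orientation of $d_i$ together with a chessboard colouring of the faces of $\Gamma_i$. Let $b_i^\flat$ be the sum of the boundaries of the black faces minus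 the sum of the boundaries of the white faces. The complex $\mathcal{DC}_*(F_s^\flat)$ is $$\mathbb Z\langle d_i\rangle\xrightarrow{\partial_2^\flat}\mathbb Z\langle c_j\rangle\xrightarrow{\partial_1^\flat}\mathbb Z\langle m_i\rangle\xrightarrow{\varepsilon}\mathbb Z$$ in degrees $2,1,0,-1$. Here $\partial_1^\flat c_j$ is the signed count of the 0-handles that the subarcs of $c_j$ point into ($+$) or away from ($-$); the $c_j$-coefficient of $\partial_2^\flat d_i$ is the intersection number with $b_i^\flat$ of an attaching arc $a_j$ of $h_j$ oriented so that $a_j\cdot c_j=1$; and $\varepsilon(m_i)=1$. **Disoriented homology.** Near a ribbon singularity $r$, the local disoriented chain $\ell_r$ is the sum of two segments running along the 1-handle from either side into a point of $r$, and two segments running from that point along the 0-handle away from $r$ on its two sides. A disoriented cycle on a ribbon-immersed surface is a 1-cycle of the form $\sum_r n_r\ell_r+a'$ with $n_r\in\mathbb Z$ and $a'$ supported outside the chosen open balls around the ribbon singularities; $DH_1$ is the subgroup of $H_1$ of the immersed surface formed by the classes of disoriented cycles. Let the cut surface $F_c$ be obtained from $F_r$ by cutting along the properly embedded arcs of the ribbon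 singularities. Call a component of $F_c$ *special* if it is not a disk with two cuts on its boundary, or if it contains the interior arc of a ribbon singularity. Let $\mathcal V$ be a finite collection of virtual bands, that is, of pairwise disjoint oriented embedded bands meeting $F_r$ exactly in their two attaching arcs on $\partial F_r$, away from the ribbon singularities, such that 1. if $\mathcal V\ne\emptyset$, a band is attached to every special component of $F_c$; if $\mathcal V=\emptyset$, there is at most one special component; 2. the graph with vertices the components of $F_c$ to which bands are attached, and edges the bands, is connected; 3. every connected component of the abstract surface $F$ underlying $F_r$ contains a component of $F_c$ that is special or has a band attached. Let $G_r=F_r\cup\bigcup\mathcal V$. Let $N_i$ be disjoint small regular neighbourhoods of the $d_i$ whose boundary spheres $S_i$ are transverse to $F_r$. Orient $S_i$, choose a chessboard colouring of the faces of $S_i\cap F_r$ on $S_i$, and let $b_i$ be the boundary of the sum of the black faces. The complex $\mathcal{DC}_*(F_r,\mathcal V,\mathcal L_0)$ is $$\mathbb Z\langle d_i\rangle\to DH_1(G_r)\xrightarrow{\partial_{\mathcal V}}\mathbb Z\langle\mathcal V\rangle$$ in degrees $2,1,0$, where $d_i\mapsto\beta_i=[b_i]$ and $\partial_{\mathcal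 V}$ counts with sign how often a class passes over each virtual band. Its homology is the disoriented homology $DH_*(F_s)$. **Proposition.** Each $b_i$ is a 1-cycle on $F_r$ whose class lies in $DH_1(F_r)$, and both sequences above are chain complexes. For all choices as above (disorientations, $\mathcal V$, $N_i$, and orientations and colourings of the $S_i$), the complexes $\mathcal{DC}_*(F_s^\flat)$ and $\mathcal{DC}_*(F_r,\mathcal V,\mathcal L_0)$ are chain homotopy equivalent. In particular $$H_*(\mathcal{DC}_*(F_s^\flat))\cong DH_*(F_s).$$ If $\mathcal V$ consists of exactly one band $V_i$ from $m_i$ to a fixed 0-handle $m_0$ for each $i\neq0$, with both attaching arcs on those 0-handles and the band oriented towards $m_0$, then there is a chain homotopy equivalence $f_*$ with homotopy inverse $g_*$ such that: * $f_0(m_i)=V_i$ for $i\ne0$, $f_0(m_0)=0$, and $g_0(V_i)=m_i-m_0$; * $f_1(c_j)$ is represented by a disoriented cycle on $G_r$ that passes once over $h_j$ in the sense of $c_j$, and algebraically zero times over every other 1-handle of $F_r$; * $f_2(d_i)=\pm d_i$ for each $i$; * $g_1=f_1^{-1}$ and $g_2=f_2^{-1}$. -/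

import Mathlib

/-!
Conventions.  We work in the piecewise linear category in dimension three, with `S³ = ℝ³ ∪ {∞}`;
every compact surface in `S³` misses a point, so all polyhedra are taken in `ℝ³`.  Everything
(the handles of the surface, the disks, the virtual bands, the neighbourhoods of the disks) is a
subcomplex of one finite geometric simplicial complex `K` in `ℝ³`; as finitely many polyhedra have
a common triangulation, this is no restriction.  A subcomplex is recorded as its set of simplices,
so that intersection and union of subcomplexes are those of sets.
-/

namespace DisorientedHomology

section

open scoped Classical

/-! ### Triangulated polyhedra in `ℝ³` -/

/-- A finite geometric simplicial complex in `ℝ³`, with vertices labelled by `ι`. -/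
structure Triangulation (ι : Type) where
  complex : Geometry.SimplicialComplex ℝ (EuclideanSpace ℝ (Fin 3))
  pos : ι ↪ EuclideanSpace ℝ (Fin 3)
  labelled : ∀ s ∈ complex.faces, ∃ t : Finset ι, t.map pos = s

/-- Sets of (nonempty) finite vertex sets; subcomplexes are such sets. -/
abbrev Faces (ι : Type) := Set (Finset ι)

variable {ι : Type} [Fintype ι] [DecidableEq ι]

/-- The simplices of a triangulation, as sets of labels. -/
def Triangulation.faces (K : Triangulation ι) : Faces ι := {t | t.map K.pos ∈ K.complex.faces}

/-- `X` is closed under passing to nonempty faces. -/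
def IsSubcomplex (X : Faces ι) : Prop :=
  ∀ s ∈ X, s.Nonempty ∧ ∀ t ⊆ s, t.Nonempty → t ∈ X

/-- All nonempty faces of the simplices in `X`. -/
def closure (X : Faces ι) : Faces ι := {s | s.Nonempty ∧ ∃ t ∈ X, s ⊆ t}

/-- The two vertices are consecutive (in either order) in the list. -/
def Consecutive (l : List ι) (a b : ι) : Prop := [a, b] <:+: l ∨ [b, a] <:+: l

/-- A list closed up to a cycle: its first entry is repeated at the end. -/
def closeUp (l : List ι) : List ι := l ++ l.take 1

/-- The vertices and edges of an edge path. -/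
def pathFaces (l : List ι) : Faces ι :=
  {s | s.Nonempty ∧ ∃ a b, [a, b] <:+: l ∧ s ⊆ {a, b}}

/-- The list of vertices of an embedded edge path with at least one edge. -/
def IsArc (l : List ι) : Prop := l.Nodup ∧ 2 ≤ l.length

/-- The complex `X` is an embedded circle. -/
def IsCircle (X : Faces ι) : Prop :=
  ∃ l : List ι, l.Nodup ∧ 3 ≤ l.length ∧ X = pathFaces (closeUp l)

/-- The subcomplex generated by the edges of `X` that lie in exactly one triangle of `X`. -/
def bdry (X : Faces ι) : Faces ι :=
  {s | s.Nonempty ∧ ∃ e ∈ X, s ⊆ e ∧ e.card = 2 ∧ ∃! t, t ∈ X ∧ t.card = 3 ∧ e ⊆ t}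

/-- `X` is a triangulated compact surface (possibly with boundary): every simplex lies in a
triangle, and the link of every vertex is an arc or a circle. -/
structure IsSurface (X : Faces ι) : Prop where
  subcomplex : IsSubcomplex X
  nonempty : X.Nonempty
  card_le : ∀ s ∈ X, s.card ≤ 3
  pure : ∀ s ∈ X, ∃ t ∈ X, t.card = 3 ∧ s ⊆ t
  link : ∀ v, {v} ∈ X → ∃ l : List ι, l.Nodup ∧
    ((2 ≤ l.length ∧
        ∀ a b, (({v, a, b} : Finset ι) ∈ X ∧ ({v, a, b} : Finset ι).card = 3) ↔
          Consecutive l a b) ∨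
      (3 ≤ l.length ∧
        ∀ a b, (({v, a, b} : Finset ι) ∈ X ∧ ({v, a, b} : Finset ι).card = 3) ↔
          Consecutive (closeUp l) a b))

/-- Elementary simplicial collapse: `σ` is a free face of `τ`, and both are removed. -/
def ElementaryCollapse (X Y : Faces ι) : Prop :=
  ∃ σ ∈ X, ∃ τ ∈ X, σ ⊂ τ ∧ τ.card = σ.card + 1 ∧ (∀ ρ ∈ X, σ ⊂ ρ → ρ = τ) ∧ Y = X \ {σ, τ}

/-- `X` collapses simplicially to `Y`. -/
def Collapses (X Y : Faces ι) : Prop := Relation.ReflTransGen ElementaryCollapse X Y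

/-- `X` is a triangulated disk: a surface with one boundary circle that collapses to a vertex. -/
structure IsDisk (X : Faces ι) : Prop where
  surface : IsSurface X
  collapses : ∃ v, Collapses X {{v}}
  circle : IsCircle (bdry X)

/-- `X` is a triangulated 2-sphere: a closed surface that becomes a disk when an open triangle is
removed. -/
structure IsSphere (X : Faces ι) : Prop where
  surface : IsSurface X
  closed : bdry X = ∅
  disk : ∃ t ∈ X, t.card = 3 ∧ IsDisk (X \ {t})

/-- The link of the simplex `s` in `X` contains a circle on which the vertices `p, x, q, y` lie
in this cyclic order.  If `X` is a surface and `s` an interior vertex, or if `X` is a triangulated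
region of `ℝ³` and `s` an interior edge, then that circle is the whole link, and the condition says
that the pair `p, q` separates the pair `x, y` in it. -/
def Crosses (X : Faces ι) (s : Finset ι) (p q x y : ι) : Prop :=
  ∃ l₁ l₂ l₃ l₄ : List ι, ∃ l : List ι, l = p :: l₁ ++ x :: l₂ ++ q :: l₃ ++ y :: l₄ ∧
    l.Nodup ∧ (∀ v ∈ l, v ∉ s) ∧
    ∀ a b, Consecutive (closeUp l) a b → s ∪ {a, b} ∈ X

/-! ### Simplicial chains and homology -/

/-- Simplicial 1-chains supported on the edges in `X`: the coefficient of the oriented edge `uv`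
is `c u v = - c v u`. -/
def Chain1 (X : Faces ι) : Submodule ℤ (ι → ι → ℤ) where
  carrier := {c | (∀ u v, c u v = - c v u) ∧ ∀ u v, ({u, v} : Finset ι) ∉ X → c u v = 0}
  add_mem' := by
    rintro a b ⟨ha, ha'⟩ ⟨hb, hb'⟩
    refine ⟨fun u v => ?_, fun u v h => ?_⟩
    · simp only [Pi.add_apply]; rw [ha u v, hb u v]; ring
    · simp [ha' u v h, hb' u v h]
  zero_mem' := by simp
  smul_mem' := by
    rintro k a ⟨ha, ha'⟩
    refine ⟨fun u v => ?_, fun u v h => ?_⟩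
    · simp only [Pi.smul_apply, smul_eq_mul]; rw [ha u v]; ring
    · simp [ha' u v h]

/-- Simplicial 2-chains supported on the triangles in `X`, as alternating functions. -/
def Chain2 (X : Faces ι) : Submodule ℤ (ι → ι → ι → ℤ) where
  carrier := {c | (∀ u v w, c u v w = - c v u w) ∧ (∀ u v w, c u v w = - c u w v) ∧
    ∀ u v w, ({u, v, w} : Finset ι) ∉ X → c u v w = 0}
  add_mem' := by
    rintro a b ⟨ha, ha', ha''⟩ ⟨hb, hb', hb''⟩
    refine ⟨fun u v w => ?_, fun u v w => ?_, fun u v w h => ?_⟩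
    · simp only [Pi.add_apply]; rw [ha u v, hb u v]; ring
    · simp only [Pi.add_apply]; rw [ha' u v, hb' u v]; ring
    · simp [ha'' u v w h, hb'' u v w h]
  zero_mem' := by simp
  smul_mem' := by
    rintro k a ⟨ha, ha', ha''⟩
    refine ⟨fun u v w => ?_, fun u v w => ?_, fun u v w h => ?_⟩
    · simp only [Pi.smul_apply, smul_eq_mul]; rw [ha u v]; ring
    · simp only [Pi.smul_apply, smul_eq_mul]; rw [ha' u v]; ring
    · simp [ha'' u v w h]

/-- The boundary of a 1-chain. -/
def bd1 : (ι → ι → ℤ) →ₗ[ℤ] (ι → ℤ) where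
  toFun c := fun v => ∑ u, c u v
  map_add' a b := by funext v; simp [Finset.sum_add_distrib]
  map_smul' k a := by funext v; simp [Finset.mul_sum]

/-- The boundary of a 2-chain. -/
def bd2 : (ι → ι → ι → ℤ) →ₗ[ℤ] (ι → ι → ℤ) where
  toFun c := fun u v => ∑ w, c u v w
  map_add' a b := by funext u v; simp [Finset.sum_add_distrib]
  map_smul' k a := by funext u v; simp [Finset.mul_sum]

/-- The 1-cycles on `X`. -/
def Z1 (X : Faces ι) : Submodule ℤ (ι → ι → ℤ) := Chain1 X ⊓ LinearMap.ker bd1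

/-- The 1-boundaries on `X`. -/
def B1 (X : Faces ι) : Submodule ℤ (ι → ι → ℤ) := (Chain2 X).map bd2

/-- The first integral homology group of `X`. -/
abbrev H1 (X : Faces ι) : Type := Z1 X ⧸ (B1 X).comap (Z1 X).subtype

/-- The homology class of a 1-cycle. -/
abbrev H1.mk (X : Faces ι) : Z1 X →ₗ[ℤ] H1 X := ((B1 X).comap (Z1 X).subtype).mkQ

/-- The 1-chain that runs once along an embedded edge path. -/
noncomputable def pathChain (l : List ι) : ι → ι → ℤ := fun u v =>
  (if [u, v] <:+: l then 1 else 0) - (if [v, u] <:+: l then 1 else 0)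

/-- Let `A` be an arc in the boundary of a disk `X`.  `flow A X z` is the signed number of times
the 1-chain `z` crosses `A` (pushed slightly into `X`), leaving `A` and entering `X`. -/
noncomputable def flow (A : List ι) (X : Faces ι) : (ι → ι → ℤ) →ₗ[ℤ] ℤ where
  toFun z := ∑ u, ∑ w, if u ∈ A ∧ w ∉ A ∧ ({u, w} : Finset ι) ∈ X then z u w else 0
  map_add' a b := by
    simp only [← Finset.sum_add_distrib]
    refine Finset.sum_congr rfl fun u _ => Finset.sum_congr rfl fun w _ => ?_
    split_ifs <;> simp
  map_smul' k a := by
    simp only [Finset.smul_sum, RingHom.id_apply]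
    refine Finset.sum_congr rfl fun u _ => Finset.sum_congr rfl fun w _ => ?_
    split_ifs <;> simp

/-- An orientation of the surface `X`, given by its fundamental chain: coefficient `±1` on every
triangle, and boundary supported on `bdry X`. -/
def IsOrientation (X : Faces ι) (o : ι → ι → ι → ℤ) : Prop :=
  o ∈ Chain2 X ∧
  (∀ u v w, ({u, v, w} : Finset ι) ∈ X → ({u, v, w} : Finset ι).card = 3 →
    o u v w = 1 ∨ o u v w = -1) ∧
  ∀ u v, ({u, v} : Finset ι) ∉ bdry X → bd2 o u v = 0

/-- `black` is the set of black triangles of a chessboard colouring of the faces of the graph `Γ`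
on the surface `X`: the colour changes across the edges of `Γ` and nowhere else. -/
def IsChessboard (X Γ black : Faces ι) : Prop :=
  ∀ t ∈ X, ∀ t' ∈ X, t.card = 3 → t'.card = 3 → (t ∩ t').card = 2 →
    ((t ∈ black ↔ t' ∈ black) ↔ t ∩ t' ∉ Γ)

/-- The part of a 2-chain that lies on the triangles in `Y`. -/
noncomputable def restrict (o : ι → ι → ι → ℤ) (Y : Faces ι) : ι → ι → ι → ℤ := fun u v w =>
  if ({u, v, w} : Finset ι) ∈ Y then o u v w else 0

/-! ### Ribbon-immersed surfaces with a handle decomposition -/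

/-- A ribbon-immersed surface `F_r` in `ℝ³ ⊂ S³`, with a handle decomposition into 0-handles
(indexed by `Z`) and 1-handles (indexed by `J`) all of whose ribbon singularities are formed by
1-handles passing through 0-handles.

The 1-handle `j` has `n j` ribbon singularities, whose properly embedded arcs cut it into `n j + 1`
rectangles `R j 0, …, R j (n j)`, in the order in which they are met along the core.  The arcs
`A j 0, …, A j (n j + 1)` are the initial attaching arc, the `n j` ribbon singularities, and the
final attaching arc, so that `R j s` runs from `A j s` to `A j (s + 1)`.  The arc `A j k` lies in
the 0-handle `z j k`. -/
structure RibbonSurface (K : Triangulation ι) (Z J : Type) where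
  m : Z → Faces ι
  n : J → ℕ
  R : ∀ j, Fin (n j + 1) → Faces ι
  A : ∀ j, Fin (n j + 2) → List ι
  z : ∀ j, Fin (n j + 2) → Z
  m_sub : ∀ i, m i ⊆ K.faces
  m_disk : ∀ i, IsDisk (m i)
  m_disj : ∀ i i', i ≠ i' → m i ∩ m i' = ∅
  R_sub : ∀ j s, R j s ⊆ K.faces
  R_disk : ∀ j s, IsDisk (R j s)
  A_arc : ∀ j k, IsArc (A j k)
  A_left : ∀ j (s : Fin (n j + 1)), pathFaces (A j s.castSucc) ⊆ bdry (R j s)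
  A_right : ∀ j (s : Fin (n j + 1)), pathFaces (A j s.succ) ⊆ bdry (R j s)
  A_disj : ∀ j (s : Fin (n j + 1)), (A j s.castSucc).Disjoint (A j s.succ)
  R_next : ∀ j (r : Fin (n j)), R j r.castSucc ∩ R j r.succ = pathFaces (A j r.succ.castSucc)
  R_far : ∀ j (s s' : Fin (n j + 1)), s.val + 1 < s'.val → R j s ∩ R j s' = ∅
  R_disj : ∀ j j', j ≠ j' → ∀ s s', R j s ∩ R j' s' = ∅
  /-- The ends of a 1-handle are attached to the boundaries of 0-handles. -/
  attach_first : ∀ j, pathFaces (A j 0) ⊆ bdry (m (z j 0))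
  attach_last : ∀ j, pathFaces (A j (Fin.last _)) ⊆ bdry (m (z j (Fin.last _)))
  /-- The ribbon singularities lie in the interiors of 0-handles. -/
  ribbon_sub : ∀ j (r : Fin (n j)),
    pathFaces (A j r.succ.castSucc) ⊆ m (z j r.succ.castSucc) \ bdry (m (z j r.succ.castSucc))
  /-- There are no other intersections of 1-handles with 0-handles. -/
  R_inter_m : ∀ j (s : Fin (n j + 1)) i, R j s ∩ m i =
    {t | (t ∈ pathFaces (A j s.castSucc) ∧ z j s.castSucc = i) ∨
      (t ∈ pathFaces (A j s.succ) ∧ z j s.succ = i)}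
  /-- At a ribbon singularity the 1-handle crosses the 0-handle transversely. -/
  ribbon_cross : ∀ j (r : Fin (n j)) u v, [u, v] <:+: A j r.succ.castSucc →
    ∃ p q x y, {u, v, p} ∈ R j r.castSucc ∧ {u, v, q} ∈ R j r.succ ∧
      {u, v, x} ∈ m (z j r.succ.castSucc) ∧ {u, v, y} ∈ m (z j r.succ.castSucc) ∧
      Crosses K.faces {u, v} p q x y

namespace RibbonSurface

variable {K : Triangulation ι} {Z J : Type} (F : RibbonSurface K Z J)

/-- The ribbon-immersed surface, as a subcomplex. -/
def space : Faces ι := (⋃ i, F.m i) ∪ ⋃ j, ⋃ s, F.R j s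

/-- The ribbon singularities. -/
abbrev Ribbon : Type := Σ j : J, Fin (F.n j)

/-- The double arc of a ribbon singularity. -/
abbrev arc (r : F.Ribbon) : List ι := F.A r.1 r.2.succ.castSucc

/-- The 0-handle that contains the interior arc of a ribbon singularity. -/
abbrev disk (r : F.Ribbon) : Z := F.z r.1 r.2.succ.castSucc

/-- The rectangles of the 1-handle before and after a ribbon singularity. -/
abbrev before (r : F.Ribbon) : Faces ι := F.R r.1 r.2.castSucc
abbrev after (r : F.Ribbon) : Faces ι := F.R r.1 r.2.succ

/-- The vertex `v` is not on a ribbon singularity, and exactly two edges of `X ∩ F_r` meet in it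
(an ordinary double point of `X` and `F_r`). -/
def DoublePoint (X : Faces ι) (v : ι) : Prop :=
  (∀ r, v ∉ F.arc r) ∧ {w | w ≠ v ∧ ({v, w} : Finset ι) ∈ X ∩ F.space}.ncard = 2

/-- The vertex `v` is an interior point of a ribbon singularity `r` that is crossed transversely by
the surface `X`: four edges of `X ∩ F_r` meet in `v`, one in each of the two rectangles of the
1-handle, two in the 0-handle, and the former separate the latter in the link of `v` in `X`. -/
def TriplePoint (X : Faces ι) (v : ι) : Prop :=
  ∃ r, v ∈ F.arc r ∧ (F.arc r).head? ≠ some v ∧ (F.arc r).getLast? ≠ some v ∧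
    ∃ p q x y, {w | w ≠ v ∧ ({v, w} : Finset ι) ∈ X ∩ F.space} = {p, q, x, y} ∧
      {v, p} ∈ F.before r ∧ {v, q} ∈ F.after r ∧
      {v, x} ∈ F.m (F.disk r) ∧ {v, y} ∈ F.m (F.disk r) ∧ Crosses X {v} p q x y

end RibbonSurface

/-! ### Local disoriented chains and the first disoriented homology group -/

/-- For every ribbon singularity `r`, the part of `F_r` in a small ball around it: a square `M r` in
the interior of the 0-handle, and strips `Qb r`, `Qa r` of the 1-handle on the two sides of the
singular arc, cut off from the 1-handle by the arcs `Tb r`, `Ta r`; and in these the four segments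
of the local disoriented chain, two (`vb r`, `va r`) running from the ends of the strips to a
point `c r` of the singularity, and two (`hx r`, `hy r`) running from `c r` to the boundary of the
square, on opposite sides of the singular arc. -/
structure LocalCharts {K : Triangulation ι} {Z J : Type} (F : RibbonSurface K Z J) where
  M : F.Ribbon → Faces ι
  Qb : F.Ribbon → Faces ι
  Qa : F.Ribbon → Faces ι
  Tb : F.Ribbon → List ι
  Ta : F.Ribbon → List ι
  M_disk : ∀ r, IsDisk (M r)
  M_sub : ∀ r, M r ⊆ F.m (F.disk r) \ bdry (F.m (F.disk r))
  arc_sub : ∀ r, pathFaces (F.arc r) ⊆ M r \ bdry (M r)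
  Qb_disk : ∀ r, IsDisk (Qb r)
  Qa_disk : ∀ r, IsDisk (Qa r)
  Qb_sub : ∀ r, pathFaces (F.arc r) ⊆ Qb r ∧ Qb r ⊆ F.before r
  Qa_sub : ∀ r, pathFaces (F.arc r) ⊆ Qa r ∧ Qa r ⊆ F.after r
  Qb_other : ∀ r, Qb r ∩ pathFaces (F.A r.1 r.2.castSucc.castSucc) = ∅
  Qa_other : ∀ r, Qa r ∩ pathFaces (F.A r.1 r.2.succ.succ) = ∅
  T_arc : ∀ r, IsArc (Tb r) ∧ IsArc (Ta r)
  Tb_frontier : ∀ r, Qb r ∩ closure (F.before r \ Qb r) = pathFaces (Tb r)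
  Ta_frontier : ∀ r, Qa r ∩ closure (F.after r \ Qa r) = pathFaces (Ta r)
  T_disj : ∀ r, (Tb r).Disjoint (F.arc r) ∧ (Ta r).Disjoint (F.arc r)
  disj : ∀ r r', r ≠ r' → (M r ∪ Qb r ∪ Qa r) ∩ (M r' ∪ Qb r' ∪ Qa r') = ∅
  c : F.Ribbon → ι
  c_mem : ∀ r, c r ∈ F.arc r
  vb : F.Ribbon → List ι
  va : F.Ribbon → List ι
  hx : F.Ribbon → List ι
  hy : F.Ribbon → List ι
  path_arc : ∀ r, IsArc (vb r) ∧ IsArc (va r) ∧ IsArc (hx r) ∧ IsArc (hy r)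
  path_sub : ∀ r, pathFaces (vb r) ⊆ Qb r ∧ pathFaces (va r) ⊆ Qa r ∧
    pathFaces (hx r) ⊆ M r ∧ pathFaces (hy r) ⊆ M r
  vb_ends : ∀ r, (vb r).getLast? = some (c r) ∧ (∀ v ∈ vb r, v ∈ F.arc r → v = c r) ∧
    ∀ v ∈ vb r, v ∈ Tb r ↔ (vb r).head? = some v
  va_ends : ∀ r, (va r).getLast? = some (c r) ∧ (∀ v ∈ va r, v ∈ F.arc r → v = c r) ∧
    ∀ v ∈ va r, v ∈ Ta r ↔ (va r).head? = some v
  hx_ends : ∀ r, (hx r).head? = some (c r) ∧ (∀ v ∈ hx r, v ∈ F.arc r → v = c r) ∧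
    ∀ v ∈ hx r, {v} ∈ bdry (M r) ↔ (hx r).getLast? = some v
  hy_ends : ∀ r, (hy r).head? = some (c r) ∧ (∀ v ∈ hy r, v ∈ F.arc r → v = c r) ∧
    ∀ v ∈ hy r, {v} ∈ bdry (M r) ↔ (hy r).getLast? = some v
  hx_hy : ∀ r, ∀ v ∈ hx r, v ∈ hy r → v = c r
  opposite : ∀ r, ∃ a b x y, [a, c r, b] <:+: F.arc r ∧ [c r, x] <:+: hx r ∧
    [c r, y] <:+: hy r ∧ Crosses (M r) {c r} a b x y

namespace LocalCharts

variable {K : Triangulation ι} {Z J : Type} {F : RibbonSurface K Z J} (L : LocalCharts F)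

/-- The part of `F_r` in the ball around the ribbon singularity `r`. -/
def nbhd (r : F.Ribbon) : Faces ι := L.M r ∪ L.Qb r ∪ L.Qa r

/-- The part of `F_r` in the open ball around the ribbon singularity `r`. -/
def openNbhd (r : F.Ribbon) : Faces ι :=
  L.nbhd r \ (bdry (L.M r) ∪ pathFaces (L.Tb r) ∪ pathFaces (L.Ta r))

/-- The local disoriented 1-chain: inwards along the 1-handle, outwards along the 0-handle. -/
noncomputable def ell (r : F.Ribbon) : ι → ι → ℤ :=
  pathChain (L.vb r) + pathChain (L.va r) + pathChain (L.hx r) + pathChain (L.hy r)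

/-- Let `G` be `F_r`, possibly with embedded bands attached away from the ribbon singularities. The
disoriented cycles on `G` are the 1-cycles of the form `∑ n_r ℓ_r + a'`, where the chain `a'` is
supported in the complement of the open balls around the ribbon singularities. -/
noncomputable def disorientedCycles (G : Faces ι) : Submodule ℤ (ι → ι → ℤ) :=
  Z1 G ⊓ (Submodule.span ℤ (Set.range L.ell) ⊔ Chain1 (G \ ⋃ r, L.openNbhd r))

/-- The first disoriented homology group: the classes in `H_1(G)` of the disoriented cycles. -/
noncomputable def DH1 (G : Faces ι) : Submodule ℤ (H1 G) :=
  ((L.disorientedCycles G).comap (Z1 G).subtype).map (H1.mk G)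

end LocalCharts

/-! ### Virtual bands -/

/-- Virtual bands: pairwise disjoint oriented embedded 1-handles `W v` that meet `F_r` exactly in
their attaching arcs, the core running from the arc `src v` to the arc `tgt v`. -/
structure VirtualBands {K : Triangulation ι} {Z J : Type} (F : RibbonSurface K Z J)
    (L : LocalCharts F) (V : Type) where
  W : V → Faces ι
  src : V → List ι
  tgt : V → List ι
  W_sub : ∀ v, W v ⊆ K.faces
  W_disk : ∀ v, IsDisk (W v)
  W_disj : ∀ v v', v ≠ v' → W v ∩ W v' = ∅
  arcs : ∀ v, IsArc (src v) ∧ IsArc (tgt v)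
  arcs_disj : ∀ v, (src v).Disjoint (tgt v)
  src_sub : ∀ v, pathFaces (src v) ⊆ bdry (W v) ∩ bdry F.space
  tgt_sub : ∀ v, pathFaces (tgt v) ⊆ bdry (W v) ∩ bdry F.space
  W_inter : ∀ v, W v ∩ F.space = pathFaces (src v) ∪ pathFaces (tgt v)
  /-- The bands are disjoint from the balls around the ribbon singularities. -/
  W_nbhd : ∀ v r, W v ∩ L.nbhd r = ∅

namespace RibbonSurface

variable {K : Triangulation ι} {Z J : Type} (F : RibbonSurface K Z J)

/-- The pieces into which the 0-handles and the 1-handles fall when the 1-handles are cut along the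
properly embedded arcs of the ribbon singularities. -/
abbrev Piece : Type := Z ⊕ (Σ j : J, Fin (F.n j + 1))

/-- The subcomplex of a piece. -/
def pieceFaces : F.Piece → Faces ι
  | .inl i => F.m i
  | .inr p => F.R p.1 p.2

/-- In the cut surface, the first and last rectangles of a 1-handle are glued to 0-handles along the
attaching arcs; there is no other gluing. -/
inductive CutGlue : F.Piece → F.Piece → Prop
  | first (j : J) : CutGlue (.inl (F.z j 0)) (.inr ⟨j, 0⟩)
  | last (j : J) : CutGlue (.inl (F.z j (Fin.last _))) (.inr ⟨j, Fin.last _⟩)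

/-- The components of the cut surface `F_c`. -/
abbrev CutComponent : Type := Quot F.CutGlue

/-- The component of the cut surface that contains a given piece. -/
abbrev comp (p : F.Piece) : F.CutComponent := Quot.mk _ p

/-- The Euler characteristic of a component of the cut surface: number of pieces (which are disks)
minus number of attaching arcs along which they are glued. -/
noncomputable def chi (κ : F.CutComponent) : ℤ :=
  (Nat.card {p : F.Piece // F.comp p = κ} : ℤ)
    - Nat.card {j : J // F.comp (.inl (F.z j 0)) = κ}
    - Nat.card {j : J // F.comp (.inl (F.z j (Fin.last _))) = κ}

/-- The number of cuts on the boundary of a component of the cut surface. -/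
noncomputable def cuts (κ : F.CutComponent) : ℕ :=
  Nat.card {r : F.Ribbon // F.comp (.inr ⟨r.1, r.2.castSucc⟩) = κ}
    + Nat.card {r : F.Ribbon // F.comp (.inr ⟨r.1, r.2.succ⟩) = κ}

/-- The components of the cut surface that need a virtual band: those that are not a disk with two
cuts on the boundary (a compact connected surface with nonempty boundary is a disk if and only if
its Euler characteristic is one), and those that contain the interior arc of a ribbon
singularity. -/
def Special (κ : F.CutComponent) : Prop :=
  ¬ (F.chi κ = 1 ∧ F.cuts κ = 2) ∨ ∃ r : F.Ribbon, F.comp (.inl (F.disk r)) = κ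

/-- Two components of the cut surface are separated by a ribbon singularity in a 1-handle, so they
lie in the same component of the abstract surface `F`. -/
def AcrossCut (κ κ' : F.CutComponent) : Prop :=
  ∃ r : F.Ribbon, F.comp (.inr ⟨r.1, r.2.castSucc⟩) = κ ∧ F.comp (.inr ⟨r.1, r.2.succ⟩) = κ'

/-- The edge path `l` meets the component `κ` of the cut surface. -/
def Meets (l : List ι) (κ : F.CutComponent) : Prop :=
  ∃ p : F.Piece, F.comp p = κ ∧ ∃ u ∈ l, {u} ∈ F.pieceFaces p

end RibbonSurface

namespace VirtualBands

variable {K : Triangulation ι} {Z J V : Type} {F : RibbonSurface K Z J} {L : LocalCharts F}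
  (B : VirtualBands F L V)

/-- The virtually-banded surface `G_r`. -/
def space : Faces ι := F.space ∪ ⋃ v, B.W v

/-- A virtual band is attached to the component `κ` of the cut surface. -/
def Attached (κ : F.CutComponent) : Prop := ∃ v, F.Meets (B.src v) κ ∨ F.Meets (B.tgt v) κ

/-- Two components of the cut surface are joined by a virtual band. -/
def Joined (κ κ' : F.CutComponent) : Prop := ∃ v, F.Meets (B.src v) κ ∧ F.Meets (B.tgt v) κ'

/-- The conditions on a collection of virtual bands.  The collection may be empty if there is only
one component of the cut surface that needs a band (for instance if the cut surface is
connected). -/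
structure Admissible : Prop where
  /-- Bands are attached to all components of the cut surface that need one. -/
  attached : Nonempty V → ∀ κ, F.Special κ → B.Attached κ
  /-- The graph formed by the components with bands, and the bands, is connected. -/
  connected : ∀ κ κ', B.Attached κ → B.Attached κ' → Relation.EqvGen B.Joined κ κ'
  empty : IsEmpty V → ∀ κ κ', F.Special κ → F.Special κ' → κ = κ'
  /-- Every component of the abstract surface `F` contains a component of the cut surface that needs
  a band or has one. -/
  reaches : ∀ κ, ∃ κ', (F.Special κ' ∨ B.Attached κ') ∧ Relation.EqvGen F.AcrossCut κ κ'

/-- The signed number of times a chain passes over the virtual band `v`. -/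
noncomputable def pass (v : V) : (ι → ι → ℤ) →ₗ[ℤ] ℤ := flow (B.src v) (B.W v)

end VirtualBands

/-! ### The 2-handles -/

/-- The 2-handles of a slice surface description: pairwise disjoint disks `d i`, each bounded by a
component of the boundary of `F_r`, otherwise disjoint from that boundary, and in general position
with respect to `F_r`. -/
structure TwoHandles {K : Triangulation ι} {Z J : Type} (F : RibbonSurface K Z J)
    (D : Type) where
  d : D → Faces ι
  d_sub : ∀ i, d i ⊆ K.faces
  d_disk : ∀ i, IsDisk (d i)
  d_disj : ∀ i i', i ≠ i' → d i ∩ d i' = ∅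
  d_bdry : ∀ i, d i ∩ bdry F.space = bdry (d i)
  /-- `Γ_i = d_i ∩ F_r` is a graph. -/
  graph : ∀ i, ∀ t ∈ d i ∩ F.space, t.card ≤ 2
  /-- Along the edges of `Γ_i` in the interior of `d_i` the disk crosses one sheet of `F_r`
  transversely. -/
  cross : ∀ i u v, u ≠ v → ({u, v} : Finset ι) ∈ (d i ∩ F.space) \ bdry (d i) →
    ∃ p q x y, {u, v, p} ∈ d i ∧ {u, v, q} ∈ d i ∧
      {t | t ∈ F.space ∧ t.card = 3 ∧ {u, v} ⊆ t} = {{u, v, x}, {u, v, y}} ∧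
      Crosses K.faces {u, v} p q x y
  /-- The points of `Γ_i` in the interior of `d_i` are double points, or triple points on ribbon
  singularities. -/
  inner : ∀ i v, {v} ∈ (d i ∩ F.space) \ bdry (d i) →
    F.DoublePoint (d i) v ∨ F.TriplePoint (d i) v
  /-- At a point of the boundary of `d_i` at most one edge of `Γ_i` enters the interior of `d_i`: none
  at an ordinary point, one at a pinch point. -/
  outer : ∀ i v, {v} ∈ bdry (d i) →
    {w | w ≠ v ∧ ({v, w} : Finset ι) ∈ (d i ∩ F.space) \ bdry (d i)}.ncard ≤ 1
  /-- At an endpoint of a ribbon singularity there is exactly one such edge, in the 0-handle. -/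
  outer_ribbon : ∀ i v, {v} ∈ bdry (d i) → ∀ r, v ∈ F.arc r →
    ∃ w, w ≠ v ∧ ({v, w} : Finset ι) ∈ (d i ∩ F.m (F.disk r)) \ bdry (d i)

/-- Disorientations of the handles: `ε j` is the sign of the first subarc of the core of the
1-handle `j` with respect to the direction from `A j 0` to the last arc (the signs of the subarcs
alternate); a 2-handle `d i` is given an orientation and a chessboard colouring of the faces of
`Γ_i = d i ∩ F_r`. -/
structure Disorientation {K : Triangulation ι} {Z J D : Type} {F : RibbonSurface K Z J}
    (S : TwoHandles F D) where
  ε : J → ℤˣ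
  o : D → ι → ι → ι → ℤ
  black : D → Faces ι
  orientation : ∀ i, IsOrientation (S.d i) (o i)
  chessboard : ∀ i, IsChessboard (S.d i) (S.d i ∩ F.space) (black i)

/-- Pairwise disjoint small regular neighbourhoods `N i` of the disks `d i`, with boundary spheres
`S i`; each sphere is given an orientation and a chessboard colouring of the faces of the graph
`S i ∩ F_r`. -/
structure SphereData {K : Triangulation ι} {Z J D : Type} {F : RibbonSurface K Z J}
    (T : TwoHandles F D) where
  N : D → Faces ι
  S : D → Faces ι
  N_sub : ∀ i, N i ⊆ K.faces
  N_subcomplex : ∀ i, IsSubcomplex (N i)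
  N_pure : ∀ i, ∀ s ∈ N i, ∃ t ∈ N i, t.card = 4 ∧ s ⊆ t
  N_disj : ∀ i i', i ≠ i' → N i ∩ N i' = ∅
  /-- `S i` is the boundary of `N i`. -/
  S_bdry : ∀ i, S i = {s | s.Nonempty ∧ ∃ t ∈ N i, s ⊆ t ∧ t.card = 3 ∧
    ∃! τ, τ ∈ N i ∧ τ.card = 4 ∧ t ⊆ τ}
  S_sphere : ∀ i, IsSphere (S i)
  /-- Away from `S i` the polyhedron `N i` is open in the ambient complex. -/
  N_open : ∀ i, ∀ t ∈ N i \ S i, ∀ s ∈ K.faces, t ⊆ s → s ∈ N i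
  /-- `N i` is a regular neighbourhood of `d i`. -/
  d_sub : ∀ i, T.d i ⊆ N i \ S i
  N_collapses : ∀ i, Collapses (N i) (T.d i)
  /-- `N i ∩ F_r` is a regular neighbourhood of `d i ∩ F_r`. -/
  F_collapses : ∀ i, Collapses (N i ∩ F.space) (T.d i ∩ F.space)
  /-- The only part of the boundary of `F_r` in `N i` is the boundary of `d i`. -/
  N_bdry : ∀ i, N i ∩ bdry F.space = bdry (T.d i)
  /-- `S i` is transverse to `F_r`: the intersection is a graph, along its edges one sheet of `F_r`
  passes from the inside of `N i` to the outside, and its points are double points, or triple points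
  on ribbon singularities. -/
  S_graph : ∀ i, ∀ t ∈ S i ∩ F.space, t.card ≤ 2
  S_cross : ∀ i, ∀ e ∈ S i ∩ F.space, e.card = 2 →
    ∃ t t', t ∈ N i ∧ t' ∉ N i ∧ {t | t ∈ F.space ∧ t.card = 3 ∧ e ⊆ t} = {t, t'}
  S_point : ∀ i v, {v} ∈ S i ∩ F.space → F.DoublePoint (S i) v ∨ F.TriplePoint (S i) v
  o : D → ι → ι → ι → ℤ
  black : D → Faces ι
  orientation : ∀ i, IsOrientation (S i) (o i)
  chessboard : ∀ i, IsChessboard (S i) (S i ∩ F.space) (black i)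

/-- The cycle `b_i`: the graph `S_i ∩ F_r`, oriented as the boundary of the black faces. -/
noncomputable def SphereData.b {K : Triangulation ι} {Z J D : Type} {F : RibbonSurface K Z J}
    {T : TwoHandles F D} (N : SphereData T) (i : D) : ι → ι → ℤ :=
  bd2 (restrict (N.o i) (N.black i))

/-! ### The two complexes -/

/-- The signed number of times the chain `z` passes over the 1-handle `j`: the intersection number
with the attaching arc `A j 0`, oriented so that its intersection number with the disoriented core
is one. -/
noncomputable def passOver {K : Triangulation ι} {Z J : Type} (F : RibbonSurface K Z J)
    (ε : J → ℤˣ) (j : J) : (ι → ι → ℤ) →ₗ[ℤ] ℤ :=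
  (ε j : ℤ) • flow (F.A j 0) (F.R j 0)

namespace Disorientation

variable {K : Triangulation ι} {Z J D : Type} {F : RibbonSurface K Z J} {S : TwoHandles F D}
  (O : Disorientation S)

/-- The chain `b_i^♭`: the sum of the boundaries of the disoriented faces of `d_i` (the black faces
with the orientation of `d_i`, the white faces with the opposite one). -/
noncomputable def bflat (i : D) : ι → ι → ℤ :=
  bd2 (restrict (O.o i) (O.black i) - restrict (O.o i) (O.black i)ᶜ)

/-- `∂₂^♭` sends a 2-handle to the combination of 1-handles over which `b_i^♭` passes. -/
noncomputable def cell2 [Fintype J] : (D →₀ ℤ) →ₗ[ℤ] (J →₀ ℤ) :=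
  Finsupp.linearCombination ℤ fun i => ∑ j, Finsupp.single j (passOver F O.ε j (O.bflat i))

/-- `∂₁^♭` sends a disoriented core to the signed sum of the 0-handles that its subarcs point into
(positive) or away from (negative). -/
noncomputable def cell1 : (J →₀ ℤ) →ₗ[ℤ] (Z →₀ ℤ) :=
  Finsupp.linearCombination ℤ fun j => ∑ s : Fin (F.n j + 1),
    ((O.ε j : ℤ) * (-1) ^ (s : ℕ)) •
      (Finsupp.single (F.z j s.succ) (1 : ℤ) - Finsupp.single (F.z j s.castSucc) 1)

/-- The augmentation `∂₀^♭`. -/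
noncomputable def cell0 (_O : Disorientation S) : (Z →₀ ℤ) →ₗ[ℤ] ℤ :=
  Finsupp.linearCombination ℤ fun _ => 1

end Disorientation

namespace VirtualBands

variable {K : Triangulation ι} {Z J V : Type} {F : RibbonSurface K Z J} {L : LocalCharts F}
  (B : VirtualBands F L V)

/-- An edge of a virtual band leaving its initial attaching arc lies in no triangle outside the band. -/
theorem mem_W_of_edge (v : V) {u w : ι} (hu : u ∈ B.src v) (hw : w ∉ B.src v)
    (huw : ({u, w} : Finset ι) ∈ B.W v) {s : Finset ι} (hs : s ∈ B.space)
    (hclosed : ∀ X ∈ ({F.space} ∪ Set.range B.W : Set (Faces ι)), s ∈ X → {u, w} ∈ X) :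
    s ∈ B.W v := by
  rcases hs with hs | hs
  · exfalso
    have h1 : ({u, w} : Finset ι) ∈ B.W v ∩ F.space :=
      ⟨huw, hclosed _ (by simp) hs⟩
    rw [B.W_inter v] at h1
    rcases h1 with ⟨-, a, b, hab, h⟩ | ⟨-, a, b, hab, h⟩
    · have hm : w ∈ ({a, b} : Finset ι) := h (by simp)
      have : w ∈ [a, b] := by simpa using hm
      exact hw (hab.subset this)
    · have hm : u ∈ ({a, b} : Finset ι) := h (by simp)
      have : u ∈ [a, b] := by simpa using hm
      exact (B.arcs_disj v) hu (hab.subset this)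
  · obtain ⟨v', hv'⟩ := Set.mem_iUnion.1 hs
    by_cases h : v = v'
    · exact h ▸ hv'
    · exfalso
      have h1 : ({u, w} : Finset ι) ∈ B.W v ∩ B.W v' := ⟨huw, hclosed _ (by simp) hv'⟩
      rw [B.W_disj v v' h] at h1
      exact h1

theorem space_closed {s t : Finset ι} (ht : t ⊆ s) (hne : t.Nonempty) :
    ∀ X ∈ ({F.space} ∪ Set.range B.W : Set (Faces ι)), s ∈ X → t ∈ X := by
  rintro X (rfl | ⟨v, rfl⟩) hs
  · rcases hs with hs | hs
    · obtain ⟨i, hi⟩ := Set.mem_iUnion.1 hs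
      exact Or.inl (Set.mem_iUnion.2 ⟨i, ((F.m_disk i).surface.subcomplex s hi).2 t ht hne⟩)
    · obtain ⟨j, hj⟩ := Set.mem_iUnion.1 hs
      obtain ⟨k, hk⟩ := Set.mem_iUnion.1 hj
      exact Or.inr (Set.mem_iUnion.2 ⟨j, Set.mem_iUnion.2
        ⟨k, ((F.R_disk j k).surface.subcomplex s hk).2 t ht hne⟩⟩)
  · exact ((B.W_disk v).surface.subcomplex s hs).2 t ht hne

/-- Counting how often a chain passes over a virtual band gives zero on boundaries. -/
theorem pass_bd2 (v : V) (t : ι → ι → ι → ℤ) (ht : t ∈ Chain2 B.space) :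
    B.pass v (bd2 t) = 0 := by
  obtain ⟨h12, h23, hsupp⟩ := ht
  set P : ι → ι → ι → Prop := fun u w x => ({u, w, x} : Finset ι) ∈ B.W v with hP
  have key : ∀ u w x, (if u ∈ B.src v ∧ w ∉ B.src v ∧ ({u, w} : Finset ι) ∈ B.W v
      then t u w x else 0) =
      (if u ∈ B.src v ∧ w ∉ B.src v ∧ x ∈ B.src v ∧ P u w x then t u w x else 0) +
      (if u ∈ B.src v ∧ w ∉ B.src v ∧ x ∉ B.src v ∧ P u w x then t u w x else 0) := by
    intro u w x
    by_cases hu : u ∈ B.src v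
    swap
    · simp [hu]
    by_cases hw : w ∈ B.src v
    · simp [hw]
    by_cases h0 : t u w x = 0
    · simp [h0]
    have hG : ({u, w, x} : Finset ι) ∈ B.space := by
      by_contra h
      exact h0 (hsupp u w x h)
    have hsub : ({u, w} : Finset ι) ⊆ {u, w, x} := by
      intro a ha
      simp only [Finset.mem_insert, Finset.mem_singleton] at ha ⊢
      tauto
    have hiff : ({u, w} : Finset ι) ∈ B.W v ↔ P u w x := by
      constructor
      · intro h
        exact B.mem_W_of_edge v hu hw h hG (B.space_closed hsub (by simp))
      · intro h
        exact B.space_closed hsub (by simp) _ (by simp) h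
    by_cases hx : x ∈ B.src v <;> simp [hu, hw, hx, hiff]
  have hA : ∑ u, ∑ w, ∑ x,
      (if u ∈ B.src v ∧ w ∉ B.src v ∧ x ∈ B.src v ∧ P u w x then t u w x else 0) = 0 := by
    have hsw : ∑ u, ∑ w, ∑ x,
        (if u ∈ B.src v ∧ w ∉ B.src v ∧ x ∈ B.src v ∧ P u w x then t u w x else 0) =
        - ∑ u, ∑ w, ∑ x,
        (if u ∈ B.src v ∧ w ∉ B.src v ∧ x ∈ B.src v ∧ P u w x then t u w x else 0) := by
      have e1 : ∀ f : ι → ι → ι → ℤ, ∑ u, ∑ w, ∑ x, f u w x = ∑ u, ∑ w, ∑ x, f x w u := by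
        intro f
        calc ∑ u, ∑ w, ∑ x, f u w x = ∑ w, ∑ u, ∑ x, f u w x := Finset.sum_comm
          _ = ∑ w, ∑ x, ∑ u, f u w x := Finset.sum_congr rfl fun _ _ => Finset.sum_comm
          _ = ∑ x, ∑ w, ∑ u, f u w x := Finset.sum_comm
      conv_lhs => rw [e1]
      simp only [← Finset.sum_neg_distrib]
      refine Finset.sum_congr rfl fun u _ => Finset.sum_congr rfl fun w _ =>
        Finset.sum_congr rfl fun x _ => ?_
      have hs : ({x, w, u} : Finset ι) = {u, w, x} := by ext; simp; tauto
      have ht' : t x w u = - t u w x := by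
        rw [h12 x w u, h23 w x u, h12 w u x]; ring
      by_cases h : u ∈ B.src v ∧ w ∉ B.src v ∧ x ∈ B.src v ∧ P u w x
      · rw [if_pos h, if_pos ⟨h.2.2.1, h.2.1, h.1, by simpa [hP, hs] using h.2.2.2⟩, ht']
      · rw [if_neg h, if_neg, neg_zero]
        intro h'
        exact h ⟨h'.2.2.1, h'.2.1, h'.1, by simpa [hP, hs] using h'.2.2.2⟩
    linarith
  have hB : ∑ u, ∑ w, ∑ x,
      (if u ∈ B.src v ∧ w ∉ B.src v ∧ x ∉ B.src v ∧ P u w x then t u w x else 0) = 0 := by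
    have hsw : ∑ u, ∑ w, ∑ x,
        (if u ∈ B.src v ∧ w ∉ B.src v ∧ x ∉ B.src v ∧ P u w x then t u w x else 0) =
        - ∑ u, ∑ w, ∑ x,
        (if u ∈ B.src v ∧ w ∉ B.src v ∧ x ∉ B.src v ∧ P u w x then t u w x else 0) := by
      simp only [← Finset.sum_neg_distrib]
      refine Finset.sum_congr rfl fun u _ => ?_
      rw [Finset.sum_comm]
      refine Finset.sum_congr rfl fun w _ => Finset.sum_congr rfl fun x _ => ?_
      have hs : ({u, x, w} : Finset ι) = {u, w, x} := by ext; simp; tauto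
      by_cases h : u ∈ B.src v ∧ w ∉ B.src v ∧ x ∉ B.src v ∧ P u w x
      · rw [if_pos h, if_pos ⟨h.1, h.2.2.1, h.2.1, by simpa [hP, hs] using h.2.2.2⟩, h23 u x w]
      · rw [if_neg h, if_neg, neg_zero]
        intro h'
        exact h ⟨h'.1, h'.2.2.1, h'.2.1, by simpa [hP, hs] using h'.2.2.2⟩
    linarith
  calc B.pass v (bd2 t) = ∑ u, ∑ w, ∑ x,
        (if u ∈ B.src v ∧ w ∉ B.src v ∧ ({u, w} : Finset ι) ∈ B.W v then t u w x else 0) := by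
        simp only [pass, flow, bd2, LinearMap.coe_mk, AddHom.coe_mk]
        refine Finset.sum_congr rfl fun u _ => Finset.sum_congr rfl fun w _ => ?_
        split_ifs <;> simp
    _ = 0 := by
        simp only [key, Finset.sum_add_distrib]
        rw [hA, hB, add_zero]

/-- The number of times a class in `H_1(G_r)` passes over the virtual band `v`. -/
noncomputable def passH1 (v : V) : H1 B.space →ₗ[ℤ] ℤ :=
  Submodule.liftQ _ (B.pass v ∘ₗ (Z1 B.space).subtype) (by
    rintro z ⟨t, ht, htz⟩
    rw [LinearMap.mem_ker, LinearMap.comp_apply, ← htz]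
    exact B.pass_bd2 v t ht)

/-- The boundary map `DC_1(F_r, V) = DH_1(G_r) → DC_0(F_r, V)` to the free abelian group on the
virtual bands. -/
noncomputable def boundary [Fintype V] : L.DH1 B.space →ₗ[ℤ] (V →₀ ℤ) :=
  (∑ v, Finsupp.lsingle v ∘ₗ B.passH1 v) ∘ₗ (L.DH1 B.space).subtype

/-- The star-shaped collections of virtual bands: one band from each 0-handle `i ≠ i₀` to the fixed
0-handle `i₀`. -/
def IsStar (i₀ : Z) (σ : V ≃ {i : Z // i ≠ i₀}) : Prop :=
  ∀ v, pathFaces (B.src v) ⊆ F.m (σ v) ∧ pathFaces (B.tgt v) ⊆ F.m i₀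

end VirtualBands

/-! ### Four-term complexes -/

open CategoryTheory

/-- The groups of the complex `C₂ → C₁ → C₀ → C₋₁`, with `C_k` placed in degree `k + 1`. -/
def fourTermX (C₂ C₁ C₀ C' : ModuleCat.{0} ℤ) : ℕ → ModuleCat.{0} ℤ
  | 0 => C'
  | 1 => C₀
  | 2 => C₁
  | 3 => C₂
  | _ + 4 => ModuleCat.of ℤ PUnit

/-- The differentials of the complex `C₂ → C₁ → C₀ → C₋₁`. -/
def fourTermD {C₂ C₁ C₀ C' : ModuleCat.{0} ℤ} (d₂ : C₂ ⟶ C₁) (d₁ : C₁ ⟶ C₀) (d₀ : C₀ ⟶ C') :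
    ∀ n, fourTermX C₂ C₁ C₀ C' (n + 1) ⟶ fourTermX C₂ C₁ C₀ C' n
  | 0 => d₀
  | 1 => d₁
  | 2 => d₂
  | _ + 3 => 0

/-- The chain complex `0 → C₂ → C₁ → C₀ → C₋₁ → 0`, with `C_k` placed in degree `k + 1`. -/
noncomputable def fourTerm {C₂ C₁ C₀ C' : Type} [AddCommGroup C₂] [AddCommGroup C₁]
    [AddCommGroup C₀] [AddCommGroup C'] (d₂ : C₂ →ₗ[ℤ] C₁) (d₁ : C₁ →ₗ[ℤ] C₀) (d₀ : C₀ →ₗ[ℤ] C')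
    (h₁ : d₁ ∘ₗ d₂ = 0) (h₀ : d₀ ∘ₗ d₁ = 0) : ChainComplex (ModuleCat.{0} ℤ) ℕ :=
  ChainComplex.of _ (fourTermD (ModuleCat.ofHom d₂) (ModuleCat.ofHom d₁) (ModuleCat.ofHom d₀)) (by
    rintro (_ | _ | n)
    · change ModuleCat.ofHom d₁ ≫ ModuleCat.ofHom d₀ = 0
      rw [← ModuleCat.ofHom_comp, h₀]; rfl
    · change ModuleCat.ofHom d₂ ≫ ModuleCat.ofHom d₁ = 0
      rw [← ModuleCat.ofHom_comp, h₁]; rfl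
    · exact Limits.zero_comp)

section Components

variable {C₂ C₁ C₀ C' : Type} [AddCommGroup C₂] [AddCommGroup C₁] [AddCommGroup C₀]
  [AddCommGroup C'] {d₂ : C₂ →ₗ[ℤ] C₁} {d₁ : C₁ →ₗ[ℤ] C₀} {d₀ : C₀ →ₗ[ℤ] C'}
  {h₁ : d₁ ∘ₗ d₂ = 0} {h₀ : d₀ ∘ₗ d₁ = 0}
  {E₂ E₁ E₀ E' : Type} [AddCommGroup E₂] [AddCommGroup E₁] [AddCommGroup E₀]
  [AddCommGroup E'] {e₂ : E₂ →ₗ[ℤ] E₁} {e₁ : E₁ →ₗ[ℤ] E₀} {e₀ : E₀ →ₗ[ℤ] E'}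
  {k₁ : e₁ ∘ₗ e₂ = 0} {k₀ : e₀ ∘ₗ e₁ = 0}

/-- The component `f₀ : C₀ → E₀` of a chain map. -/
def comp0 (f : fourTerm d₂ d₁ d₀ h₁ h₀ ⟶ fourTerm e₂ e₁ e₀ k₁ k₀) : C₀ →ₗ[ℤ] E₀ :=
  (show ModuleCat.of ℤ C₀ ⟶ ModuleCat.of ℤ E₀ from f.f 1).hom

/-- The component `f₁ : C₁ → E₁` of a chain map. -/
def comp1 (f : fourTerm d₂ d₁ d₀ h₁ h₀ ⟶ fourTerm e₂ e₁ e₀ k₁ k₀) : C₁ →ₗ[ℤ] E₁ :=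
  (show ModuleCat.of ℤ C₁ ⟶ ModuleCat.of ℤ E₁ from f.f 2).hom

/-- The component `f₂ : C₂ → E₂` of a chain map. -/
def comp2 (f : fourTerm d₂ d₁ d₀ h₁ h₀ ⟶ fourTerm e₂ e₁ e₀ k₁ k₀) : C₂ →ₗ[ℤ] E₂ :=
  (show ModuleCat.of ℤ C₂ ⟶ ModuleCat.of ℤ E₂ from f.f 3).hom

end Components

/-- The cellular disoriented complex `DC_2 → DC_1 → DC_0 → ℤ`, with `DC_k` placed in
degree `k + 1`. -/
noncomputable def cellularComplex {K : Triangulation ι} {Z J D : Type} [Fintype J]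
    {F : RibbonSurface K Z J} {S : TwoHandles F D} (O : Disorientation S)
    (h₁ : O.cell1 ∘ₗ O.cell2 = 0) (h₀ : O.cell0 ∘ₗ O.cell1 = 0) :
    ChainComplex (ModuleCat.{0} ℤ) ℕ :=
  fourTerm O.cell2 O.cell1 O.cell0 h₁ h₀

/-- The complex `DC_2 → DC_1 → DC_0 → 0` of a virtually-banded surface, with `DC_k` placed in
degree `k + 1`: `DC_2` is free on the 2-handles, `DC_1` is `DH_1(G_r)`, and `DC_0` is free on the
virtual bands; the 2-handle `d_i` is sent to the class `β i`. -/
noncomputable def virtualComplex {K : Triangulation ι} {Z J V : Type} [Fintype V]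
    {F : RibbonSurface K Z J} {L : LocalCharts F} (B : VirtualBands F L V) {D : Type}
    (β : D → L.DH1 B.space)
    (h₁ : B.boundary ∘ₗ Finsupp.linearCombination ℤ β = 0) : ChainComplex (ModuleCat.{0} ℤ) ℕ :=
  fourTerm (Finsupp.linearCombination ℤ β) B.boundary (0 : (V →₀ ℤ) →ₗ[ℤ] PUnit) h₁
    (LinearMap.zero_comp _)

end

end DisorientedHomology

open DisorientedHomology CategoryTheory

namespace DisorientedHomology

section

open scoped Classical

set_option linter.unusedSectionVars false

variable {ι : Type}

/-! ### Consecutive entries of lists -/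

/-! The first disoriented homology is computed by counting crossings. The ribbon arcs cut the
1-handles into rectangles, and all pieces (rectangles and 0-handles) are disks. So a cycle on `F_r`
that flows through no rectangle bounds (`mem_B1_of_flow_eq_zero`). A disoriented cycle crosses the
two sides of each ribbon arc equally often (`balanced_of_disoriented`), so its flow alternates in
sign along a 1-handle and is determined by the flow through the first rectangle. Conservation of
flow at the 0-handles then says exactly that the vector of passages lies in the kernel of ∂₁♭, and
every such vector is realized by explicit chains (`exists_chain_core`). Hence DH₁(F_r) ≅ ker ∂₁♭
(`overDH1_injective`, `range_overDH1`).

Virtual bands are compared with 0-handles by giving each rectangle a class in ℤ⟨m_i⟩: at a ribbon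
singularity in the 0-handle m the class ρ becomes 2m − ρ. This is the rule for which the boundary of
a local disoriented chain has class zero. A band is sent by g₀ to the difference of the classes of
its ends. Then DH₁(F_r) is the kernel of ∂_V on DH₁(G_r) (`range_inclDH1`), g₀ carries the image of
∂_V into the image of ∂₁♭ (`ends_boundary_mem`), and whatever g₀ sends into that image is hit by ∂_V
(`exists_boundary_eq`). Once a compatible g₁ is chosen, DH₁(G_r) is the fibre product of ∂₁♭ and g₀.
The conditions on the bands yield im g₀ + im ∂₁♭ = ker ε (`exists_of_cell0_eq_zero`). From these
data the equivalence is pure algebra (`exists_homotopyEquiv`).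

The 2-handles need b_i to be homologous in F_r to ± the disoriented boundary of d_i (`exists_b_eq`).
In the collapsible neighbourhood N_i, the part of F_r, the disk d_i and the black faces of S_i
together form a cycle modulo two. It bounds, which colours the tetrahedra of N_i with two colours.
The coloured part of the integral fundamental chain of N_i has boundary supported on the black
faces, F_r and d_i. On d_i it is ± the chain that turns over the white faces, because signs agree
across Γ_i and change nowhere else (`bd3_half_cross`). Taking boundaries gives the homology. That
the class lies in DH₁ follows from the alternation of colours around a triple point (`flow_b`).

For a star of bands on 0-handles, passages over 1-handles are defined on all of DH₁(G_r). They serve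
as g₁, no homotopy is needed in degree one, and f₁ and f₂ become isomorphisms. -/

theorem pair_infix_iff {l : List ι} {a b : ι} :
    [a, b] <:+: l ↔ ∃ k, l[k]? = some a ∧ l[k + 1]? = some b := by
  rw [List.infix_iff_getElem?]
  constructor
  · rintro ⟨k, -, h⟩
    refine ⟨k, by simpa using h 0 (by simp), ?_⟩
    have := h 1 (by simp)
    rwa [add_comm] at this
  · rintro ⟨k, h0, h1⟩
    refine ⟨k, ?_, ?_⟩
    · have := (List.getElem?_eq_some_iff.1 h1).1
      simp; omega
    · intro i hi
      simp only [List.length_cons, List.length_nil] at hi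
      interval_cases i
      · simpa using h0
      · rw [add_comm]; simpa using h1

theorem infix_left_mem {l : List ι} {a b : ι} (h : [a, b] <:+: l) : a ∈ l :=
  h.subset (by simp)

theorem infix_right_mem {l : List ι} {a b : ι} (h : [a, b] <:+: l) : b ∈ l :=
  h.subset (by simp)

theorem Consecutive.symm {l : List ι} {a b : ι} (h : Consecutive l a b) : Consecutive l b a :=
  Or.symm h

theorem Consecutive.left_mem {l : List ι} {a b : ι} (h : Consecutive l a b) : a ∈ l :=
  h.elim infix_left_mem infix_right_mem

theorem Consecutive.right_mem {l : List ι} {a b : ι} (h : Consecutive l a b) : b ∈ l :=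
  h.symm.left_mem

theorem getElem?_inj_of_nodup {l : List ι} (hl : l.Nodup) {i j : ℕ} {a : ι}
    (hi : l[i]? = some a) (hj : l[j]? = some a) : i = j := by
  obtain ⟨h1, h2⟩ := List.getElem?_eq_some_iff.1 hi
  obtain ⟨h3, h4⟩ := List.getElem?_eq_some_iff.1 hj
  exact (List.Nodup.getElem_inj_iff hl).1 (h2.trans h4.symm)

theorem infix_right_unique {l : List ι} (hl : l.Nodup) {a b c : ι}
    (hb : [a, b] <:+: l) (hc : [a, c] <:+: l) : b = c := by
  obtain ⟨i, h1, h2⟩ := pair_infix_iff.1 hb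
  obtain ⟨j, h3, h4⟩ := pair_infix_iff.1 hc
  obtain rfl := getElem?_inj_of_nodup hl h1 h3
  simpa using h2.symm.trans h4

theorem infix_left_unique {l : List ι} (hl : l.Nodup) {a b c : ι}
    (hb : [b, a] <:+: l) (hc : [c, a] <:+: l) : b = c := by
  obtain ⟨i, h1, h2⟩ := pair_infix_iff.1 hb
  obtain ⟨j, h3, h4⟩ := pair_infix_iff.1 hc
  obtain rfl : i = j := by simpa using getElem?_inj_of_nodup hl h2 h4
  simpa using h1.symm.trans h3

theorem pair_infix_cons {l : List ι} {x y a b : ι} :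
    [a, b] <:+: x :: y :: l ↔ (a = x ∧ b = y) ∨ [a, b] <:+: y :: l := by
  constructor
  · intro h
    obtain ⟨i, h1, h2⟩ := pair_infix_iff.1 h
    cases i with
    | zero => left; simp at h1 h2; exact ⟨h1.symm, h2.symm⟩
    | succ i => right; exact pair_infix_iff.2 ⟨i, by simpa using h1, by simpa using h2⟩
  · rintro (⟨rfl, rfl⟩ | h)
    · exact pair_infix_iff.2 ⟨0, by simp, by simp⟩
    · obtain ⟨i, h1, h2⟩ := pair_infix_iff.1 h
      exact pair_infix_iff.2 ⟨i + 1, by simpa using h1, by simpa using h2⟩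

/-- The closed-up list, parametrized periodically. -/
theorem exists_periodic {l : List ι} (hl : l.Nodup) (h3 : 3 ≤ l.length) :
    ∃ f : ℕ → ι, (∀ i, f (i + l.length) = f i) ∧
      (∀ i (h : i < l.length), f i = l[i]) ∧
      (∀ i j, f i = f j ↔ i ≡ j [MOD l.length]) ∧
      (∀ a, a ∈ l ↔ ∃ i, f i = a) ∧
      ∀ a b, [a, b] <:+: closeUp l ↔ ∃ i, f i = a ∧ f (i + 1) = b := by
  have hpos : 0 < l.length := by omega
  have hm : ∀ i, i % l.length < l.length := fun i => Nat.mod_lt _ hpos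
  have hf : ∀ k, (closeUp l)[k]? = if h : k < l.length then some l[k] else
      if k = l.length then some l[0] else none := by
    intro k
    unfold closeUp
    split_ifs with h h'
    · rw [List.getElem?_append_left h, List.getElem?_eq_getElem h]
    · subst h'
      rw [List.getElem?_append_right le_rfl]
      simp
    · rw [List.getElem?_eq_none]
      simp; omega
  refine ⟨fun i => l[i % l.length]'(hm i), fun i => by simp, fun i h => by
    simp [Nat.mod_eq_of_lt h], fun i j => ?_, fun a => ?_, fun a b => ?_⟩
  · rw [List.Nodup.getElem_inj_iff hl]; rfl
  · constructor
    · intro h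
      obtain ⟨i, hi, rfl⟩ := List.getElem_of_mem h
      exact ⟨i, by simp [Nat.mod_eq_of_lt hi]⟩
    · rintro ⟨i, rfl⟩
      exact List.getElem_mem _
  · rw [pair_infix_iff]
    constructor
    · rintro ⟨k, h1, h2⟩
      rw [hf] at h1 h2
      have hk : k < l.length := by
        by_contra hk
        rw [dif_neg (by omega), if_neg (by omega)] at h2
        simp at h2
      rw [dif_pos hk] at h1
      refine ⟨k, by simpa [Nat.mod_eq_of_lt hk] using h1, ?_⟩
      by_cases hk' : k + 1 < l.length
      · rw [dif_pos hk'] at h2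
        simpa [Nat.mod_eq_of_lt hk'] using h2
      · have : k + 1 = l.length := by omega
        rw [dif_neg hk', if_pos this] at h2
        simpa [this] using h2
    · rintro ⟨i, rfl, rfl⟩
      refine ⟨i % l.length, ?_, ?_⟩
      · rw [hf, dif_pos (hm i)]
      · rw [hf]
        have e := Nat.add_mod i 1 l.length
        rw [Nat.mod_eq_of_lt (show 1 < l.length by omega)] at e
        by_cases hk : i % l.length + 1 < l.length
        · rw [dif_pos hk]
          simp only [e, Nat.mod_eq_of_lt hk]
        · have h' : i % l.length + 1 = l.length := by have := hm i; omega
          rw [dif_neg hk, if_pos h']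
          simp only [e, h', Nat.mod_self]

theorem closeUp_right_unique {l : List ι} (hl : l.Nodup) (h3 : 3 ≤ l.length) {a b c : ι}
    (hb : [a, b] <:+: closeUp l) (hc : [a, c] <:+: closeUp l) : b = c := by
  obtain ⟨f, -, -, hinj, -, hf⟩ := exists_periodic hl h3
  obtain ⟨i, h1, rfl⟩ := (hf _ _).1 hb
  obtain ⟨j, h2, rfl⟩ := (hf _ _).1 hc
  rw [hinj]
  exact Nat.ModEq.add_right 1 ((hinj _ _).1 (h1.trans h2.symm))

theorem closeUp_left_unique {l : List ι} (hl : l.Nodup) (h3 : 3 ≤ l.length) {a b c : ι}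
    (hb : [b, a] <:+: closeUp l) (hc : [c, a] <:+: closeUp l) : b = c := by
  obtain ⟨f, -, -, hinj, -, hf⟩ := exists_periodic hl h3
  obtain ⟨i, rfl, h1⟩ := (hf _ _).1 hb
  obtain ⟨j, rfl, h2⟩ := (hf _ _).1 hc
  rw [hinj]
  exact Nat.ModEq.add_right_cancel' 1 ((hinj _ _).1 (h1.trans h2.symm))

theorem mem_closeUp {l : List ι} {a : ι} : a ∈ closeUp l ↔ a ∈ l := by
  unfold closeUp
  rw [List.mem_append]
  exact ⟨fun h => h.elim id fun h => List.mem_of_mem_take h, Or.inl⟩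

variable [DecidableEq ι]

theorem pair_subset_pair {u v a b : ι} (huv : u ≠ v) (h : ({u, v} : Finset ι) ⊆ {a, b}) :
    (u = a ∧ v = b) ∨ (u = b ∧ v = a) := by
  have h1 : u ∈ ({a, b} : Finset ι) := h (by simp)
  have h2 : v ∈ ({a, b} : Finset ι) := h (by simp)
  simp only [Finset.mem_insert, Finset.mem_singleton] at h1 h2
  rcases h1 with rfl | rfl <;> rcases h2 with rfl | rfl <;> simp_all

theorem mem_pathFaces_pair {l : List ι} {u v : ι} (huv : u ≠ v) :
    ({u, v} : Finset ι) ∈ pathFaces l ↔ Consecutive l u v := by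
  constructor
  · rintro ⟨-, a, b, hab, h⟩
    rcases pair_subset_pair huv h with ⟨rfl, rfl⟩ | ⟨rfl, rfl⟩
    · exact Or.inl hab
    · exact Or.inr hab
  · rintro (h | h)
    · exact ⟨by simp, u, v, h, by simp⟩
    · exact ⟨by simp, v, u, h, by simp [Finset.pair_comm]⟩

theorem mem_of_mem_pathFaces {l : List ι} {s : Finset ι} (h : s ∈ pathFaces l) {u : ι}
    (hu : u ∈ s) : u ∈ l := by
  obtain ⟨-, a, b, hab, h⟩ := h
  have := h hu
  simp only [Finset.mem_insert, Finset.mem_singleton] at this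
  rcases this with rfl | rfl
  · exact infix_left_mem hab
  · exact infix_right_mem hab

theorem card_le_of_mem_pathFaces {l : List ι} {s : Finset ι} (h : s ∈ pathFaces l) :
    s.card ≤ 2 := by
  obtain ⟨-, a, b, -, h⟩ := h
  exact (Finset.card_le_card h).trans Finset.card_le_two

theorem exists_neighbour {l : List ι} (h2 : 2 ≤ l.length) {u : ι} (hu : u ∈ l) :
    ∃ w, Consecutive l u w := by
  obtain ⟨i, hi, rfl⟩ := List.getElem_of_mem hu
  by_cases h : i + 1 < l.length
  · exact ⟨l[i + 1], Or.inl (pair_infix_iff.2 ⟨i, by simp, by simp⟩)⟩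
  · refine ⟨l[i - 1], Or.inr (pair_infix_iff.2 ⟨i - 1, by simp, ?_⟩)⟩
    rw [Nat.sub_add_cancel (by omega)]
    simp

theorem singleton_mem_pathFaces {l : List ι} (h2 : 2 ≤ l.length) {u : ι} :
    ({u} : Finset ι) ∈ pathFaces l ↔ u ∈ l := by
  constructor
  · intro h; exact mem_of_mem_pathFaces h (by simp)
  · intro h
    obtain ⟨w, hw | hw⟩ := exists_neighbour h2 h
    · exact ⟨by simp, u, w, hw, by simp⟩
    · exact ⟨by simp, w, u, hw, by simp⟩

theorem isSubcomplex_pathFaces (l : List ι) : IsSubcomplex (pathFaces l) := by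
  rintro s ⟨hs, a, b, hab, h⟩
  exact ⟨hs, fun t ht hne => ⟨hne, a, b, hab, ht.trans h⟩⟩

/-! ### Edge connectedness -/

/-- Two vertices are joined by an edge path in `X`. -/
def Linked (X : Faces ι) : ι → ι → Prop := Relation.ReflTransGen fun u w => ({u, w} : Finset ι) ∈ X

theorem Linked.symm {X : Faces ι} {a b : ι} (h : Linked X a b) : Linked X b a := by
  induction h with
  | refl => exact Relation.ReflTransGen.refl
  | tail _ hbc ih => exact Relation.ReflTransGen.head (by rwa [Finset.pair_comm]) ih

theorem Linked.mono {X Y : Faces ι} (hXY : X ⊆ Y) {a b : ι} (h : Linked X a b) : Linked Y a b :=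
  Relation.ReflTransGen.mono (fun _ _ h' => hXY h') _ _ h

theorem linked_pathFaces {l : List ι} {a b : ι} (ha : a ∈ l) (hb : b ∈ l) :
    Linked (pathFaces l) a b := by
  have key : ∀ (m : List ι) (x : ι), ∀ y ∈ x :: m, Linked (pathFaces (x :: m)) x y := by
    intro m
    induction m with
    | nil => intro x y hy; simp at hy; subst hy; exact Relation.ReflTransGen.refl
    | cons z m ih =>
      intro x y hy
      rcases List.mem_cons.1 hy with rfl | hy
      · exact Relation.ReflTransGen.refl
      · refine Relation.ReflTransGen.head (b := z) ?_ ((ih z y hy).mono ?_)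
        · exact ⟨by simp, x, z, pair_infix_cons.2 (Or.inl ⟨rfl, rfl⟩), by simp⟩
        · rintro s ⟨hs, c, d, hcd, h⟩
          exact ⟨hs, c, d, pair_infix_cons.2 (Or.inr hcd), h⟩
  cases l with
  | nil => simp at ha
  | cons x m => exact (key m x a ha).symm.trans (key m x b hb)

/-- A path in `X` can enter or leave a region `Q k` only through its frontier `T k`. As the frontier
is connected inside `Y`, every excursion into the region can be replaced by a path in `Y`. -/
theorem linked_removing {κ : Type} {X : Faces ι} (Q : κ → Faces ι) (T : κ → Set ι)
    (Y : Faces ι)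
    (hT : ∀ k, ∀ a ∈ T k, ∀ b ∈ T k, Linked Y a b)
    (hQ : ∀ k, ∀ s ∈ Q k, ∀ a ∈ s, ({a} : Finset ι) ∈ Q k)
    (hQdisj : ∀ k k' a, ({a} : Finset ι) ∈ Q k → ({a} : Finset ι) ∈ Q k' → k = k')
    (hfr : ∀ k u w, ({u, w} : Finset ι) ∈ X → ({u, w} : Finset ι) ∉ Q k → ({w} : Finset ι) ∈ Q k →
      w ∈ T k)
    (hY : ∀ u w, ({u, w} : Finset ι) ∈ X → (∀ k, ({u, w} : Finset ι) ∉ Q k) →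
      ({u, w} : Finset ι) ∈ Y)
    {a b : ι} (hab : Linked X a b)
    (ha : ∀ k, ({a} : Finset ι) ∈ Q k → a ∈ T k) (hb : ∀ k, ({b} : Finset ι) ∈ Q k → b ∈ T k) :
    Linked Y a b := by
  -- While the path is inside a region its current vertex need not be reachable in `Y`. The
  -- invariant therefore records that the whole frontier of that region is reachable.
  have key : (∀ k, ({b} : Finset ι) ∈ Q k → ∀ t ∈ T k, Linked Y a t) ∧
      ((∀ k, ({b} : Finset ι) ∉ Q k) → Linked Y a b) := by
    clear hb
    induction hab with
    | refl => exact ⟨fun k hk t ht => hT k _ (ha k hk) _ ht, fun _ => Relation.ReflTransGen.refl⟩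
    | @tail w w' _ hww' ih =>
      by_cases hin : ∃ k, ({w, w'} : Finset ι) ∈ Q k
      · obtain ⟨k, hk⟩ := hin
        have hw := hQ k _ hk w (by simp)
        have hw' := hQ k _ hk w' (by simp)
        refine ⟨fun k' hk' t ht => ?_, fun h => absurd hw' (h k)⟩
        obtain rfl := hQdisj _ _ _ hw' hk'
        exact ih.1 _ hw t ht
      · have hin : ∀ k, ({w, w'} : Finset ι) ∉ Q k := fun k hk => hin ⟨k, hk⟩
        have hww := hY _ _ hww' hin
        have haw : Linked Y a w := by
          by_cases h : ∃ k, ({w} : Finset ι) ∈ Q k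
          · obtain ⟨k, hk⟩ := h
            refine ih.1 k hk w (hfr k w' w ?_ ?_ hk)
            · rwa [Finset.pair_comm]
            · rw [Finset.pair_comm]; exact hin k
          · exact ih.2 fun k hk => h ⟨k, hk⟩
        have haw' : Linked Y a w' := haw.tail hww
        exact ⟨fun k hk t ht => haw'.trans (hT k _ (hfr k _ _ hww' (hin k) hk) _ ht), fun _ => haw'⟩
  by_cases h : ∃ k, ({b} : Finset ι) ∈ Q k
  · obtain ⟨k, hk⟩ := h
    exact key.1 k hk b (hb k hk)
  · exact key.2 fun k hk => h ⟨k, hk⟩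

/-! ### 1-chains -/

theorem Chain1_mono [Fintype ι] {X Y : Faces ι} (h : X ⊆ Y) : Chain1 X ≤ Chain1 Y :=
  fun _ hc => ⟨hc.1, fun u v huv => hc.2 u v fun h' => huv (h h')⟩

theorem Chain2_mono [Fintype ι] {X Y : Faces ι} (h : X ⊆ Y) : Chain2 X ≤ Chain2 Y :=
  fun _ hc => ⟨hc.1, hc.2.1, fun u v w huv => hc.2.2 u v w fun h' => huv (h h')⟩

/-- The 1-chain consisting of one oriented edge. -/
def edgeChain (a b : ι) : ι → ι → ℤ := fun u v =>
  (if u = a ∧ v = b then 1 else 0) - (if u = b ∧ v = a then 1 else 0)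

theorem antisymm_self {c : ι → ι → ℤ} (h : ∀ u v, c u v = - c v u) (u : ι) : c u u = 0 := by
  have := h u u; omega

/-- The 0-chain consisting of one vertex. -/
abbrev vert (a : ι) : ι → ℤ := Pi.single a 1

variable [Fintype ι]

theorem edgeChain_mem {X : Faces ι} {a b : ι} (h : ({a, b} : Finset ι) ∈ X) :
    edgeChain a b ∈ Chain1 X := by
  refine ⟨fun u v => ?_, fun u v huv => ?_⟩
  · simp only [edgeChain, neg_sub, and_comm]
  · have h1 : ¬ (u = a ∧ v = b) := by rintro ⟨rfl, rfl⟩; exact huv h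
    have h2 : ¬ (u = b ∧ v = a) := by rintro ⟨rfl, rfl⟩; rw [Finset.pair_comm] at huv; exact huv h
    simp [edgeChain, h1, h2]

theorem bd1_apply (c : ι → ι → ℤ) (v : ι) : bd1 c v = ∑ u, c u v := rfl

theorem bd2_apply (c : ι → ι → ι → ℤ) (u v : ι) : bd2 c u v = ∑ w, c u v w := rfl

theorem bd1_edgeChain (a b : ι) : bd1 (edgeChain a b) = vert b - vert a := by
  funext v
  simp only [bd1_apply, edgeChain, Finset.sum_sub_distrib, Pi.sub_apply, Pi.single_apply]
  congr 1
  · by_cases h : v = b <;> simp [h]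
  · by_cases h : v = a <;> simp [h]

theorem Linked.exists_chain {X : Faces ι} {a b : ι} (h : Linked X a b) :
    ∃ c ∈ Chain1 X, bd1 c = vert b - vert a := by
  induction h with
  | refl => exact ⟨0, zero_mem _, by simp⟩
  | tail _ hbc ih =>
    obtain ⟨c, hc, hc'⟩ := ih
    exact ⟨c + edgeChain _ _, add_mem hc (edgeChain_mem hbc), by
      rw [map_add, hc', bd1_edgeChain]; abel⟩

/-- Join every point of `S` to one base point. The weighted sum of these paths has the prescribed
boundary up to a multiple of the base point, and that multiple is the total weight, zero. -/
theorem exists_chain_of_sum_eq_zero {X : Faces ι} {S : Set ι}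
    (hS : ∀ a ∈ S, ∀ b ∈ S, Linked X a b) (f : ι → ℤ) (hf : ∀ v, v ∉ S → f v = 0)
    (h0 : ∑ v, f v = 0) : ∃ c ∈ Chain1 X, bd1 c = f := by
  by_cases hne : S.Nonempty
  · obtain ⟨s, hs⟩ := hne
    have hch : ∀ v, ∃ c ∈ Chain1 X, v ∈ S → bd1 c = vert v - vert s := by
      intro v
      by_cases hv : v ∈ S
      · obtain ⟨c, hc, h⟩ := (hS s hs v hv).exists_chain
        exact ⟨c, hc, fun _ => h⟩
      · exact ⟨0, zero_mem _, fun h => absurd h hv⟩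
    choose c hc hc' using hch
    refine ⟨∑ v, f v • c v, Submodule.sum_mem _ fun v _ => Submodule.smul_mem _ _ (hc v), ?_⟩
    have : ∀ v, f v • bd1 (c v) = f v • vert v - f v • vert s := by
      intro v
      by_cases hv : v ∈ S
      · rw [hc' v hv, smul_sub]
      · simp [hf v hv]
    rw [map_sum]
    simp only [map_smul, this, Finset.sum_sub_distrib, ← Finset.sum_smul, h0, zero_smul, sub_zero]
    funext w
    simp [Finset.sum_apply, Pi.single_apply]
  · refine ⟨0, zero_mem _, ?_⟩
    funext v
    rw [map_zero, hf v fun hv => hne ⟨v, hv⟩]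
    rfl

theorem sum_bd1 {c : ι → ι → ℤ} (hc : ∀ u v, c u v = - c v u) : ∑ v, bd1 c v = 0 := by
  have h : ∑ v, bd1 c v = - ∑ v, bd1 c v := by
    conv_lhs => simp only [bd1_apply]; rw [Finset.sum_comm]
    rw [← Finset.sum_neg_distrib]
    refine Finset.sum_congr rfl fun u _ => ?_
    rw [bd1_apply, ← Finset.sum_neg_distrib]
    exact Finset.sum_congr rfl fun v _ => hc _ _
  omega

theorem bd1_bd2 {c : ι → ι → ι → ℤ} (h : ∀ u v w, c u v w = - c v u w)
    (h' : ∀ u v w, c u v w = - c u w v) : bd1 (bd2 c) = 0 := by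
  funext v
  have e : bd1 (bd2 c) v = - bd1 (bd2 c) v := by
    simp only [bd1_apply, bd2_apply]
    conv_lhs => rw [Finset.sum_comm]
    rw [← Finset.sum_neg_distrib]
    refine Finset.sum_congr rfl fun u _ => ?_
    rw [← Finset.sum_neg_distrib]
    refine Finset.sum_congr rfl fun w _ => ?_
    rw [h w v u, h' v w u, h v u w, neg_neg]
  simp only [Pi.zero_apply]
  omega

theorem bd2_antisymm {c : ι → ι → ι → ℤ} (h : ∀ u v w, c u v w = - c v u w) (u v : ι) :
    bd2 c u v = - bd2 c v u := by
  rw [bd2_apply, bd2_apply, ← Finset.sum_neg_distrib]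
  exact Finset.sum_congr rfl fun w _ => h u v w

theorem bd2_mem_Chain1 {X : Faces ι} (hX : IsSubcomplex X) {c : ι → ι → ι → ℤ}
    (hc : c ∈ Chain2 X) : bd2 c ∈ Chain1 X := by
  refine ⟨bd2_antisymm hc.1, fun u v huv => ?_⟩
  rw [bd2_apply]
  refine Finset.sum_eq_zero fun w _ => hc.2.2 u v w fun h => huv ?_
  refine (hX _ h).2 _ ?_ (by simp)
  intro a ha
  simp only [Finset.mem_insert, Finset.mem_singleton] at ha ⊢
  tauto

theorem bd2_mem_Z1 {X : Faces ι} (hX : IsSubcomplex X) {c : ι → ι → ι → ℤ}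
    (hc : c ∈ Chain2 X) : bd2 c ∈ Z1 X :=
  ⟨bd2_mem_Chain1 hX hc, bd1_bd2 hc.1 hc.2.1⟩

theorem B1_le_Z1 {X : Faces ι} (hX : IsSubcomplex X) : B1 X ≤ Z1 X := by
  rintro _ ⟨c, hc, rfl⟩
  exact bd2_mem_Z1 hX hc

theorem B1_mono {X Y : Faces ι} (h : X ⊆ Y) : B1 X ≤ B1 Y :=
  Submodule.map_mono (Chain2_mono h)

theorem Z1_mono {X Y : Faces ι} (h : X ⊆ Y) : Z1 X ≤ Z1 Y :=
  inf_le_inf_right _ (Chain1_mono h)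

/-- The part of a 1-chain that lies on the edges in `Y`. -/
noncomputable def restrict1 (Y : Faces ι) : (ι → ι → ℤ) →ₗ[ℤ] (ι → ι → ℤ) where
  toFun c := fun u v => if ({u, v} : Finset ι) ∈ Y then c u v else 0
  map_add' a b := by funext u v; simp only [Pi.add_apply]; split_ifs <;> simp
  map_smul' k a := by funext u v; simp

theorem restrict1_apply (Y : Faces ι) (c : ι → ι → ℤ) (u v : ι) :
    restrict1 Y c u v = if ({u, v} : Finset ι) ∈ Y then c u v else 0 := rfl

theorem restrict1_mem (Y : Faces ι) {c : ι → ι → ℤ} (hc : ∀ u v, c u v = - c v u) :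
    restrict1 Y c ∈ Chain1 Y := by
  refine ⟨fun u v => ?_, fun u v huv => ?_⟩
  · simp only [restrict1_apply, Finset.pair_comm u v]
    split_ifs
    · exact hc u v
    · simp
  · rw [restrict1_apply, if_neg huv]

theorem bd1_restrict1_of_forall {Y : Faces ι} {c : ι → ι → ℤ} {v : ι}
    (h : ∀ u, c u v ≠ 0 → ({u, v} : Finset ι) ∈ Y) : bd1 (restrict1 Y c) v = bd1 c v := by
  rw [bd1_apply, bd1_apply]
  refine Finset.sum_congr rfl fun u _ => ?_
  rw [restrict1_apply]
  split_ifs with h'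
  · rfl
  · by_contra h0
    exact h' (h u fun e => h0 e.symm)

theorem Chain1_eq_zero_of_forall {X : Faces ι} {c : ι → ι → ℤ} (hc : c ∈ Chain1 X) {v : ι}
    (h : ∀ u, ({u, v} : Finset ι) ∉ X) : bd1 c v = 0 :=
  Finset.sum_eq_zero fun u _ => hc.2 u v (h u)

/-- An arc carries no cycle: its first vertex lies on one edge only, whose coefficient must vanish,
and the rest is a shorter arc. -/
theorem eq_zero_of_mem_Chain1_pathFaces {l : List ι} (hl : l.Nodup) {c : ι → ι → ℤ}
    (hc : c ∈ Chain1 (pathFaces l)) (h0 : bd1 c = 0) : c = 0 := by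
  induction l with
  | nil =>
    funext u v
    exact hc.2 u v fun ⟨_, a, b, h, _⟩ => by simpa using infix_left_mem h
  | cons x l ih =>
    cases l with
    | nil =>
      funext u v
      refine hc.2 u v fun ⟨_, a, b, h, _⟩ => ?_
      have := h.length_le
      simp at this
    | cons y l =>
      refine ih (List.nodup_cons.1 hl).2 ⟨hc.1, fun u v huv => ?_⟩
      have hx : ∀ w, w ≠ y → c w x = 0 := by
        intro w hw
        by_cases hwx : w = x
        · subst hwx; exact antisymm_self hc.1 _
        refine hc.2 w x fun h => ?_
        rcases (mem_pathFaces_pair hwx).1 h with h | h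
        · rcases pair_infix_cons.1 h with ⟨rfl, -⟩ | h
          · exact hwx rfl
          · exact (List.nodup_cons.1 hl).1 (infix_right_mem h)
        · rcases pair_infix_cons.1 h with ⟨-, rfl⟩ | h
          · exact hw rfl
          · exact (List.nodup_cons.1 hl).1 (infix_left_mem h)
      have hyx : c y x = 0 := by
        have := congrFun h0 x
        rw [bd1_apply, Finset.sum_eq_single y (fun w _ hw => hx w hw) (by simp)] at this
        exact this
      have hx' : ∀ w, c w x = 0 := fun w => by
        by_cases h : w = y
        · rw [h, hyx]
        · exact hx w h
      by_contra hne
      have huv' : u ≠ v := by rintro rfl; exact hne (antisymm_self hc.1 u)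
      have hmem : ({u, v} : Finset ι) ∈ pathFaces (x :: y :: l) := by
        by_contra h; exact hne (hc.2 u v h)
      rcases (mem_pathFaces_pair huv').1 hmem with h | h
      · rcases pair_infix_cons.1 h with ⟨rfl, rfl⟩ | h
        · exact hne (by rw [hc.1, hx', neg_zero])
        · exact huv ((mem_pathFaces_pair huv').2 (Or.inl h))
      · rcases pair_infix_cons.1 h with ⟨rfl, rfl⟩ | h
        · exact hne (hx' _)
        · exact huv ((mem_pathFaces_pair huv').2 (Or.inr h))

/-- No edge of one arc touches the other, so the restriction of the cycle to each arc is again a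
cycle. This is what prevents a virtual band, attached along two arcs, from creating new relations in
homology. -/
theorem eq_zero_of_mem_Chain1_pathFaces_union {l l' : List ι} (hl : l.Nodup) (hl' : l'.Nodup)
    (hd : l.Disjoint l') {c : ι → ι → ℤ}
    (hc : c ∈ Chain1 (pathFaces l ∪ pathFaces l')) (h0 : bd1 c = 0) : c = 0 := by
  have key : ∀ m m' : List ι, m.Nodup → m.Disjoint m' →
      c ∈ Chain1 (pathFaces m ∪ pathFaces m') →
      ∀ u v, ({u, v} : Finset ι) ∈ pathFaces m → c u v = 0 := by
    intro m m' hm hd hc u v huv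
    have hz : restrict1 (pathFaces m) c = 0 := by
      refine eq_zero_of_mem_Chain1_pathFaces hm (restrict1_mem _ hc.1) ?_
      funext v
      by_cases hv : v ∈ m
      · rw [bd1_restrict1_of_forall, h0]
        intro u hu
        by_contra hn
        have : ({u, v} : Finset ι) ∈ pathFaces m ∪ pathFaces m' := by
          by_contra h; exact hu (hc.2 u v h)
        rcases this with h | h
        · exact hn h
        · exact hd hv (mem_of_mem_pathFaces h (by simp))
      · refine Chain1_eq_zero_of_forall (restrict1_mem (pathFaces m) hc.1) fun u h => ?_
        exact hv (mem_of_mem_pathFaces h (by simp))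
    have := congrFun (congrFun hz u) v
    rwa [restrict1_apply, if_pos huv] at this
  funext u v
  by_cases h : ({u, v} : Finset ι) ∈ pathFaces l ∪ pathFaces l'
  · rcases h with h | h
    · exact key l l' hl hd hc u v h
    · exact key l' l hl' hd.symm (by rwa [Set.union_comm]) u v h
  · exact hc.2 u v h

/-! ### The chain of an embedded path -/

theorem pathChain_cons {x y : ι} {l : List ι} (hl : (x :: y :: l).Nodup) :
    pathChain (x :: y :: l) = edgeChain x y + pathChain (y :: l) := by
  funext u v
  have hx : x ∉ y :: l := (List.nodup_cons.1 hl).1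
  have e : ∀ u v, (if [u, v] <:+: x :: y :: l then (1 : ℤ) else 0) =
      (if u = x ∧ v = y then 1 else 0) + (if [u, v] <:+: y :: l then 1 else 0) := by
    intro u v
    rw [if_congr pair_infix_cons rfl rfl]
    by_cases h : u = x ∧ v = y
    · have : ¬ [u, v] <:+: y :: l := fun h' => hx (h.1 ▸ infix_left_mem h')
      simp [h.1, h.2] at this ⊢
      simp [this]
    · simp [h]
  simp only [pathChain, Pi.add_apply, edgeChain, e]
  have : (if v = x ∧ u = y then (1 : ℤ) else 0) = if u = y ∧ v = x then 1 else 0 := by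
    simp only [and_comm]
  rw [this]
  ring

theorem bd1_pathChain {x : ι} {l : List ι} (hl : (x :: l).Nodup) :
    bd1 (pathChain (x :: l)) = vert ((x :: l).getLast (by simp)) - vert x := by
  induction l generalizing x with
  | nil =>
    have : pathChain [x] = 0 := by
      funext u v
      have : ∀ u v, ¬ [u, v] <:+: [x] := fun u v h => by have := h.length_le; simp at this
      simp [pathChain, this]
    simp [this]
  | cons y l ih =>
    rw [pathChain_cons hl, map_add, bd1_edgeChain, ih (List.nodup_cons.1 hl).2]
    simp

theorem bd1_pathChain_of_ends {l : List ι} (hl : l.Nodup) {a b : ι} (ha : l.head? = some a)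
    (hb : l.getLast? = some b) : bd1 (pathChain l) = vert b - vert a := by
  cases l with
  | nil => simp at ha
  | cons x l =>
    rw [bd1_pathChain hl]
    simp only [List.head?_cons, Option.some.injEq] at ha
    rw [List.getLast?_eq_getLast_of_ne_nil (by simp)] at hb
    simp only [Option.some.injEq] at hb
    subst ha hb
    rfl

theorem pathChain_mem (l : List ι) : pathChain l ∈ Chain1 (pathFaces l) := by
  refine ⟨fun u v => by simp [pathChain], fun u v huv => ?_⟩
  have h1 : ¬ [u, v] <:+: l := fun h => huv ⟨by simp, u, v, h, by simp⟩
  have h2 : ¬ [v, u] <:+: l := fun h => huv ⟨by simp, v, u, h, by simp [Finset.pair_comm]⟩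
  simp [pathChain, h1, h2]

end

section

open scoped Classical

set_option linter.unusedSectionVars false

variable {ι : Type} [Fintype ι] [DecidableEq ι]

/-! ### Alternating functions -/

theorem card_triple {u v w : ι} (huv : u ≠ v) (huw : u ≠ w) (hvw : v ≠ w) :
    ({u, v, w} : Finset ι).card = 3 := by
  rw [Finset.card_insert_of_notMem (by simp [huv, huw]), Finset.card_pair hvw]

theorem triple_ne {u v w : ι} (h : ({u, v, w} : Finset ι).card = 3) : u ≠ v ∧ u ≠ w ∧ v ≠ w := by
  refine ⟨?_, ?_, ?_⟩ <;> rintro rfl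
  · simp only [Finset.mem_insert, Finset.mem_singleton, true_or, Finset.insert_eq_of_mem] at h
    exact absurd h (Finset.card_le_two.trans_lt (by norm_num)).ne
  · have : ({u, v, u} : Finset ι) = {u, v} := by ext; simp; tauto
    rw [this] at h
    exact absurd h (Finset.card_le_two.trans_lt (by norm_num)).ne
  · simp only [Finset.mem_singleton, Finset.insert_eq_of_mem] at h
    exact absurd h (Finset.card_le_two.trans_lt (by norm_num)).ne

/-- Reordering vertices only changes signs. Passing to absolute values lets vanishing and "equal to
±1" be transferred between orderings of a simplex without tracking permutations. -/
theorem abs_alternating_two {c : ι → ι → ℤ} (h : ∀ u v, c u v = - c v u) {u v a b : ι}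
    (huv : u ≠ v) (he : ({u, v} : Finset ι) = {a, b}) : |c u v| = |c a b| := by
  rcases pair_subset_pair huv he.subset with ⟨rfl, rfl⟩ | ⟨rfl, rfl⟩
  · rfl
  · rw [h, abs_neg]

theorem abs_alternating_three {c : ι → ι → ι → ℤ} (h : ∀ u v w, c u v w = - c v u w)
    (h' : ∀ u v w, c u v w = - c u w v) {u v w a b d : ι}
    (hcard : ({u, v, w} : Finset ι).card = 3) (he : ({u, v, w} : Finset ι) = {a, b, d}) :
    |c u v w| = |c a b d| := by
  obtain ⟨h1, h2, h3⟩ := triple_ne hcard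
  have herase : ∀ {x y z : ι}, u = x → ({u, v, w} : Finset ι) = {x, y, z} →
      ({x, y, z} : Finset ι).card = 3 → ({v, w} : Finset ι) = {y, z} := by
    intro x y z hx he hc
    obtain ⟨g1, g2, g3⟩ := triple_ne hc
    have := congrArg (fun s => s.erase u) he
    rw [Finset.erase_insert (by simp [h1, h2]), hx, Finset.erase_insert (by simp [g1, g2])] at this
    exact this
  have hu : u ∈ ({a, b, d} : Finset ι) := he ▸ by simp
  simp only [Finset.mem_insert, Finset.mem_singleton] at hu
  rcases hu with hu | hu | hu
  · rw [← hu, abs_alternating_two (c := c u) (h' u) h3 (herase hu he (he ▸ hcard))]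
  · have e : ({a, b, d} : Finset ι) = {b, a, d} := by ext; simp; tauto
    rw [h a b d, abs_neg, ← hu, abs_alternating_two (c := c u) (h' u) h3
      (herase hu (he.trans e) (e ▸ he ▸ hcard))]
  · have e : ({a, b, d} : Finset ι) = {d, a, b} := by ext; simp; tauto
    rw [h' a b d, abs_neg, h a d b, abs_neg, ← hu, abs_alternating_two (c := c u) (h' u) h3
      (herase hu (he.trans e) (e ▸ he ▸ hcard))]

/-- An alternating integer function vanishes on repeated vertices, so it does no harm that the
support condition also admits triples spanning an edge or a vertex of `X`. -/
theorem Chain2_eq_zero_of_card_ne {X : Faces ι} {z : ι → ι → ι → ℤ} (hz : z ∈ Chain2 X)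
    {u v w : ι} (huvw : ({u, v, w} : Finset ι).card ≠ 3) : z u v w = 0 := by
  have h1 := hz.1
  have h2 := hz.2.1
  by_cases huv : u = v
  · subst huv; have := h1 u u w; omega
  by_cases hvw : v = w
  · subst hvw; have := h2 u v v; omega
  by_cases huw : u = w
  · subst huw
    have e1 := h1 u v u
    have e2 := h2 v u u
    omega
  · exact absurd (card_triple huv huw hvw) huvw

/-- Simplicial 3-chains supported on the tetrahedra in `X`, as alternating functions. -/
structure IsChain3 (X : Faces ι) (c : ι → ι → ι → ι → ℤ) : Prop where
  swap12 : ∀ u v w x, c u v w x = - c v u w x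
  swap23 : ∀ u v w x, c u v w x = - c u w v x
  swap34 : ∀ u v w x, c u v w x = - c u v x w
  support : ∀ u v w x, ({u, v, w, x} : Finset ι) ∉ X → c u v w x = 0

/-- The boundary of a 3-chain. -/
def bd3 (c : ι → ι → ι → ι → ℤ) : ι → ι → ι → ℤ := fun u v w => ∑ x, c u v w x

theorem abs_alternating_four {X : Faces ι} {c : ι → ι → ι → ι → ℤ} (hc : IsChain3 X c)
    {u v w x a b d e : ι}
    (hcard : ({u, v, w, x} : Finset ι).card = 4)
    (he : ({u, v, w, x} : Finset ι) = {a, b, d, e}) :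
    |c u v w x| = |c a b d e| := by
  have hne : ∀ {u v w x : ι}, ({u, v, w, x} : Finset ι).card = 4 →
      u ∉ ({v, w, x} : Finset ι) ∧ ({v, w, x} : Finset ι).card = 3 := by
    intro u v w x h
    have h1 : u ∉ ({v, w, x} : Finset ι) := by
      intro hu
      rw [Finset.insert_eq_of_mem hu] at h
      exact absurd h (Finset.card_le_three.trans_lt (by norm_num)).ne
    rw [Finset.card_insert_of_notMem h1] at h
    exact ⟨h1, by omega⟩
  have herase : ∀ {p y z t : ι}, u = p → ({u, v, w, x} : Finset ι) = {p, y, z, t} →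
      ({p, y, z, t} : Finset ι).card = 4 → |c u v w x| = |c p y z t| := by
    intro p y z t hx he hc'
    have := congrArg (fun s => s.erase u) he
    rw [Finset.erase_insert (hne hcard).1, hx, Finset.erase_insert (hne hc').1] at this
    rw [hx]
    exact abs_alternating_three (hc.swap23 p) (hc.swap34 p) (hne hcard).2 this
  have hu : u ∈ ({a, b, d, e} : Finset ι) := he ▸ by simp
  simp only [Finset.mem_insert, Finset.mem_singleton] at hu
  rcases hu with hu | hu | hu | hu
  · exact herase hu he (he ▸ hcard)
  · have e' : ({a, b, d, e} : Finset ι) = {b, a, d, e} := by ext; simp; tauto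
    rw [hc.swap12 a b d e, abs_neg, herase hu (he.trans e') (e' ▸ he ▸ hcard)]
  · have e' : ({a, b, d, e} : Finset ι) = {d, a, b, e} := by ext; simp; tauto
    rw [hc.swap23 a b d e, abs_neg, hc.swap12 a d b e, abs_neg,
      herase hu (he.trans e') (e' ▸ he ▸ hcard)]
  · have e' : ({a, b, d, e} : Finset ι) = {e, a, b, d} := by ext; simp; tauto
    rw [hc.swap34 a b d e, abs_neg, hc.swap23 a b e d, abs_neg, hc.swap12 a e b d, abs_neg,
      herase hu (he.trans e') (e' ▸ he ▸ hcard)]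

/-- The sign of the ordered simplex `q` with respect to the ordered simplex `p` with the same
vertices. -/
def simplexSign {n : ℕ} (p q : Fin n → ι) : ℤ :=
  (Matrix.of fun i j => if q i = p j then (1 : ℤ) else 0).det

/-- A determinant changes sign when two rows are exchanged. The same matrix has a zero row or column
when the vertex sets differ, so one formula gives both alternation and support in every dimension.
-/
theorem simplexSign_swap {n : ℕ} (p q : Fin n → ι) {i j : Fin n} (hij : i ≠ j) :
    simplexSign p q = - simplexSign p (q ∘ Equiv.swap i j) := by
  unfold simplexSign
  have h := Matrix.det_permute (Equiv.swap i j)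
    (Matrix.of fun i j => if q i = p j then (1 : ℤ) else 0)
  rw [Equiv.Perm.sign_swap hij] at h
  simp only [Units.val_neg, Units.val_one, Int.cast_neg, Int.cast_one, neg_mul, one_mul] at h
  rw [eq_comm, neg_eq_iff_eq_neg]
  exact h

theorem simplexSign_self {n : ℕ} {p : Fin n → ι} (hp : Function.Injective p) :
    simplexSign p p = 1 := by
  have : (Matrix.of fun i j => if p i = p j then (1 : ℤ) else 0) = 1 := by
    ext i j
    simp [Matrix.one_apply, hp.eq_iff]
  rw [simplexSign, this, Matrix.det_one]

theorem image_eq_of_simplexSign_ne_zero {n : ℕ} {p q : Fin n → ι} (h : simplexSign p q ≠ 0) :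
    Finset.univ.image q = Finset.univ.image p := by
  apply Finset.Subset.antisymm
  · intro x hx
    obtain ⟨i, -, rfl⟩ := Finset.mem_image.1 hx
    by_contra hn
    refine h (Matrix.det_eq_zero_of_row_eq_zero i fun j => ?_)
    simp only [Matrix.of_apply]
    rw [if_neg]
    exact fun e => hn (Finset.mem_image.2 ⟨j, by simp, e.symm⟩)
  · intro x hx
    obtain ⟨j, -, rfl⟩ := Finset.mem_image.1 hx
    by_contra hn
    refine h (Matrix.det_eq_zero_of_column_eq_zero j fun i => ?_)
    simp only [Matrix.of_apply]
    rw [if_neg]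
    exact fun e => hn (Finset.mem_image.2 ⟨i, by simp, e⟩)

/-- The 2-chain consisting of one oriented triangle. -/
def triangleChain (a b d : ι) : ι → ι → ι → ℤ := fun u v w => simplexSign ![a, b, d] ![u, v, w]

/-- The 3-chain consisting of one oriented tetrahedron. -/
def tetraChain (a b d e : ι) : ι → ι → ι → ι → ℤ := fun u v w x =>
  simplexSign ![a, b, d, e] ![u, v, w, x]

theorem image_univ_three (u v w : ι) :
    Finset.univ.image ![u, v, w] = ({u, v, w} : Finset ι) := by
  ext x
  simp only [Finset.mem_image, Finset.mem_univ, true_and, Finset.mem_insert,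
    Finset.mem_singleton, Fin.exists_fin_succ]
  simp [eq_comm]

theorem image_univ_four (u v w x : ι) :
    Finset.univ.image ![u, v, w, x] = ({u, v, w, x} : Finset ι) := by
  ext y
  simp only [Finset.mem_image, Finset.mem_univ, true_and, Finset.mem_insert,
    Finset.mem_singleton, Fin.exists_fin_succ]
  simp [eq_comm]

theorem triangleChain_support {a b d u v w : ι} (h : triangleChain a b d u v w ≠ 0) :
    ({u, v, w} : Finset ι) = {a, b, d} := by
  have := image_eq_of_simplexSign_ne_zero h
  rwa [image_univ_three, image_univ_three] at this

theorem tetraChain_support {a b d e u v w x : ι} (h : tetraChain a b d e u v w x ≠ 0) :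
    ({u, v, w, x} : Finset ι) = {a, b, d, e} := by
  have := image_eq_of_simplexSign_ne_zero h
  rwa [image_univ_four, image_univ_four] at this

theorem triangleChain_mem {X : Faces ι} {a b d : ι} (h : ({a, b, d} : Finset ι) ∈ X) :
    triangleChain a b d ∈ Chain2 X := by
  refine ⟨fun u v w => ?_, fun u v w => ?_, fun u v w huv => ?_⟩
  · unfold triangleChain
    rw [simplexSign_swap _ _ (show (0 : Fin 3) ≠ 1 by decide)]
    congr 2
    funext i; fin_cases i <;> rfl
  · unfold triangleChain
    rw [simplexSign_swap _ _ (show (1 : Fin 3) ≠ 2 by decide)]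
    congr 2
    funext i; fin_cases i <;> rfl
  · by_contra hne
    exact huv (triangleChain_support hne ▸ h)

theorem tetraChain_mem {X : Faces ι} {a b d e : ι} (h : ({a, b, d, e} : Finset ι) ∈ X) :
    IsChain3 X (tetraChain a b d e) := by
  refine ⟨fun u v w x => ?_, fun u v w x => ?_, fun u v w x => ?_, fun u v w x huv => ?_⟩
  · unfold tetraChain
    rw [simplexSign_swap _ _ (show (0 : Fin 4) ≠ 1 by decide)]
    congr 2
    funext i; fin_cases i <;> rfl
  · unfold tetraChain
    rw [simplexSign_swap _ _ (show (1 : Fin 4) ≠ 2 by decide)]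
    congr 2
    funext i; fin_cases i <;> rfl
  · unfold tetraChain
    rw [simplexSign_swap _ _ (show (2 : Fin 4) ≠ 3 by decide)]
    congr 2
    funext i; fin_cases i <;> rfl
  · by_contra hne
    exact huv (tetraChain_support hne ▸ h)

/-- Coefficient one at the chosen face makes an elementary collapse reversible on chains:
subtracting a multiple of this boundary clears the coefficient at a free edge. -/
theorem bd2_triangleChain {a b d : ι} (h : ({a, b, d} : Finset ι).card = 3) :
    bd2 (triangleChain a b d) a b = 1 := by
  obtain ⟨h1, h2, h3⟩ := triple_ne h
  rw [bd2_apply, Finset.sum_eq_single d]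
  · refine simplexSign_self ?_
    intro i j hij
    fin_cases i <;> fin_cases j <;> simp_all
  · intro x _ hx
    by_contra hne
    have he := triangleChain_support hne
    have : d ∈ ({a, b, x} : Finset ι) := he ▸ by simp
    simp only [Finset.mem_insert, Finset.mem_singleton] at this
    rcases this with e | e | e
    · exact h2 e.symm
    · exact h3 e.symm
    · exact hx e.symm
  · simp

theorem bd3_tetraChain {a b d e : ι} (h : ({a, b, d} : Finset ι).card = 3)
    (he : e ∉ ({a, b, d} : Finset ι)) : bd3 (tetraChain a b d e) a b d = 1 := by
  obtain ⟨h1, h2, h3⟩ := triple_ne h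
  simp only [Finset.mem_insert, Finset.mem_singleton, not_or] at he
  obtain ⟨g1, g2, g3⟩ := he
  unfold bd3
  rw [Finset.sum_eq_single e]
  · refine simplexSign_self ?_
    intro i j hij
    fin_cases i <;> fin_cases j <;> simp_all
  · intro x _ hx
    by_contra hne
    have he := tetraChain_support hne
    have : e ∈ ({a, b, d, x} : Finset ι) := he ▸ by simp
    simp only [Finset.mem_insert, Finset.mem_singleton] at this
    rcases this with e' | e' | e' | e'
    · exact g1 e'
    · exact g2 e'
    · exact g3 e'
    · exact hx e'.symm
  · simp

theorem IsChain3.add {X : Faces ι} {c c' : ι → ι → ι → ι → ℤ} (h : IsChain3 X c)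
    (h' : IsChain3 X c') : IsChain3 X (c + c') where
  swap12 u v w x := by
    simp only [Pi.add_apply]; rw [h.swap12, h'.swap12]; ring
  swap23 u v w x := by
    simp only [Pi.add_apply]; rw [h.swap23, h'.swap23]; ring
  swap34 u v w x := by
    simp only [Pi.add_apply]; rw [h.swap34, h'.swap34]; ring
  support u v w x hs := by
    simp only [Pi.add_apply]; rw [h.support _ _ _ _ hs, h'.support _ _ _ _ hs]; ring

theorem IsChain3.smul {X : Faces ι} {c : ι → ι → ι → ι → ℤ} (h : IsChain3 X c)
    (k : ℤ) : IsChain3 X (k • c) where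
  swap12 u v w x := by
    simp only [Pi.smul_apply]; rw [h.swap12]; simp
  swap23 u v w x := by
    simp only [Pi.smul_apply]; rw [h.swap23]; simp
  swap34 u v w x := by
    simp only [Pi.smul_apply]; rw [h.swap34]; simp
  support u v w x hs := by
    simp only [Pi.smul_apply]; rw [h.support _ _ _ _ hs]; simp

theorem IsChain3.mono {X Y : Faces ι} (hXY : X ⊆ Y) {c : ι → ι → ι → ι → ℤ} (h : IsChain3 X c) :
    IsChain3 Y c :=
  ⟨h.swap12, h.swap23, h.swap34, fun u v w x hs => h.support u v w x fun h' => hs (hXY h')⟩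

theorem bd3_add (c c' : ι → ι → ι → ι → ℤ) : bd3 (c + c') = bd3 c + bd3 c' := by
  funext u v w
  simp [bd3, Finset.sum_add_distrib]

theorem bd3_smul (k : ℤ) (c : ι → ι → ι → ι → ℤ) : bd3 (k • c) = k • bd3 c := by
  funext u v w
  simp [bd3, Finset.mul_sum]

theorem bd3_mem_Chain2 {X : Faces ι} (hX : IsSubcomplex X) {c : ι → ι → ι → ι → ℤ}
    (hc : IsChain3 X c) : bd3 c ∈ Chain2 X := by
  refine ⟨fun u v w => ?_, fun u v w => ?_, fun u v w h => ?_⟩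
  · unfold bd3
    rw [← Finset.sum_neg_distrib]
    exact Finset.sum_congr rfl fun x _ => hc.swap12 u v w x
  · unfold bd3
    rw [← Finset.sum_neg_distrib]
    exact Finset.sum_congr rfl fun x _ => hc.swap23 u v w x
  · unfold bd3
    refine Finset.sum_eq_zero fun x _ => hc.support u v w x fun h' => h ?_
    refine (hX _ h').2 _ ?_ (by simp)
    intro a ha
    simp only [Finset.mem_insert, Finset.mem_singleton] at ha ⊢
    tauto

theorem bd2_bd3 {X : Faces ι} {c : ι → ι → ι → ι → ℤ} (hc : IsChain3 X c) : bd2 (bd3 c) = 0 := by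
  funext u v
  have e : bd2 (bd3 c) u v = - bd2 (bd3 c) u v := by
    simp only [bd2_apply, bd3]
    conv_lhs => rw [Finset.sum_comm]
    rw [← Finset.sum_neg_distrib]
    refine Finset.sum_congr rfl fun w _ => ?_
    rw [← Finset.sum_neg_distrib]
    exact Finset.sum_congr rfl fun x _ => hc.swap34 u v x w
  simp only [Pi.zero_apply]
  omega

/-! ### Collapses and homology -/

theorem ElementaryCollapse.subset {X Y : Faces ι} (h : ElementaryCollapse X Y) : Y ⊆ X := by
  obtain ⟨σ, -, τ, -, -, -, -, rfl⟩ := h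
  exact Set.sdiff_subset

/-- Any simplex that properly contains `σ` is `τ` itself by freeness, so no remaining simplex has a
removed face. -/
theorem ElementaryCollapse.isSubcomplex {X Y : Faces ι} (h : ElementaryCollapse X Y)
    (hX : IsSubcomplex X) : IsSubcomplex Y := by
  obtain ⟨σ, hσ, τ, hτ, hστ, hcard, hfree, rfl⟩ := h
  rintro s ⟨hs, hs'⟩
  simp only [Set.mem_insert_iff, Set.mem_singleton_iff, not_or] at hs'
  refine ⟨(hX s hs).1, fun t ht hne => ⟨(hX s hs).2 t ht hne, ?_⟩⟩
  simp only [Set.mem_insert_iff, Set.mem_singleton_iff, not_or]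
  constructor
  · rintro rfl
    exact hs'.2 (hfree s hs (ht.ssubset_of_ne fun e => hs'.1 e.symm))
  · rintro rfl
    exact hs'.2 (hfree s hs (hστ.trans_subset ht))

theorem Collapses.subset {X Y : Faces ι} (h : Collapses X Y) : Y ⊆ X := by
  induction h with
  | refl => exact subset_rfl
  | tail _ h ih => exact h.subset.trans ih

/-- A set with one more element. -/
theorem exists_eq_insert_of_ssubset {σ τ : Finset ι} (h : σ ⊂ τ) (hc : τ.card = σ.card + 1) :
    ∃ w ∉ σ, τ = insert w σ := by
  obtain ⟨w, hw⟩ := Finset.card_eq_one.1 (show (τ \ σ).card = 1 by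
    rw [Finset.card_sdiff_of_subset h.1]; omega)
  have hw' : w ∈ τ \ σ := by rw [hw]; simp
  refine ⟨w, (Finset.mem_sdiff.1 hw').2, ?_⟩
  rw [Finset.insert_eq, ← hw, Finset.sdiff_union_of_subset h.1]

/-- Undo the collapses one at a time. A vertex is regained only together with an edge joining it to
a vertex that was already there. -/
theorem linked_of_collapses {X : Faces ι} {x : ι} (h : Collapses X {{x}}) (hX : IsSubcomplex X)
    {a b : ι} (ha : ({a} : Finset ι) ∈ X) (hb : ({b} : Finset ι) ∈ X) : Linked X a b := by
  suffices H : ∀ a, ({a} : Finset ι) ∈ X → Linked X a x from (H a ha).trans (H b hb).symm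
  clear ha hb
  induction h using Relation.ReflTransGen.head_induction_on with
  | refl =>
    intro a ha
    simp only [Set.mem_singleton_iff, Finset.singleton_inj] at ha
    subst ha
    exact Relation.ReflTransGen.refl
  | @head X Y hXY _ ih =>
    have ih := ih (hXY.isSubcomplex hX)
    have hsub := hXY.subset
    obtain ⟨σ, hσ, τ, hτ, hστ, hcard, hfree, rfl⟩ := hXY
    intro a ha
    have hσ0 : 0 < σ.card := Finset.card_pos.2 (hX σ hσ).1
    by_cases hY : ({a} : Finset ι) ∈ X \ {σ, τ}
    · exact (ih a hY).mono hsub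
    · have hY' : ({a} : Finset ι) = σ := by
        have : ({a} : Finset ι) ∈ ({σ, τ} : Set (Finset ι)) := by
          by_contra hn; exact hY ⟨ha, hn⟩
        rcases this with h | h
        · exact h
        · have := congrArg Finset.card (Set.mem_singleton_iff.1 h)
          rw [Finset.card_singleton] at this
          omega
      subst hY'
      obtain ⟨w, hw, rfl⟩ := exists_eq_insert_of_ssubset hστ hcard
      have hwX : ({w} : Finset ι) ∈ X := (hX _ hτ).2 _ (by simp) (by simp)
      have hwa : w ≠ a := by simpa using hw
      refine Relation.ReflTransGen.head (b := w) (by rwa [Finset.pair_comm]) ((ih w ?_).mono hsub)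
      refine ⟨hwX, ?_⟩
      simp only [Set.mem_insert_iff, Finset.singleton_inj, Set.mem_singleton_iff, not_or]
      refine ⟨hwa, fun e => ?_⟩
      have := congrArg Finset.card e
      rw [Finset.card_singleton, hcard, Finset.card_singleton] at this
      omega

/-- A complex that collapses to a vertex has no first homology. -/
theorem Z1_le_B1_of_collapses {X : Faces ι} {x : ι} (h : Collapses X {{x}})
    (hX : IsSubcomplex X) : Z1 X ≤ B1 X := by
  induction h using Relation.ReflTransGen.head_induction_on with
  | refl =>
    intro z hz
    have : z = 0 := by
      funext u v
      by_cases huv : u = v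
      · subst huv; exact antisymm_self hz.1.1 _
      · refine hz.1.2 u v fun h => huv ?_
        have := Set.mem_singleton_iff.1 h
        have hu : u ∈ ({x} : Finset ι) := this ▸ by simp
        have hv : v ∈ ({x} : Finset ι) := this ▸ by simp
        simp only [Finset.mem_singleton] at hu hv
        rw [hu, hv]
    rw [this]; exact zero_mem _
  | @head X Y hXY _ ih =>
    have ih := ih (hXY.isSubcomplex hX)
    have hsub := hXY.subset
    obtain ⟨σ, hσ, τ, hτ, hστ, hcard, hfree, rfl⟩ := hXY
    intro z hz
    have hσ0 : 0 < σ.card := Finset.card_pos.2 (hX σ hσ).1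
    obtain ⟨w, hw, rfl⟩ := exists_eq_insert_of_ssubset hστ hcard
    -- At a free vertex there is a single edge, so the cycle condition kills its coefficient and the
    -- cycle already lives on the smaller complex.
    by_cases h1 : σ.card = 1
    · obtain ⟨v, rfl⟩ := Finset.card_eq_one.1 h1
      refine B1_mono hsub (ih ⟨⟨hz.1.1, fun a b hab => ?_⟩, hz.2⟩)
      by_contra hne
      have habX : ({a, b} : Finset ι) ∈ X := by by_contra h; exact hne (hz.1.2 a b h)
      have hab' : a ≠ b := by rintro rfl; exact hne (antisymm_self hz.1.1 a)
      have key : z w v = 0 := by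
        have := congrFun (LinearMap.mem_ker.1 hz.2) v
        rw [bd1_apply, Finset.sum_eq_single w] at this
        · exact this
        · intro u _ hu
          by_cases huv : u = v
          · subst huv; exact antisymm_self hz.1.1 _
          · refine hz.1.2 u v fun h => hu ?_
            have e := hfree _ h (by
              refine (Finset.ssubset_iff_subset_ne).2 ⟨by simp, fun e => huv ?_⟩
              have : u ∈ ({v} : Finset ι) := e ▸ by simp
              simpa using this)
            have : u ∈ ({w, v} : Finset ι) := e ▸ by simp
            simp only [Finset.mem_insert, Finset.mem_singleton] at this
            exact this.resolve_right huv
        · simp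
      have : ({a, b} : Finset ι) ∈ ({{v}, {w, v}} : Set (Finset ι)) := by
        by_contra h; exact hab ⟨habX, h⟩
      rcases this with e | e
      · have := congrArg Finset.card e
        rw [Finset.card_pair hab', Finset.card_singleton] at this
        omega
      · rcases pair_subset_pair hab' (Set.mem_singleton_iff.1 e).subset with ⟨rfl, rfl⟩ | ⟨rfl, rfl⟩
        · exact hne key
        · exact hne (by rw [hz.1.1, key, neg_zero])
    -- At a free edge, subtract the multiple of the boundary of the triangle `τ` that makes the
    -- coefficient of `σ` zero.
    by_cases h2 : σ.card = 2
    · obtain ⟨a, b, hab, rfl⟩ := Finset.card_eq_two.1 h2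
      have e3 : (insert w {a, b} : Finset ι) = {a, b, w} := by ext; simp; tauto
      have ht : triangleChain a b w ∈ Chain2 X := triangleChain_mem (e3 ▸ hτ)
      have hcard3 : ({a, b, w} : Finset ι).card = 3 := by rw [← e3, hcard, h2]
      have hz' : z - z a b • bd2 (triangleChain a b w) ∈ Z1 X :=
        sub_mem hz (Submodule.smul_mem _ _ (bd2_mem_Z1 hX ht))
      have hzY : z - z a b • bd2 (triangleChain a b w) ∈ Z1 (X \ {{a, b}, insert w {a, b}}) := by
        refine ⟨⟨hz'.1.1, fun u v huv => ?_⟩, hz'.2⟩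
        by_cases hX' : ({u, v} : Finset ι) ∈ X
        · by_cases huv' : u = v
          · subst huv'; exact antisymm_self hz'.1.1 _
          · have : ({u, v} : Finset ι) ∈ ({{a, b}, insert w {a, b}} : Set (Finset ι)) := by
              by_contra h; exact huv ⟨hX', h⟩
            rcases this with e | e
            · have := abs_alternating_two hz'.1.1 huv' e
              rw [← abs_eq_zero, this]
              simp [bd2_triangleChain hcard3]
            · have := congrArg Finset.card (Set.mem_singleton_iff.1 e)
              rw [Finset.card_pair huv', hcard] at this
              omega
        · exact hz'.1.2 u v hX'
      have := add_mem (B1_mono hsub (ih hzY))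
        (Submodule.smul_mem _ (z a b) (Submodule.mem_map_of_mem (f := bd2) ht))
      simpa [B1] using this
    -- Collapses in higher dimensions remove no edges.
    · refine B1_mono hsub (ih ⟨⟨hz.1.1, fun a b hab => ?_⟩, hz.2⟩)
      refine hz.1.2 a b fun h => hab ⟨h, ?_⟩
      have := Finset.card_le_two (a := a) (b := b)
      simp only [Set.mem_insert_iff, Set.mem_singleton_iff, not_or]
      exact ⟨fun e => by rw [e] at this; omega, fun e => by rw [e] at this; omega⟩

/-- A complex that collapses to a vertex has no second homology. -/
theorem exists_bd3_eq_of_collapses {X : Faces ι} {x : ι} (h : Collapses X {{x}})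
    (hX : IsSubcomplex X) {z : ι → ι → ι → ℤ} (hz : z ∈ Chain2 X)
    (h0 : bd2 z = 0) :
    ∃ c, IsChain3 X c ∧ bd3 c = z := by
  induction h using Relation.ReflTransGen.head_induction_on generalizing z with
  | refl =>
    have hdeg : ∀ u v w, ({u, v, w} : Finset ι).card ≠ 3 → z u v w = 0 :=
      fun _ _ _ h => Chain2_eq_zero_of_card_ne hz h
    refine ⟨0, ⟨by simp, by simp, by simp, by simp⟩, ?_⟩
    funext u v w
    by_cases h : ({u, v, w} : Finset ι).card = 3
    · rw [hz.2.2 u v w fun h' => by rw [Set.mem_singleton_iff.1 h'] at h; simp at h]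
      simp [bd3]
    · rw [hdeg u v w h]
      simp [bd3]
  | @head X Y hXY _ ih =>
    have hdeg : ∀ u v w, ({u, v, w} : Finset ι).card ≠ 3 → z u v w = 0 :=
      fun _ _ _ h => Chain2_eq_zero_of_card_ne hz h
    have ih := @ih (hXY.isSubcomplex hX)
    have hsub := hXY.subset
    obtain ⟨σ, hσ, τ, hτ, hστ, hcard, hfree, rfl⟩ := hXY
    obtain ⟨e, he, rfl⟩ := exists_eq_insert_of_ssubset hστ hcard
    -- Only the triangle `τ` lies on the free edge, so vanishing of the boundary there forces its
    -- coefficient to be zero.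
    by_cases h2 : σ.card = 2
    · obtain ⟨a, b, hab, rfl⟩ := Finset.card_eq_two.1 h2
      have key : z a b e = 0 := by
        have := congrFun (congrFun h0 a) b
        rw [bd2_apply, Finset.sum_eq_single e] at this
        · exact this
        · intro x _ hx
          by_contra hne
          have hc : ({a, b, x} : Finset ι).card = 3 := by
            by_contra h; exact hne (hdeg _ _ _ h)
          have hm : ({a, b, x} : Finset ι) ∈ X := by
            by_contra h; exact hne (hz.2.2 _ _ _ h)
          have := hfree _ hm (by
            refine (Finset.ssubset_iff_subset_ne).2 ⟨?_, fun e' => ?_⟩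
            · intro y; simp; tauto
            · rw [← e', h2] at hc; omega)
          have hxm : x ∈ (insert e {a, b} : Finset ι) := this ▸ by simp
          obtain ⟨-, g2, g3⟩ := triple_ne hc
          simp only [Finset.mem_insert, Finset.mem_singleton] at hxm
          rcases hxm with h | h | h
          · exact hx h
          · exact g2 h.symm
          · exact g3 h.symm
        · simp
      obtain ⟨c, hc, hc'⟩ := @ih z ⟨hz.1, hz.2.1, fun u v w huv => by
        by_contra hne
        have h3 : ({u, v, w} : Finset ι).card = 3 := by
          by_contra h; exact hne (hdeg _ _ _ h)
        have hm : ({u, v, w} : Finset ι) ∈ X := by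
          by_contra h; exact hne (hz.2.2 _ _ _ h)
        have : ({u, v, w} : Finset ι) ∈ ({{a, b}, insert e {a, b}} : Set (Finset ι)) := by
          by_contra h; exact huv ⟨hm, h⟩
        rcases this with e' | e'
        · rw [e', h2] at h3; omega
        · have e3 : (insert e {a, b} : Finset ι) = {a, b, e} := by ext; simp; tauto
          have := abs_alternating_three hz.1 hz.2.1 h3 ((Set.mem_singleton_iff.1 e').trans e3)
          rw [key, abs_zero, abs_eq_zero] at this
          exact hne this⟩ h0
      exact ⟨c, hc.mono hsub, hc'⟩
    -- Here the coefficient at the free triangle is cleared by a multiple of the boundary of the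
    -- tetrahedron `τ`, which is added back to the filling afterwards.
    by_cases h3 : σ.card = 3
    · obtain ⟨a, b, d, -, -, -, rfl⟩ := Finset.card_eq_three.1 h3
      have e4 : (insert e {a, b, d} : Finset ι) = {a, b, d, e} := by ext; simp; tauto
      have ht : IsChain3 X (tetraChain a b d e) := tetraChain_mem (e4 ▸ hτ)
      have hbd : bd3 (tetraChain a b d e) a b d = 1 := bd3_tetraChain h3 he
      have hbm := bd3_mem_Chain2 hX ht
      have hz' : z - z a b d • bd3 (tetraChain a b d e) ∈ Chain2 X :=
        sub_mem hz (Submodule.smul_mem _ _ hbm)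
      have hdeg' : ∀ u v w, ({u, v, w} : Finset ι).card ≠ 3 →
          (z - z a b d • bd3 (tetraChain a b d e)) u v w = 0 :=
        fun _ _ _ h => Chain2_eq_zero_of_card_ne hz' h
      obtain ⟨c, hc, hc'⟩ := @ih _ ⟨hz'.1, hz'.2.1, fun u v w huv => by
        by_contra hne
        have h3' : ({u, v, w} : Finset ι).card = 3 := by
          by_contra h; exact hne (hdeg' _ _ _ h)
        have hm : ({u, v, w} : Finset ι) ∈ X := by
          by_contra h; exact hne (hz'.2.2 _ _ _ h)
        have : ({u, v, w} : Finset ι) ∈ ({{a, b, d}, insert e {a, b, d}} : Set (Finset ι)) := by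
          by_contra h; exact huv ⟨hm, h⟩
        rcases this with e' | e'
        · have := abs_alternating_three hz'.1 hz'.2.1 h3' e'
          rw [← abs_eq_zero, this] at hne
          simp [hbd] at hne
        · rw [Set.mem_singleton_iff.1 e', hcard, h3] at h3'; omega⟩ (by
          rw [map_sub, map_smul, bd2_bd3 ht, h0]; simp)
      refine ⟨c + z a b d • tetraChain a b d e, (hc.mono hsub).add (ht.smul _), ?_⟩
      rw [bd3_add, bd3_smul, hc']
      abel
    · obtain ⟨c, hc, hc'⟩ := @ih z ⟨hz.1, hz.2.1, fun u v w huv => by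
        by_contra hne
        have h3' : ({u, v, w} : Finset ι).card = 3 := by
          by_contra h; exact hne (hdeg _ _ _ h)
        have hm : ({u, v, w} : Finset ι) ∈ X := by
          by_contra h; exact hne (hz.2.2 _ _ _ h)
        have : ({u, v, w} : Finset ι) ∈ ({σ, insert e σ} : Set (Finset ι)) := by
          by_contra h; exact huv ⟨hm, h⟩
        rcases this with e' | e'
        · rw [e'] at h3'; omega
        · rw [Set.mem_singleton_iff.1 e'] at h3'; omega⟩ h0
      exact ⟨c, hc.mono hsub, hc'⟩

end

section

open scoped Classical

set_option linter.unusedSectionVars false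

variable {ι : Type} [Fintype ι] [DecidableEq ι]

/-! ### Second homology modulo two -/

/-- The simplices of cardinality `k` of `X` that contain `s`. -/
noncomputable def cofaces (X : Faces ι) (k : ℕ) (s : Finset ι) : Finset (Finset ι) :=
  Finset.univ.filter fun t => t ∈ X ∧ t.card = k ∧ s ⊆ t

theorem mem_cofaces {X : Faces ι} {k : ℕ} {s t : Finset ι} :
    t ∈ cofaces X k s ↔ t ∈ X ∧ t.card = k ∧ s ⊆ t := by
  simp [cofaces]

/-- This evenness is the statement that the boundary of the boundary of a tetrahedron vanishes
modulo two. -/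
theorem card_between {e τ : Finset ι} (he : e.card = 2) (hτ : τ.card = 4) (h : e ⊆ τ) :
    (Finset.univ.filter fun t : Finset ι => t.card = 3 ∧ e ⊆ t ∧ t ⊆ τ).card = 2 := by
  obtain ⟨p, q, hpq, hpq'⟩ := Finset.card_eq_two.1 (show (τ \ e).card = 2 by
    rw [Finset.card_sdiff_of_subset h]; omega)
  have hp : p ∈ τ \ e := by rw [hpq']; simp
  have hq : q ∈ τ \ e := by rw [hpq']; simp
  rw [Finset.mem_sdiff] at hp hq
  have : (Finset.univ.filter fun t : Finset ι => t.card = 3 ∧ e ⊆ t ∧ t ⊆ τ) =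
      {insert p e, insert q e} := by
    ext t
    simp only [Finset.mem_filter, Finset.mem_univ, true_and, Finset.mem_insert,
      Finset.mem_singleton]
    constructor
    · rintro ⟨h3, het, htτ⟩
      obtain ⟨w, hw, rfl⟩ := exists_eq_insert_of_ssubset
        (Finset.ssubset_iff_subset_ne.2 ⟨het, fun e' => by rw [← e'] at h3; omega⟩) (by omega)
      have : w ∈ τ \ e := Finset.mem_sdiff.2 ⟨htτ (by simp), hw⟩
      rw [hpq'] at this
      simp only [Finset.mem_insert, Finset.mem_singleton] at this
      rcases this with rfl | rfl <;> simp
    · rintro (rfl | rfl)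
      · refine ⟨by rw [Finset.card_insert_of_notMem hp.2, he], by simp, ?_⟩
        exact Finset.insert_subset hp.1 h
      · refine ⟨by rw [Finset.card_insert_of_notMem hq.2, he], by simp, ?_⟩
        exact Finset.insert_subset hq.1 h
  rw [this, Finset.card_pair]
  intro e'
  have : p ∈ insert q e := e' ▸ by simp
  rcases Finset.mem_insert.1 this with h | h
  · exact hpq h
  · exact hp.2 h

/-- A collapsible complex has no second homology modulo two. Chains modulo two are functions on
simplices, so no orientations enter and the filling can be read as a two-colouring of the
tetrahedra. -/
theorem exists_mod_two_filling {X : Faces ι} {x : ι} (h : Collapses X {{x}})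
    (hX : IsSubcomplex X) (f : Finset ι → ZMod 2)
    (hf : ∀ e : Finset ι, e.card = 2 → ∑ t ∈ cofaces X 3 e, f t = 0) :
    ∃ g : Finset ι → ZMod 2, ∀ t ∈ X, t.card = 3 → f t = ∑ τ ∈ cofaces X 4 t, g τ := by
  induction h using Relation.ReflTransGen.head_induction_on generalizing f with
  | refl =>
    refine ⟨0, fun t ht h3 => ?_⟩
    rw [Set.mem_singleton_iff.1 ht] at h3
    simp at h3
  | @head X Y hXY _ ih =>
    have ih := @ih (hXY.isSubcomplex hX)
    have hsub := hXY.subset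
    obtain ⟨σ, hσ, τ, hτ, hστ, hcard, hfree, rfl⟩ := hXY
    have hne : σ ≠ τ := hστ.ne
    have hmax : ∀ ρ ∈ X, τ ⊆ ρ → ρ = τ := fun ρ hρ h => hfree ρ hρ (hστ.trans_subset h)
    by_cases h3 : σ.card = 3
    -- Subtract the boundary of `τ`, weighted so that the value at the free triangle `σ` becomes
    -- zero. It is restored by giving `τ` the colour `f σ`.
    · obtain ⟨g, hg⟩ := ih (fun t => f t - if t ⊆ τ then f σ else 0) (by
        intro e he
        have h1 : cofaces (X \ {σ, τ}) 3 e = (cofaces X 3 e).erase σ := by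
          ext t
          simp only [mem_cofaces, Finset.mem_erase, Set.mem_sdiff, Set.mem_insert_iff,
            Set.mem_singleton_iff, not_or]
          constructor
          · rintro ⟨⟨a, b, c⟩, d⟩; exact ⟨b, a, d⟩
          · rintro ⟨b, a, d, d'⟩
            exact ⟨⟨a, b, fun e' => by rw [e'] at d; omega⟩, d, d'⟩
        rw [h1, Finset.sum_erase _ (by simp [hστ.1])]
        rw [Finset.sum_sub_distrib, hf e he, zero_sub, neg_eq_zero, ← Finset.sum_filter]
        by_cases heτ : e ⊆ τ
        · have : (cofaces X 3 e).filter (fun t => t ⊆ τ) =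
              Finset.univ.filter fun t : Finset ι => t.card = 3 ∧ e ⊆ t ∧ t ⊆ τ := by
            ext t
            simp only [Finset.mem_filter, mem_cofaces, Finset.mem_univ, true_and]
            constructor
            · rintro ⟨⟨-, a, b⟩, c⟩; exact ⟨a, b, c⟩
            · rintro ⟨a, b, c⟩
              exact ⟨⟨(hX τ hτ).2 t c (Finset.card_pos.1 (by omega)), a, b⟩, c⟩
          rw [this, Finset.sum_const, card_between he (by omega) heτ, two_nsmul]
          exact CharTwo.add_self_eq_zero _
        · rw [Finset.sum_eq_zero]
          intro t ht
          simp only [Finset.mem_filter, mem_cofaces] at ht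
          exact absurd (ht.1.2.2.trans ht.2) heτ)
      refine ⟨fun ρ => if ρ = τ then f σ else g ρ, fun t ht ht3 => ?_⟩
      by_cases htσ : t = σ
      · subst htσ
        have : cofaces X 4 t = {τ} := by
          ext ρ
          simp only [mem_cofaces, Finset.mem_singleton]
          constructor
          · rintro ⟨a, b, c⟩
            exact hfree ρ a (Finset.ssubset_iff_subset_ne.2 ⟨c, fun e => by rw [e] at h3; omega⟩)
          · rintro rfl; exact ⟨hτ, by omega, hστ.1⟩
        rw [this]; simp
      · have hg' := hg t ⟨ht, by
          simp only [Set.mem_insert_iff, Set.mem_singleton_iff, not_or]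
          exact ⟨htσ, fun e => by rw [e] at ht3; omega⟩⟩ ht3
        have h1 : cofaces (X \ {σ, τ}) 4 t = (cofaces X 4 t).erase τ := by
          ext ρ
          simp only [mem_cofaces, Finset.mem_erase, Set.mem_sdiff, Set.mem_insert_iff,
            Set.mem_singleton_iff, not_or]
          constructor
          · rintro ⟨⟨a, b, c⟩, d⟩; exact ⟨c, a, d⟩
          · rintro ⟨b, a, d, d'⟩
            exact ⟨⟨a, fun e' => by rw [e'] at d; omega, b⟩, d, d'⟩
        rw [sub_eq_iff_eq_add, h1] at hg'
        rw [hg']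
        by_cases htτ : t ⊆ τ
        · have hm : τ ∈ cofaces X 4 t := mem_cofaces.2 ⟨hτ, by omega, htτ⟩
          rw [if_pos htτ, ← Finset.sum_erase_add _ _ hm, if_pos rfl]
          congr 1
          refine Finset.sum_congr rfl fun ρ hρ => ?_
          rw [if_neg (Finset.ne_of_mem_erase hρ)]
        · have hm : τ ∉ cofaces X 4 t := fun h => htτ (mem_cofaces.1 h).2.2
          rw [if_neg htτ, add_zero, Finset.erase_eq_of_notMem hm]
          refine Finset.sum_congr rfl fun ρ hρ => (if_neg ?_).symm
          rintro rfl
          exact hm hρ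
    -- If the removed pair is an edge and a triangle, that triangle is alone on the free edge, so
    -- the cycle condition gives it value zero.
    · have hfτ : τ.card = 3 → f τ = 0 := by
        intro hτ3
        have := hf σ (by omega)
        have h1 : cofaces X 3 σ = {τ} := by
          ext ρ
          simp only [mem_cofaces, Finset.mem_singleton]
          constructor
          · rintro ⟨a, b, c⟩
            exact hfree ρ a (Finset.ssubset_iff_subset_ne.2 ⟨c, fun e => h3 (by rw [e, b])⟩)
          · rintro rfl; exact ⟨hτ, hτ3, hστ.1⟩
        rwa [h1, Finset.sum_singleton] at this
      obtain ⟨g, hg⟩ := ih f (by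
        intro e he
        rw [← hf e he]
        refine Finset.sum_subset (fun t ht => ?_) fun t ht ht' => ?_
        · rw [mem_cofaces] at ht ⊢
          exact ⟨hsub ht.1, ht.2⟩
        · rw [mem_cofaces] at ht ht'
          have : t = σ ∨ t = τ := by
            by_contra hn
            exact ht' ⟨⟨ht.1, by simpa using hn⟩, ht.2⟩
          rcases this with rfl | rfl
          · exact absurd ht.2.1 h3
          · exact hfτ ht.2.1)
      -- The cut-off matters when `σ` is itself a tetrahedron: it is a simplex of `X` that the
      -- colouring of the smaller complex does not control.
      refine ⟨fun ρ => if ρ ∈ X \ {σ, τ} then g ρ else 0, fun t ht ht3 => ?_⟩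
      by_cases htτ : t = τ
      · subst htτ
        rw [hfτ ht3, Finset.sum_eq_zero]
        intro ρ hρ
        rw [mem_cofaces] at hρ
        have := hmax ρ hρ.1 hρ.2.2
        rw [if_neg]
        simp [this]
      · rw [hg t ⟨ht, by
          simp only [Set.mem_insert_iff, Set.mem_singleton_iff, not_or]
          exact ⟨fun e => h3 (e ▸ ht3), htτ⟩⟩ ht3]
        have : cofaces (X \ {σ, τ}) 4 t = (cofaces X 4 t).filter (· ∈ X \ {σ, τ}) := by
          ext ρ
          simp only [mem_cofaces, Finset.mem_filter]
          constructor
          · rintro ⟨a, b, c⟩; exact ⟨⟨a.1, b, c⟩, a⟩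
          · rintro ⟨⟨_, b, c⟩, a⟩; exact ⟨a, b, c⟩
        rw [this, Finset.sum_filter]

/-! ### Triangles in three-space -/

/-- Two tetrahedra on the same side of a common face overlap off that face: a point near the
barycentre of `a, b, c`, moved slightly towards `q`, lies in both. -/
theorem sameSide_eq {E : Type} [AddCommGroup E] [Module ℝ E] (n : E →ₗ[ℝ] ℝ) {a b c p q : E}
    (hker : ∀ v, n v = 0 → ∃ s t : ℝ, v = s • (b - a) + t • (c - a))
    (hb : n (b - a) = 0) (hc : n (c - a) = 0) (hpq : 0 < n (p - a) * n (q - a)) :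
    ∃ y ∈ convexHull ℝ ({a, b, c, p} : Set E) ∩ convexHull ℝ ({a, b, c, q} : Set E),
      n (y - a) ≠ 0 := by
  have hp0 : n (p - a) ≠ 0 := left_ne_zero_of_mul hpq.ne'
  have hq0 : n (q - a) ≠ 0 := right_ne_zero_of_mul hpq.ne'
  set α : ℝ := n (q - a) / n (p - a) with hα
  have hα0 : 0 < α := by
    rw [hα, ← mul_div_mul_left _ _ hp0, ← pow_two]
    positivity
  obtain ⟨s, t, hst⟩ := hker ((q - a) - α • (p - a)) (by
    rw [map_sub, map_smul, smul_eq_mul, hα]; field_simp; ring)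
  -- the common point
  set D : ℝ := 4 + 4 * |s| + 4 * |t| + 4 * α with hD
  have hDpos : 0 < D := by positivity
  -- The displacement is chosen so small that each of `δ`, `δ|s|`, `δ|t|` and `δα` is at most 1/12,
  -- which cannot exhaust the barycentric weights near 1/3.
  set δ : ℝ := 1 / (3 * D) with hδ
  have hδpos : 0 < δ := by positivity
  have hs1 : δ * |s| ≤ 1 / 12 := by
    rw [hδ, one_div_mul_eq_div, div_le_div_iff₀ (by positivity) (by norm_num)]
    rw [hD]
    have h1 := abs_nonneg s
    have h2 := abs_nonneg t
    linarith
  have ht1 : δ * |t| ≤ 1 / 12 := by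
    rw [hδ, one_div_mul_eq_div, div_le_div_iff₀ (by positivity) (by norm_num)]
    rw [hD]
    have h1 := abs_nonneg s
    have h2 := abs_nonneg t
    linarith
  have hα1 : δ * α ≤ 1 / 12 := by
    rw [hδ, one_div_mul_eq_div, div_le_div_iff₀ (by positivity) (by norm_num)]
    rw [hD]
    have h1 := abs_nonneg s
    have h2 := abs_nonneg t
    linarith
  have hδ1 : δ ≤ 1 / 12 := by
    rw [hδ, div_le_div_iff₀ (by positivity) (by norm_num)]
    have h1 := abs_nonneg s
    have h2 := abs_nonneg t
    rw [hD]; linarith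
  have hs2 := abs_le.1 (show |δ * s| ≤ 1 / 12 by rwa [abs_mul, abs_of_pos hδpos])
  have ht2 := abs_le.1 (show |δ * t| ≤ 1 / 12 by rwa [abs_mul, abs_of_pos hδpos])
  have hull : ∀ (r : E) (w₀ w₁ w₂ w₃ : ℝ), 0 ≤ w₀ → 0 ≤ w₁ → 0 ≤ w₂ → 0 ≤ w₃ →
      w₀ + w₁ + w₂ + w₃ = 1 →
      w₀ • a + w₁ • b + w₂ • c + w₃ • r ∈ convexHull ℝ ({a, b, c, r} : Set E) := by
    intro r w₀ w₁ w₂ w₃ h0 h1 h2 h3 hsum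
    have hconv := convex_convexHull ℝ ({a, b, c, r} : Set E)
    have hz : ∀ i ∈ (Finset.univ : Finset (Fin 4)),
        ![a, b, c, r] i ∈ convexHull ℝ ({a, b, c, r} : Set E) := by
      intro i _
      apply subset_convexHull
      fin_cases i <;> simp
    have := hconv.sum_mem (t := Finset.univ) (w := ![w₀, w₁, w₂, w₃]) (z := ![a, b, c, r])
      (by intro i _; fin_cases i <;> simpa) (by simp [Fin.sum_univ_four, hsum]) hz
    simpa [Fin.sum_univ_four] using this
  refine ⟨(1 / 3 - δ / 3) • a + (1 / 3 - δ / 3) • b + (1 / 3 - δ / 3) • c + δ • q, ⟨?_, ?_⟩, ?_⟩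
  -- Since `q` differs from a positive multiple of `p` only by a vector of the plane, the same point
  -- has an expression in terms of `p`, whose weight `δα` is positive.
  · have hq : q = (1 - α - s - t) • a + s • b + t • c + α • p := by
      have : q = a + α • (p - a) + (s • (b - a) + t • (c - a)) := by rw [← hst]; abel
      rw [this]; module
    have e : (1 / 3 - δ / 3) • a + (1 / 3 - δ / 3) • b + (1 / 3 - δ / 3) • c + δ • q =
        (1 / 3 - δ / 3 + δ * (1 - α - s - t)) • a + (1 / 3 - δ / 3 + δ * s) • b +
          (1 / 3 - δ / 3 + δ * t) • c + (δ * α) • p := by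
      conv_lhs => rw [hq]
      module
    rw [e]
    refine hull p _ _ _ _ ?_ ?_ ?_ (by positivity) (by ring)
    · nlinarith [hs2.1, hs2.2, ht2.1, ht2.2]
    · linarith [hs2.1]
    · linarith [ht2.1]
  · refine hull q _ _ _ _ ?_ ?_ ?_ hδpos.le (by ring) <;> linarith
  · have e : (1 / 3 - δ / 3) • a + (1 / 3 - δ / 3) • b + (1 / 3 - δ / 3) • c + δ • q - a =
        (1 / 3 - δ / 3) • (b - a) + (1 / 3 - δ / 3) • (c - a) + δ • (q - a) := by module
    rw [e, map_add, map_add, map_smul, map_smul, map_smul, hb, hc]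
    simp only [smul_eq_mul, mul_zero, zero_add]
    exact mul_ne_zero hδpos.ne' hq0

theorem linearIndependent_of_affineIndependent {E : Type} [AddCommGroup E] [Module ℝ E]
    [DecidableEq E] {a b c x : E} (hcard : ({a, b, c, x} : Finset E).card = 4)
    (h : AffineIndependent ℝ (Subtype.val : ({a, b, c, x} : Finset E) → E)) :
    LinearIndependent ℝ ![b - a, c - a, x - a] := by
  have himg : Finset.univ.image ![a, b, c, x] = ({a, b, c, x} : Finset E) := by
    ext y
    simp only [Finset.mem_image, Finset.mem_univ, true_and, Finset.mem_insert,
      Finset.mem_singleton, Fin.exists_fin_succ]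
    simp [eq_comm]
  have hinj : Function.Injective ![a, b, c, x] := by
    have := Finset.injOn_of_card_image_eq (s := Finset.univ) (f := ![a, b, c, x])
      (by rw [himg, hcard]; simp)
    rwa [Finset.coe_univ, Set.injOn_univ] at this
  have h' : AffineIndependent ℝ ![a, b, c, x] := by
    let emb : Fin 4 ↪ ({a, b, c, x} : Finset E) :=
      ⟨fun i => ⟨![a, b, c, x] i, by rw [← himg]; simp⟩, fun i j hij =>
        hinj (congrArg Subtype.val hij)⟩
    exact h.comp_embedding emb
  rw [affineIndependent_iff_linearIndependent_vsub ℝ _ (0 : Fin 4)] at h'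
  let g : Fin 3 → {i : Fin 4 // i ≠ 0} := fun i => ⟨i.succ, Fin.succ_ne_zero i⟩
  have := h'.comp g (by
    intro i j hij
    simpa [g] using hij)
  have e : (fun i : {i : Fin 4 // i ≠ 0} => ![a, b, c, x] ↑i -ᵥ ![a, b, c, x] 0) ∘ g =
      ![b - a, c - a, x - a] := by
    funext i
    fin_cases i <;> rfl
  rwa [e] at this

/-- The tetrahedra on a triangle in three-space number at most two. -/
theorem Triangulation.apex_eq (K : Triangulation ι) {σ : Finset ι} (hσ : σ.card = 3)
    {p q r : ι} (hp : p ∉ σ) (hq : q ∉ σ) (hr : r ∉ σ) (hpK : insert p σ ∈ K.faces)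
    (hqK : insert q σ ∈ K.faces) (hrK : insert r σ ∈ K.faces) : p = q ∨ p = r ∨ q = r := by
  obtain ⟨a, b, c, hab, hac, hbc, rfl⟩ := Finset.card_eq_three.1 hσ
  set P := K.pos with hP
  have hmap : ∀ x : ι, (insert x {a, b, c} : Finset ι).map P = {P a, P b, P c, P x} := by
    intro x
    ext y
    simp only [Finset.mem_map, Finset.mem_insert, Finset.mem_singleton]
    constructor
    · rintro ⟨z, h, rfl⟩; rcases h with rfl | rfl | rfl | rfl <;> simp
    · rintro (rfl | rfl | rfl | rfl) <;> simp
  have hind : ∀ x ∉ ({a, b, c} : Finset ι), insert x ({a, b, c} : Finset ι) ∈ K.faces →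
      LinearIndependent ℝ ![P b - P a, P c - P a, P x - P a] := by
    intro x hx hxK
    have h := K.complex.indep hxK
    rw [hmap x] at h
    refine linearIndependent_of_affineIndependent ?_ h
    rw [← hmap x, Finset.card_map, Finset.card_insert_of_notMem hx, hσ]
  -- In dimension three the two edge vectors and the vector to `p` form a basis. The last coordinate
  -- is a functional whose kernel is the plane of the triangle, and its sign tells the two sides
  -- apart.
  have hW : ∃ n : EuclideanSpace ℝ (Fin 3) →ₗ[ℝ] ℝ, n (P b - P a) = 0 ∧ n (P c - P a) = 0 ∧
      ∀ v, n v = 0 → ∃ s t : ℝ, v = s • (P b - P a) + t • (P c - P a) := by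
    have hli := hind p hp hpK
    have hcard : Fintype.card (Fin 3) = Module.finrank ℝ (EuclideanSpace ℝ (Fin 3)) := by simp
    let B := basisOfLinearIndependentOfCardEqFinrank hli hcard
    have hB : ⇑B = ![P b - P a, P c - P a, P p - P a] := by
      simp [B, coe_basisOfLinearIndependentOfCardEqFinrank]
    refine ⟨B.coord 2, ?_, ?_, fun v hv => ⟨B.repr v 0, B.repr v 1, ?_⟩⟩
    · have : P b - P a = B 0 := by rw [hB]; rfl
      rw [this]; simp
    · have : P c - P a = B 1 := by rw [hB]; rfl
      rw [this]; simp
    · conv_lhs => rw [← B.sum_repr v]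
      rw [Fin.sum_univ_three]
      have h2 : B.repr v 2 = 0 := hv
      rw [h2, hB]
      simp
  obtain ⟨n, hnb, hnc, hker⟩ := hW
  have hne : ∀ x ∉ ({a, b, c} : Finset ι), insert x ({a, b, c} : Finset ι) ∈ K.faces →
      n (P x - P a) ≠ 0 := by
    intro x hx hxK h0
    obtain ⟨s, t, hst⟩ := hker _ h0
    have hli := hind x hx hxK
    rw [Fintype.linearIndependent_iff] at hli
    have := hli ![s, t, -1] (by
      simp only [Fin.sum_univ_three]
      simp only [Matrix.cons_val, hst]
      module) 2
    simp at this
  -- Different tetrahedra of a simplicial complex meet in a common face, here inside the plane. An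
  -- overlap off the plane is impossible, so there is at most one apex on each side.
  have hsame : ∀ x ∉ ({a, b, c} : Finset ι), ∀ y ∉ ({a, b, c} : Finset ι),
      insert x ({a, b, c} : Finset ι) ∈ K.faces → insert y ({a, b, c} : Finset ι) ∈ K.faces →
      0 < n (P x - P a) * n (P y - P a) → x = y := by
    intro x hx y hy hxK hyK hpos
    by_contra hxy
    obtain ⟨w, hw, hw'⟩ := sameSide_eq n hker hnb hnc hpos
    have h1 := K.complex.inter_subset_convexHull hxK hyK
    have e : ((insert x {a, b, c} : Finset ι).map P : Set (EuclideanSpace ℝ (Fin 3))) ∩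
        ((insert y {a, b, c} : Finset ι).map P) ⊆ {P a, P b, P c} := by
      rintro z ⟨hz1, hz2⟩
      simp only [Finset.coe_map, Set.mem_image, Finset.mem_coe] at hz1 hz2
      obtain ⟨u, hu, rfl⟩ := hz1
      obtain ⟨u', hu', hu2⟩ := hz2
      obtain rfl := P.injective hu2
      simp only [Finset.mem_insert, Finset.mem_singleton] at hu hu' hx hy
      rcases hu with rfl | rfl | rfl | rfl
      · exfalso; tauto
      all_goals simp
    have hw2 : w ∈ convexHull ℝ ({P a, P b, P c} : Set (EuclideanSpace ℝ (Fin 3))) := by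
      refine convexHull_mono e (h1 ?_)
      have e1 := hmap x
      have e2 := hmap y
      rw [hP] at e1 e2
      rw [e1, e2]
      simpa using hw
    have hplane : Convex ℝ {v | n (v - P a) = 0} := by
      intro u hu v hv s t _ _ hst
      simp only [Set.mem_ofPred_eq] at hu hv ⊢
      have : s • u + t • v - P a = s • (u - P a) + t • (v - P a) := by
        have : P a = (s + t) • P a := by rw [hst, one_smul]
        conv_lhs => rw [this]
        module
      rw [this, map_add, map_smul, map_smul, hu, hv]
      simp
    refine hw' (convexHull_min (s := {P a, P b, P c}) ?_ hplane hw2)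
    rintro z (rfl | rfl | rfl)
    · simp
    · exact hnb
    · exact hnc
  -- Among three nonzero real numbers two have the same sign.
  have hp0 := hne p hp hpK
  have hq0 := hne q hq hqK
  have hr0 := hne r hr hrK
  by_contra hcon
  simp only [not_or] at hcon
  have k1 : ¬ 0 < n (P p - P a) * n (P q - P a) := fun h => hcon.1 (hsame p hp q hq hpK hqK h)
  have k2 : ¬ 0 < n (P p - P a) * n (P r - P a) := fun h => hcon.2.1 (hsame p hp r hr hpK hrK h)
  have k3 : ¬ 0 < n (P q - P a) * n (P r - P a) := fun h => hcon.2.2 (hsame q hq r hr hqK hrK h)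
  have m1 := mul_ne_zero hp0 hq0
  have m2 := mul_ne_zero hp0 hr0
  have m3 := mul_ne_zero hq0 hr0
  rw [mul_pos_iff, not_or, not_and_or, not_and_or] at k1 k2 k3
  grind

end

section

open scoped Classical

set_option linter.unusedSectionVars false

variable {ι : Type} [Fintype ι] [DecidableEq ι]

/-! ### Triangulated surfaces -/

/-- `a` and `b` are joined by an edge of the link of `v` in `X`. -/
def LinkAdj (X : Faces ι) (v a b : ι) : Prop :=
  ({v, a, b} : Finset ι) ∈ X ∧ ({v, a, b} : Finset ι).card = 3

theorem LinkAdj.symm {X : Faces ι} {v a b : ι} (h : LinkAdj X v a b) : LinkAdj X v b a := by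
  have : ({v, b, a} : Finset ι) = {v, a, b} := by rw [Finset.pair_comm]
  rw [LinkAdj, this]
  exact h

theorem Consecutive.closeUp {l : List ι} {a b : ι} (h : Consecutive l a b) :
    Consecutive (closeUp l) a b := by
  have : l <:+: DisorientedHomology.closeUp l := (List.prefix_append l _).isInfix
  exact h.imp (fun h => h.trans this) fun h => h.trans this

/-- A vertex has at most one successor and one predecessor, so two of any three neighbours coincide.
Both arcs and circles satisfy the two uniqueness hypotheses. -/
theorem consecutive_third {l : List ι}
    (hr : ∀ a b c, [a, b] <:+: l → [a, c] <:+: l → b = c)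
    (hl : ∀ a b c, [b, a] <:+: l → [c, a] <:+: l → b = c) {v p q r : ι}
    (hp : Consecutive l v p) (hq : Consecutive l v q) (hr' : Consecutive l v r) :
    p = q ∨ p = r ∨ q = r := by
  rcases hp with hp | hp <;> rcases hq with hq | hq <;> rcases hr' with h | h
  · exact Or.inl (hr _ _ _ hp hq)
  · exact Or.inl (hr _ _ _ hp hq)
  · exact Or.inr (Or.inl (hr _ _ _ hp h))
  · exact Or.inr (Or.inr (hl _ _ _ hq h))
  · exact Or.inr (Or.inr (hr _ _ _ hq h))
  · exact Or.inr (Or.inl (hl _ _ _ hp h))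
  · exact Or.inl (hl _ _ _ hp hq)
  · exact Or.inl (hl _ _ _ hp hq)

namespace IsSubcomplex

theorem pair_mem {X : Faces ι} (hX : IsSubcomplex X) {a b c : ι}
    (h : ({a, b, c} : Finset ι) ∈ X) : ({a, b} : Finset ι) ∈ X := by
  refine (hX _ h).2 _ ?_ (by simp)
  intro x; simp; tauto

theorem left_mem {X : Faces ι} (hX : IsSubcomplex X) {a b : ι}
    (h : ({a, b} : Finset ι) ∈ X) : ({a} : Finset ι) ∈ X :=
  (hX _ h).2 _ (by simp) (by simp)

theorem right_mem {X : Faces ι} (hX : IsSubcomplex X) {a b : ι}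
    (h : ({a, b} : Finset ι) ∈ X) : ({b} : Finset ι) ∈ X :=
  (hX _ h).2 _ (by simp) (by simp)

theorem vertex_mem {X : Faces ι} (hX : IsSubcomplex X) {s : Finset ι} (h : s ∈ X) {a : ι}
    (ha : a ∈ s) : ({a} : Finset ι) ∈ X :=
  (hX _ h).2 _ (by simpa using ha) (by simp)

theorem inter {X Y : Faces ι} (hX : IsSubcomplex X) (hY : IsSubcomplex Y) :
    IsSubcomplex (X ∩ Y) :=
  fun s hs => ⟨(hX s hs.1).1, fun t ht hne => ⟨(hX s hs.1).2 t ht hne, (hY s hs.2).2 t ht hne⟩⟩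

theorem union {X Y : Faces ι} (hX : IsSubcomplex X) (hY : IsSubcomplex Y) :
    IsSubcomplex (X ∪ Y) := by
  rintro s (hs | hs)
  · exact ⟨(hX s hs).1, fun t ht hne => Or.inl ((hX s hs).2 t ht hne)⟩
  · exact ⟨(hY s hs).1, fun t ht hne => Or.inr ((hY s hs).2 t ht hne)⟩

theorem iUnion {κ : Sort*} {X : κ → Faces ι} (hX : ∀ k, IsSubcomplex (X k)) :
    IsSubcomplex (⋃ k, X k) := by
  intro s hs
  obtain ⟨k, hk⟩ := Set.mem_iUnion.1 hs
  exact ⟨(hX k s hk).1, fun t ht hne => Set.mem_iUnion.2 ⟨k, (hX k s hk).2 t ht hne⟩⟩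

end IsSubcomplex

theorem isSubcomplex_bdry {X : Faces ι} : IsSubcomplex (bdry X) := by
  rintro s ⟨hs, e, he, hse, h⟩
  exact ⟨hs, fun t ht hne => ⟨hne, e, he, ht.trans hse, h⟩⟩

theorem bdry_subset {X : Faces ι} (hX : IsSubcomplex X) : bdry X ⊆ X := by
  rintro s ⟨hs, e, he, hse, -⟩
  exact (hX e he).2 s hse hs

theorem mem_bdry_of_card {X : Faces ι} {e : Finset ι} (he : e.card = 2) :
    e ∈ bdry X ↔ e ∈ X ∧ ∃! t, t ∈ X ∧ t.card = 3 ∧ e ⊆ t := by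
  constructor
  · rintro ⟨-, e', he', hee', hc, h⟩
    obtain rfl := Finset.eq_of_subset_of_card_le hee' (by omega)
    exact ⟨he', h⟩
  · rintro ⟨h, h'⟩
    exact ⟨Finset.card_pos.1 (by omega), e, h, subset_rfl, he, h'⟩

theorem eq_triple_of_mem {t : Finset ι} {u v : ι} (ht : t.card = 3) (huv : u ≠ v)
    (h : ({u, v} : Finset ι) ⊆ t) : ∃ w, t = {u, v, w} := by
  obtain ⟨w, -, rfl⟩ := exists_eq_insert_of_ssubset
    (Finset.ssubset_iff_subset_ne.2 ⟨h, fun e => by rw [← e, Finset.card_pair huv] at ht; omega⟩)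
    (by rw [Finset.card_pair huv, ht])
  exact ⟨w, by ext; simp; tauto⟩

namespace IsSurface

variable {X : Faces ι} (hX : IsSurface X)
include hX

theorem third {u v p q r : ι} (hp : LinkAdj X u v p) (hq : LinkAdj X u v q)
    (hr : LinkAdj X u v r) : p = q ∨ p = r ∨ q = r := by
  obtain ⟨l, hl, ⟨h2, hadj⟩ | ⟨h3, hadj⟩⟩ := hX.link u
    (hX.subcomplex.left_mem (hX.subcomplex.pair_mem hp.1))
  · exact consecutive_third (fun _ _ _ => infix_right_unique hl)
      (fun _ _ _ => infix_left_unique hl) ((hadj _ _).1 hp) ((hadj _ _).1 hq) ((hadj _ _).1 hr)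
  · exact consecutive_third (fun _ _ _ => closeUp_right_unique hl h3)
      (fun _ _ _ => closeUp_left_unique hl h3) ((hadj _ _).1 hp) ((hadj _ _).1 hq) ((hadj _ _).1 hr)

theorem exists_linkAdj {u v : ι} (huv : u ≠ v) (h : ({u, v} : Finset ι) ∈ X) :
    ∃ w, LinkAdj X u v w := by
  obtain ⟨t, ht, hc, hs⟩ := hX.pure _ h
  obtain ⟨w, rfl⟩ := eq_triple_of_mem hc huv hs
  exact ⟨w, ht, hc⟩

/-- By purity both edges belong to triangles, so their far ends occur in the list that describes the
link, and an arc or a circle is connected. -/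
theorem link_connected {v a b : ι} (hva : v ≠ a) (hvb : v ≠ b) (ha : ({v, a} : Finset ι) ∈ X)
    (hb : ({v, b} : Finset ι) ∈ X) : Relation.ReflTransGen (LinkAdj X v) a b := by
  obtain ⟨x, hx⟩ := hX.exists_linkAdj hva ha
  obtain ⟨y, hy⟩ := hX.exists_linkAdj hvb hb
  have key : ∃ l : List ι, a ∈ l ∧ b ∈ l ∧ ∀ x y, Consecutive l x y → LinkAdj X v x y := by
    obtain ⟨l, hl, ⟨h2, hadj⟩ | ⟨h3, hadj⟩⟩ := hX.link v (hX.subcomplex.left_mem ha)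
    · exact ⟨l, ((hadj _ _).1 hx).left_mem, ((hadj _ _).1 hy).left_mem, fun _ _ => (hadj _ _).2⟩
    · exact ⟨l, mem_closeUp.1 ((hadj _ _).1 hx).left_mem, mem_closeUp.1 ((hadj _ _).1 hy).left_mem,
        fun _ _ h => (hadj _ _).2 h.closeUp⟩
  obtain ⟨l, hal, hbl, hadj⟩ := key
  have h := linked_pathFaces hal hbl
  clear hb hbl hvb hy
  induction h with
  | refl => exact Relation.ReflTransGen.refl
  | @tail c d _ hcd ih =>
    by_cases hne : c = d
    · exact hne ▸ ih
    · exact ih.tail (hadj _ _ ((mem_pathFaces_pair hne).1 hcd))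

/-- At an interior vertex of a subsurface all edges lie in the subsurface. -/
theorem edge_mem_of_notMem_bdry {M : Faces ι} (hM : IsSurface M) (hMX : M ⊆ X) {w u : ι}
    (hw : ({w} : Finset ι) ∈ M) (hw' : ({w} : Finset ι) ∉ bdry M) (hwu : w ≠ u)
    (hu : ({w, u} : Finset ι) ∈ X) : ({w, u} : Finset ι) ∈ M := by
  -- An edge at `w` in only one triangle of `M` would put `w` on the boundary of `M`.
  have two : ∀ x, ({w, x} : Finset ι) ∈ M → w ≠ x → ∃ p q, p ≠ q ∧ LinkAdj M w x p ∧
      LinkAdj M w x q := by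
    intro x hx hwx
    obtain ⟨p, hp⟩ := hM.exists_linkAdj hwx hx
    by_contra hcon
    refine hw' ⟨by simp, {w, x}, hx, by simp, Finset.card_pair hwx, {w, x, p}, ⟨hp.1, hp.2, ?_⟩, ?_⟩
    · intro y; simp; tauto
    · rintro t ⟨ht, hc, hs⟩
      obtain ⟨q, rfl⟩ := eq_triple_of_mem hc hwx hs
      by_contra hne
      exact hcon ⟨p, q, fun e => hne (by rw [e]), hp, ht, hc⟩
  obtain ⟨t, ht, hc, hs⟩ := hM.pure _ hw
  have hwt : w ∈ t := hs (by simp)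
  obtain ⟨x, hx, hxw⟩ := Finset.exists_mem_ne (show 1 < t.card by omega) w
  have hwx : ({w, x} : Finset ι) ∈ M := (hM.subcomplex t ht).2 _
    (by intro y hy; simp only [Finset.mem_insert, Finset.mem_singleton] at hy
        rcases hy with rfl | rfl <;> assumption) (by simp)
  -- Walk around the link of `w` in `X`, starting in `M`. The two triangles of `M` at each edge are
  -- all those of `X`, so the walk never leaves `M`.
  have h := hX.link_connected hxw.symm hwu (hMX hwx) hu
  clear hu hwu
  induction h with
  | refl => exact hwx
  | @tail c d hc' hcd ih =>
    have hwc : w ≠ c := (triple_ne hcd.2).1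
    obtain ⟨p, q, hpq, hp, hq⟩ := two c ih hwc
    have := hX.third ⟨hMX hp.1, hp.2⟩ ⟨hMX hq.1, hq.2⟩ hcd
    have hd : LinkAdj M w c d := by
      rcases this with h | rfl | rfl
      · exact absurd h hpq
      · exact hp
      · exact hq
    exact hM.subcomplex.pair_mem hd.symm.1

/-- Connectedness by edge paths implies connectedness through triangles sharing edges: links are
connected, so the triangles at one vertex are related, and consecutive vertices of an edge path
share a triangle. -/
theorem constant_of_adjacent {α : Type} (f : Finset ι → α)
    (hconn : ∀ a b, ({a} : Finset ι) ∈ X → ({b} : Finset ι) ∈ X → Linked X a b)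
    (hf : ∀ t ∈ X, ∀ t' ∈ X, t.card = 3 → t'.card = 3 → (t ∩ t').card = 2 → f t = f t')
    {t t' : Finset ι} (ht : t ∈ X) (ht' : t' ∈ X) (hc : t.card = 3) (hc' : t'.card = 3) :
    f t = f t' := by
  have hedge : ∀ t ∈ X, ∀ t' ∈ X, t.card = 3 → t'.card = 3 → ∀ u v, u ≠ v → u ∈ t → u ∈ t' →
      v ∈ t → v ∈ t' → f t = f t' := by
    intro t ht t' ht' hc hc' u v huv h1 h2 h3 h4
    by_cases he : t = t'
    · rw [he]
    refine hf t ht t' ht' hc hc' (le_antisymm ?_ ?_)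
    · by_contra hn
      have h5 : (t ∩ t').card ≤ t.card := Finset.card_le_card Finset.inter_subset_left
      have h6 : t ∩ t' = t := Finset.eq_of_subset_of_card_le Finset.inter_subset_left (by omega)
      have h7 : t ∩ t' = t' := Finset.eq_of_subset_of_card_le Finset.inter_subset_right (by omega)
      exact he (h6.symm.trans h7)
    · rw [← Finset.card_pair huv]
      refine Finset.card_le_card ?_
      intro x hx
      simp only [Finset.mem_insert, Finset.mem_singleton] at hx
      rcases hx with rfl | rfl <;> simp [*]
  have hother : ∀ t ∈ X, t.card = 3 → ∀ v ∈ t, ∃ a b, t = {v, a, b} ∧ LinkAdj X v a b := by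
    intro t ht hc v hv
    obtain ⟨a, ha, hav⟩ := Finset.exists_mem_ne (show 1 < t.card by omega) v
    obtain ⟨b, rfl⟩ := eq_triple_of_mem hc hav.symm (by
      intro y hy; simp only [Finset.mem_insert, Finset.mem_singleton] at hy
      rcases hy with rfl | rfl <;> assumption)
    exact ⟨a, b, rfl, ht, hc⟩
  have hstar : ∀ v, ∀ t ∈ X, ∀ t' ∈ X, t.card = 3 → t'.card = 3 → v ∈ t → v ∈ t' → f t = f t' := by
    intro v t ht t' ht' hc hc' hv hv'
    obtain ⟨a, b, rfl, hab⟩ := hother t ht hc v hv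
    obtain ⟨a', b', rfl, hab'⟩ := hother t' ht' hc' v hv'
    have hva := (triple_ne hc).1
    have hva' := (triple_ne hc').1
    have h := hX.link_connected hva hva' (hX.subcomplex.pair_mem ht) (hX.subcomplex.pair_mem ht')
    clear hv'
    induction h generalizing b' with
    | refl => exact hedge _ ht _ ht' hc hc' v a hva (by simp) (by simp) (by simp) (by simp)
    | @tail c d _ hcd ih =>
      refine (ih d hcd hcd.1 hcd.2 (triple_ne hcd.2).1).trans ?_
      exact hedge _ hcd.1 _ ht' hcd.2 hc' v d hva' (by simp) (by simp) (by simp) (by simp)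
  obtain ⟨v, hv⟩ := Finset.card_pos.1 (show 0 < t.card by omega)
  obtain ⟨v', hv'⟩ := Finset.card_pos.1 (show 0 < t'.card by omega)
  have h := hconn v v' (hX.subcomplex.vertex_mem ht hv) (hX.subcomplex.vertex_mem ht' hv')
  induction h generalizing t' with
  | refl => exact hstar v t ht t' ht' hc hc' hv hv'
  | @tail c d _ hcd ih =>
    by_cases hne : c = d
    · subst hne; exact ih ht' hc' hv'
    · obtain ⟨w, hw⟩ := hX.exists_linkAdj hne hcd
      exact (ih hw.1 hw.2 (by simp)).trans
        (hstar d _ hw.1 _ ht' hw.2 hc' (by simp) hv')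

theorem cofaces_card_le (e : Finset ι) (he : e.card = 2) : (cofaces X 3 e).card ≤ 2 := by
  by_contra hcon
  obtain ⟨t₁, t₂, t₃, h1, h2, h3, h12, h13, h23⟩ := Finset.two_lt_card_iff.1 (not_le.1 hcon)
  obtain ⟨u, v, huv, rfl⟩ := Finset.card_eq_two.1 he
  rw [mem_cofaces] at h1 h2 h3
  obtain ⟨p, rfl⟩ := eq_triple_of_mem h1.2.1 huv h1.2.2
  obtain ⟨q, rfl⟩ := eq_triple_of_mem h2.2.1 huv h2.2.2
  obtain ⟨r, rfl⟩ := eq_triple_of_mem h3.2.1 huv h3.2.2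
  rcases hX.third ⟨h1.1, h1.2.1⟩ ⟨h2.1, h2.2.1⟩ ⟨h3.1, h3.2.1⟩ with rfl | rfl | rfl
  · exact h12 rfl
  · exact h13 rfl
  · exact h23 rfl

omit hX in
theorem _root_.DisorientedHomology.cofaces_card_eq_one_iff {X : Faces ι} {k : ℕ} {e : Finset ι} :
    (cofaces X k e).card = 1 ↔ ∃! t, t ∈ X ∧ t.card = k ∧ e ⊆ t := by
  rw [Finset.card_eq_one]
  constructor
  · rintro ⟨t, ht⟩
    have := fun s => (Finset.ext_iff.1 ht) s
    simp only [mem_cofaces, Finset.mem_singleton] at this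
    exact ⟨t, (this t).2 rfl, fun s hs => (this s).1 hs⟩
  · rintro ⟨t, ht, h⟩
    refine ⟨t, Finset.ext fun s => ?_⟩
    rw [mem_cofaces, Finset.mem_singleton]
    exact ⟨h s, fun e => e ▸ ht⟩

theorem cofaces_card (e : Finset ι) (he : e.card = 2) :
    (cofaces X 3 e).card = if e ∈ X then if e ∈ bdry X then 1 else 2 else 0 := by
  split_ifs with h1 h2
  · rw [cofaces_card_eq_one_iff]
    exact ((mem_bdry_of_card he).1 h2).2
  · have h3 := hX.cofaces_card_le e he
    have h4 : (cofaces X 3 e).card ≠ 1 := by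
      rw [Ne, cofaces_card_eq_one_iff]
      exact fun h => h2 ((mem_bdry_of_card he).2 ⟨h1, h⟩)
    have h5 : 0 < (cofaces X 3 e).card := by
      obtain ⟨t, ht, hc, hs⟩ := hX.pure e h1
      exact Finset.card_pos.2 ⟨t, mem_cofaces.2 ⟨ht, hc, hs⟩⟩
    omega
  · rw [Finset.card_eq_zero, Finset.eq_empty_iff_forall_notMem]
    intro t ht
    rw [mem_cofaces] at ht
    exact h1 ((hX.subcomplex t ht.1).2 e ht.2.2 (Finset.card_pos.1 (by omega)))

end IsSurface

namespace IsDisk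

variable {X : Faces ι} (hX : IsDisk X)
include hX

theorem linked {a b : ι} (ha : ({a} : Finset ι) ∈ X) (hb : ({b} : Finset ι) ∈ X) :
    Linked X a b := by
  obtain ⟨v, hv⟩ := hX.collapses
  exact linked_of_collapses hv hX.surface.subcomplex ha hb

theorem Z1_le_B1 : Z1 X ≤ B1 X := by
  obtain ⟨v, hv⟩ := hX.collapses
  exact Z1_le_B1_of_collapses hv hX.surface.subcomplex

end IsDisk

end

section

open scoped Classical

set_option linter.unusedSectionVars false

variable {ι : Type} [Fintype ι] [DecidableEq ι]

/-! ### Incidences between the handles -/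

namespace RibbonSurface

variable {K : Triangulation ι} {Z J : Type} (F : RibbonSurface K Z J)

theorem pieceFaces_disk (p : F.Piece) : IsDisk (F.pieceFaces p) := by
  rcases p with i | p
  · exact F.m_disk i
  · exact F.R_disk p.1 p.2

theorem mem_space {s : Finset ι} : s ∈ F.space ↔ ∃ p, s ∈ F.pieceFaces p := by
  constructor
  · rintro (h | h)
    · obtain ⟨i, hi⟩ := Set.mem_iUnion.1 h
      exact ⟨.inl i, hi⟩
    · obtain ⟨j, hj⟩ := Set.mem_iUnion.1 h
      obtain ⟨s, hs⟩ := Set.mem_iUnion.1 hj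
      exact ⟨.inr ⟨j, s⟩, hs⟩
  · rintro ⟨i | ⟨j, k⟩, h⟩
    · exact Or.inl (Set.mem_iUnion.2 ⟨i, h⟩)
    · exact Or.inr (Set.mem_iUnion.2 ⟨j, Set.mem_iUnion.2 ⟨k, h⟩⟩)

theorem pieceFaces_subset (p : F.Piece) : F.pieceFaces p ⊆ F.space :=
  fun _ hs => F.mem_space.2 ⟨p, hs⟩

theorem m_subset_space (i : Z) : F.m i ⊆ F.space := F.pieceFaces_subset (.inl i)

theorem R_subset_space (j : J) (s : Fin (F.n j + 1)) : F.R j s ⊆ F.space :=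
  F.pieceFaces_subset (.inr ⟨j, s⟩)

theorem pieceFaces_subcomplex (p : F.Piece) : IsSubcomplex (F.pieceFaces p) :=
  (F.pieceFaces_disk p).surface.subcomplex

theorem m_subcomplex (i : Z) : IsSubcomplex (F.m i) := (F.m_disk i).surface.subcomplex

theorem R_subcomplex (j : J) (s : Fin (F.n j + 1)) : IsSubcomplex (F.R j s) :=
  (F.R_disk j s).surface.subcomplex

theorem space_subcomplex : IsSubcomplex F.space :=
  (IsSubcomplex.iUnion F.m_subcomplex).union
    (IsSubcomplex.iUnion fun j => IsSubcomplex.iUnion fun s => F.R_subcomplex j s)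

theorem space_subset : F.space ⊆ K.faces := by
  intro s hs
  obtain ⟨i | p, h⟩ := F.mem_space.1 hs
  · exact F.m_sub i h
  · exact F.R_sub p.1 p.2 h

theorem A_left_R (j : J) (s : Fin (F.n j + 1)) : pathFaces (F.A j s.castSucc) ⊆ F.R j s :=
  (F.A_left j s).trans (bdry_subset (F.R_subcomplex j s))

theorem A_right_R (j : J) (s : Fin (F.n j + 1)) : pathFaces (F.A j s.succ) ⊆ F.R j s :=
  (F.A_right j s).trans (bdry_subset (F.R_subcomplex j s))

theorem fin_cases_A {n : ℕ} (k : Fin (n + 2)) :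
    k = 0 ∨ (∃ r : Fin n, k = r.succ.castSucc) ∨ k = Fin.last (n + 1) := by
  induction k using Fin.cases with
  | zero => exact Or.inl rfl
  | succ k =>
    induction k using Fin.lastCases with
    | last => exact Or.inr (Or.inr rfl)
    | cast r => exact Or.inr (Or.inl ⟨r, rfl⟩)

theorem A_sub_m (j : J) (k : Fin (F.n j + 2)) : pathFaces (F.A j k) ⊆ F.m (F.z j k) := by
  rcases fin_cases_A k with rfl | ⟨r, rfl⟩ | rfl
  · exact (F.attach_first j).trans (bdry_subset (F.m_subcomplex _))
  · exact fun s hs => (F.ribbon_sub j r hs).1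
  · exact (F.attach_last j).trans (bdry_subset (F.m_subcomplex _))

theorem vertex_A {j : J} {k : Fin (F.n j + 2)} {v : ι} :
    ({v} : Finset ι) ∈ pathFaces (F.A j k) ↔ v ∈ F.A j k :=
  singleton_mem_pathFaces (F.A_arc j k).2

theorem eq_of_mem_m {i i' : Z} {s : Finset ι} (h : s ∈ F.m i) (h' : s ∈ F.m i') : i = i' := by
  by_contra hne
  have : s ∈ F.m i ∩ F.m i' := ⟨h, h'⟩
  rw [F.m_disj i i' hne] at this
  exact this

/-- Rectangles of different 1-handles, and non-consecutive ones of the same 1-handle, are disjoint;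
consecutive ones meet exactly in their ribbon arc. Both orders must be allowed because the
rectangles enter symmetrically. -/
theorem R_inter {j j' : J} {s : Fin (F.n j + 1)} {s' : Fin (F.n j' + 1)} {t : Finset ι}
    (h : t ∈ F.R j s) (h' : t ∈ F.R j' s') :
    (⟨j, s⟩ : Σ j, Fin (F.n j + 1)) = ⟨j', s'⟩ ∨
    (∃ r : F.Ribbon, t ∈ pathFaces (F.arc r) ∧
      (((⟨j, s⟩ : Σ j, Fin (F.n j + 1)) = ⟨r.1, r.2.castSucc⟩ ∧
        (⟨j', s'⟩ : Σ j, Fin (F.n j + 1)) = ⟨r.1, r.2.succ⟩) ∨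
      ((⟨j', s'⟩ : Σ j, Fin (F.n j + 1)) = ⟨r.1, r.2.castSucc⟩ ∧
        (⟨j, s⟩ : Σ j, Fin (F.n j + 1)) = ⟨r.1, r.2.succ⟩))) := by
  by_cases hj : j = j'
  swap
  · have : t ∈ F.R j s ∩ F.R j' s' := ⟨h, h'⟩
    rw [F.R_disj j j' hj] at this
    exact absurd this (Set.notMem_empty _)
  subst hj
  have key : ∀ s s' : Fin (F.n j + 1), s < s' → t ∈ F.R j s → t ∈ F.R j s' →
      ∃ r : Fin (F.n j), t ∈ pathFaces (F.A j r.succ.castSucc) ∧ s = r.castSucc ∧ s' = r.succ := by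
    intro s s' hlt h h'
    by_cases hs : s.val + 1 < s'.val
    · have : t ∈ F.R j s ∩ F.R j s' := ⟨h, h'⟩
      rw [F.R_far j s s' hs] at this
      exact absurd this (Set.notMem_empty _)
    · have hlt' : s.val < s'.val := hlt
      have hs' : s'.val = s.val + 1 := by omega
      have hr : s.val < F.n j := by have := s'.isLt; omega
      have e1 : s = (⟨s.val, hr⟩ : Fin (F.n j)).castSucc := rfl
      have e2 : s' = (⟨s.val, hr⟩ : Fin (F.n j)).succ := by
        apply Fin.ext; simp [hs']
      refine ⟨⟨s.val, hr⟩, ?_, e1, e2⟩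
      rw [← F.R_next, ← e1, ← e2]
      exact ⟨h, h'⟩
  rcases lt_trichotomy s s' with hlt | rfl | hlt
  · obtain ⟨r, hr, rfl, rfl⟩ := key s s' hlt h h'
    exact Or.inr ⟨⟨j, r⟩, hr, Or.inl ⟨rfl, rfl⟩⟩
  · exact Or.inl rfl
  · obtain ⟨r, hr, rfl, rfl⟩ := key s' s hlt h' h
    exact Or.inr ⟨⟨j, r⟩, hr, Or.inr ⟨rfl, rfl⟩⟩

theorem A_ne (j : J) (s : Fin (F.n j + 1)) {v : ι} (h : v ∈ F.A j s.castSucc) :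
    v ∉ F.A j s.succ := fun h' => F.A_disj j s h h'

theorem eq_of_mem_A_m {j : J} {k : Fin (F.n j + 2)} {v : ι} (h : v ∈ F.A j k) {i : Z}
    (hi : ({v} : Finset ι) ∈ F.m i) : i = F.z j k :=
  F.eq_of_mem_m hi (F.A_sub_m j k (F.vertex_A.2 h))

/-- The arc is an end of some rectangle, so any other rectangle through `v` is its neighbour across
a ribbon arc. Disjointness of the two ends of a rectangle then identifies that ribbon arc with the
given arc. -/
theorem eq_of_mem_A_R {j j' : J} {k : Fin (F.n j + 2)} {v : ι} (h : v ∈ F.A j k)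
    {s : Fin (F.n j' + 1)} (hs : ({v} : Finset ι) ∈ F.R j' s) :
    ∃ s' : Fin (F.n j + 1), (⟨j', s⟩ : Σ j, Fin (F.n j + 1)) = ⟨j, s'⟩ ∧
      (k = s'.castSucc ∨ k = s'.succ) := by
  have hA := F.vertex_A.2 h
  induction k using Fin.lastCases with
  | last =>
    have hR := F.A_right_R j (Fin.last _) hA
    rcases F.R_inter hs hR with e | ⟨r, hr, ⟨e1, e2⟩ | ⟨e1, e2⟩⟩
    · exact ⟨Fin.last _, e, Or.inr rfl⟩
    · exfalso
      obtain ⟨j₀, r⟩ := r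
      obtain ⟨rfl, e2⟩ := Sigma.mk.inj_iff.1 e2
      have e3 : r.succ = Fin.last (F.n j) := (eq_of_heq e2).symm
      refine F.A_ne j r.succ (v := v) (F.vertex_A.1 hr) ?_
      rw [e3, Fin.succ_last]
      exact h
    · exfalso
      obtain ⟨j₀, r⟩ := r
      obtain ⟨rfl, e1⟩ := Sigma.mk.inj_iff.1 e1
      exact Fin.castSucc_ne_last r (eq_of_heq e1).symm
  | cast s' =>
    have hR := F.A_left_R j s' hA
    rcases F.R_inter hs hR with e | ⟨r, hr, ⟨e1, e2⟩ | ⟨e1, e2⟩⟩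
    · exact ⟨s', e, Or.inl rfl⟩
    · obtain ⟨j₀, r⟩ := r
      obtain ⟨rfl, e2⟩ := Sigma.mk.inj_iff.1 e2
      obtain rfl := eq_of_heq e2
      refine ⟨r.castSucc, e1, Or.inr (Fin.succ_castSucc r).symm⟩
    · exfalso
      obtain ⟨j₀, r⟩ := r
      obtain ⟨rfl, e1⟩ := Sigma.mk.inj_iff.1 e1
      obtain rfl := eq_of_heq e1
      exact F.A_ne j _ h (F.vertex_A.1 hr)

theorem eq_of_mem_A_A {j j' : J} {k : Fin (F.n j + 2)} {k' : Fin (F.n j' + 2)} {v : ι}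
    (h : v ∈ F.A j k) (h' : v ∈ F.A j' k') :
    (⟨j, k⟩ : Σ j, Fin (F.n j + 2)) = ⟨j', k'⟩ := by
  have hA := F.vertex_A.2 h
  induction k using Fin.lastCases with
  | last =>
    obtain ⟨s', e, hk⟩ := F.eq_of_mem_A_R h' (F.A_right_R j (Fin.last _) hA)
    obtain ⟨rfl, e⟩ := Sigma.mk.inj_iff.1 e
    obtain rfl := eq_of_heq e
    rcases hk with rfl | rfl
    · exact absurd h (F.A_ne j _ h')
    · rfl
  | cast s =>
    obtain ⟨s', e, hk⟩ := F.eq_of_mem_A_R h' (F.A_left_R j s hA)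
    obtain ⟨rfl, e⟩ := Sigma.mk.inj_iff.1 e
    obtain rfl := eq_of_heq e
    rcases hk with rfl | rfl
    · rfl
    · exact absurd h' (F.A_ne j _ h)

theorem arc_eq {r r' : F.Ribbon} {v : ι} (h : v ∈ F.arc r) (h' : v ∈ F.arc r') : r = r' := by
  have := F.eq_of_mem_A_A h h'
  obtain ⟨j, r⟩ := r
  obtain ⟨j', r'⟩ := r'
  obtain ⟨rfl, e⟩ := Sigma.mk.inj_iff.1 this
  have := eq_of_heq e
  simp only at this
  rw [Fin.castSucc_inj, Fin.succ_inj] at this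
  rw [this]

/-- A rectangle meets the 0-handles in vertices of its two end arcs. -/
theorem mem_A_of_mem_R_m {j : J} {s : Fin (F.n j + 1)} {i : Z} {t : Finset ι} (h : t ∈ F.R j s)
    (h' : t ∈ F.m i) : (t ∈ pathFaces (F.A j s.castSucc) ∧ F.z j s.castSucc = i) ∨
      (t ∈ pathFaces (F.A j s.succ) ∧ F.z j s.succ = i) := by
  have : t ∈ F.R j s ∩ F.m i := ⟨h, h'⟩
  rwa [F.R_inter_m] at this

/-- Two different pieces meet in an arc only. -/
theorem exists_A_of_mem {p p' : F.Piece} (hp : p ≠ p') {t : Finset ι} (h : t ∈ F.pieceFaces p)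
    (h' : t ∈ F.pieceFaces p') : ∃ j k, t ∈ pathFaces (F.A j k) := by
  rcases p with i | ⟨j, s⟩ <;> rcases p' with i' | ⟨j', s'⟩
  · exact absurd (congrArg Sum.inl (F.eq_of_mem_m h h')) hp
  · rcases F.mem_A_of_mem_R_m h' h with h | h
    · exact ⟨_, _, h.1⟩
    · exact ⟨_, _, h.1⟩
  · rcases F.mem_A_of_mem_R_m h h' with h | h
    · exact ⟨_, _, h.1⟩
    · exact ⟨_, _, h.1⟩
  · rcases F.R_inter h h' with e | ⟨r, hr, -⟩
    · exact absurd (congrArg Sum.inr e) hp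
    · exact ⟨_, _, hr⟩

variable [Fintype Z] [Fintype J]

/-- Different pieces meet only in arcs, so no triangle is counted twice. -/
theorem cofaces_space_card (e : Finset ι) :
    (cofaces F.space 3 e).card = ∑ p : F.Piece, (cofaces (F.pieceFaces p) 3 e).card := by
  rw [← Finset.card_biUnion]
  · congr 1
    ext t
    simp only [mem_cofaces, Finset.mem_biUnion, Finset.mem_univ, true_and, F.mem_space]
    constructor
    · rintro ⟨⟨p, h⟩, h'⟩; exact ⟨p, h, h'⟩
    · rintro ⟨p, h, h'⟩; exact ⟨⟨p, h⟩, h'⟩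
  · intro p _ p' _ hpp'
    rw [Function.onFun, Finset.disjoint_left]
    intro t ht ht'
    rw [mem_cofaces] at ht ht'
    obtain ⟨j, k, h⟩ := F.exists_A_of_mem hpp' ht.1 ht'.1
    have := card_le_of_mem_pathFaces h
    omega

-- An attaching arc bounds the 0-handle and an end rectangle; a ribbon arc bounds the two adjacent
-- rectangles but is interior to its 0-handle. In either case the boundary contributions come in a
-- pair and cancel modulo two.
omit [Fintype Z] [Fintype J] in
theorem piece_of_mem_bdry {j : J} {k : Fin (F.n j + 2)} {e : Finset ι}
    (he : e ∈ pathFaces (F.A j k)) :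
    ∃ p p' : F.Piece, p ≠ p' ∧ ∀ q : F.Piece, e ∈ bdry (F.pieceFaces q) ↔ q = p ∨ q = p' := by
  have hne : e.Nonempty := he.1
  obtain ⟨v, hv⟩ := hne
  have hvA : v ∈ F.A j k := mem_of_mem_pathFaces he hv
  have hR : ∀ j' (s : Fin (F.n j' + 1)), e ∈ bdry (F.R j' s) →
      ∃ s' : Fin (F.n j + 1), (⟨j', s⟩ : Σ j, Fin (F.n j + 1)) = ⟨j, s'⟩ ∧
      (k = s'.castSucc ∨ k = s'.succ) := fun j' s h =>
    F.eq_of_mem_A_R hvA ((F.R_subcomplex j' s).vertex_mem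
      (bdry_subset (F.R_subcomplex j' s) h) hv)
  have hm : ∀ i, e ∈ bdry (F.m i) → i = F.z j k := fun i h =>
    F.eq_of_mem_A_m hvA ((F.m_subcomplex i).vertex_mem (bdry_subset (F.m_subcomplex i) h) hv)
  rcases fin_cases_A k with rfl | ⟨r, rfl⟩ | rfl
  · refine ⟨.inl (F.z j 0), .inr ⟨j, 0⟩, by simp, fun q => ⟨fun h => ?_, ?_⟩⟩
    · rcases q with i | ⟨j', s⟩
      · rw [hm i h]; exact Or.inl rfl
      · obtain ⟨s', e', h0 | h0⟩ := hR j' s h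
        · have : s' = 0 := by rw [← Fin.castSucc_zero] at h0; exact (Fin.castSucc_injective _ h0).symm
          rw [e', this]; exact Or.inr rfl
        · exact absurd h0.symm (Fin.succ_ne_zero _)
    · rintro (rfl | rfl)
      · exact F.attach_first j he
      · exact F.A_left j 0 he
  · refine ⟨.inr ⟨j, r.castSucc⟩, .inr ⟨j, r.succ⟩, ?_, fun q => ⟨fun h => ?_, ?_⟩⟩
    · simp [Fin.ext_iff]
    · rcases q with i | ⟨j', s⟩
      · obtain rfl := hm i h
        exact absurd h (F.ribbon_sub j r he).2
      · obtain ⟨s', e', h0 | h0⟩ := hR j' s h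
        · have : s' = r.succ := (Fin.castSucc_injective _ h0).symm
          rw [e', this]; exact Or.inr rfl
        · rw [← Fin.succ_castSucc, Fin.succ_inj] at h0
          rw [e', ← h0]; exact Or.inl rfl
    · rintro (rfl | rfl)
      · have := F.A_right j r.castSucc
        rw [Fin.succ_castSucc] at this
        exact this he
      · exact F.A_left j r.succ he
  · refine ⟨.inl (F.z j (Fin.last _)), .inr ⟨j, Fin.last _⟩, by simp, fun q => ⟨fun h => ?_, ?_⟩⟩
    · rcases q with i | ⟨j', s⟩
      · rw [hm i h]; exact Or.inl rfl
      · obtain ⟨s', e', h0 | h0⟩ := hR j' s h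
        · exact absurd h0.symm (Fin.castSucc_ne_last _)
        · have : s' = Fin.last _ := by
            rw [← Fin.succ_last, Fin.succ_inj] at h0; exact h0.symm
          rw [e', this]; exact Or.inr rfl
    · rintro (rfl | rfl)
      · exact F.attach_last j he
      · exact F.A_right j (Fin.last _) he

/-- The number of triangles at an edge of `F_r` is odd exactly for boundary edges. -/
theorem cofaces_space_cast {e : Finset ι} (he : e.card = 2) :
    ((cofaces F.space 3 e).card : ZMod 2) = if e ∈ bdry F.space then 1 else 0 := by
  split_ifs with hb
  · rw [cofaces_card_eq_one_iff.2 ((mem_bdry_of_card he).1 hb).2, Nat.cast_one]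
  by_cases hA : ∃ j k, e ∈ pathFaces (F.A j k)
  · obtain ⟨j, k, hjk⟩ := hA
    -- Two pieces contribute one triangle each and every other piece contributes none or two.
    obtain ⟨p, p', hpp', hq⟩ := F.piece_of_mem_bdry hjk
    rw [F.cofaces_space_card, Nat.cast_sum]
    have : ∀ q : F.Piece, ((cofaces (F.pieceFaces q) 3 e).card : ZMod 2) =
        if q = p ∨ q = p' then 1 else 0 := by
      intro q
      rw [(F.pieceFaces_disk q).surface.cofaces_card e he, if_congr (hq q).symm rfl rfl]
      by_cases h : e ∈ bdry (F.pieceFaces q)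
      · simp [h, bdry_subset (F.pieceFaces_subcomplex q) h]
      · rw [if_neg h]
        split_ifs
        · exact CharTwo.two_eq_zero
        · rfl
    simp only [this]
    rw [← Finset.sum_filter, Finset.sum_const]
    have h2 : (Finset.univ.filter fun q : F.Piece => q = p ∨ q = p') = {p, p'} := by
      ext q; simp
    rw [h2, Finset.card_pair hpp', two_nsmul]
    exact CharTwo.add_self_eq_zero _
  -- Away from the arcs an edge lies in at most one piece, which is a surface.
  · have hone : (cofaces F.space 3 e).card ≤ 2 := by
      by_cases hp : ∃ p, e ∈ F.pieceFaces p
      · obtain ⟨p, hp⟩ := hp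
        rw [F.cofaces_space_card, Finset.sum_eq_single p]
        · exact (F.pieceFaces_disk p).surface.cofaces_card_le e he
        · intro q _ hq
          rw [(F.pieceFaces_disk q).surface.cofaces_card e he, if_neg]
          exact fun h => hA (F.exists_A_of_mem hq h hp)
        · simp
      · rw [F.cofaces_space_card, Finset.sum_eq_zero]
        · simp
        · intro q _
          rw [(F.pieceFaces_disk q).surface.cofaces_card e he, if_neg]
          exact fun h => hp ⟨q, h⟩
    have hn1 : (cofaces F.space 3 e).card ≠ 1 := by
      intro h1
      rw [cofaces_card_eq_one_iff] at h1
      obtain ⟨t, ht, -⟩ := id h1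
      refine hb ((mem_bdry_of_card he).2 ⟨?_, h1⟩)
      exact (F.space_subcomplex t ht.1).2 e ht.2.2 (Finset.card_pos.1 (by omega))
    interval_cases h : (cofaces F.space 3 e).card
    · simp
    · exact absurd rfl hn1
    · exact CharTwo.two_eq_zero

/-- An edge of a ribbon singularity lies in four triangles. -/
theorem two_lt_cofaces_card_arc {r : F.Ribbon} {e : Finset ι} (he : e.card = 2)
    (h : e ∈ pathFaces (F.arc r)) : 2 < (cofaces F.space 3 e).card := by
  rw [F.cofaces_space_card]
  have hm : (cofaces (F.pieceFaces (.inl (F.disk r))) 3 e).card = 2 := by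
    rw [(F.pieceFaces_disk _).surface.cofaces_card e he, if_pos, if_neg]
    · exact (F.ribbon_sub _ _ h).2
    · exact F.A_sub_m _ _ h
  have hR : 1 ≤ (cofaces (F.pieceFaces (.inr ⟨r.1, r.2.succ⟩)) 3 e).card := by
    rw [(F.pieceFaces_disk _).surface.cofaces_card e he, if_pos]
    · split_ifs <;> norm_num
    · exact F.A_left_R r.1 r.2.succ h
  have := Finset.sum_le_sum_of_subset (f := fun p : F.Piece => (cofaces (F.pieceFaces p) 3 e).card)
    (Finset.subset_univ {.inl (F.disk r), .inr ⟨r.1, r.2.succ⟩})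
  rw [Finset.sum_pair (by simp)] at this
  omega

end RibbonSurface

end

section

open scoped Classical

set_option linter.unusedSectionVars false

variable {ι : Type} [Fintype ι] [DecidableEq ι]

/-! ### Chains around a circle with alternating colours -/

/-- Around the circle `c` has a constant value, since its boundary vanishes at each vertex. The
colour changes exactly at `p, x, q, y`, so going from `p` to the opposite point `q` it returns to
its initial state, and the coloured edges contribute equally at both. The lemma serves twice: for
tetrahedra around an edge of the disk, and for triangles around a vertex of the sphere. -/
theorem sum_eq_of_circle {l l₁ l₂ l₃ l₄ : List ι} {p x q y : ι}
    (hl : l = p :: l₁ ++ x :: l₂ ++ q :: l₃ ++ y :: l₄) (hnd : l.Nodup) (c : ι → ι → ℤ)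
    (hc : ∀ a b, c a b = - c b a)
    (hthird : ∀ a ∈ l, ∀ b b₁ b₂, c a b ≠ 0 → Consecutive (closeUp l) a b₁ →
      Consecutive (closeUp l) a b₂ → b₁ = b₂ ∨ b = b₁ ∨ b = b₂)
    (hsum : ∀ a ∈ l, ∑ b, c a b = 0) (col : ι → ι → Prop) (hcol : ∀ a b, col a b → col b a)
    (hflip : ∀ a b d, a ≠ d → [a, b] <:+: closeUp l → [b, d] <:+: closeUp l →
      ((col a b ↔ col b d) ↔ ¬ (b = p ∨ b = x ∨ b = q ∨ b = y))) :
    (∑ b, if col p b then c p b else 0) = ∑ b, if col q b then c q b else 0 := by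
  have hlen : l.length = l₁.length + l₂.length + l₃.length + l₄.length + 4 := by
    rw [hl]; simp; omega
  obtain ⟨f, hper, hval, hinj, hmem, hf⟩ := exists_periodic hnd (by omega)
  set n := l.length with hn
  set i₁ := l₁.length + 1 with hi₁
  set i₂ := i₁ + l₂.length + 1 with hi₂
  set i₃ := i₂ + l₃.length + 1 with hi₃
  have f0 : f 0 = p := by rw [hval 0 (by omega)]; simp [hl]
  have f1 : f i₁ = x := by
    rw [hval i₁ (by omega)]
    simp only [hl, List.append_assoc, List.cons_append]
    rw [List.getElem_cons_succ, List.getElem_append_right (by omega)]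
    simp
  have f2 : f i₂ = q := by
    rw [hval i₂ (by omega)]
    have : l = (p :: l₁ ++ x :: l₂) ++ (q :: (l₃ ++ y :: l₄)) := by rw [hl]; simp
    simp only [this]
    rw [List.getElem_append_right (by simp; omega)]
    have e : i₂ - (p :: l₁ ++ x :: l₂).length = 0 := by simp; omega
    simp only [e, List.getElem_cons_zero]
  have f3 : f i₃ = y := by
    rw [hval i₃ (by omega)]
    simp only [hl]
    rw [List.getElem_append_right (by simp; omega)]
    have e : i₃ - (p :: l₁ ++ x :: l₂ ++ q :: l₃).length = 0 := by simp; omega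
    simp only [e, List.getElem_cons_zero]
  have finj : ∀ i j, i < n → j < n → f i = f j → i = j := fun i j hi hj h =>
    Nat.ModEq.eq_of_lt_of_lt ((hinj i j).1 h) hi hj
  have hne2 : ∀ i, f i ≠ f (i + 2) := by
    intro i h
    have h1 := (hinj _ _).1 h
    have h2 : 0 ≡ 2 [MOD n] := by
      have : i + 0 ≡ i + 2 [MOD n] := h1
      exact Nat.ModEq.add_left_cancel' i this
    have := Nat.ModEq.eq_of_lt_of_lt h2 (by omega) (by omega)
    omega
  have hcons : ∀ i, [f i, f (i + 1)] <:+: closeUp l := fun i => (hf _ _).2 ⟨i, rfl, rfl⟩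
  set C : ℕ → Prop := fun i => col (f i) (f (i + 1)) with hC
  have flip : ∀ i, (C i ↔ C (i + 1)) ↔
      ¬ (f (i + 1) = p ∨ f (i + 1) = x ∨ f (i + 1) = q ∨ f (i + 1) = y) := fun i =>
    hflip _ _ _ (hne2 i) (hcons i) (hcons (i + 1))
  have nbr : ∀ i b, c (f (i + 1)) b ≠ 0 → b = f i ∨ b = f (i + 2) := fun i b hb =>
    (hthird (f (i + 1)) ((hmem _).2 ⟨_, rfl⟩) b (f i) (f (i + 2)) hb (Or.inr (hcons i))
      (Or.inl (hcons (i + 1)))).resolve_left (hne2 i)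
  have sum_two : ∀ i (φ : ι → ℤ), (∀ b, c (f (i + 1)) b = 0 → φ b = 0) →
      ∑ b, φ b = φ (f i) + φ (f (i + 2)) := by
    intro i φ hφ
    rw [← Finset.sum_pair (hne2 i)]
    symm
    refine Finset.sum_subset (Finset.subset_univ _) fun b _ hb => ?_
    refine hφ b ?_
    by_contra h
    simp only [Finset.mem_insert, Finset.mem_singleton] at hb
    exact hb (nbr i b h)
  have step : ∀ i, c (f (i + 1)) (f (i + 2)) = c (f i) (f (i + 1)) := by
    intro i
    have h1 := hsum (f (i + 1)) ((hmem _).2 ⟨_, rfl⟩)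
    rw [sum_two i _ fun _ h => h] at h1
    have h2 := hc (f (i + 1)) (f i)
    omega
  -- Kirchhoff's law at a vertex with two neighbours: what comes in goes out.
  have const : ∀ i, c (f i) (f (i + 1)) = c (f 0) (f 1) := by
    intro i
    induction i with
    | zero => rfl
    | succ i ih => rw [← ih]; exact step i
  have value : ∀ i, (∑ b, if col (f (i + 1)) b then c (f (i + 1)) b else 0) =
      (if C i then - c (f 0) (f 1) else 0) + if C (i + 1) then c (f 0) (f 1) else 0 := by
    intro i
    rw [sum_two i _ fun b hb => by simp [hb]]
    have e1 : col (f (i + 1)) (f i) ↔ C i := ⟨hcol _ _, hcol _ _⟩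
    have e2 : c (f (i + 1)) (f i) = - c (f 0) (f 1) := by rw [hc, const i]
    have e3 : c (f (i + 1)) (f (i + 2)) = c (f 0) (f 1) := const (i + 1)
    rw [e2, e3]
    congr 1
    exact if_congr e1 rfl rfl
  have hlt : ∀ k, 0 < k → k < i₂ → k ≠ i₁ → (C (k - 1) ↔ C k) := by
    intro k h0 h2 h1
    have := flip (k - 1)
    rw [Nat.sub_add_cancel h0] at this
    rw [this]
    rintro (h | h | h | h)
    · exact absurd (finj k 0 (by omega) (by omega) (h.trans f0.symm)) (by omega)
    · exact absurd (finj k i₁ (by omega) (by omega) (h.trans f1.symm)) h1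
    · exact absurd (finj k i₂ (by omega) (by omega) (h.trans f2.symm)) (by omega)
    · exact absurd (finj k i₃ (by omega) (by omega) (h.trans f3.symm)) (by omega)
  -- The colour is followed from `p` to `x`, then from `x` to `q`. The state just before `p` is
  -- obtained by going one step back, using periodicity.
  have hseg1 : ∀ k, k < i₁ → (C k ↔ C 0) := by
    intro k
    induction k with
    | zero => intro; rfl
    | succ k ih =>
      intro hk
      rw [← ih (by omega)]
      exact (hlt (k + 1) (by omega) (by omega) (by omega)).symm
  have hx : C i₁ ↔ ¬ C 0 := by
    have h := flip (i₁ - 1)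
    rw [Nat.sub_add_cancel (by omega), hseg1 (i₁ - 1) (by omega)] at h
    have : ¬ (C 0 ↔ C i₁) := fun h' => h.1 h' (Or.inr (Or.inl f1))
    tauto
  have hseg2 : ∀ k, i₁ + k < i₂ → (C (i₁ + k) ↔ ¬ C 0) := by
    intro k
    induction k with
    | zero => intro; exact hx
    | succ k ih =>
      intro hk
      rw [← ih (by omega)]
      exact (hlt (i₁ + (k + 1)) (by omega) (by omega) (by omega)).symm
  have hq1 : C (i₂ - 1) ↔ ¬ C 0 := by
    have := hseg2 (i₂ - 1 - i₁) (by omega)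
    rwa [show i₁ + (i₂ - 1 - i₁) = i₂ - 1 by omega] at this
  have hq2 : C i₂ ↔ C 0 := by
    have h := flip (i₂ - 1)
    rw [Nat.sub_add_cancel (by omega), hq1] at h
    have : ¬ (¬ C 0 ↔ C i₂) := fun h' => h.1 h' (Or.inr (Or.inr (Or.inl f2)))
    tauto
  have hCn : C n ↔ C 0 := by
    have e1 : f n = f 0 := by have := hper 0; rwa [zero_add] at this
    have e2 : f (n + 1) = f 1 := by rw [add_comm]; exact hper 1
    simp only [hC, e1, e2]
  have hp1 : C (n - 1) ↔ ¬ C 0 := by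
    have h := flip (n - 1)
    rw [Nat.sub_add_cancel (by omega), hCn] at h
    have e1 : f n = p := by have := hper 0; rw [zero_add] at this; rw [this, f0]
    have : ¬ (C (n - 1) ↔ C 0) := fun h' => h.1 h' (Or.inl e1)
    tauto
  have vp := value (n - 1)
  have vq := value (i₂ - 1)
  rw [Nat.sub_add_cancel (by omega)] at vp vq
  have e1 : f n = p := by have := hper 0; rw [zero_add] at this; rw [this, f0]
  rw [e1] at vp
  rw [f2] at vq
  rw [vp, vq]
  congr 1
  · exact if_congr (hp1.trans hq1.symm) rfl rfl
  · exact if_congr (hCn.trans hq2.symm) rfl rfl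

theorem restrict_mem {o : ι → ι → ι → ℤ} {X : Faces ι} (ho : o ∈ Chain2 X) (Y : Faces ι) :
    restrict o Y ∈ Chain2 (X ∩ Y) := by
  refine ⟨fun u v w => ?_, fun u v w => ?_, fun u v w h => ?_⟩
  · simp only [restrict, Finset.insert_comm u v {w}]
    split_ifs
    · exact ho.1 u v w
    · simp
  · simp only [restrict, Finset.pair_comm v w]
    split_ifs
    · exact ho.2.1 u v w
    · simp
  · unfold restrict
    split_ifs with h'
    · exact ho.2.2 u v w fun h'' => h ⟨h'', h'⟩
    · rfl

end

section

open scoped Classical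

set_option linter.unusedSectionVars false

variable {ι : Type} [Fintype ι] [DecidableEq ι]

/-! ### The boundary sphere of a neighbourhood of a 2-handle -/

namespace SphereData

variable {K : Triangulation ι} {Z J D : Type} {F : RibbonSurface K Z J}
  {T : TwoHandles F D} (N : SphereData T) (i : D)

theorem mem_S_of_card {t : Finset ι} (ht : t.card = 3) :
    t ∈ N.S i ↔ ∃! τ, τ ∈ N.N i ∧ τ.card = 4 ∧ t ⊆ τ := by
  rw [N.S_bdry]
  constructor
  · rintro ⟨-, t', -, hs, hc, h⟩
    obtain rfl := Finset.eq_of_subset_of_card_le hs (by omega)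
    exact h
  · intro h
    obtain ⟨τ, hτ, -⟩ := id h
    have hne : t.Nonempty := Finset.card_pos.1 (by omega)
    exact ⟨hne, t, (N.N_subcomplex i τ hτ.1).2 t hτ.2.2 hne, subset_rfl, ht, h⟩

theorem S_sub : N.S i ⊆ N.N i := by
  intro s hs
  rw [N.S_bdry] at hs
  obtain ⟨hne, t, ht, hst, -⟩ := hs
  exact (N.N_subcomplex i t ht).2 s hst hne

theorem S_subcomplex : IsSubcomplex (N.S i) := (N.S_sphere i).surface.subcomplex

theorem d_subcomplex (T : TwoHandles F D) (i : D) : IsSubcomplex (T.d i) :=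
  (T.d_disk i).surface.subcomplex

theorem collapses : ∃ v, Collapses (N.N i) {{v}} := by
  obtain ⟨v, hv⟩ := (T.d_disk i).collapses
  exact ⟨v, (N.N_collapses i).trans hv⟩

theorem notMem_S_of_mem_d {t : Finset ι} (h : t ∈ T.d i) : t ∉ N.S i := (N.d_sub i h).2

theorem bd2_o : bd2 (N.o i) = 0 := by
  funext u v
  refine (N.orientation i).2.2 u v ?_
  rw [(N.S_sphere i).closed]
  exact Set.notMem_empty _

/-- The triangles of `N` that lie in `F_r`, in the disk, or in a black face of the sphere. -/
def wall : Faces ι := F.space ∪ T.d i ∪ (N.S i ∩ N.black i)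

/-- At each edge the numbers of triangles in `F_r`, in the disk and in the black faces are compared
modulo two. The three families of triangles are disjoint for reasons of dimension and position. -/
theorem wall_cycle [Fintype Z] [Fintype J] {e : Finset ι} (he : e.card = 2) :
    ∑ t ∈ cofaces (N.N i) 3 e, (if t ∈ N.wall i then (1 : ZMod 2) else 0) = 0 := by
  have hsplit : ∀ t ∈ cofaces (N.N i) 3 e, (if t ∈ N.wall i then (1 : ZMod 2) else 0) =
      (if t ∈ F.space then 1 else 0) + (if t ∈ T.d i then 1 else 0) +
        if t ∈ N.S i ∩ N.black i then 1 else 0 := by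
    intro t ht
    have h3 := (mem_cofaces.1 ht).2.1
    have h1 : t ∈ F.space → t ∉ T.d i := fun h h' => by
      have := T.graph i t ⟨h', h⟩; omega
    have h2 : t ∈ F.space → t ∉ N.S i := fun h h' => by
      have := N.S_graph i t ⟨h', h⟩; omega
    have h4 : t ∈ T.d i → t ∉ N.S i := N.notMem_S_of_mem_d i
    unfold wall
    by_cases a : t ∈ F.space
    · simp [a, h1 a, h2 a]
    · by_cases b : t ∈ T.d i
      · simp [a, b, h4 b]
      · simp [a, b]
  rw [Finset.sum_congr rfl hsplit, Finset.sum_add_distrib, Finset.sum_add_distrib]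
  simp only [Finset.sum_ite, Finset.sum_const_zero, add_zero, Finset.sum_const, nsmul_one]
  by_cases heN : e ∈ N.N i
  swap
  · have : cofaces (N.N i) 3 e = ∅ := by
      rw [Finset.eq_empty_iff_forall_notMem]
      intro t ht
      rw [mem_cofaces] at ht
      exact heN ((N.N_subcomplex i t ht.1).2 e ht.2.2 (Finset.card_pos.1 (by omega)))
    simp [this]
  have hd : (cofaces (N.N i) 3 e).filter (· ∈ T.d i) = cofaces (T.d i) 3 e := by
    ext t
    simp only [Finset.mem_filter, mem_cofaces]
    exact ⟨fun h => ⟨h.2, h.1.2⟩, fun h => ⟨⟨(N.d_sub i h.1).1, h.2⟩, h.1⟩⟩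
  rw [hd]
  by_cases heS : e ∈ N.S i
  -- On the sphere: if `e` lies on `F_r`, one triangle of `F_r` points inwards and exactly one of
  -- the two triangles of the sphere is black; otherwise both have the same colour.
  · have hd0 : (cofaces (T.d i) 3 e).card = 0 := by
      rw [(T.d_disk i).surface.cofaces_card e he, if_neg]
      exact fun h => N.notMem_S_of_mem_d i h heS
    have hS2 : (cofaces (N.S i) 3 e).card = 2 := by
      rw [(N.S_sphere i).surface.cofaces_card e he, if_pos heS, if_neg]
      rw [(N.S_sphere i).closed]
      exact Set.notMem_empty _
    obtain ⟨t₁, t₂, hne, ht⟩ := Finset.card_eq_two.1 hS2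
    have hm : ∀ t, (t ∈ N.S i ∧ t.card = 3 ∧ e ⊆ t) ↔ t = t₁ ∨ t = t₂ := by
      intro t
      rw [← mem_cofaces, ht]
      simp
    have h1 := (hm t₁).2 (Or.inl rfl)
    have h2 := (hm t₂).2 (Or.inr rfl)
    have hint : t₁ ∩ t₂ = e := by
      symm
      refine Finset.eq_of_subset_of_card_le (Finset.subset_inter h1.2.2 h2.2.2) ?_
      by_contra hcon
      have h5 : (t₁ ∩ t₂).card ≤ t₁.card := Finset.card_le_card Finset.inter_subset_left
      have h6 : t₁ ∩ t₂ = t₁ := Finset.eq_of_subset_of_card_le Finset.inter_subset_left (by omega)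
      have h7 : t₁ ∩ t₂ = t₂ := Finset.eq_of_subset_of_card_le Finset.inter_subset_right (by omega)
      exact hne (h6.symm.trans h7)
    have hchess := N.chessboard i t₁ h1.1 t₂ h2.1 h1.2.1 h2.2.1 (by rw [hint, he])
    rw [hint] at hchess
    have hSb : (cofaces (N.N i) 3 e).filter (· ∈ N.S i ∩ N.black i) =
        ({t₁, t₂} : Finset (Finset ι)).filter (· ∈ N.black i) := by
      ext t
      simp only [Finset.mem_filter, mem_cofaces, Finset.mem_insert, Finset.mem_singleton, ← hm,
        Set.mem_inter_iff]
      exact ⟨fun h => ⟨⟨h.2.1, h.1.2⟩, h.2.2⟩, fun h => ⟨⟨N.S_sub i h.1.1, h.1.2⟩, h.1.1, h.2⟩⟩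
    rw [hSb, hd0]
    by_cases heF : e ∈ F.space
    · have hF1 : (cofaces (N.N i) 3 e).filter (· ∈ F.space) = {(N.S_cross i e ⟨heS, heF⟩ he).choose} := by
        obtain ⟨t', ht, ht', hset⟩ := (N.S_cross i e ⟨heS, heF⟩ he).choose_spec
        generalize (N.S_cross i e ⟨heS, heF⟩ he).choose = t at ht hset
        have hm' : ∀ s, (s ∈ F.space ∧ s.card = 3 ∧ e ⊆ s) ↔ s = t ∨ s = t' := fun s => by
          have := Set.ext_iff.1 hset s
          simp only [Set.mem_insert_iff, Set.mem_singleton_iff] at this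
          exact this
        ext s
        simp only [Finset.mem_filter, mem_cofaces, Finset.mem_singleton]
        constructor
        · rintro ⟨⟨a, b⟩, c⟩
          rcases (hm' s).1 ⟨c, b⟩ with h | h
          · exact h
          · exact absurd (h ▸ a) ht'
        · rintro rfl
          have := (hm' s).2 (Or.inl rfl)
          exact ⟨⟨ht, this.2⟩, this.1⟩
      have hflip : ¬ (t₁ ∈ N.black i ↔ t₂ ∈ N.black i) := fun h => hchess.1 h ⟨heS, heF⟩
      have hb1 : (({t₁, t₂} : Finset (Finset ι)).filter (· ∈ N.black i)).card = 1 := by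
        by_cases hb : t₁ ∈ N.black i
        · have hb2 : t₂ ∉ N.black i := fun h => hflip ⟨fun _ => h, fun _ => hb⟩
          rw [Finset.filter_insert, if_pos hb, Finset.filter_singleton, if_neg hb2]
          simp
        · have hb2 : t₂ ∈ N.black i := by tauto
          rw [Finset.filter_insert, if_neg hb, Finset.filter_singleton, if_pos hb2]
          simp
      rw [hF1, hb1]
      simp only [Finset.card_singleton, Nat.cast_one, Nat.cast_zero, add_zero]
      exact CharTwo.add_self_eq_zero _
    · have hF0 : (cofaces (N.N i) 3 e).filter (· ∈ F.space) = ∅ := by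
        rw [Finset.eq_empty_iff_forall_notMem]
        intro t ht
        simp only [Finset.mem_filter, mem_cofaces] at ht
        exact heF ((F.space_subcomplex t ht.2).2 e ht.1.2.2 (Finset.card_pos.1 (by omega)))
      have hsame : t₁ ∈ N.black i ↔ t₂ ∈ N.black i := hchess.2 fun h => heF h.2
      rw [hF0]
      by_cases hb : t₁ ∈ N.black i
      · rw [Finset.filter_insert, if_pos hb, Finset.filter_singleton, if_pos (hsame.1 hb),
          Finset.card_pair hne]
        simpa using CharTwo.two_eq_zero
      · rw [Finset.filter_insert, if_neg hb, Finset.filter_singleton, if_neg (fun h => hb (hsame.2 h))]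
        simp
  -- Inside the neighbourhood: all triangles of `F_r` at `e` lie in `N`, and their number is odd
  -- exactly on the boundary of `F_r`, which inside `N` is the boundary of the disk.
  · have hS0 : (cofaces (N.N i) 3 e).filter (· ∈ N.S i ∩ N.black i) = ∅ := by
      rw [Finset.eq_empty_iff_forall_notMem]
      intro t ht
      simp only [Finset.mem_filter, mem_cofaces] at ht
      exact heS ((N.S_subcomplex i t ht.2.1).2 e ht.1.2.2 (Finset.card_pos.1 (by omega)))
    have hF : (cofaces (N.N i) 3 e).filter (· ∈ F.space) = cofaces F.space 3 e := by
      ext t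
      simp only [Finset.mem_filter, mem_cofaces]
      exact ⟨fun h => ⟨h.2, h.1.2⟩, fun h =>
        ⟨⟨N.N_open i e ⟨heN, heS⟩ t (F.space_subset h.1) h.2.2, h.2⟩, h.1⟩⟩
    have hbd : e ∈ bdry F.space ↔ e ∈ bdry (T.d i) := by
      rw [← N.N_bdry i]
      exact ⟨fun h => ⟨heN, h⟩, fun h => h.2⟩
    have hdc : ((cofaces (T.d i) 3 e).card : ZMod 2) = if e ∈ bdry F.space then 1 else 0 := by
      rw [(T.d_disk i).surface.cofaces_card e he, if_congr hbd rfl rfl]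
      by_cases h : e ∈ bdry (T.d i)
      · simp [h, bdry_subset (d_subcomplex T i) h]
      · rw [if_neg h, if_neg h]
        split_ifs
        · exact CharTwo.two_eq_zero
        · rfl
    rw [hS0, hF, F.cofaces_space_cast he, hdc, CharTwo.add_self_eq_zero]
    simp

theorem exists_tetra_colouring [Fintype Z] [Fintype J] : ∃ g : Finset ι → ZMod 2,
    ∀ t ∈ N.N i, t.card = 3 →
      (if t ∈ N.wall i then (1 : ZMod 2) else 0) = ∑ τ ∈ cofaces (N.N i) 4 t, g τ := by
  obtain ⟨v, hv⟩ := N.collapses i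
  exact exists_mod_two_filling hv (N.N_subcomplex i) _ fun e he => N.wall_cycle i he

/-- The oriented sphere is a 2-cycle in a collapsible complex, so it bounds; the filling is a
fundamental chain of the neighbourhood. -/
theorem exists_filling : ∃ Y, IsChain3 (N.N i) Y ∧ bd3 Y = N.o i := by
  obtain ⟨v, hv⟩ := N.collapses i
  exact exists_bd3_eq_of_collapses hv (N.N_subcomplex i)
    (Chain2_mono (N.S_sub i) (N.orientation i).1) (N.bd2_o i)

omit [Fintype ι] in
theorem four_insert (a b d e : ι) : (insert e {a, b, d} : Finset ι) = {a, b, d, e} := by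
  ext; simp; tauto

theorem apex_of_ne_zero {Y : ι → ι → ι → ι → ℤ} (hY : IsChain3 (N.N i) Y) {a b d x : ι}
    (h : Y a b d x ≠ 0) : x ∉ ({a, b, d} : Finset ι) ∧ insert x {a, b, d} ∈ N.N i := by
  constructor
  · intro hx
    simp only [Finset.mem_insert, Finset.mem_singleton] at hx
    have h1 : ∀ u v w, Y u v w w = 0 := fun u v w => by have := hY.swap34 u v w w; omega
    have h2 : ∀ u v w, Y u w v w = 0 := fun u v w => by
      have e1 := hY.swap34 u w v w
      have e2 := hY.swap23 u w w v
      omega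
    rcases hx with rfl | rfl | rfl
    · apply h; rw [hY.swap12, h2]; rfl
    · exact h (h2 _ _ _)
    · exact h (h1 _ _ _)
  · rw [four_insert]
    by_contra hn
    exact h (hY.support _ _ _ _ hn)

/-- The tetrahedra of `N` at a triangle. -/
theorem cofaces_four_cases {a b d : ι} (ht : ({a, b, d} : Finset ι).card = 3) :
    (({a, b, d} : Finset ι) ∈ N.S i ∧ ∃ x, x ∉ ({a, b, d} : Finset ι) ∧
      ∀ y, y ∉ ({a, b, d} : Finset ι) ∧ insert y {a, b, d} ∈ N.N i ↔ y = x) ∨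
    (({a, b, d} : Finset ι) ∉ N.S i ∧ ∀ y, ¬ (y ∉ ({a, b, d} : Finset ι) ∧
      insert y {a, b, d} ∈ N.N i)) ∨
    (({a, b, d} : Finset ι) ∉ N.S i ∧ ∃ x x', x ≠ x' ∧
      ∀ y, y ∉ ({a, b, d} : Finset ι) ∧ insert y {a, b, d} ∈ N.N i ↔ y = x ∨ y = x') := by
  set P : ι → Prop := fun y => y ∉ ({a, b, d} : Finset ι) ∧ insert y {a, b, d} ∈ N.N i with hP
  -- This is the only input from the geometry of three-space: a triangle has at most two tetrahedra
  -- on it.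
  have hthree : ∀ x y z, P x → P y → P z → x = y ∨ x = z ∨ y = z := fun x y z hx hy hz =>
    K.apex_eq ht hx.1 hy.1 hz.1 (N.N_sub i hx.2) (N.N_sub i hy.2) (N.N_sub i hz.2)
  have hS : ({a, b, d} : Finset ι) ∈ N.S i ↔ ∃! x, P x := by
    rw [N.mem_S_of_card i ht]
    constructor
    · rintro ⟨τ, ⟨hτ, hc, hs⟩, huniq⟩
      obtain ⟨x, hx, rfl⟩ := exists_eq_insert_of_ssubset
        (Finset.ssubset_iff_subset_ne.2 ⟨hs, fun e => by rw [e] at ht; omega⟩) (by omega)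
      refine ⟨x, ⟨hx, hτ⟩, fun y hy => ?_⟩
      have := huniq _ ⟨hy.2, by rw [Finset.card_insert_of_notMem hy.1, ht], by simp⟩
      have hm : y ∈ insert x ({a, b, d} : Finset ι) := this ▸ by simp
      exact (Finset.mem_insert.1 hm).resolve_right hy.1
    · rintro ⟨x, hx, huniq⟩
      refine ⟨insert x {a, b, d}, ⟨hx.2, by rw [Finset.card_insert_of_notMem hx.1, ht],
        by simp⟩, ?_⟩
      rintro τ ⟨hτ, hc, hs⟩
      obtain ⟨y, hy, rfl⟩ := exists_eq_insert_of_ssubset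
        (Finset.ssubset_iff_subset_ne.2 ⟨hs, fun e => by rw [e] at ht; omega⟩) (by omega)
      rw [huniq y ⟨hy, hτ⟩]
  by_cases h0 : ∃ x, P x
  · obtain ⟨x, hx⟩ := h0
    by_cases h1 : ∃ x', x ≠ x' ∧ P x'
    · obtain ⟨x', hne, hx'⟩ := h1
      refine Or.inr (Or.inr ⟨?_, x, x', hne, fun y => ⟨fun hy => ?_, ?_⟩⟩)
      · rw [hS]
        rintro ⟨z, -, hz⟩
        exact hne ((hz x hx).trans (hz x' hx').symm)
      · rcases hthree x x' y hx hx' hy with h | h | h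
        · exact absurd h hne
        · exact Or.inl h.symm
        · exact Or.inr h.symm
      · rintro (rfl | rfl) <;> assumption
    · have hu : ∀ y, P y → y = x := fun y hy => by
        by_contra h; exact h1 ⟨y, fun e => h e.symm, hy⟩
      exact Or.inl ⟨hS.2 ⟨x, hx, hu⟩, x, hx.1, fun y => ⟨hu y, fun e => e ▸ hx⟩⟩
  · refine Or.inr (Or.inl ⟨?_, fun y hy => h0 ⟨y, hy⟩⟩)
    rw [hS]
    rintro ⟨x, hx, -⟩
    exact h0 ⟨x, hx⟩

end SphereData

end

section

open scoped Classical

set_option linter.unusedSectionVars false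

variable {ι : Type} [Fintype ι] [DecidableEq ι]

/-! ### The coloured half of the neighbourhood of a 2-handle and its boundary -/

namespace SphereData

variable {K : Triangulation ι} {Z J D : Type} {F : RibbonSurface K Z J}
  {T : TwoHandles F D} (N : SphereData T) (i : D)

theorem abs_o {u v w : ι} (h : ({u, v, w} : Finset ι) ∈ N.S i)
    (hc : ({u, v, w} : Finset ι).card = 3) : |N.o i u v w| = 1 := by
  rcases (N.orientation i).2.1 u v w h hc with h | h <;> rw [h] <;> rfl

theorem o_eq_zero {u v w : ι} (h : ({u, v, w} : Finset ι) ∉ N.S i) : N.o i u v w = 0 :=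
  (N.orientation i).1.2.2 u v w h

theorem bd3_eq_of_unique {Y : ι → ι → ι → ι → ℤ} (hY : IsChain3 (N.N i) Y) {a b d x : ι}
    (h : ∀ y, y ∉ ({a, b, d} : Finset ι) ∧ insert y {a, b, d} ∈ N.N i ↔ y = x) :
    bd3 Y a b d = Y a b d x := by
  unfold bd3
  refine Finset.sum_eq_single x (fun y _ hy => ?_) (by simp)
  by_contra hne
  exact hy ((h y).1 (N.apex_of_ne_zero i hY hne))

theorem bd3_eq_of_pair {Y : ι → ι → ι → ι → ℤ} (hY : IsChain3 (N.N i) Y) {a b d x x' : ι}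
    (hne : x ≠ x')
    (h : ∀ y, y ∉ ({a, b, d} : Finset ι) ∧ insert y {a, b, d} ∈ N.N i ↔ y = x ∨ y = x') :
    bd3 Y a b d = Y a b d x + Y a b d x' := by
  unfold bd3
  rw [← Finset.sum_pair hne]
  symm
  refine Finset.sum_subset (Finset.subset_univ _) fun y _ hy => ?_
  by_contra hn
  simp only [Finset.mem_insert, Finset.mem_singleton] at hy
  exact hy ((h y).1 (N.apex_of_ne_zero i hY hn))

/-- During the collapse of `N` to the disk each tetrahedron disappears through a free triangle.
Beyond that triangle there is either the sphere, where the boundary is ±1, or a tetrahedron removed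
earlier, whose coefficient ±1 has to be cancelled. The disk has no tetrahedra, so all of them are
reached. -/
theorem abs_filling {Y : ι → ι → ι → ι → ℤ} (hY : IsChain3 (N.N i) Y) (hbd : bd3 Y = N.o i)
    {u v w x : ι} (h : ({u, v, w, x} : Finset ι) ∈ N.N i)
    (hc : ({u, v, w, x} : Finset ι).card = 4) : |Y u v w x| = 1 := by
  have key : ∀ X, Collapses (N.N i) X → ∀ u v w x, ({u, v, w, x} : Finset ι) ∈ N.N i →
      ({u, v, w, x} : Finset ι) ∉ X → ({u, v, w, x} : Finset ι).card = 4 → |Y u v w x| = 1 := by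
    intro X hX
    induction hX with
    | refl => exact fun u v w x h h' => absurd h h'
    | @tail X₁ X₂ h12 hcol ih =>
      intro u v w x hN hX2 hc
      by_cases hX1 : ({u, v, w, x} : Finset ι) ∈ X₁
      swap
      · exact ih u v w x hN hX1 hc
      obtain ⟨σ, hσ, τ, hτ, hστ, hcard, hfree, rfl⟩ := hcol
      have huvwx : ({u, v, w, x} : Finset ι) = σ ∨ ({u, v, w, x} : Finset ι) = τ := by
        by_contra hn
        exact hX2 ⟨hX1, by simpa using hn⟩
      rcases huvwx with hs | hs
      · -- a tetrahedron is not a free face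
        obtain ⟨t, ht, ht4, hst⟩ := N.N_pure i τ (Collapses.subset h12 hτ)
        have := Finset.card_le_card hst
        rw [← hs, hc] at hcard
        omega
      · have hσ3 : σ.card = 3 := by rw [← hs, hc] at hcard; omega
        obtain ⟨e, he, hτe⟩ := exists_eq_insert_of_ssubset hστ hcard
        obtain ⟨a, b, d, -, -, -, rfl⟩ := Finset.card_eq_three.1 hσ3
        have hτ4 : ({u, v, w, x} : Finset ι) = {a, b, d, e} := by
          rw [hs, hτe, four_insert]
        rw [abs_alternating_four hY hc hτ4]
        have heN : insert e {a, b, d} ∈ N.N i := hτe ▸ Collapses.subset h12 hτ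
        have hbd' := congrFun (congrFun (congrFun hbd a) b) d
        rcases N.cofaces_four_cases i hσ3 with ⟨hS, y, -, hy⟩ | ⟨-, hy⟩ | ⟨hS, y, y', hne, hy⟩
        · rw [N.bd3_eq_of_unique i hY hy, ← (hy e).1 ⟨he, heN⟩] at hbd'
          rw [hbd', N.abs_o i hS hσ3]
        · exact absurd ⟨he, heN⟩ (hy e)
        -- Freeness of the triangle excludes the second tetrahedron from `X₁`, so the induction
        -- hypothesis applies to it.
        · obtain ⟨e', hee', he'⟩ : ∃ e', e ≠ e' ∧ ∀ y, (y ∉ ({a, b, d} : Finset ι) ∧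
              insert y {a, b, d} ∈ N.N i ↔ y = e ∨ y = e') := by
            rcases (hy e).1 ⟨he, heN⟩ with rfl | rfl
            · exact ⟨y', hne, hy⟩
            · exact ⟨y, hne.symm, fun z => (hy z).trans or_comm⟩
          rw [N.bd3_eq_of_pair i hY hee' he', N.o_eq_zero i hS] at hbd'
          obtain ⟨h1, h2⟩ := (he' e').2 (Or.inr rfl)
          have h4 : (insert e' {a, b, d} : Finset ι).card = 4 := by
            rw [Finset.card_insert_of_notMem h1, hσ3]
          have h3 : (insert e' {a, b, d} : Finset ι) ∉ X₁ := by
            intro hX1'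
            have := hfree _ hX1' (Finset.ssubset_iff_subset_ne.2 ⟨by simp, fun h => by
              rw [← h] at h4; omega⟩)
            rw [hτe] at this
            have hm : e' ∈ insert e ({a, b, d} : Finset ι) := this ▸ by simp
            rcases Finset.mem_insert.1 hm with h | h
            · exact hee' h.symm
            · exact h1 h
          rw [four_insert] at h2 h3 h4
          have := ih a b d e' h2 h3 h4
          rw [eq_neg_of_add_eq_zero_left hbd', abs_neg, this]
  refine key _ (N.N_collapses i) u v w x h (fun hd => ?_) hc
  have := (T.d_disk i).surface.card_le _ hd
  omega

/-- The part of a 3-chain on the tetrahedra of colour one. -/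
noncomputable def half (g : Finset ι → ZMod 2) (Y : ι → ι → ι → ι → ℤ) : ι → ι → ι → ι → ℤ :=
  fun u v w x => if g {u, v, w, x} = 1 then Y u v w x else 0

theorem half_mem {X : Faces ι} {Y : ι → ι → ι → ι → ℤ} (hY : IsChain3 X Y)
    (g : Finset ι → ZMod 2) : IsChain3 X (half g Y) := by
  refine ⟨fun u v w x => ?_, fun u v w x => ?_, fun u v w x => ?_, fun u v w x h => ?_⟩
  · have e : ({v, u, w, x} : Finset ι) = {u, v, w, x} := Finset.insert_comm _ _ _
    simp only [half, e]
    split_ifs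
    · exact hY.swap12 u v w x
    · simp
  · have e : ({u, w, v, x} : Finset ι) = {u, v, w, x} := by rw [Finset.insert_comm w]
    simp only [half, e]
    split_ifs
    · exact hY.swap23 u v w x
    · simp
  · have e : ({u, v, x, w} : Finset ι) = {u, v, w, x} := by rw [Finset.pair_comm x]
    simp only [half, e]
    split_ifs
    · exact hY.swap34 u v w x
    · simp
  · simp [half, hY.support u v w x h]

theorem cofaces_four_eq_singleton {a b d x : ι} (ht : ({a, b, d} : Finset ι).card = 3)
    (h : ∀ y, y ∉ ({a, b, d} : Finset ι) ∧ insert y {a, b, d} ∈ N.N i ↔ y = x) :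
    cofaces (N.N i) 4 {a, b, d} = {{a, b, d, x}} := by
  ext τ
  rw [mem_cofaces, Finset.mem_singleton]
  constructor
  · rintro ⟨hτ, hc, hs⟩
    obtain ⟨y, hy, rfl⟩ := exists_eq_insert_of_ssubset
      (Finset.ssubset_iff_subset_ne.2 ⟨hs, fun e => by rw [e] at ht; omega⟩) (by omega)
    rw [(h y).1 ⟨hy, hτ⟩, four_insert]
  · rintro rfl
    obtain ⟨h1, h2⟩ := (h x).2 rfl
    rw [← four_insert]
    exact ⟨h2, by rw [Finset.card_insert_of_notMem h1, ht], by simp⟩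

theorem cofaces_four_eq_pair {a b d x x' : ι} (ht : ({a, b, d} : Finset ι).card = 3)
    (h : ∀ y, y ∉ ({a, b, d} : Finset ι) ∧ insert y {a, b, d} ∈ N.N i ↔ y = x ∨ y = x') :
    cofaces (N.N i) 4 {a, b, d} = {{a, b, d, x}, {a, b, d, x'}} := by
  ext τ
  rw [mem_cofaces, Finset.mem_insert, Finset.mem_singleton]
  constructor
  · rintro ⟨hτ, hc, hs⟩
    obtain ⟨y, hy, rfl⟩ := exists_eq_insert_of_ssubset
      (Finset.ssubset_iff_subset_ne.2 ⟨hs, fun e => by rw [e] at ht; omega⟩) (by omega)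
    rcases (h y).1 ⟨hy, hτ⟩ with rfl | rfl
    · left; rw [four_insert]
    · right; rw [four_insert]
  · rintro (rfl | rfl)
    · obtain ⟨h1, h2⟩ := (h x).2 (Or.inl rfl)
      rw [← four_insert]
      exact ⟨h2, by rw [Finset.card_insert_of_notMem h1, ht], by simp⟩
    · obtain ⟨h1, h2⟩ := (h x').2 (Or.inr rfl)
      rw [← four_insert]
      exact ⟨h2, by rw [Finset.card_insert_of_notMem h1, ht], by simp⟩

theorem four_ne {a b d x x' : ι} (hx : x ∉ ({a, b, d} : Finset ι)) (hne : x ≠ x') :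
    ({a, b, d, x} : Finset ι) ≠ {a, b, d, x'} := by
  intro e
  rw [← four_insert a b d x, ← four_insert a b d x'] at e
  have hm : x ∈ insert x' ({a, b, d} : Finset ι) := e ▸ by simp
  rcases Finset.mem_insert.1 hm with h | h
  · exact hne h
  · exact hx h

theorem zmod_two_cases (a : ZMod 2) : a = 0 ∨ a = 1 := by
  revert a; decide

/-- The boundary of the black half of the neighbourhood, at a triangle. -/
theorem bd3_half {Y : ι → ι → ι → ι → ℤ} (hY : IsChain3 (N.N i) Y) (hbd : bd3 Y = N.o i)
    {g : Finset ι → ZMod 2}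
    (hg : ∀ t ∈ N.N i, t.card = 3 →
      (if t ∈ N.wall i then (1 : ZMod 2) else 0) = ∑ τ ∈ cofaces (N.N i) 4 t, g τ)
    {a b d : ι} (ht : ({a, b, d} : Finset ι).card = 3) :
    (({a, b, d} : Finset ι) ∈ N.S i →
      bd3 (half g Y) a b d = if ({a, b, d} : Finset ι) ∈ N.black i then N.o i a b d else 0) ∧
    (({a, b, d} : Finset ι) ∉ N.S i → ({a, b, d} : Finset ι) ∉ N.wall i →
      bd3 (half g Y) a b d = 0) ∧
    (({a, b, d} : Finset ι) ∈ T.d i → |bd3 (half g Y) a b d| = 1) := by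
  have hH := half_mem hY g
  have hbd' := congrFun (congrFun (congrFun hbd a) b) d
  rcases N.cofaces_four_cases i ht with ⟨hS, y, -, hy⟩ | ⟨hS, hy⟩ | ⟨hS, y, y', hne, hy⟩
  -- On the sphere only one tetrahedron is present, and it is coloured exactly when the triangle is
  -- black.
  · refine ⟨fun _ => ?_, fun h => absurd hS h, fun h => absurd hS (N.notMem_S_of_mem_d i h)⟩
    rw [N.bd3_eq_of_unique i hH hy]
    rw [N.bd3_eq_of_unique i hY hy] at hbd'
    have := hg _ (N.S_sub i hS) ht
    rw [N.cofaces_four_eq_singleton i ht hy, Finset.sum_singleton] at this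
    have hw : ({a, b, d} : Finset ι) ∈ N.wall i ↔ ({a, b, d} : Finset ι) ∈ N.black i := by
      constructor
      · rintro ((h | h) | h)
        · have := N.S_graph i _ ⟨hS, h⟩; omega
        · exact absurd hS (N.notMem_S_of_mem_d i h)
        · exact h.2
      · exact fun h => Or.inr ⟨hS, h⟩
    unfold half
    rw [← this, ← hbd']
    by_cases hb : ({a, b, d} : Finset ι) ∈ N.black i
    · rw [if_pos (hw.2 hb), if_pos rfl, if_pos hb]
    · rw [if_neg (fun h => hb (hw.1 h)), if_neg (by decide), if_neg hb]
  · have h0 : bd3 (half g Y) a b d = 0 := by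
      unfold bd3
      refine Finset.sum_eq_zero fun x _ => ?_
      by_contra hn
      exact hy x (N.apex_of_ne_zero i hH hn)
    refine ⟨fun h => absurd h hS, fun _ _ => h0, fun h => ?_⟩
    exfalso
    have := hg _ (N.d_sub i h).1 ht
    rw [if_pos (show ({a, b, d} : Finset ι) ∈ N.wall i from Or.inl (Or.inr h))] at this
    have hemp : cofaces (N.N i) 4 {a, b, d} = ∅ := by
      rw [Finset.eq_empty_iff_forall_notMem]
      intro τ hτ
      rw [mem_cofaces] at hτ
      obtain ⟨x, hx, rfl⟩ := exists_eq_insert_of_ssubset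
        (Finset.ssubset_iff_subset_ne.2 ⟨hτ.2.2, fun e => by rw [← e, ht] at hτ; omega⟩)
        (by omega)
      exact hy x ⟨hx, hτ.1⟩
    rw [hemp, Finset.sum_empty] at this
    exact absurd this (by decide)
  · obtain ⟨hy1, hy2⟩ := (hy y).2 (Or.inl rfl)
    obtain ⟨hy1', hy2'⟩ := (hy y').2 (Or.inr rfl)
    have htN : ({a, b, d} : Finset ι) ∈ N.N i :=
      (N.N_subcomplex i _ hy2).2 _ (by simp) (by simp)
    have := hg _ htN ht
    rw [N.cofaces_four_eq_pair i ht hy, Finset.sum_pair (four_ne hy1 hne)] at this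
    rw [N.bd3_eq_of_pair i hY hne hy, N.o_eq_zero i hS] at hbd'
    rw [N.bd3_eq_of_pair i hH hne hy]
    unfold half
    -- Off the wall both tetrahedra have the same colour and cancel as they do in the full chain. On
    -- the disk exactly one of them is coloured, so a single coefficient ±1 survives.
    refine ⟨fun h => absurd h hS, fun _ hw => ?_, fun hd => ?_⟩
    · rw [if_neg hw] at this
      have hgg : g {a, b, d, y} = g {a, b, d, y'} := by
        rw [← CharTwo.sub_eq_add] at this
        exact sub_eq_zero.1 this.symm
      rw [hgg]
      split_ifs
      · exact hbd'
      · rfl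
    · rw [if_pos (show ({a, b, d} : Finset ι) ∈ N.wall i from Or.inl (Or.inr hd))] at this
      have h1 : |Y a b d y| = 1 := by
        refine N.abs_filling i hY hbd ?_ ?_
        · rwa [← four_insert]
        · rw [← four_insert, Finset.card_insert_of_notMem hy1, ht]
      have h1' : |Y a b d y'| = 1 := by
        refine N.abs_filling i hY hbd ?_ ?_
        · rwa [← four_insert]
        · rw [← four_insert, Finset.card_insert_of_notMem hy1', ht]
      rcases zmod_two_cases (g {a, b, d, y}) with h | h <;>
        rcases zmod_two_cases (g {a, b, d, y'}) with h' | h' <;> rw [h, h'] at this ⊢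
      · exact absurd this (by decide)
      · simpa using h1'
      · simpa using h1
      · exact absurd this (by decide)

theorem bd2_restrict_eq_zero {o : ι → ι → ι → ℤ} {X Y : Faces ι} (ho : o ∈ Chain2 X)
    (hX : IsSubcomplex X) {u v : ι} (h : ({u, v} : Finset ι) ∉ X) : bd2 (restrict o Y) u v = 0 := by
  refine Finset.sum_eq_zero fun w _ => ?_
  unfold restrict
  split_ifs
  · exact ho.2.2 u v w fun h' => h (hX.pair_mem h')
  · rfl

/-- The colour changes only across the wall, so the boundary of the coloured half is the sum of its
parts on the three kinds of wall. The boundary of this identity is the homology between the sphere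
cycle and the disk. -/
theorem bd3_half_eq {Y : ι → ι → ι → ι → ℤ} (hY : IsChain3 (N.N i) Y) (hbd : bd3 Y = N.o i)
    {g : Finset ι → ZMod 2}
    (hg : ∀ t ∈ N.N i, t.card = 3 →
      (if t ∈ N.wall i then (1 : ZMod 2) else 0) = ∑ τ ∈ cofaces (N.N i) 4 t, g τ) :
    bd3 (half g Y) = restrict (N.o i) (N.black i) + restrict (bd3 (half g Y)) F.space +
      restrict (bd3 (half g Y)) (T.d i) := by
  have hH := bd3_mem_Chain2 (N.N_subcomplex i) (half_mem hY g)
  funext a b d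
  simp only [Pi.add_apply, restrict]
  by_cases ht : ({a, b, d} : Finset ι).card = 3
  · obtain ⟨h1, h2, -⟩ := N.bd3_half i hY hbd hg ht
    by_cases hS : ({a, b, d} : Finset ι) ∈ N.S i
    · have hF : ({a, b, d} : Finset ι) ∉ F.space := fun h => by
        have := N.S_graph i _ ⟨hS, h⟩; omega
      have hd : ({a, b, d} : Finset ι) ∉ T.d i := fun h => N.notMem_S_of_mem_d i h hS
      rw [if_neg hF, if_neg hd, h1 hS]
      simp
    · rw [N.o_eq_zero i hS]
      by_cases hF : ({a, b, d} : Finset ι) ∈ F.space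
      · have hd : ({a, b, d} : Finset ι) ∉ T.d i := fun h => by
          have := T.graph i _ ⟨h, hF⟩; omega
        rw [if_pos hF, if_neg hd]
        simp
      · by_cases hd : ({a, b, d} : Finset ι) ∈ T.d i
        · rw [if_neg hF, if_pos hd]
          simp
        · rw [if_neg hF, if_neg hd, h2 hS]
          · simp
          · rintro ((h | h) | h)
            · exact hF h
            · exact hd h
            · exact hS h.1
  · rw [Chain2_eq_zero_of_card_ne hH ht, Chain2_eq_zero_of_card_ne (N.orientation i).1 ht]
    simp

end SphereData

end

section

open scoped Classical

set_option linter.unusedSectionVars false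

variable {ι : Type} [Fintype ι] [DecidableEq ι]

/-! ### Orientations and chessboard colourings -/

theorem closeUp_ne {l : List ι} (hnd : l.Nodup) (hlen : 3 ≤ l.length) {a b : ι}
    (h : Consecutive (closeUp l) a b) : a ≠ b := by
  rintro rfl
  obtain ⟨f, -, -, hinj, -, hf⟩ := exists_periodic hnd hlen
  obtain ⟨k, hk1, hk2⟩ := (hf a a).1 (h.elim id id)
  have h3 : (k + 0) ≡ (k + 1) [MOD l.length] := (hinj k (k + 1)).1 (hk1.trans hk2.symm)
  have h5 := Nat.ModEq.add_left_cancel' k h3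
  have := Nat.le_of_dvd (by omega) ((Nat.modEq_iff_dvd' (by omega : 0 ≤ 1)).1 h5)
  omega

theorem zmod_two_flip {P : Prop} [Decidable P] {a b : ZMod 2}
    (h : (if P then (1 : ZMod 2) else 0) = a + b) : (a = 1 ↔ b = 1) ↔ ¬ P := by
  by_cases hP : P
  · rw [if_pos hP] at h
    simp only [hP, not_true_eq_false, iff_false]
    revert a b; decide
  · rw [if_neg hP] at h
    simp only [hP, not_false_eq_true, iff_true]
    revert a b; decide

theorem linkAdj_iff_card {X : Faces ι} {u v w : ι} :
    LinkAdj X u v w ↔ ({u, v, w} : Finset ι) ∈ X ∧ ({u, v, w} : Finset ι).card = 3 := Iff.rfl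

/-- Two triangles with a common edge. -/
theorem exists_common_edge {t t' : Finset ι} (hc : t.card = 3) (hc' : t'.card = 3)
    (h : (t ∩ t').card = 2) :
    ∃ u v p q, p ≠ q ∧ t = {u, v, p} ∧ t' = {u, v, q} ∧ t ∩ t' = {u, v} := by
  obtain ⟨u, v, huv, he⟩ := Finset.card_eq_two.1 h
  obtain ⟨p, hp⟩ := eq_triple_of_mem hc huv (he ▸ Finset.inter_subset_left)
  obtain ⟨q, hq⟩ := eq_triple_of_mem hc' huv (he ▸ Finset.inter_subset_right)
  refine ⟨u, v, p, q, ?_, hp, hq, he⟩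
  rintro rfl
  rw [hp, hq, Finset.inter_self, ← hp, hc] at h
  omega

theorem inter_of_common_edge {u v p q : ι} (hp : ({u, v, p} : Finset ι).card = 3)
    (hq : ({u, v, q} : Finset ι).card = 3) (hpq : p ≠ q) :
    ({u, v, p} : Finset ι) ∩ {u, v, q} = {u, v} := by
  obtain ⟨h1, h2, h3⟩ := triple_ne hp
  obtain ⟨h4, h5, h6⟩ := triple_ne hq
  ext a
  simp only [Finset.mem_inter, Finset.mem_insert, Finset.mem_singleton]
  constructor
  · rintro ⟨h, h'⟩
    rcases h with h | h | rfl
    · exact Or.inl h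
    · exact Or.inr h
    · rcases h' with h' | h' | h'
      · exact Or.inl h'
      · exact Or.inr h'
      · exact absurd h' hpq
  · tauto

theorem bd2_eq_add {X : Faces ι} (hX : IsSurface X) {A : ι → ι → ι → ℤ} (hA : A ∈ Chain2 X)
    {u v p q : ι} (hp : LinkAdj X u v p) (hq : LinkAdj X u v q) (hpq : p ≠ q) :
    bd2 A u v = A u v p + A u v q := by
  rw [bd2_apply, ← Finset.sum_pair hpq]
  symm
  refine Finset.sum_subset (Finset.subset_univ _) fun y _ hy => ?_
  simp only [Finset.mem_insert, Finset.mem_singleton, not_or] at hy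
  by_contra hne
  have hy' : LinkAdj X u v y := by
    constructor
    · by_contra h
      exact hne (hA.2.2 _ _ _ h)
    · by_contra h
      exact hne (Chain2_eq_zero_of_card_ne hA h)
  rcases hX.third hp hq hy' with h | h | h
  · exact hpq h
  · exact hy.1 h.symm
  · exact hy.2 h.symm

theorem notMem_bdry_of_two {X : Faces ι} {u v p q : ι} (hp : LinkAdj X u v p)
    (hq : LinkAdj X u v q) (hpq : p ≠ q) : ({u, v} : Finset ι) ∉ bdry X := by
  obtain ⟨h1, h2, h3⟩ := triple_ne hp.2
  rw [mem_bdry_of_card (Finset.card_pair h1)]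
  rintro ⟨-, t, -, ht⟩
  have e1 := ht _ ⟨hp.1, hp.2, by intro a; simp; tauto⟩
  have e2 := ht _ ⟨hq.1, hq.2, by intro a; simp; tauto⟩
  have hm : p ∈ ({u, v, q} : Finset ι) := by rw [e2, ← e1]; simp
  simp only [Finset.mem_insert, Finset.mem_singleton] at hm
  rcases hm with h | h | h
  · exact h2 h.symm
  · exact h3 h.symm
  · exact hpq h

/-- Two fundamental chains that agree up to a global sign across every edge agree up to sign. -/
theorem eq_or_eq_neg_of_adjacent {X : Faces ι} (hX : IsSurface X)
    (hconn : ∀ a b, ({a} : Finset ι) ∈ X → ({b} : Finset ι) ∈ X → Linked X a b)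
    {A B : ι → ι → ι → ℤ} (hA : A ∈ Chain2 X) (hB : B ∈ Chain2 X)
    (hA1 : ∀ u v w, LinkAdj X u v w → |A u v w| = 1)
    (hB1 : ∀ u v w, LinkAdj X u v w → |B u v w| = 1)
    (hadj : ∀ u v p q, p ≠ q → LinkAdj X u v p → LinkAdj X u v q →
      (A u v p = B u v p ↔ A u v q = B u v q)) : A = B ∨ A = -B := by
  have hD : A - B ∈ Chain2 X := sub_mem hA hB
  have hind : ∀ {u v w a b d : ι}, ({u, v, w} : Finset ι).card = 3 →
      ({u, v, w} : Finset ι) = {a, b, d} → (A u v w = B u v w ↔ A a b d = B a b d) := by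
    intro u v w a b d hc he
    have := abs_alternating_three hD.1 hD.2.1 hc he
    simp only [Pi.sub_apply] at this
    rw [← sub_eq_zero, ← abs_eq_zero, this, abs_eq_zero, sub_eq_zero]
  -- Whether the two chains agree on a triangle does not depend on the ordering of its vertices and
  -- does not change across edges, so it is constant on the connected surface.
  have hconst : ∀ t t', t ∈ X → t' ∈ X → t.card = 3 → t'.card = 3 → _ := fun t t' =>
    hX.constant_of_adjacent (t := t) (t' := t')
    (fun t : Finset ι => ∀ u v w, ({u, v, w} : Finset ι) = t → A u v w = B u v w) hconn (by
      intro t ht t' ht' hc hc' hcard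
      obtain ⟨u, v, p, q, hpq, rfl, rfl, -⟩ := exists_common_edge hc hc' hcard
      have key := hadj u v p q hpq ⟨ht, hc⟩ ⟨ht', hc'⟩
      refine propext ⟨fun h a b d he => ?_, fun h a b d he => ?_⟩
      · exact (hind hc' he.symm).1 (key.1 (h u v p rfl))
      · exact (hind hc he.symm).1 (key.2 (h u v q rfl)))
  by_cases hall : ∀ u v w, LinkAdj X u v w → A u v w = B u v w
  · left
    funext u v w
    by_cases h : LinkAdj X u v w
    · exact hall u v w h
    · rw [linkAdj_iff_card, not_and_or] at h
      rcases h with h | h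
      · rw [hA.2.2 _ _ _ h, hB.2.2 _ _ _ h]
      · rw [Chain2_eq_zero_of_card_ne hA h, Chain2_eq_zero_of_card_ne hB h]
  · right
    push Not at hall
    obtain ⟨a, b, d, habd, hne⟩ := hall
    funext u v w
    by_cases h : LinkAdj X u v w
    · have hne' : A u v w ≠ B u v w := fun heq => by
        have := (hconst _ _ h.1 habd.1 h.2 habd.2).mp
          (fun u' v' w' he => (hind h.2 he.symm).1 heq)
        exact hne (this a b d rfl)
      have h1 := hA1 u v w h
      have h2 := hB1 u v w h
      rw [Pi.neg_apply, Pi.neg_apply, Pi.neg_apply]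
      rcases abs_eq_abs.1 (h1.trans h2.symm) with h' | h'
      · exact absurd h' hne'
      · exact h'
    · rw [linkAdj_iff_card, not_and_or] at h
      rw [Pi.neg_apply, Pi.neg_apply, Pi.neg_apply]
      rcases h with h | h
      · rw [hA.2.2 _ _ _ h, hB.2.2 _ _ _ h]; rfl
      · rw [Chain2_eq_zero_of_card_ne hA h, Chain2_eq_zero_of_card_ne hB h]; rfl

/-- The fundamental chain of a surface whose white faces have been turned over. -/
noncomputable def disoriented (o : ι → ι → ι → ℤ) (black : Faces ι) : ι → ι → ι → ℤ :=
  restrict o black - restrict o blackᶜ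

theorem disoriented_apply (o : ι → ι → ι → ℤ) (black : Faces ι) (u v w : ι) :
    disoriented o black u v w = if ({u, v, w} : Finset ι) ∈ black then o u v w else -o u v w := by
  simp only [disoriented, Pi.sub_apply, restrict, Set.mem_compl_iff]
  split_ifs <;> simp

theorem disoriented_mem {X : Faces ι} {o : ι → ι → ι → ℤ} (ho : o ∈ Chain2 X) (black : Faces ι) :
    disoriented o black ∈ Chain2 X :=
  sub_mem (Chain2_mono Set.inter_subset_left (restrict_mem ho _))
    (Chain2_mono Set.inter_subset_left (restrict_mem ho _))

/-- Coherent orientation makes adjacent coefficients opposite with respect to the common edge.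
Crossing `Γ` changes the colour, and turning over the white faces then makes them equal. -/
theorem disoriented_adjacent {X Γ black : Faces ι} (hX : IsSurface X) {o : ι → ι → ι → ℤ}
    (ho : IsOrientation X o) (hb : IsChessboard X Γ black) {u v p q : ι}
    (hp : LinkAdj X u v p) (hq : LinkAdj X u v q) (hpq : p ≠ q) :
    disoriented o black u v q =
      if ({u, v} : Finset ι) ∈ Γ then disoriented o black u v p
      else - disoriented o black u v p := by
  have h0 := ho.2.2 u v (notMem_bdry_of_two hp hq hpq)
  rw [bd2_eq_add hX ho.1 hp hq hpq] at h0
  have hcol := hb _ hp.1 _ hq.1 hp.2 hq.2 (by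
    rw [inter_of_common_edge hp.2 hq.2 hpq, Finset.card_pair (triple_ne hp.2).1])
  rw [inter_of_common_edge hp.2 hq.2 hpq] at hcol
  rw [disoriented_apply, disoriented_apply]
  by_cases h1 : ({u, v, p} : Finset ι) ∈ black <;> by_cases h2 : ({u, v, q} : Finset ι) ∈ black <;>
    by_cases h3 : ({u, v} : Finset ι) ∈ Γ <;> simp only [h1, h2, h3, if_true, if_false] at hcol ⊢
  all_goals first | omega | (exfalso; tauto)

/-- The boundary of the black faces lies on the graph. -/
theorem bd2_black_mem {X Γ black : Faces ι} (hX : IsSurface X) (hcl : bdry X = ∅)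
    {o : ι → ι → ι → ℤ} (ho : IsOrientation X o) (hb : IsChessboard X Γ black) :
    bd2 (restrict o black) ∈ Chain1 (X ∩ Γ) := by
  have hmem : restrict o black ∈ Chain2 X := Chain2_mono Set.inter_subset_left (restrict_mem ho.1 _)
  have h1 := bd2_mem_Chain1 hX.subcomplex hmem
  refine ⟨h1.1, fun u v huv => ?_⟩
  by_cases hXe : ({u, v} : Finset ι) ∈ X
  swap
  · exact h1.2 u v hXe
  have hΓ : ({u, v} : Finset ι) ∉ Γ := fun h => huv ⟨hXe, h⟩
  by_cases hne : u = v
  · subst hne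
    exact antisymm_self h1.1 u
  have hc := hX.cofaces_card _ (Finset.card_pair hne)
  rw [if_pos hXe, hcl, if_neg (Set.notMem_empty _)] at hc
  obtain ⟨t, t', htt, he⟩ := Finset.card_eq_two.1 hc
  have ht : t ∈ cofaces X 3 {u, v} := by rw [he]; simp
  have ht' : t' ∈ cofaces X 3 {u, v} := by rw [he]; simp
  rw [mem_cofaces] at ht ht'
  obtain ⟨p, rfl⟩ := eq_triple_of_mem ht.2.1 hne ht.2.2
  obtain ⟨q, rfl⟩ := eq_triple_of_mem ht'.2.1 hne ht'.2.2
  have hp : LinkAdj X u v p := ⟨ht.1, ht.2.1⟩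
  have hq : LinkAdj X u v q := ⟨ht'.1, ht'.2.1⟩
  have hpq : p ≠ q := fun h => htt (h ▸ rfl)
  have h0 := ho.2.2 u v (notMem_bdry_of_two hp hq hpq)
  rw [bd2_eq_add hX ho.1 hp hq hpq] at h0
  have hcol := hb _ hp.1 _ hq.1 hp.2 hq.2 (by
    rw [inter_of_common_edge hp.2 hq.2 hpq, Finset.card_pair (triple_ne hp.2).1])
  rw [inter_of_common_edge hp.2 hq.2 hpq] at hcol
  -- Off the graph both triangles have the same colour: either both are dropped, or they cancel
  -- because the surface is oriented.
  have hsame := hcol.2 hΓ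
  rw [bd2_eq_add hX hmem hp hq hpq]
  unfold restrict
  by_cases h : ({u, v, p} : Finset ι) ∈ black
  · rw [if_pos h, if_pos (hsame.1 h), h0]
  · rw [if_neg h, if_neg fun h' => h (hsame.2 h'), add_zero]

/-- Edges with both ends on `A` are counted once in each direction and cancel, so the condition on
the far end may be dropped. -/
theorem flow_eq_sum {A : List ι} {X : Faces ι} {z : ι → ι → ℤ} (hz : ∀ u v, z u v = - z v u) :
    flow A X z = ∑ u, ∑ w, if u ∈ A ∧ ({u, w} : Finset ι) ∈ X then z u w else 0 := by
  have hsplit : ∀ u w, (if u ∈ A ∧ ({u, w} : Finset ι) ∈ X then z u w else 0) =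
      (if u ∈ A ∧ w ∉ A ∧ ({u, w} : Finset ι) ∈ X then z u w else 0) +
      (if u ∈ A ∧ w ∈ A ∧ ({u, w} : Finset ι) ∈ X then z u w else 0) := by
    intro u w
    by_cases h1 : u ∈ A <;> by_cases h2 : w ∈ A <;> by_cases h3 : ({u, w} : Finset ι) ∈ X <;>
      simp [h1, h2, h3]
  simp only [hsplit, Finset.sum_add_distrib]
  have h0 : ∑ u, ∑ w, (if u ∈ A ∧ w ∈ A ∧ ({u, w} : Finset ι) ∈ X then z u w else 0) = 0 := by
    have hs : ∑ u, ∑ w, (if u ∈ A ∧ w ∈ A ∧ ({u, w} : Finset ι) ∈ X then z u w else 0) =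
        - ∑ u, ∑ w, (if u ∈ A ∧ w ∈ A ∧ ({u, w} : Finset ι) ∈ X then z u w else 0) := by
      conv_lhs => rw [Finset.sum_comm]
      simp only [← Finset.sum_neg_distrib]
      refine Finset.sum_congr rfl fun u _ => Finset.sum_congr rfl fun w _ => ?_
      rw [Finset.pair_comm w u, if_congr (show _ ↔ u ∈ A ∧ w ∈ A ∧ ({u, w} : Finset ι) ∈ X by tauto)
        rfl rfl, hz w u]
      split_ifs <;> simp
    omega
  rw [h0, add_zero]
  rfl

/-! ### Comparison of the sphere cycle with the disoriented boundary of the 2-handle -/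

namespace SphereData

variable {K : Triangulation ι} {Z J D : Type} {F : RibbonSurface K Z J}
  {T : TwoHandles F D} (N : SphereData T) (i : D)

/-- The black half of the neighbourhood has the same boundary sign on both sides of an edge along
which the disk crosses the surface. -/
theorem bd3_half_cross {Y : ι → ι → ι → ι → ℤ} (hY : IsChain3 (N.N i) Y) (hbd : bd3 Y = N.o i)
    {g : Finset ι → ZMod 2}
    (hg : ∀ t ∈ N.N i, t.card = 3 →
      (if t ∈ N.wall i then (1 : ZMod 2) else 0) = ∑ τ ∈ cofaces (N.N i) 4 t, g τ)
    {u v p q : ι} (hp : LinkAdj (T.d i) u v p) (hq : LinkAdj (T.d i) u v q) (hpq : p ≠ q)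
    (hF : ({u, v} : Finset ι) ∈ F.space) :
    bd3 (half g Y) u v p = bd3 (half g Y) u v q := by
  have huv : u ≠ v := (triple_ne hp.2).1
  have hd : ({u, v} : Finset ι) ∈ T.d i := (d_subcomplex T i).pair_mem hp.1
  have heN : ({u, v} : Finset ι) ∈ N.N i \ N.S i := N.d_sub i hd
  -- General position provides the circle around the edge, on which the two sides `p', q'` of the
  -- disk separate the two sides `x, y` of the sheet of `F_r`.
  obtain ⟨p', q', x, y, hp', hq', hxy, l₁, l₂, l₃, l₄, l, hl, hnd, hs, hK⟩ :=
    T.cross i u v huv ⟨⟨hd, hF⟩, notMem_bdry_of_two hp hq hpq⟩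
  have hnot : ∀ a ∈ l, u ≠ a ∧ v ≠ a := fun a ha => by
    have := hs a ha
    simp only [Finset.mem_insert, Finset.mem_singleton, not_or] at this
    exact ⟨fun h => this.1 h.symm, fun h => this.2 h.symm⟩
  have hcard : ∀ a ∈ l, ({u, v, a} : Finset ι).card = 3 := fun a ha =>
    card_triple huv (hnot a ha).1 (hnot a ha).2
  have hpl : p' ∈ l := by rw [hl]; simp
  have hql : q' ∈ l := by rw [hl]; simp
  have hpq' : p' ≠ q' := by
    rintro rfl
    rw [hl] at hnd
    simp at hnd
  have hLp : LinkAdj (T.d i) u v p' := ⟨hp', hcard p' hpl⟩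
  have hLq : LinkAdj (T.d i) u v q' := ⟨hq', hcard q' hql⟩
  have htri : ∀ a ∈ l, ({u, v, a} : Finset ι) ∉ N.S i := fun a _ h =>
    heN.2 ((N.S_subcomplex i).pair_mem h)
  have hedge : ∀ a b, Consecutive (closeUp l) a b → a ∈ l ∧ b ∈ l ∧
      insert b ({u, v, a} : Finset ι) ∈ N.N i := by
    intro a b hab
    refine ⟨mem_closeUp.1 hab.left_mem, mem_closeUp.1 hab.right_mem, ?_⟩
    have := hK a b hab
    have e : ({u, v} : Finset ι) ∪ {a, b} = insert b {u, v, a} := by ext; simp; tauto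
    rw [e] at this
    exact N.N_open i _ heN _ this (by intro z; simp; tauto)
  have hlen : 3 ≤ l.length := by rw [hl]; simp; omega
  -- These four are the only wall triangles at the edge: it is inside the neighbourhood, away from
  -- the sphere.
  have hwall : ∀ b ∈ l, (({u, v, b} : Finset ι) ∈ N.wall i ↔ (b = p' ∨ b = x ∨ b = q' ∨ b = y)) := by
    intro b ha
    have hbn := hnot b ha
    have hFb : ({u, v, b} : Finset ι) ∈ F.space ↔ b = x ∨ b = y := by
      have h1 := Set.ext_iff.1 hxy {u, v, b}
      have hx : ∀ x, ({u, v, b} : Finset ι) = {u, v, x} ↔ b = x := by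
        intro x
        constructor
        · intro h
          have : b ∈ ({u, v, x} : Finset ι) := h ▸ by simp
          simp only [Finset.mem_insert, Finset.mem_singleton] at this
          rcases this with h | h | h
          · exact absurd h.symm hbn.1
          · exact absurd h.symm hbn.2
          · exact h
        · rintro rfl; rfl
      simp only [Set.mem_ofPred_eq, Set.mem_insert_iff, Set.mem_singleton_iff, hx] at h1
      rw [← h1]
      exact ⟨fun h => ⟨h, hcard b ha, by intro z; simp; tauto⟩, fun h => h.1⟩
    have hdb : ({u, v, b} : Finset ι) ∈ T.d i ↔ b = p' ∨ b = q' := by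
      constructor
      · intro h
        rcases (T.d_disk i).surface.third hLp hLq ⟨h, hcard b ha⟩ with h | h | h
        · exact absurd h hpq'
        · exact Or.inl h.symm
        · exact Or.inr h.symm
      · rintro (rfl | rfl) <;> assumption
    unfold wall
    simp only [Set.mem_union, hFb, hdb, Set.mem_inter_iff, htri b ha, false_and, or_false]
    tauto
  -- On the circle of tetrahedra around the edge the filling is a cycle, because its boundary
  -- vanishes off the sphere. The colouring changes exactly at the four wall triangles.
  have hmain := sum_eq_of_circle hl hnd (fun a b => Y u v a b) (fun a b => hY.swap34 u v a b)
    (by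
      intro a ha b b₁ b₂ hne h1 h2
      have hapex := N.apex_of_ne_zero i hY hne
      have hb : ∀ b', Consecutive (closeUp l) a b' → a ≠ b' → b' ∉ ({u, v, a} : Finset ι) := by
        intro b' hb' hab'
        have := hnot b' (hedge a b' hb').2.1
        simp only [Finset.mem_insert, Finset.mem_singleton, not_or]
        exact ⟨fun h => this.1 h.symm, fun h => this.2 h.symm, fun h => hab' h.symm⟩
      have hself : ∀ b', Consecutive (closeUp l) a b' → a ≠ b' := fun b' => closeUp_ne hnd hlen
      rcases K.apex_eq (hcard a ha) hapex.1 (hb b₁ h1 (hself b₁ h1)) (hb b₂ h2 (hself b₂ h2))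
        (N.N_sub i hapex.2) (N.N_sub i (hedge a b₁ h1).2.2) (N.N_sub i (hedge a b₂ h2).2.2)
        with h | h | h
      · exact Or.inr (Or.inl h)
      · exact Or.inr (Or.inr h)
      · exact Or.inl h)
    (by
      intro a ha
      have := congrFun (congrFun (congrFun hbd u) v) a
      rw [N.o_eq_zero i (htri a ha)] at this
      exact this)
    (fun a b => g {u, v, a, b} = 1)
    (by
      intro a b h
      have e : ({u, v, b, a} : Finset ι) = {u, v, a, b} := by rw [Finset.pair_comm b]
      rw [e]; exact h)
    (by
      intro a b d had hab hbd'
      obtain ⟨ha, hb, hNab⟩ := hedge b a (Or.inr hab)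
      obtain ⟨-, hdl, hNbd⟩ := hedge b d (Or.inl hbd')
      rw [four_insert] at hNab hNbd
      have hne : ∀ a b, [a, b] <:+: closeUp l → a ≠ b := fun a b h => closeUp_ne hnd hlen (Or.inl h)
      have hab' := hne a b hab
      have hbd'' := hne b d hbd'
      have hna := hnot a hb
      have hnd' := hnot d hdl
      have hcof : cofaces (N.N i) 4 {u, v, b} = {{u, v, b, a}, {u, v, b, d}} := by
        refine N.cofaces_four_eq_pair i (hcard b ha) fun z => ⟨?_, ?_⟩
        · rintro ⟨h1, h2⟩
          have hna' : a ∉ ({u, v, b} : Finset ι) := by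
            simp only [Finset.mem_insert, Finset.mem_singleton, not_or]
            exact ⟨fun h => hna.1 h.symm, fun h => hna.2 h.symm, hab'⟩
          have hnd'' : d ∉ ({u, v, b} : Finset ι) := by
            simp only [Finset.mem_insert, Finset.mem_singleton, not_or]
            exact ⟨fun h => hnd'.1 h.symm, fun h => hnd'.2 h.symm, fun h => hbd'' h.symm⟩
          rcases K.apex_eq (hcard b ha) h1 hna' hnd'' (N.N_sub i h2)
            (N.N_sub i (by rw [four_insert]; exact hNab))
            (N.N_sub i (by rw [four_insert]; exact hNbd)) with h | h | h
          · exact Or.inl h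
          · exact Or.inr h
          · exact absurd h had
        · rintro (rfl | rfl)
          · refine ⟨?_, by rw [four_insert]; exact hNab⟩
            simp only [Finset.mem_insert, Finset.mem_singleton, not_or]
            exact ⟨fun h => hna.1 h.symm, fun h => hna.2 h.symm, hab'⟩
          · refine ⟨?_, by rw [four_insert]; exact hNbd⟩
            simp only [Finset.mem_insert, Finset.mem_singleton, not_or]
            exact ⟨fun h => hnd'.1 h.symm, fun h => hnd'.2 h.symm, fun h => hbd'' h.symm⟩
      have hbN : ({u, v, b} : Finset ι) ∈ N.N i :=
        (N.N_subcomplex i _ hNab).2 _ (by intro z; simp; tauto) (by simp)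
      have hsum := hg _ hbN (hcard b ha)
      have hna' : a ∉ ({u, v, b} : Finset ι) := by
        simp only [Finset.mem_insert, Finset.mem_singleton, not_or]
        exact ⟨fun h => hna.1 h.symm, fun h => hna.2 h.symm, hab'⟩
      rw [hcof, Finset.sum_pair (four_ne hna' had)] at hsum
      have e : ({u, v, a, b} : Finset ι) = {u, v, b, a} := by rw [Finset.pair_comm a]
      rw [e, ← hwall b ha]
      exact zmod_two_flip hsum)
  have hmain' : bd3 (half g Y) u v p' = bd3 (half g Y) u v q' := by
    unfold bd3 half
    refine (Finset.sum_congr rfl fun b _ => ?_).trans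
      (hmain.trans (Finset.sum_congr rfl fun b _ => ?_)) <;> split_ifs <;> rfl
  -- An edge of the disk has only two triangles, so the given apexes are those found on the circle,
  -- in some order.
  rcases (T.d_disk i).surface.third hp hLp hLq with h | h | h
  · subst h
    rcases (T.d_disk i).surface.third hq hLp hLq with h | h | h
    · exact absurd h.symm hpq
    · subst h; exact hmain'
    · exact absurd h hpq'
  · subst h
    rcases (T.d_disk i).surface.third hq hLp hLq with h | h | h
    · subst h; exact hmain'.symm
    · exact absurd h.symm hpq
    · exact absurd h hpq'
  · exact absurd h hpq'

/-- The cycle on the sphere around a 2-handle is homologous in `F_r`, up to sign, to the disoriented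
boundary of the 2-handle. -/
theorem exists_b_eq [Fintype Z] [Fintype J] (O : Disorientation T) :
    ∃ s : ℤˣ, ∃ φ ∈ Chain2 F.space, N.b i = (s : ℤ) • O.bflat i + bd2 φ := by
  obtain ⟨g, hg⟩ := N.exists_tetra_colouring i
  obtain ⟨Y, hY, hbd⟩ := N.exists_filling i
  have hH := bd3_mem_Chain2 (N.N_subcomplex i) (half_mem hY g)
  set C := bd3 (half g Y) with hC
  have hdec := N.bd3_half_eq i hY hbd hg
  rw [← hC] at hdec
  have hψ : restrict C (T.d i) ∈ Chain2 (T.d i) :=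
    Chain2_mono Set.inter_subset_right (restrict_mem hH _)
  have hφ : restrict C F.space ∈ Chain2 F.space :=
    Chain2_mono Set.inter_subset_right (restrict_mem hH _)
  have h0 : bd2 C = 0 := bd2_bd3 (half_mem hY g)
  have hval : ∀ u v w, ({u, v, w} : Finset ι) ∈ T.d i → restrict C (T.d i) u v w = C u v w :=
    fun u v w h => if_pos h
  -- Both chains have coefficients ±1 and behave in the same way across each edge, so on the
  -- connected disk they agree up to one global sign.
  have hsign : restrict C (T.d i) = disoriented (O.o i) (O.black i) ∨
      restrict C (T.d i) = -disoriented (O.o i) (O.black i) := by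
    refine eq_or_eq_neg_of_adjacent (T.d_disk i).surface
      (fun a b ha hb => (T.d_disk i).linked ha hb) hψ (disoriented_mem (O.orientation i).1 _)
      ?_ ?_ ?_
    · intro u v w h
      rw [hval u v w h.1]
      exact (N.bd3_half i hY hbd hg h.2).2.2 h.1
    · intro u v w h
      rw [disoriented_apply]
      have := (O.orientation i).2.1 u v w h.1 h.2
      split_ifs
      · rcases this with h | h <;> rw [h] <;> rfl
      · rcases this with h | h <;> rw [h] <;> rfl
    · intro u v p q hpq hp hq
      rw [disoriented_adjacent (T.d_disk i).surface (O.orientation i) (O.chessboard i) hp hq hpq,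
        hval _ _ _ hp.1, hval _ _ _ hq.1]
      have hd : ({u, v} : Finset ι) ∈ T.d i := (d_subcomplex T i).pair_mem hp.1
      by_cases hF : ({u, v} : Finset ι) ∈ F.space
      · have h1 := N.bd3_half_cross i hY hbd hg hp hq hpq hF
        rw [← hC] at h1
        rw [if_pos ⟨hd, hF⟩, h1]
      -- Off `F_r` neither the sphere nor `F_r` reaches this edge, so the boundary of the disk part
      -- vanishes there by itself and the two coefficients are opposite.
      · rw [if_neg fun h => hF h.2]
        have h1 := congrFun (congrFun (congrArg bd2 hdec) u) v
        rw [h0, map_add, map_add, Pi.add_apply, Pi.add_apply, Pi.add_apply, Pi.add_apply,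
          bd2_restrict_eq_zero (N.orientation i).1 (N.S_subcomplex i) (N.notMem_S_of_mem_d i hd),
          (bd2_mem_Chain1 F.space_subcomplex hφ).2 u v hF,
          bd2_eq_add (T.d_disk i).surface hψ hp hq hpq, hval _ _ _ hp.1, hval _ _ _ hq.1,
          Pi.zero_apply, Pi.zero_apply] at h1
        constructor <;> intro h <;> omega
  have hb : O.bflat i = bd2 (disoriented (O.o i) (O.black i)) := rfl
  -- The boundary of a boundary vanishes; this already is the homology, up to the sign of the disk
  -- part.
  have hsum : N.b i + bd2 (restrict C F.space) + bd2 (restrict C (T.d i)) = 0 := by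
    rw [← h0]
    conv_rhs => rw [hdec, map_add, map_add]
    rfl
  rcases hsign with h | h
  · refine ⟨-1, -restrict C F.space, neg_mem hφ, ?_⟩
    rw [h, ← hb] at hsum
    rw [map_neg]
    simp only [Units.val_neg, Units.val_one, neg_smul, one_smul]
    linear_combination (exp := 1) hsum
  · refine ⟨1, -restrict C F.space, neg_mem hφ, ?_⟩
    rw [h, map_neg, ← hb] at hsum
    rw [map_neg]
    simp only [Units.val_one, one_smul]
    linear_combination (exp := 1) hsum

theorem b_mem : N.b i ∈ Chain1 (N.S i ∩ (N.S i ∩ F.space)) :=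
  bd2_black_mem (N.S_sphere i).surface (N.S_sphere i).closed (N.orientation i) (N.chessboard i)

theorem b_mem_Z1 : N.b i ∈ Z1 F.space := by
  refine ⟨Chain1_mono (fun s hs => hs.2.2) (N.b_mem i), ?_⟩
  have h := restrict_mem (N.orientation i).1 (N.black i)
  exact bd1_bd2 h.1 h.2.1

/-- At an edge of a ribbon arc two sheets meet, giving more than two triangles, whereas
transversality to the sphere allows a single sheet. So the sphere meets ribbon arcs in isolated
points only. -/
theorem notMem_arc_of_mem_S [Fintype Z] [Fintype J] {e : Finset ι} (he : e.card = 2)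
    (h : e ∈ N.S i ∩ F.space) (r : F.Ribbon) : e ∉ pathFaces (F.arc r) := by
  intro ha
  have h2 := F.two_lt_cofaces_card_arc he ha
  obtain ⟨t, t', -, -, hset⟩ := N.S_cross i e h he
  have hsub : cofaces F.space 3 e ⊆ {t, t'} := by
    intro s hs
    have := (Set.ext_iff.1 hset s).1 (mem_cofaces.1 hs)
    simpa using this
  have := (Finset.card_le_card hsub).trans Finset.card_le_two
  omega

/-- The cycle on the sphere around a 2-handle crosses the two sides of every ribbon singularity
equally often. -/
theorem flow_b [Fintype Z] [Fintype J] (r : F.Ribbon) :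
    flow (F.arc r) (F.before r) (N.b i) = flow (F.arc r) (F.after r) (N.b i) := by
  have hb := N.b_mem i
  rw [flow_eq_sum hb.1, flow_eq_sum hb.1]
  refine Finset.sum_congr rfl fun u _ => ?_
  by_cases hu : u ∈ F.arc r
  swap
  · simp [hu]
  simp only [hu, true_and]
  have huF : ({u} : Finset ι) ∈ F.space :=
    F.m_subset_space _ (F.A_sub_m _ _ (F.vertex_A.2 hu))
  by_cases hS : ({u} : Finset ι) ∈ N.S i
  swap
  · have : ∀ w, N.b i u w = 0 := fun w => hb.2 u w fun h => hS ((N.S_subcomplex i).left_mem h.1)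
    simp [this]
  -- Double points are by definition off the ribbon arcs, so only triple points contribute.
  rcases N.S_point i u ⟨hS, huF⟩ with h | h
  · exact absurd hu (h.1 r)
  obtain ⟨r', hr', -, -, p, q, x, y, hset, hp, hq, hx, hy, l₁, l₂, l₃, l₄, l, hl, hnd, hs, hl'⟩ := h
  obtain rfl := F.arc_eq hu hr'
  have hnb : ∀ w, N.b i u w ≠ 0 → w = p ∨ w = q ∨ w = x ∨ w = y := by
    intro w hw
    have hne : w ≠ u := fun h => hw (h ▸ antisymm_self hb.1 u)
    have hm : ({u, w} : Finset ι) ∈ N.S i ∩ F.space := by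
      by_contra h
      exact hw (hb.2 u w fun h' => h h'.2)
    have := (Set.ext_iff.1 hset w).1 ⟨hne, hm⟩
    simpa using this
  have hmem : ∀ w, w = p ∨ w = q ∨ w = x ∨ w = y →
      w ≠ u ∧ ({u, w} : Finset ι) ∈ N.S i ∩ F.space := fun w hw =>
    (Set.ext_iff.1 hset w).2 (by simpa using hw)
  have harc : ∀ w, w = p ∨ w = q ∨ w = x ∨ w = y → ({u, w} : Finset ι) ∉ pathFaces (F.arc r) :=
    fun w hw => N.notMem_arc_of_mem_S i (Finset.card_pair (hmem w hw).1.symm) (hmem w hw).2 r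
  have hbefore : ∀ w, ({u, w} : Finset ι) ∈ F.m (F.disk r) → ({u, w} : Finset ι) ∈ F.before r →
      ({u, w} : Finset ι) ∈ pathFaces (F.arc r) := by
    intro w h1 h2
    rcases F.mem_A_of_mem_R_m h2 h1 with ⟨h, -⟩ | ⟨h, -⟩
    · exact absurd hu (F.A_ne _ _ (mem_of_mem_pathFaces h (by simp)))
    · exact h
  have hafter : ∀ w, ({u, w} : Finset ι) ∈ F.m (F.disk r) → ({u, w} : Finset ι) ∈ F.after r →
      ({u, w} : Finset ι) ∈ pathFaces (F.arc r) := by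
    intro w h1 h2
    rcases F.mem_A_of_mem_R_m h2 h1 with ⟨h, -⟩ | ⟨h, -⟩
    · exact h
    · exact absurd (mem_of_mem_pathFaces h (by simp)) (F.A_ne _ _ hu)
  have hboth : ∀ w, ({u, w} : Finset ι) ∈ F.before r → ({u, w} : Finset ι) ∈ F.after r →
      ({u, w} : Finset ι) ∈ pathFaces (F.arc r) := fun w h1 h2 => by
    have h3 : ({u, w} : Finset ι) ∈ F.before r ∩ F.after r := ⟨h1, h2⟩
    rwa [F.R_next] at h3
  -- Of the four edges at the triple point only `p` runs into the rectangle before the arc. Any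
  -- other would lie in two pieces, hence along the arc.
  have e1 : (∑ w, if ({u, w} : Finset ι) ∈ F.before r then N.b i u w else 0) = N.b i u p := by
    rw [Finset.sum_eq_single p, if_pos hp]
    · intro w _ hw
      by_cases h : N.b i u w = 0
      · simp [h]
      rw [if_neg]
      intro hbw
      rcases hnb w h with rfl | rfl | rfl | rfl
      · exact hw rfl
      · exact harc w (by tauto) (hboth w hbw hq)
      · exact harc w (by tauto) (hbefore w hx hbw)
      · exact harc w (by tauto) (hbefore w hy hbw)
    · simp
  have e2 : (∑ w, if ({u, w} : Finset ι) ∈ F.after r then N.b i u w else 0) = N.b i u q := by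
    rw [Finset.sum_eq_single q, if_pos hq]
    · intro w _ hw
      by_cases h : N.b i u w = 0
      · simp [h]
      rw [if_neg]
      intro hbw
      rcases hnb w h with rfl | rfl | rfl | rfl
      · exact harc w (by tauto) (hboth w hp hbw)
      · exact hw rfl
      · exact harc w (by tauto) (hafter w hx hbw)
      · exact harc w (by tauto) (hafter w hy hbw)
    · simp
  rw [e1, e2]
  have hSs := (N.S_sphere i).surface
  have hnu : ∀ a ∈ l, u ≠ a := fun a ha h => hs a ha (by simp [h])
  have hlen : 3 ≤ l.length := by rw [hl]; simp; omega
  have hself : ∀ a b, Consecutive (closeUp l) a b → a ≠ b := fun a b => closeUp_ne hnd hlen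
  have hadj : ∀ a b, Consecutive (closeUp l) a b → LinkAdj (N.S i) u a b := by
    intro a b hab
    have h1 := hl' a b hab
    have e : ({u} : Finset ι) ∪ {a, b} = {u, a, b} := rfl
    rw [e] at h1
    exact ⟨h1, card_triple (hnu a (mem_closeUp.1 hab.left_mem)) (hnu b (mem_closeUp.1 hab.right_mem))
      (hself a b hab)⟩
  have ho := (N.orientation i).1
  -- Going around the triple point on the sphere, the faces alternate in colour, so the boundary of
  -- the black faces leaves along `p` and along the opposite edge `q` with the same coefficient.
  exact sum_eq_of_circle hl hnd (fun a b => N.o i u a b) (fun a b => ho.2.1 u a b)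
    (by
      intro a ha b b₁ b₂ hne h1 h2
      have hab : LinkAdj (N.S i) u a b := by
        constructor
        · by_contra h
          exact hne (ho.2.2 _ _ _ h)
        · by_contra h
          exact hne (Chain2_eq_zero_of_card_ne ho h)
      rcases hSs.third hab (hadj a b₁ h1) (hadj a b₂ h2) with h | h | h
      · exact Or.inr (Or.inl h)
      · exact Or.inr (Or.inr h)
      · exact Or.inl h)
    (fun a _ => congrFun (congrFun (N.bd2_o i) u) a)
    (fun a b => ({u, a, b} : Finset ι) ∈ N.black i)
    (fun a b h => by rw [Finset.pair_comm b]; exact h)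
    (by
      intro a b d had hab hbd
      have h1 := (hadj b a (Or.inr hab))
      have h2 := (hadj b d (Or.inl hbd))
      have hc := N.chessboard i _ h1.1 _ h2.1 h1.2 h2.2 (by
        rw [inter_of_common_edge h1.2 h2.2 had, Finset.card_pair (triple_ne h1.2).1])
      rw [inter_of_common_edge h1.2 h2.2 had] at hc
      have e : ({u, a, b} : Finset ι) = {u, b, a} := by rw [Finset.pair_comm a]
      rw [e, hc]
      refine not_congr ⟨fun h => ?_, fun h => (hmem b (by tauto)).2⟩
      have := (Set.ext_iff.1 hset b).1 ⟨(triple_ne h1.2).1.symm, h⟩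
      simp only [Set.mem_insert_iff, Set.mem_singleton_iff] at this
      tauto)

end SphereData

end

section

open scoped Classical

set_option linter.unusedSectionVars false

variable {ι : Type} [Fintype ι] [DecidableEq ι]

/-! ### The neighbourhoods of the ribbon singularities -/

namespace LocalCharts

variable {K : Triangulation ι} {Z J : Type} {F : RibbonSurface K Z J} (L : LocalCharts F)

/-- A vertex of the complement of the open balls around the ribbon singularities. -/
def Outside (a : ι) : Prop := ∀ r, ({a} : Finset ι) ∉ L.openNbhd r

theorem nbhd_eq {r r' : F.Ribbon} {t : Finset ι} (h : t ∈ L.nbhd r) (h' : t ∈ L.nbhd r') :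
    r = r' := by
  by_contra hne
  have : t ∈ L.nbhd r ∩ L.nbhd r' := ⟨h, h'⟩
  have e := L.disj r r' hne
  unfold nbhd at this
  rw [e] at this
  exact this

theorem M_sub_nbhd (r : F.Ribbon) : L.M r ⊆ L.nbhd r := fun _ h => Or.inl (Or.inl h)

theorem Qb_sub_nbhd (r : F.Ribbon) : L.Qb r ⊆ L.nbhd r := fun _ h => Or.inl (Or.inr h)

theorem Qa_sub_nbhd (r : F.Ribbon) : L.Qa r ⊆ L.nbhd r := fun _ h => Or.inr h

theorem arc_sub_M (r : F.Ribbon) : pathFaces (F.arc r) ⊆ L.M r := fun _ h => (L.arc_sub r h).1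

theorem Tb_sub (r : F.Ribbon) : pathFaces (L.Tb r) ⊆ L.Qb r := by
  rw [← L.Tb_frontier r]; exact Set.inter_subset_left

theorem Ta_sub (r : F.Ribbon) : pathFaces (L.Ta r) ⊆ L.Qa r := by
  rw [← L.Ta_frontier r]; exact Set.inter_subset_left

theorem nbhd_subcomplex (r : F.Ribbon) : IsSubcomplex (L.nbhd r) :=
  ((L.M_disk r).surface.subcomplex.union (L.Qb_disk r).surface.subcomplex).union
    (L.Qa_disk r).surface.subcomplex

theorem frontier_subcomplex (r : F.Ribbon) :
    IsSubcomplex (bdry (L.M r) ∪ pathFaces (L.Tb r) ∪ pathFaces (L.Ta r)) :=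
  (isSubcomplex_bdry.union (isSubcomplex_pathFaces _)).union (isSubcomplex_pathFaces _)

theorem nbhd_subset_space (r : F.Ribbon) : L.nbhd r ⊆ F.space := by
  rintro t ((h | h) | h)
  · exact F.m_subset_space _ (L.M_sub r h).1
  · exact F.R_subset_space _ _ ((L.Qb_sub r).2 h)
  · exact F.R_subset_space _ _ ((L.Qa_sub r).2 h)

theorem arc_mem_openNbhd {r : F.Ribbon} {a : ι} (h : a ∈ F.arc r) :
    ({a} : Finset ι) ∈ L.openNbhd r := by
  have ha : ({a} : Finset ι) ∈ pathFaces (F.arc r) := F.vertex_A.2 h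
  refine ⟨L.M_sub_nbhd r (L.arc_sub_M r ha), ?_⟩
  rintro ((hb | hb) | hb)
  · exact (L.arc_sub r ha).2 hb
  · exact (L.T_disj r).1 (mem_of_mem_pathFaces hb (by simp)) h
  · exact (L.T_disj r).2 (mem_of_mem_pathFaces hb (by simp)) h

/-- The parts of the neighbourhood of a ribbon singularity in the pieces of the surface. -/
theorem piece_cases {p : F.Piece} {r : F.Ribbon} {t : Finset ι} (hp : t ∈ F.pieceFaces p)
    (ht : t ∈ L.nbhd r) :
    (p = .inl (F.disk r) ∧ t ∈ L.M r) ∨ (p = .inr ⟨r.1, r.2.castSucc⟩ ∧ t ∈ L.Qb r) ∨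
      (p = .inr ⟨r.1, r.2.succ⟩ ∧ t ∈ L.Qa r) := by
  have key : ∀ r', t ∈ pathFaces (F.arc r') → r' = r := fun r' h =>
    L.nbhd_eq (L.M_sub_nbhd r' (L.arc_sub_M r' h)) ht
  -- The square is interior to its 0-handle, which excludes attaching arcs, and neighbourhoods of
  -- different singularities are disjoint. So the only arc in it is that of `r`.
  have hM : t ∈ L.M r → ∀ (j : J) (k : Fin (F.n j + 2)), t ∈ pathFaces (F.A j k) →
      F.z j k = F.disk r → (⟨j, k⟩ : Σ j, Fin (F.n j + 2)) = ⟨r.1, r.2.succ.castSucc⟩ := by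
    intro htM j k hk hz
    have hnb := (L.M_sub r htM).2
    rcases RibbonSurface.fin_cases_A k with rfl | ⟨r', rfl⟩ | rfl
    · exact absurd (hz ▸ F.attach_first j hk) hnb
    · obtain rfl := key ⟨j, r'⟩ hk
      rfl
    · exact absurd (hz ▸ F.attach_last j hk) hnb
  rcases ht with (htM | htb) | hta
  · rcases p with i | ⟨j, s⟩
    · left
      exact ⟨by rw [F.eq_of_mem_m hp (L.M_sub r htM).1], htM⟩
    · rcases F.mem_A_of_mem_R_m hp (L.M_sub r htM).1 with ⟨h, hz⟩ | ⟨h, hz⟩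
      · right; right
        have := hM htM j s.castSucc h hz
        obtain ⟨j', r⟩ := r
        obtain ⟨rfl, h2⟩ := Sigma.mk.inj_iff.1 this
        have h3 := Fin.castSucc_injective _ (eq_of_heq h2)
        subst h3
        exact ⟨rfl, (L.Qa_sub ⟨j, r⟩).1 h⟩
      · right; left
        have := hM htM j s.succ h hz
        obtain ⟨j', r⟩ := r
        obtain ⟨rfl, h2⟩ := Sigma.mk.inj_iff.1 this
        have h3 : s.succ = r.castSucc.succ := (eq_of_heq h2).trans (Fin.succ_castSucc r).symm
        have h4 := Fin.succ_injective _ h3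
        subst h4
        exact ⟨rfl, (L.Qb_sub ⟨j, r⟩).1 h⟩
  · have hbef := (L.Qb_sub r).2 htb
    rcases p with i | ⟨j, s⟩
    · left
      rcases F.mem_A_of_mem_R_m hbef hp with ⟨h, hz⟩ | ⟨h, hz⟩
      · have : t ∈ L.Qb r ∩ pathFaces (F.A r.1 r.2.castSucc.castSucc) := ⟨htb, h⟩
        rw [L.Qb_other r] at this
        exact absurd this (Set.notMem_empty _)
      · exact ⟨by rw [← hz]; rfl, L.arc_sub_M r h⟩
    · right
      rcases F.R_inter hp hbef with h | ⟨r', hr', ⟨-, h2⟩ | ⟨-, h2⟩⟩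
      · exact Or.inl ⟨by rw [h], htb⟩
      · obtain rfl := key r' hr'
        have := (Sigma.mk.inj_iff.1 h2).2
        have h3 := congrArg Fin.val (eq_of_heq this)
        simp at h3
      · obtain rfl := key r' hr'
        exact Or.inr ⟨by rw [h2], (L.Qa_sub r').1 hr'⟩
  · have haft := (L.Qa_sub r).2 hta
    rcases p with i | ⟨j, s⟩
    · left
      rcases F.mem_A_of_mem_R_m haft hp with ⟨h, hz⟩ | ⟨h, hz⟩
      · exact ⟨by rw [← hz], L.arc_sub_M r h⟩
      · have : t ∈ L.Qa r ∩ pathFaces (F.A r.1 r.2.succ.succ) := ⟨hta, h⟩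
        rw [L.Qa_other r] at this
        exact absurd this (Set.notMem_empty _)
    · right
      rcases F.R_inter hp haft with h | ⟨r', hr', ⟨h1, -⟩ | ⟨h1, -⟩⟩
      · exact Or.inr ⟨by rw [h], hta⟩
      · obtain rfl := key r' hr'
        rename_i h2
        exact Or.inl ⟨by rw [h1], (L.Qb_sub r').1 hr'⟩
      · obtain rfl := key r' hr'
        have := (Sigma.mk.inj_iff.1 h1).2
        have h3 := congrArg Fin.val (eq_of_heq this)
        simp at h3

/-- The open neighbourhoods are open in the surface. -/
theorem edge_mem_openNbhd {r : F.Ribbon} {u w : ι} (hu : ({u} : Finset ι) ∈ L.openNbhd r)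
    (hF : ({u, w} : Finset ι) ∈ F.space) : ({u, w} : Finset ι) ∈ L.openNbhd r := by
  by_cases huw : u = w
  · subst huw; simpa using hu
  obtain ⟨p, hp⟩ := F.mem_space.1 hF
  have hup := (F.pieceFaces_subcomplex p).left_mem hp
  refine ⟨?_, fun h => hu.2 ((L.frontier_subcomplex r).left_mem h)⟩
  -- In the 0-handle, an interior vertex of the square has all its edges in the square. In a strip,
  -- an edge leaving it would put `u` on the frontier arc.
  rcases L.piece_cases hup hu.1 with ⟨rfl, h⟩ | ⟨rfl, h⟩ | ⟨rfl, h⟩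
  · exact L.M_sub_nbhd r ((F.m_disk _).surface.edge_mem_of_notMem_bdry (L.M_disk r).surface
      (fun t ht => (L.M_sub r ht).1) h (fun hb => hu.2 (Or.inl (Or.inl hb))) huw hp)
  · by_contra hn
    have : ({u} : Finset ι) ∈ L.Qb r ∩ closure (F.before r \ L.Qb r) :=
      ⟨h, by simp, _, ⟨hp, fun hq => hn (L.Qb_sub_nbhd r hq)⟩, by simp⟩
    rw [L.Tb_frontier r] at this
    exact hu.2 (Or.inl (Or.inr this))
  · by_contra hn
    have : ({u} : Finset ι) ∈ L.Qa r ∩ closure (F.after r \ L.Qa r) :=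
      ⟨h, by simp, _, ⟨hp, fun hq => hn (L.Qa_sub_nbhd r hq)⟩, by simp⟩
    rw [L.Ta_frontier r] at this
    exact hu.2 (Or.inr this)

/-- The complement of the open neighbourhoods in a piece is connected. -/
theorem linked_outside (p : F.Piece) {a b : ι} (ha : ({a} : Finset ι) ∈ F.pieceFaces p)
    (hb : ({b} : Finset ι) ∈ F.pieceFaces p) (ha' : L.Outside a) (hb' : L.Outside b) :
    Linked (F.pieceFaces p \ ⋃ r, L.openNbhd r) a b := by
  -- The piece is connected, and the frontier of each removed region in it is connected: a whole
  -- circle in a 0-handle, one arc in a rectangle. Detours along the frontier avoid the open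
  -- neighbourhoods.
  refine linked_removing (κ := F.Ribbon) (X := F.pieceFaces p)
    (fun r => F.pieceFaces p ∩ L.nbhd r)
    (fun r => {a | ({a} : Finset ι) ∈ F.pieceFaces p ∩ L.nbhd r ∧ ({a} : Finset ι) ∉ L.openNbhd r})
    _ ?_ ?_ ?_ ?_ ?_ ((F.pieceFaces_disk p).linked ha hb) ?_ ?_
  · intro r
    have hfr : ∀ X : Faces ι, X ⊆ F.pieceFaces p → X ⊆ L.nbhd r →
        X ⊆ bdry (L.M r) ∪ pathFaces (L.Tb r) ∪ pathFaces (L.Ta r) →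
        X ⊆ F.pieceFaces p \ ⋃ r, L.openNbhd r := by
      intro X h1 h2 h3 t ht
      refine ⟨h1 ht, fun h => ?_⟩
      obtain ⟨r', hr'⟩ := Set.mem_iUnion.1 h
      obtain rfl := L.nbhd_eq (h2 ht) hr'.1
      exact hr'.2 (h3 ht)
    rintro a ⟨⟨hap, han⟩, hao⟩ b ⟨⟨hbp, hbn⟩, hbo⟩
    have haf : ({a} : Finset ι) ∈ bdry (L.M r) ∪ pathFaces (L.Tb r) ∪ pathFaces (L.Ta r) := by
      by_contra h; exact hao ⟨han, h⟩
    have hbf : ({b} : Finset ι) ∈ bdry (L.M r) ∪ pathFaces (L.Tb r) ∪ pathFaces (L.Ta r) := by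
      by_contra h; exact hbo ⟨hbn, h⟩
    -- the frontier in each kind of piece
    have hcase : (p = .inl (F.disk r) ∧ ∀ a, ({a} : Finset ι) ∈ F.pieceFaces p →
          ({a} : Finset ι) ∈ bdry (L.M r) ∪ pathFaces (L.Tb r) ∪ pathFaces (L.Ta r) →
          ({a} : Finset ι) ∈ bdry (L.M r)) ∨
        (p = .inr ⟨r.1, r.2.castSucc⟩ ∧ ∀ a, ({a} : Finset ι) ∈ F.pieceFaces p →
          ({a} : Finset ι) ∈ bdry (L.M r) ∪ pathFaces (L.Tb r) ∪ pathFaces (L.Ta r) →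
          ({a} : Finset ι) ∈ pathFaces (L.Tb r)) ∨
        (p = .inr ⟨r.1, r.2.succ⟩ ∧ ∀ a, ({a} : Finset ι) ∈ F.pieceFaces p →
          ({a} : Finset ι) ∈ bdry (L.M r) ∪ pathFaces (L.Tb r) ∪ pathFaces (L.Ta r) →
          ({a} : Finset ι) ∈ pathFaces (L.Ta r)) := by
      have hnot : ∀ a, ({a} : Finset ι) ∈
          bdry (L.M r) ∪ pathFaces (L.Tb r) ∪ pathFaces (L.Ta r) → a ∉ F.arc r := fun a h h' =>
        (L.arc_mem_openNbhd h').2 h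
      have hMb : ∀ t ∈ bdry (L.M r), t ∈ F.m (F.disk r) := fun t ht =>
        (L.M_sub r (bdry_subset (L.M_disk r).surface.subcomplex ht)).1
      have hTb : ∀ t ∈ pathFaces (L.Tb r), t ∈ F.before r := fun t ht =>
        (L.Qb_sub r).2 (L.Tb_sub r ht)
      have hTa : ∀ t ∈ pathFaces (L.Ta r), t ∈ F.after r := fun t ht =>
        (L.Qa_sub r).2 (L.Ta_sub r ht)
      have hMM : ∀ t ∈ bdry (L.M r), t ∈ L.M r := fun t ht =>
        bdry_subset (L.M_disk r).surface.subcomplex ht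
      have hvert : ∀ {a : ι} {r' : F.Ribbon}, ({a} : Finset ι) ∈ pathFaces (F.arc r') →
          ({a} : Finset ι) ∈ L.nbhd r → a ∈ F.arc r := by
        intro a r' h h'
        obtain rfl := L.nbhd_eq (L.M_sub_nbhd r' (L.arc_sub_M r' h)) h'
        exact F.vertex_A.1 h
      have hRR : (⟨r.1, r.2.castSucc⟩ : Σ j, Fin (F.n j + 1)) ≠ ⟨r.1, r.2.succ⟩ := fun h => by
        have h3 := congrArg Fin.val (eq_of_heq (Sigma.mk.inj_iff.1 h).2)
        simp at h3
      have hba : ∀ {a : ι}, ({a} : Finset ι) ∈ F.before r → ({a} : Finset ι) ∈ F.after r →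
          ({a} : Finset ι) ∈ L.nbhd r → a ∈ F.arc r := by
        intro a h1 h2 h3
        rcases F.R_inter h1 h2 with h | ⟨r', hr', -⟩
        · exact absurd h hRR
        · exact hvert hr' h3
      have hmR : ∀ {a : ι} {s : Fin (F.n r.1 + 1)}, ({a} : Finset ι) ∈ L.M r →
          ({a} : Finset ι) ∈ F.R r.1 s → a ∈ F.arc r := by
        intro a s h1 h2
        have hk : ∀ k, ({a} : Finset ι) ∈ pathFaces (F.A r.1 k) → F.z r.1 k = F.disk r →
            a ∈ F.arc r := by
          intro k h hz
          have hnb := (L.M_sub r h1).2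
          rcases RibbonSurface.fin_cases_A k with rfl | ⟨r', rfl⟩ | rfl
          · exact absurd (hz ▸ F.attach_first _ h) hnb
          · exact hvert (r' := ⟨r.1, r'⟩) h (L.M_sub_nbhd r h1)
          · exact absurd (hz ▸ F.attach_last _ h) hnb
        rcases F.mem_A_of_mem_R_m h2 (L.M_sub r h1).1 with ⟨h, hz⟩ | ⟨h, hz⟩
        · exact hk _ h hz
        · exact hk _ h hz
      rcases L.piece_cases hap han with ⟨rfl, -⟩ | ⟨rfl, -⟩ | ⟨rfl, -⟩
      · refine Or.inl ⟨rfl, fun a hp hf => ?_⟩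
        rcases id hf with (h | h) | h
        · exact h
        · rcases L.piece_cases hp (L.Qb_sub_nbhd r (L.Tb_sub r h)) with ⟨-, h'⟩ | ⟨h', -⟩ | ⟨h', -⟩
          · exact absurd (hmR h' (hTb _ h)) (hnot a hf)
          · cases h'
          · cases h'
        · rcases L.piece_cases hp (L.Qa_sub_nbhd r (L.Ta_sub r h)) with ⟨-, h'⟩ | ⟨h', -⟩ | ⟨h', -⟩
          · exact absurd (hmR h' (hTa _ h)) (hnot a hf)
          · cases h'
          · cases h'
      · refine Or.inr (Or.inl ⟨rfl, fun a hp hf => ?_⟩)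
        rcases id hf with (h | h) | h
        · exact absurd (hmR (hMM _ h) hp) (hnot a hf)
        · exact h
        · exact absurd (hba hp (hTa _ h) (L.Qa_sub_nbhd r (L.Ta_sub r h))) (hnot a hf)
      · refine Or.inr (Or.inr ⟨rfl, fun a hp hf => ?_⟩)
        rcases id hf with (h | h) | h
        · exact absurd (hmR (hMM _ h) hp) (hnot a hf)
        · exact absurd (hba (hTb _ h) hp (L.Qb_sub_nbhd r (L.Tb_sub r h))) (hnot a hf)
        · exact h
    rcases hcase with ⟨rfl, hcase⟩ | ⟨rfl, hcase⟩ | ⟨rfl, hcase⟩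
    · have hM := bdry_subset (L.M_disk r).surface.subcomplex
      refine Linked.mono (hfr (bdry (L.M r)) (fun t ht => (L.M_sub r (hM ht)).1)
        (fun t ht => L.M_sub_nbhd r (hM ht)) fun t ht => Or.inl (Or.inl ht)) ?_
      obtain ⟨l, -, -, hl⟩ := (L.M_disk r).circle
      have h1 := hcase a hap haf
      have h2 := hcase b hbp hbf
      rw [hl] at h1 h2 ⊢
      exact linked_pathFaces (mem_of_mem_pathFaces h1 (by simp)) (mem_of_mem_pathFaces h2 (by simp))
    · refine Linked.mono (hfr (pathFaces (L.Tb r)) (fun t ht => (L.Qb_sub r).2 (L.Tb_sub r ht))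
        (fun t ht => L.Qb_sub_nbhd r (L.Tb_sub r ht)) fun t ht => Or.inl (Or.inr ht)) ?_
      exact linked_pathFaces (mem_of_mem_pathFaces (hcase a hap haf) (by simp))
        (mem_of_mem_pathFaces (hcase b hbp hbf) (by simp))
    · refine Linked.mono (hfr (pathFaces (L.Ta r)) (fun t ht => (L.Qa_sub r).2 (L.Ta_sub r ht))
        (fun t ht => L.Qa_sub_nbhd r (L.Ta_sub r ht)) fun t ht => Or.inr ht) ?_
      exact linked_pathFaces (mem_of_mem_pathFaces (hcase a hap haf) (by simp))
        (mem_of_mem_pathFaces (hcase b hbp hbf) (by simp))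
  · rintro r s hs a ha
    exact ((F.pieceFaces_subcomplex p).inter (L.nbhd_subcomplex r)).vertex_mem hs ha
  · rintro r r' a h h'
    exact L.nbhd_eq h.2 h'.2
  · rintro r u w huw hn hw
    refine ⟨hw, fun h => hn ⟨huw, ?_⟩⟩
    have := L.edge_mem_openNbhd h (w := u) (by
      rw [Finset.pair_comm]; exact F.pieceFaces_subset p huw)
    rw [Finset.pair_comm] at this
    exact this.1
  · rintro u w huw hn
    refine ⟨huw, fun h => ?_⟩
    obtain ⟨r, hr⟩ := Set.mem_iUnion.1 h
    exact hn r ⟨huw, hr.1⟩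
  · exact fun r h => ⟨h, ha' r⟩
  · exact fun r h => ⟨h, hb' r⟩

end LocalCharts

end

section

open scoped Classical

set_option linter.unusedSectionVars false

variable {ι : Type} [Fintype ι] [DecidableEq ι]

/-! ### Flows through the handles -/

/-- For a chain inside `X`, what leaves `A` into `X` is measured by its boundary on `A`. This turns
flows into linear algebra with boundaries. -/
theorem flow_eq_neg_sum_bd1 {A : List ι} {X : Faces ι} {c : ι → ι → ℤ} (hc : c ∈ Chain1 X) :
    flow A X c = -∑ u, if u ∈ A then bd1 c u else 0 := by
  rw [flow_eq_sum hc.1, ← Finset.sum_neg_distrib]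
  refine Finset.sum_congr rfl fun u _ => ?_
  by_cases hu : u ∈ A
  · simp only [hu, true_and, if_true, bd1_apply, ← Finset.sum_neg_distrib]
    refine Finset.sum_congr rfl fun w _ => ?_
    rw [← hc.1 u w]
    split_ifs with h
    · rfl
    · exact (hc.2 u w h).symm
  · simp [hu]

theorem flow_eq_zero_of_forall {A : List ι} {X : Faces ι} {c : ι → ι → ℤ}
    (h : ∀ u w, u ∈ A → w ∉ A → ({u, w} : Finset ι) ∈ X → c u w = 0) : flow A X c = 0 := by
  refine Finset.sum_eq_zero fun u _ => Finset.sum_eq_zero fun w _ => ?_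
  split_ifs with h'
  · exact h u w h'.1 h'.2.1 h'.2.2
  · rfl

theorem flow_congr {A : List ι} {X : Faces ι} {c c' : ι → ι → ℤ}
    (h : ∀ u w, u ∈ A → w ∉ A → ({u, w} : Finset ι) ∈ X → c u w = c' u w) :
    flow A X c = flow A X c' := by
  rw [← sub_eq_zero, ← map_sub]
  exact flow_eq_zero_of_forall fun u w h1 h2 h3 => sub_eq_zero.2 (h u w h1 h2 h3)

/-- Each arc is connected, so total weight zero on each of the two arcs separately suffices. This is
used to move boundary points along attaching arcs. -/
theorem exists_chain_on_arcs {A A' : List ι} (hd : A.Disjoint A') {f : ι → ℤ}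
    (hf : ∀ v, v ∉ A → v ∉ A' → f v = 0) (h0 : (∑ u, if u ∈ A then f u else 0) = 0)
    (h0' : (∑ u, if u ∈ A' then f u else 0) = 0) :
    ∃ c ∈ Chain1 (pathFaces A ∪ pathFaces A'), bd1 c = f := by
  obtain ⟨c, hc, hbc⟩ := exists_chain_of_sum_eq_zero (X := pathFaces A) (S := {a | a ∈ A})
    (fun a ha b hb => linked_pathFaces ha hb) (fun u => if u ∈ A then f u else 0)
    (fun v hv => if_neg hv) h0
  obtain ⟨c', hc', hbc'⟩ := exists_chain_of_sum_eq_zero (X := pathFaces A') (S := {a | a ∈ A'})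
    (fun a ha b hb => linked_pathFaces ha hb) (fun u => if u ∈ A' then f u else 0)
    (fun v hv => if_neg hv) h0'
  refine ⟨c + c', add_mem (Chain1_mono Set.subset_union_left hc)
    (Chain1_mono Set.subset_union_right hc'), ?_⟩
  rw [map_add, hbc, hbc']
  funext v
  simp only [Pi.add_apply]
  by_cases h : v ∈ A
  · rw [if_pos h, if_neg fun h' => hd h h', add_zero]
  · by_cases h' : v ∈ A'
    · rw [if_neg h, if_pos h', zero_add]
    · rw [if_neg h, if_neg h', hf v h h', add_zero]

/-! ### Decomposing cycles into their parts on the handles -/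

namespace RibbonSurface

variable {K : Triangulation ι} {Z J : Type} (F : RibbonSurface K Z J)

theorem mem_A_of_two {j : J} {s : Fin (F.n j + 1)} {p : F.Piece} (hne : p ≠ .inr ⟨j, s⟩)
    {t : Finset ι} (h : t ∈ F.R j s) (h' : t ∈ F.pieceFaces p) :
    t ∈ pathFaces (F.A j s.castSucc) ∨ t ∈ pathFaces (F.A j s.succ) := by
  rcases p with i | ⟨j', s'⟩
  · rcases F.mem_A_of_mem_R_m h h' with h | h
    · exact Or.inl h.1
    · exact Or.inr h.1
  · rcases F.R_inter h h' with e | ⟨r, hr, ⟨e, -⟩ | ⟨-, e⟩⟩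
    · exact absurd (by rw [e]) hne
    · right
      obtain ⟨rfl, h2⟩ := Sigma.mk.inj_iff.1 e
      obtain rfl := eq_of_heq h2
      rw [Fin.succ_castSucc]
      exact hr
    · left
      obtain ⟨rfl, h2⟩ := Sigma.mk.inj_iff.1 e
      obtain rfl := eq_of_heq h2
      exact hr

/-- An edge of a rectangle with just one end on one of its arcs lies in no other piece. -/
theorem notMem_of_leaves {j : J} {s : Fin (F.n j + 1)} {k : Fin (F.n j + 2)}
    (hk : k = s.castSucc ∨ k = s.succ) {u w : ι} (hu : u ∈ F.A j k) (hw : w ∉ F.A j k) :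
    ({u, w} : Finset ι) ∉ pathFaces (F.A j s.castSucc) ∧
      ({u, w} : Finset ι) ∉ pathFaces (F.A j s.succ) := by
  constructor <;> intro h
  · have h1 := mem_of_mem_pathFaces h (u := u) (by simp)
    have h2 := mem_of_mem_pathFaces h (u := w) (by simp)
    rcases hk with rfl | rfl
    · exact hw h2
    · exact F.A_ne _ _ h1 hu
  · have h1 := mem_of_mem_pathFaces h (u := u) (by simp)
    have h2 := mem_of_mem_pathFaces h (u := w) (by simp)
    rcases hk with rfl | rfl
    · exact F.A_ne _ _ hu h1
    · exact hw h2

/-- Another piece meets this rectangle in its end arcs at most, whereas a flow counts edges having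
just one end on such an arc. -/
theorem flow_other {j : J} {s : Fin (F.n j + 1)} {k : Fin (F.n j + 2)}
    (hk : k = s.castSucc ∨ k = s.succ) {p : F.Piece} (hne : p ≠ .inr ⟨j, s⟩) {c : ι → ι → ℤ}
    (hc : c ∈ Chain1 (F.pieceFaces p)) : flow (F.A j k) (F.R j s) c = 0 := by
  refine flow_eq_zero_of_forall fun u w hu hw hR => hc.2 u w fun hp => ?_
  have := F.notMem_of_leaves hk hu hw
  rcases F.mem_A_of_two hne hR hp with h | h
  · exact this.1 h
  · exact this.2 h

/-- The simplices that are assigned to a piece: those on an arc belong to the 0-handle. -/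
def own : F.Piece → Faces ι
  | .inl i => F.m i
  | .inr q => F.R q.1 q.2 \ ⋃ i, F.m i

theorem own_subset (p : F.Piece) : F.own p ⊆ F.pieceFaces p := by
  rcases p with i | q
  · exact subset_rfl
  · exact Set.sdiff_subset

theorem own_unique {p p' : F.Piece} {t : Finset ι} (h : t ∈ F.own p) (h' : t ∈ F.own p') :
    p = p' := by
  by_contra hne
  have hA : ∀ {j : J} {k : Fin (F.n j + 2)}, t ∈ pathFaces (F.A j k) → t ∈ ⋃ i, F.m i :=
    fun h => Set.mem_iUnion.2 ⟨_, F.A_sub_m _ _ h⟩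
  rcases p with i | ⟨j, s⟩
  · rcases p' with i' | ⟨j', s'⟩
    · exact hne (by rw [F.eq_of_mem_m h h'])
    · exact h'.2 (Set.mem_iUnion.2 ⟨i, h⟩)
  · rcases F.mem_A_of_two (fun e => hne e.symm) h.1 (F.own_subset _ h') with h1 | h1
    · exact h.2 (hA h1)
    · exact h.2 (hA h1)

theorem exists_own {t : Finset ι} (h : t ∈ F.space) : ∃ p, t ∈ F.own p := by
  by_cases hm : t ∈ ⋃ i, F.m i
  · obtain ⟨i, hi⟩ := Set.mem_iUnion.1 hm
    exact ⟨.inl i, hi⟩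
  · obtain ⟨p, hp⟩ := F.mem_space.1 h
    rcases p with i | q
    · exact ⟨.inl i, hp⟩
    · exact ⟨.inr q, hp, hm⟩

theorem part_mem {c : ι → ι → ℤ} (hc : c ∈ Chain1 F.space) (p : F.Piece) :
    restrict1 (F.own p) c ∈ Chain1 (F.pieceFaces p) :=
  Chain1_mono (F.own_subset p) (restrict1_mem _ hc.1)

/-- Off the end arcs a vertex of the rectangle belongs to no other piece, so all edges of `c` at it
are kept. Hence the part of a cycle has its boundary on the two end arcs. -/
theorem bd1_part {c : ι → ι → ℤ} (hc : c ∈ Chain1 F.space) {j : J} {s : Fin (F.n j + 1)} {v : ι}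
    (h1 : v ∉ F.A j s.castSucc) (h2 : v ∉ F.A j s.succ) :
    bd1 (restrict1 (F.own (.inr ⟨j, s⟩)) c) v =
      if ({v} : Finset ι) ∈ F.R j s then bd1 c v else 0 := by
  split_ifs with hv
  · refine bd1_restrict1_of_forall fun u hu => ?_
    have hF : ({u, v} : Finset ι) ∈ F.space := by
      by_contra h; exact hu (hc.2 u v h)
    obtain ⟨p, hp⟩ := F.exists_own hF
    by_cases hne : p = .inr ⟨j, s⟩
    · exact hne ▸ hp
    · have hvp := (F.pieceFaces_subcomplex p).right_mem (F.own_subset p hp)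
      rcases F.mem_A_of_two hne hv hvp with h | h
      · exact absurd (F.vertex_A.1 h) h1
      · exact absurd (F.vertex_A.1 h) h2
  · exact Chain1_eq_zero_of_forall (F.part_mem hc (.inr ⟨j, s⟩)) fun u hu =>
      hv ((F.R_subcomplex j s).right_mem hu)

theorem flow_part {j : J} {s : Fin (F.n j + 1)} {k : Fin (F.n j + 2)}
    (hk : k = s.castSucc ∨ k = s.succ) (c : ι → ι → ℤ) :
    flow (F.A j k) (F.R j s) (restrict1 (F.own (.inr ⟨j, s⟩)) c) =
      flow (F.A j k) (F.R j s) c := by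
  refine flow_congr fun u w hu hw hR => ?_
  rw [restrict1_apply, if_pos]
  refine ⟨hR, fun h => ?_⟩
  obtain ⟨i, hi⟩ := Set.mem_iUnion.1 h
  have := F.notMem_of_leaves hk hu hw
  rcases F.mem_A_of_two (p := .inl i) (by simp) hR hi with h | h
  · exact this.1 h
  · exact this.2 h

/-- A cycle leaves a rectangle as often as it enters it. -/
theorem sum_bd1_part {c : ι → ι → ℤ} (hc : c ∈ Z1 F.space) (j : J) (s : Fin (F.n j + 1))
    (g : ι → ℤ) :
    ∑ v, g v * bd1 (restrict1 (F.own (.inr ⟨j, s⟩)) c) v =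
      (∑ v, if v ∈ F.A j s.castSucc then
        g v * bd1 (restrict1 (F.own (.inr ⟨j, s⟩)) c) v else 0) +
      ∑ v, if v ∈ F.A j s.succ then
        g v * bd1 (restrict1 (F.own (.inr ⟨j, s⟩)) c) v else 0 := by
  rw [← Finset.sum_add_distrib]
  refine Finset.sum_congr rfl fun v _ => ?_
  by_cases h1 : v ∈ F.A j s.castSucc
  · rw [if_pos h1, if_neg (F.A_ne j s h1), add_zero]
  · by_cases h2 : v ∈ F.A j s.succ
    · rw [if_neg h1, if_pos h2, zero_add]
    · rw [if_neg h1, if_neg h2, F.bd1_part hc.1 h1 h2]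
      have : bd1 c v = 0 := congrFun (LinearMap.mem_ker.1 hc.2) v
      simp [this]

/-- The total boundary of the part in the rectangle is zero and is concentrated on the two end arcs.
Both flows point into the rectangle, whence the sign. -/
theorem flow_add_flow {c : ι → ι → ℤ} (hc : c ∈ Z1 F.space) (j : J) (s : Fin (F.n j + 1)) :
    flow (F.A j s.succ) (F.R j s) c = - flow (F.A j s.castSucc) (F.R j s) c := by
  have hp := F.part_mem hc.1 (.inr ⟨j, s⟩)
  rw [← F.flow_part (Or.inl rfl), ← F.flow_part (Or.inr rfl), flow_eq_neg_sum_bd1 (X := F.R j s) hp,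
    flow_eq_neg_sum_bd1 (X := F.R j s) hp]
  have h := F.sum_bd1_part hc j s (fun _ => 1)
  simp only [one_mul] at h
  rw [sum_bd1 hp.1] at h
  linarith

variable [Fintype Z] [Fintype J]

theorem sum_part {c : ι → ι → ℤ} (hc : c ∈ Chain1 F.space) :
    ∑ p, restrict1 (F.own p) c = c := by
  funext u v
  rw [Finset.sum_apply, Finset.sum_apply]
  simp only [restrict1_apply]
  by_cases h : ({u, v} : Finset ι) ∈ F.space
  · obtain ⟨p, hp⟩ := F.exists_own h
    rw [Finset.sum_eq_single p, if_pos hp]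
    · exact fun p' _ hne => if_neg fun h' => hne (F.own_unique h' hp)
    · simp
  · rw [hc.2 u v h]
    simp

theorem sum_restrict {t : ι → ι → ι → ℤ} (ht : t ∈ Chain2 F.space) :
    ∑ p, restrict t (F.own p) = t := by
  funext u v w
  rw [Finset.sum_apply, Finset.sum_apply, Finset.sum_apply]
  simp only [restrict]
  by_cases h : ({u, v, w} : Finset ι) ∈ F.space
  · obtain ⟨p, hp⟩ := F.exists_own h
    rw [Finset.sum_eq_single p, if_pos hp]
    · exact fun p' _ hne => if_neg fun h' => hne (F.own_unique h' hp)
    · simp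
  · rw [ht.2.2 u v w h]
    simp

/-- At every 0-handle, the flows of a cycle through the adjacent 1-handles add up to zero. -/
theorem sum_flow_eq_zero [DecidableEq Z] {c : ι → ι → ℤ} (hc : c ∈ Z1 F.space) (i : Z) :
    ∑ j, ∑ s, flow (F.A j s.castSucc) (F.R j s) c *
      ((if F.z j s.succ = i then 1 else 0) - if F.z j s.castSucc = i then 1 else 0) = 0 := by
  -- Pair the vanishing boundary of `c` with the indicator function of the 0-handle. The parts in
  -- 0-handles contribute nothing, and each rectangle contributes its flow at those ends that lie in
  -- this 0-handle.
  set g : ι → ℤ := fun v => if ({v} : Finset ι) ∈ F.m i then 1 else 0 with hg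
  have hgA : ∀ j k, ∀ v ∈ F.A j k, g v = if F.z j k = i then 1 else 0 := by
    intro j k v hv
    refine if_congr ⟨fun h => (F.eq_of_mem_A_m hv h).symm, ?_⟩ rfl rfl
    rintro rfl
    exact F.A_sub_m j k (F.vertex_A.2 hv)
  have h0 : ∑ v, g v * bd1 c v = 0 := by
    rw [LinearMap.mem_ker.1 hc.2]; simp
  conv_lhs at h0 => rw [← F.sum_part hc.1, map_sum]
  simp only [Finset.sum_apply, Finset.mul_sum] at h0
  rw [Finset.sum_comm, Fintype.sum_sum_type, Fintype.sum_sigma] at h0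
  have hm : ∀ i', ∑ v, g v * bd1 (restrict1 (F.own (.inl i')) c) v = 0 := by
    intro i'
    have hp := F.part_mem hc.1 (.inl i')
    by_cases hi : i' = i
    · subst hi
      rw [← sum_bd1 hp.1]
      refine Finset.sum_congr rfl fun v _ => ?_
      by_cases hv : ({v} : Finset ι) ∈ F.m i'
      · simp [hg, hv]
      · rw [Chain1_eq_zero_of_forall hp fun u hu => hv ((F.m_subcomplex i').right_mem hu), mul_zero]
    · refine Finset.sum_eq_zero fun v _ => ?_
      by_cases hv : ({v} : Finset ι) ∈ F.m i
      · rw [Chain1_eq_zero_of_forall hp fun u hu =>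
          hi (F.eq_of_mem_m ((F.m_subcomplex i').right_mem hu) hv), mul_zero]
      · simp [hg, hv]
  rw [Finset.sum_eq_zero fun i' _ => hm i', zero_add] at h0
  refine Eq.trans ?_ h0
  refine Finset.sum_congr rfl fun j _ => Finset.sum_congr rfl fun s _ => ?_
  have hp := F.part_mem hc.1 (.inr ⟨j, s⟩)
  have h1 := F.flow_part (j := j) (s := s) (Or.inl rfl) c
  have h2 := F.flow_part (j := j) (s := s) (Or.inr rfl) c
  rw [flow_eq_neg_sum_bd1 (X := F.R j s) hp] at h1 h2
  have hk : ∀ k, (∑ v, if v ∈ F.A j k then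
      g v * bd1 (restrict1 (F.own (.inr ⟨j, s⟩)) c) v else 0) =
      (if F.z j k = i then 1 else 0) *
      ∑ v, if v ∈ F.A j k then bd1 (restrict1 (F.own (.inr ⟨j, s⟩)) c) v else 0 := by
    intro k
    rw [Finset.mul_sum]
    refine Finset.sum_congr rfl fun v _ => ?_
    by_cases hv : v ∈ F.A j k
    · rw [if_pos hv, if_pos hv, hgA j k v hv]
    · rw [if_neg hv, if_neg hv, mul_zero]
  rw [F.sum_bd1_part hc j s g, hk, hk]
  have h3 := F.flow_add_flow hc j s
  rw [h3] at h2
  rw [neg_eq_iff_eq_neg.1 h1, neg_eq_iff_eq_neg.1 h2]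
  ring

/-- A cycle that does not flow through any rectangle is a boundary. -/
theorem mem_B1_of_flow_eq_zero {c : ι → ι → ℤ} (hc : c ∈ Z1 F.space)
    (h0 : ∀ j s, flow (F.A j s.castSucc) (F.R j s) c = 0) : c ∈ B1 F.space := by
  -- Without flow the boundary of the part in a rectangle has total zero on each end arc, so a chain
  -- `y` along the arcs has the same boundary. The difference is then a cycle in a disk.
  have hR : ∀ q : Σ j, Fin (F.n j + 1), ∃ y ∈ Chain1 (pathFaces (F.A q.1 q.2.castSucc) ∪
      pathFaces (F.A q.1 q.2.succ)), bd1 y = bd1 (restrict1 (F.own (.inr q)) c) := by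
    rintro ⟨j, s⟩
    have hp := F.part_mem hc.1 (.inr ⟨j, s⟩)
    refine exists_chain_on_arcs (F.A_disj j s) (fun v h1 h2 => ?_) ?_ ?_
    · rw [F.bd1_part hc.1 h1 h2, LinearMap.mem_ker.1 hc.2]; simp
    · have h := F.flow_part (j := j) (s := s) (Or.inl rfl) c
      rw [flow_eq_neg_sum_bd1 (X := F.R j s) hp, h0] at h
      linarith
    · have h := F.flow_part (j := j) (s := s) (Or.inr rfl) c
      rw [flow_eq_neg_sum_bd1 (X := F.R j s) hp, F.flow_add_flow hc, h0] at h
      linarith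
  choose y hy hby using hR
  -- the corrected parts in the rectangles
  have h1 : ∀ q, restrict1 (F.own (.inr q)) c - y q ∈ B1 F.space := by
    rintro ⟨j, s⟩
    refine B1_mono (F.R_subset_space j s) ((F.R_disk j s).Z1_le_B1 ⟨?_, ?_⟩)
    · refine sub_mem (F.part_mem hc.1 (.inr ⟨j, s⟩)) (Chain1_mono ?_ (hy ⟨j, s⟩))
      exact Set.union_subset (F.A_left_R j s) (F.A_right_R j s)
    · refine LinearMap.mem_ker.2 ?_
      rw [map_sub, hby, sub_self]
  -- The cycle has been pushed out of the rectangles into the union of the 0-handles, where all arcs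
  -- lie.
  set c' := c - ∑ q, (restrict1 (F.own (.inr q)) c - y q) with hc'
  have hsum1 : ∑ q, (restrict1 (F.own (.inr q)) c - y q) ∈ B1 F.space :=
    sum_mem fun q _ => h1 q
  have hc'Z : c' ∈ Z1 F.space := sub_mem hc (B1_le_Z1 F.space_subcomplex hsum1)
  have hc'm : c' ∈ Chain1 (⋃ i, F.m i) := by
    have e : c' = ∑ i, restrict1 (F.own (.inl i)) c + ∑ q, y q := by
      rw [hc', Finset.sum_sub_distrib]
      conv_lhs => enter [1]; rw [← F.sum_part hc.1, Fintype.sum_sum_type]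
      abel
    rw [e]
    refine add_mem (sum_mem fun i _ => Chain1_mono (Set.subset_iUnion F.m i)
      (F.part_mem hc.1 (.inl i))) (sum_mem fun q _ => Chain1_mono ?_ (hy q))
    exact Set.union_subset ((F.A_sub_m _ _).trans (Set.subset_iUnion F.m _))
      ((F.A_sub_m _ _).trans (Set.subset_iUnion F.m _))
  have hsum : c' = ∑ i, restrict1 (F.m i) c' := by
    funext u v
    rw [Finset.sum_apply, Finset.sum_apply]
    simp only [restrict1_apply]
    by_cases h : ({u, v} : Finset ι) ∈ ⋃ i, F.m i
    · obtain ⟨i, hi⟩ := Set.mem_iUnion.1 h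
      rw [Finset.sum_eq_single i, if_pos hi]
      · exact fun i' _ hne => if_neg fun h' => hne (F.eq_of_mem_m h' hi)
      · simp
    · rw [hc'm.2 u v h]
      simp
  -- The 0-handles are disjoint, so the part of the cycle in each is again a cycle, and disks have
  -- no first homology.
  have hm : ∀ i, restrict1 (F.m i) c' ∈ B1 F.space := by
    intro i
    refine B1_mono (F.m_subset_space i) ((F.m_disk i).Z1_le_B1 ⟨restrict1_mem _ hc'Z.1.1, ?_⟩)
    refine LinearMap.mem_ker.2 ?_
    funext v
    by_cases hv : ({v} : Finset ι) ∈ F.m i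
    · rw [bd1_restrict1_of_forall, LinearMap.mem_ker.1 hc'Z.2]
      intro u hu
      have : ({u, v} : Finset ι) ∈ ⋃ i, F.m i := by
        by_contra h; exact hu (hc'm.2 u v h)
      obtain ⟨i', hi'⟩ := Set.mem_iUnion.1 this
      rwa [F.eq_of_mem_m hv ((F.m_subcomplex i').right_mem hi')]
    · exact Chain1_eq_zero_of_forall (restrict1_mem _ hc'Z.1.1) fun u hu =>
        hv ((F.m_subcomplex i).right_mem hu)
  have : c = c' + ∑ q, (restrict1 (F.own (.inr q)) c - y q) := by rw [hc']; abel
  rw [this]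
  refine add_mem ?_ hsum1
  rw [hsum]
  exact sum_mem fun i _ => hm i

/-- A boundary does not flow through any rectangle. -/
theorem flow_bd2 {t : ι → ι → ι → ℤ} (ht : t ∈ Chain2 F.space) (j : J) (s : Fin (F.n j + 1)) :
    flow (F.A j s.castSucc) (F.R j s) (bd2 t) = 0 := by
  rw [← F.sum_restrict ht, map_sum, map_sum]
  refine Finset.sum_eq_zero fun p _ => ?_
  have h1 : restrict t (F.own p) ∈ Chain2 (F.pieceFaces p) :=
    Chain2_mono (Set.inter_subset_right.trans (F.own_subset p)) (restrict_mem ht _)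
  have h2 := bd2_mem_Z1 (F.pieceFaces_subcomplex p) h1
  by_cases hp : p = .inr ⟨j, s⟩
  · subst hp
    rw [flow_eq_neg_sum_bd1 (X := F.R j s) h2.1, LinearMap.mem_ker.1 h2.2]
    simp
  · exact F.flow_other (Or.inl rfl) hp h2.1

end RibbonSurface

end

section

open scoped Classical

set_option linter.unusedSectionVars false

variable {ι : Type} [Fintype ι] [DecidableEq ι]

/-! ### Disoriented chains -/

/-- The recursion `ρ' = 2f − ρ` gives `f − ρ' = −(f − ρ)`, so the alternating sum telescopes. It
shows that the boundary of a disoriented core is, up to sign, the difference between its last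
0-handle and the class of its last rectangle. -/
theorem sum_alternating {M : Type} [AddCommGroup M] {n : ℕ} (f : Fin (n + 2) → M)
    (ρ : Fin (n + 1) → M) (h0 : ρ 0 = f 0)
    (hs : ∀ r : Fin n, ρ r.succ = (2 : ℤ) • f r.succ.castSucc - ρ r.castSucc) :
    ∑ s : Fin (n + 1), ((-1 : ℤ) ^ (s : ℕ)) • (f s.succ - f s.castSucc) =
      ((-1 : ℤ) ^ n) • (f (Fin.last _) - ρ (Fin.last _)) := by
  induction n with
  | zero => simp [h0]
  | succ n ih =>
    rw [Fin.sum_univ_castSucc]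
    have := ih (fun k => f k.castSucc) (fun s => ρ s.castSucc) (by simpa using h0) (fun r => by
      have := hs r.castSucc
      simpa using this)
    simp only [Fin.val_castSucc, Fin.succ_castSucc]
    rw [this]
    have hl := hs (Fin.last n)
    rw [Fin.succ_last] at hl
    simp only [Fin.val_last, Fin.succ_last, hl, pow_succ]
    module

/-! ### Reflection at ribbon singularities and balanced chains -/

namespace RibbonSurface

variable {K : Triangulation ι} {Z J : Type} (F : RibbonSurface K Z J)

/-- The class of a rectangle of a 1-handle as a combination of 0-handles: passing a ribbon
singularity reflects it in the 0-handle that contains the singularity. -/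
noncomputable def rhoR (j : J) (s : Fin (F.n j + 1)) : Z →₀ ℤ :=
  Fin.induction (motive := fun _ => Z →₀ ℤ) (Finsupp.single (F.z j 0) 1)
    (fun r prev => (2 : ℤ) • Finsupp.single (F.z j r.succ.castSucc) 1 - prev) s

/-- The class of a piece as a combination of 0-handles. -/
noncomputable def rho : F.Piece → (Z →₀ ℤ)
  | .inl i => Finsupp.single i 1
  | .inr q => F.rhoR q.1 q.2

theorem rhoR_zero (j : J) : F.rhoR j 0 = Finsupp.single (F.z j 0) 1 := rfl

theorem rhoR_succ (j : J) (r : Fin (F.n j)) : F.rhoR j r.succ =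
    (2 : ℤ) • Finsupp.single (F.z j r.succ.castSucc) 1 - F.rhoR j r.castSucc := by
  unfold rhoR
  rw [Fin.induction_succ]

/-- A chain that crosses the two sides of every ribbon singularity equally often. -/
def Balanced (c : ι → ι → ℤ) : Prop :=
  ∀ r : F.Ribbon, flow (F.arc r) (F.before r) c = flow (F.arc r) (F.after r) c

/-- Within a rectangle the inward flows at the two ends are opposite; across a ribbon arc balance
makes the flows into the two adjacent rectangles equal. Hence one sign change per rectangle, as in
the disoriented core. -/
theorem flow_eq_of_balanced {c : ι → ι → ℤ} (hc : c ∈ Z1 F.space) (hb : F.Balanced c) (j : J)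
    (s : Fin (F.n j + 1)) : flow (F.A j s.castSucc) (F.R j s) c =
      (-1) ^ (s : ℕ) * flow (F.A j 0) (F.R j 0) c := by
  induction s using Fin.induction with
  | zero => simp
  | succ r ih =>
    have h1 := hb ⟨j, r⟩
    have h2 := F.flow_add_flow hc j r.castSucc
    have h3 : flow (F.A j r.succ.castSucc) (F.R j r.succ) c =
      flow (F.A j r.castSucc.succ) (F.R j r.castSucc) c := h1.symm
    rw [h3, h2, ih]
    simp only [Fin.val_castSucc, Fin.val_succ, pow_succ]
    ring

end RibbonSurface

/-! ### Counting passages over the 1-handles -/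

namespace Disorientation

variable {K : Triangulation ι} {Z J D : Type} {F : RibbonSurface K Z J} {S : TwoHandles F D}
  (O : Disorientation S)

theorem cell1_single (j : J) : O.cell1 (Finsupp.single j 1) =
    ((O.ε j : ℤ) * (-1) ^ F.n j) •
      (Finsupp.single (F.z j (Fin.last _)) 1 - F.rhoR j (Fin.last _)) := by
  rw [cell1, Finsupp.linearCombination_single, one_smul]
  simp only [mul_smul]
  rw [← Finset.smul_sum, sum_alternating (fun k => Finsupp.single (F.z j k) (1 : ℤ)) (F.rhoR j)
    (F.rhoR_zero j) (F.rhoR_succ j)]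

variable [Fintype J]

/-- The combination of 1-handles over which a chain passes. -/
noncomputable def overHandles : (ι → ι → ℤ) →ₗ[ℤ] (J →₀ ℤ) :=
  ∑ j, Finsupp.lsingle j ∘ₗ passOver F O.ε j

theorem over_apply (c : ι → ι → ℤ) (j : J) : O.overHandles c j = passOver F O.ε j c := by
  simp only [overHandles, LinearMap.sum_apply, LinearMap.comp_apply, Finsupp.lsingle_apply]
  rw [Finsupp.finsetSum_apply, Finset.sum_eq_single j]
  · simp
  · intro j' _ h
    simp [h]
  · simp

theorem passOver_apply (j : J) (c : ι → ι → ℤ) :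
    passOver F O.ε j c = (O.ε j : ℤ) * flow (F.A j 0) (F.R j 0) c := rfl

theorem over_eq_zero_iff (c : ι → ι → ℤ) :
    O.overHandles c = 0 ↔ ∀ j, flow (F.A j 0) (F.R j 0) c = 0 := by
  rw [Finsupp.ext_iff]
  refine forall_congr' fun j => ?_
  rw [over_apply, passOver_apply]
  simp

/-- This is conservation of flow at each 0-handle, with the flows through all rectangles expressed
by the first one. The disorientation sign enters twice and disappears. -/
theorem cell1_over [Fintype Z] {c : ι → ι → ℤ} (hc : c ∈ Z1 F.space) (hb : F.Balanced c) :
    O.cell1 (O.overHandles c) = 0 := by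
  ext i
  have h := F.sum_flow_eq_zero hc i
  rw [Finsupp.zero_apply, ← h, cell1, overHandles, LinearMap.sum_apply, map_sum, Finsupp.finsetSum_apply]
  refine Finset.sum_congr rfl fun j _ => ?_
  rw [LinearMap.comp_apply, Finsupp.lsingle_apply, Finsupp.linearCombination_single,
    Finsupp.smul_apply, Finsupp.finsetSum_apply, Finset.smul_sum]
  refine Finset.sum_congr rfl fun s _ => ?_
  rw [F.flow_eq_of_balanced hc hb j s, O.passOver_apply]
  simp only [Finsupp.smul_apply, Finsupp.sub_apply, Finsupp.single_apply, smul_eq_mul]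
  have hε : (O.ε j : ℤ) * (O.ε j : ℤ) = 1 := by
    rcases Int.units_eq_one_or (O.ε j) with h | h <;> simp [h]
  linear_combination ((-1) ^ (s : ℕ) * flow (F.A j 0) (F.R j 0) c *
    ((if F.z j s.succ = i then 1 else 0) - if F.z j s.castSucc = i then 1 else 0)) * hε

theorem over_bd2 [Fintype Z] {t : ι → ι → ι → ℤ} (ht : t ∈ Chain2 F.space) :
    O.overHandles (bd2 t) = 0 :=
  (O.over_eq_zero_iff _).2 fun j => F.flow_bd2 ht j 0

theorem mem_B1_of_over_eq_zero [Fintype Z] {c : ι → ι → ℤ} (hc : c ∈ Z1 F.space)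
    (hb : F.Balanced c) (h : O.overHandles c = 0) : c ∈ B1 F.space :=
  F.mem_B1_of_flow_eq_zero hc fun j s => by
    rw [F.flow_eq_of_balanced hc hb, (O.over_eq_zero_iff c).1 h, mul_zero]

theorem over_of_mem_piece {p : F.Piece} (hp : ∀ j, p ≠ .inr ⟨j, 0⟩) {c : ι → ι → ℤ}
    (hc : c ∈ Chain1 (F.pieceFaces p)) : O.overHandles c = 0 :=
  (O.over_eq_zero_iff _).2 fun j => F.flow_other (s := 0) (Or.inl rfl) (hp j) hc

/-- Passages are measured at the initial attaching arc, so among chains lying in one piece only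
those in a first rectangle can be seen. -/
theorem over_of_mem_first {j : J} {c : ι → ι → ℤ} (hc : c ∈ Chain1 (F.R j 0)) :
    O.overHandles c = Finsupp.single j (-(O.ε j : ℤ) * ∑ u, if u ∈ F.A j 0 then bd1 c u else 0) := by
  ext j'
  rw [over_apply, passOver_apply]
  by_cases h : j = j'
  · subst h
    rw [Finsupp.single_eq_same, flow_eq_neg_sum_bd1 hc]
    ring
  · rw [Finsupp.single_eq_of_ne (Ne.symm h)]
    have := F.flow_other (j := j') (s := 0) (k := 0) (Or.inl rfl) (p := .inr ⟨j, 0⟩)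
      (fun e => h (congrArg Sigma.fst (Sum.inr_injective e))) hc
    rw [this, mul_zero]

end Disorientation

/-! ### Disoriented chains: boundaries, balance and passages -/

namespace LocalCharts

variable {K : Triangulation ι} {Z J : Type} {F : RibbonSurface K Z J} (L : LocalCharts F)

/-- The disoriented chains on `G`. -/
noncomputable def disorientedChains (G : Faces ι) : Submodule ℤ (ι → ι → ℤ) :=
  Submodule.span ℤ (Set.range L.ell) ⊔ Chain1 (G \ ⋃ r, L.openNbhd r)

theorem mem_disorientedCycles {G : Faces ι} {c : ι → ι → ℤ} :
    c ∈ L.disorientedCycles G ↔ c ∈ Z1 G ∧ c ∈ L.disorientedChains G := Iff.rfl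

theorem disorientedChains_mono {G G' : Faces ι} (h : G ⊆ G') :
    L.disorientedChains G ≤ L.disorientedChains G' :=
  sup_le_sup_left (Chain1_mono (Set.sdiff_subset_sdiff_left h)) _

theorem ell_mem_disorientedChains (G : Faces ι) (r : F.Ribbon) :
    L.ell r ∈ L.disorientedChains G :=
  Submodule.mem_sup_left (Submodule.subset_span ⟨r, rfl⟩)

theorem mem_disorientedChains {G : Faces ι} {c : ι → ι → ℤ}
    (h : c ∈ Chain1 (G \ ⋃ r, L.openNbhd r)) : c ∈ L.disorientedChains G :=
  Submodule.mem_sup_right h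

theorem pathChain_vb_mem (r : F.Ribbon) : pathChain (L.vb r) ∈ Chain1 (L.Qb r) :=
  Chain1_mono (L.path_sub r).1 (pathChain_mem _)

theorem pathChain_va_mem (r : F.Ribbon) : pathChain (L.va r) ∈ Chain1 (L.Qa r) :=
  Chain1_mono (L.path_sub r).2.1 (pathChain_mem _)

theorem pathChain_hx_mem (r : F.Ribbon) : pathChain (L.hx r) ∈ Chain1 (L.M r) :=
  Chain1_mono (L.path_sub r).2.2.1 (pathChain_mem _)

theorem pathChain_hy_mem (r : F.Ribbon) : pathChain (L.hy r) ∈ Chain1 (L.M r) :=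
  Chain1_mono (L.path_sub r).2.2.2 (pathChain_mem _)

theorem ell_mem (r : F.Ribbon) : L.ell r ∈ Chain1 (L.nbhd r) :=
  add_mem (add_mem (add_mem (Chain1_mono (L.Qb_sub_nbhd r) (L.pathChain_vb_mem r))
    (Chain1_mono (L.Qa_sub_nbhd r) (L.pathChain_va_mem r)))
    (Chain1_mono (L.M_sub_nbhd r) (L.pathChain_hx_mem r)))
    (Chain1_mono (L.M_sub_nbhd r) (L.pathChain_hy_mem r))

theorem disorientedChains_le : L.disorientedChains F.space ≤ Chain1 F.space := by
  refine sup_le (Submodule.span_le.2 ?_) (Chain1_mono Set.sdiff_subset)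
  rintro _ ⟨r, rfl⟩
  exact Chain1_mono (L.nbhd_subset_space r) (L.ell_mem r)

theorem exists_head {l : List ι} (h : IsArc l) : ∃ a, l.head? = some a ∧ a ∈ l := by
  rcases l with _ | ⟨a, l⟩
  · exact absurd h.2 (by simp)
  · exact ⟨a, rfl, by simp⟩

theorem exists_getLast {l : List ι} (h : IsArc l) : ∃ a, l.getLast? = some a ∧ a ∈ l := by
  have hne : l ≠ [] := fun e => by simpa [e] using h.2
  exact ⟨l.getLast hne, List.getLast?_eq_getLast_of_ne_nil hne, List.getLast_mem hne⟩

/-- The boundary of the local disoriented chain. -/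
theorem bd1_ell (r : F.Ribbon) : ∃ b a x y, b ∈ L.Tb r ∧ a ∈ L.Ta r ∧
    ({x} : Finset ι) ∈ bdry (L.M r) ∧ ({y} : Finset ι) ∈ bdry (L.M r) ∧
    bd1 (L.ell r) = vert x + vert y - vert b - vert a := by
  obtain ⟨pb, pa, px, py⟩ := L.path_arc r
  obtain ⟨b, hb, hbm⟩ := exists_head pb
  obtain ⟨a, ha, ham⟩ := exists_head pa
  obtain ⟨x, hx, hxm⟩ := exists_getLast px
  obtain ⟨y, hy, hym⟩ := exists_getLast py
  refine ⟨b, a, x, y, ((L.vb_ends r).2.2 b hbm).2 hb, ((L.va_ends r).2.2 a ham).2 ha,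
    ((L.hx_ends r).2.2 x hxm).2 hx, ((L.hy_ends r).2.2 y hym).2 hy, ?_⟩
  rw [ell, map_add, map_add, map_add, bd1_pathChain_of_ends pb.1 hb (L.vb_ends r).1,
    bd1_pathChain_of_ends pa.1 ha (L.va_ends r).1, bd1_pathChain_of_ends px.1 (L.hx_ends r).1 hx,
    bd1_pathChain_of_ends py.1 (L.hy_ends r).1 hy]
  abel

theorem outside_of_frontier {r : F.Ribbon} {a : ι}
    (h : ({a} : Finset ι) ∈ bdry (L.M r) ∪ pathFaces (L.Tb r) ∪ pathFaces (L.Ta r)) :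
    L.Outside a := by
  intro r' h'
  have hn : ({a} : Finset ι) ∈ L.nbhd r := by
    rcases h with (h | h) | h
    · exact L.M_sub_nbhd r (bdry_subset (L.M_disk r).surface.subcomplex h)
    · exact L.Qb_sub_nbhd r (L.Tb_sub r h)
    · exact L.Qa_sub_nbhd r (L.Ta_sub r h)
  obtain rfl := L.nbhd_eq hn h'.1
  exact h'.2 h

theorem notMem_nbhd_of_mem_bdry {i : Z} {a : ι} (h : ({a} : Finset ι) ∈ bdry (F.m i))
    (r : F.Ribbon) : ({a} : Finset ι) ∉ L.nbhd r := by
  intro h'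
  have hm := bdry_subset (F.m_subcomplex i) h
  rcases L.piece_cases (p := .inl i) hm h' with ⟨e, hM⟩ | ⟨e, -⟩ | ⟨e, -⟩
  · obtain rfl := Sum.inl_injective e
    exact (L.M_sub r hM).2 h
  · cases e
  · cases e

theorem outside_of_mem_bdry {i : Z} {a : ι} (h : ({a} : Finset ι) ∈ bdry (F.m i)) :
    L.Outside a := fun r h' => L.notMem_nbhd_of_mem_bdry h r h'.1

theorem notMem_nbhd_of_mem_A_zero {j : J} {a : ι} (h : a ∈ F.A j 0) (r : F.Ribbon) :
    ({a} : Finset ι) ∉ L.nbhd r :=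
  L.notMem_nbhd_of_mem_bdry (F.attach_first j (F.vertex_A.2 h)) r

theorem outside_of_mem_A_zero {j : J} {a : ι} (h : a ∈ F.A j 0) : L.Outside a :=
  L.outside_of_mem_bdry (F.attach_first j (F.vertex_A.2 h))

theorem outside_of_mem_A_last {j : J} {a : ι} (h : a ∈ F.A j (Fin.last _)) : L.Outside a :=
  L.outside_of_mem_bdry (F.attach_last j (F.vertex_A.2 h))

theorem exists_outside (i : Z) : ∃ a, ({a} : Finset ι) ∈ F.m i ∧ L.Outside a := by
  obtain ⟨l, -, h3, hl⟩ := (F.m_disk i).circle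
  rcases l with _ | ⟨a, l⟩
  · simp at h3
  · have : ({a} : Finset ι) ∈ bdry (F.m i) := by
      rw [hl, singleton_mem_pathFaces (by simp [closeUp]), mem_closeUp]
      simp
    exact ⟨a, bdry_subset (F.m_subcomplex i) this, L.outside_of_mem_bdry this⟩

/-- A chain between two points of a piece outside the open neighbourhoods. -/
theorem exists_chain (p : F.Piece) {a b : ι} (ha : ({a} : Finset ι) ∈ F.pieceFaces p)
    (hb : ({b} : Finset ι) ∈ F.pieceFaces p) (ha' : L.Outside a) (hb' : L.Outside b) :
    ∃ c ∈ L.disorientedChains F.space, c ∈ Chain1 (F.pieceFaces p) ∧ bd1 c = vert b - vert a := by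
  obtain ⟨c, hc, hbc⟩ := (L.linked_outside p ha hb ha' hb').exists_chain
  exact ⟨c, L.mem_disorientedChains (Chain1_mono (Set.sdiff_subset_sdiff_left (F.pieceFaces_subset p))
    hc), Chain1_mono Set.sdiff_subset hc, hbc⟩

theorem sum_vert (A : List ι) (a : ι) :
    (∑ u, if u ∈ A then vert a u else 0) = if a ∈ A then 1 else 0 := by
  rw [Finset.sum_eq_single a]
  · simp [vert]
  · intro u _ hu
    simp [vert, hu]
  · simp

theorem sum_vert_sub (A : List ι) (a b : ι) :
    (∑ u, if u ∈ A then (vert a - vert b) u else 0) =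
      (if a ∈ A then 1 else 0) - if b ∈ A then 1 else 0 := by
  rw [← sum_vert, ← sum_vert, ← Finset.sum_sub_distrib]
  refine Finset.sum_congr rfl fun u _ => ?_
  split_ifs <;> simp

theorem flow_outside {r : F.Ribbon} {X : Faces ι} {c : ι → ι → ℤ}
    (hc : c ∈ Chain1 (F.space \ ⋃ r, L.openNbhd r)) : flow (F.arc r) X c = 0 := by
  refine flow_eq_zero_of_forall fun u w hu _ _ => ?_
  by_contra hne
  have hm : ({u, w} : Finset ι) ∈ F.space \ ⋃ r, L.openNbhd r := by
    by_contra h; exact hne (hc.2 u w h)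
  exact hm.2 (Set.mem_iUnion.2 ⟨r, L.edge_mem_openNbhd (L.arc_mem_openNbhd hu) hm.1⟩)

theorem before_ne_after (r : F.Ribbon) :
    (.inr ⟨r.1, r.2.castSucc⟩ : F.Piece) ≠ .inr ⟨r.1, r.2.succ⟩ := fun e => by
  have := congrArg Fin.val (eq_of_heq (Sigma.mk.inj_iff.1 (Sum.inr_injective e)).2)
  simp at this

/-- The segments along the 1-handle run into the same point of the arc from its two sides, hence
contribute equally; the segments in the 0-handle cross neither side. -/
theorem balanced_ell (r : F.Ribbon) : F.Balanced (L.ell r) := by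
  intro r'
  by_cases hr : r' = r
  · subst hr
    obtain ⟨pb, pa, px, py⟩ := L.path_arc r'
    obtain ⟨b, hb, hbm⟩ := exists_head pb
    obtain ⟨a, ha, ham⟩ := exists_head pa
    have hbA : b ∉ F.arc r' := (L.T_disj r').1 (((L.vb_ends r').2.2 b hbm).2 hb)
    have haA : a ∉ F.arc r' := (L.T_disj r').2 (((L.va_ends r').2.2 a ham).2 ha)
    have hvb : pathChain (L.vb r') ∈ Chain1 (F.before r') :=
      Chain1_mono (L.Qb_sub r').2 (L.pathChain_vb_mem r')
    have hva : pathChain (L.va r') ∈ Chain1 (F.after r') :=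
      Chain1_mono (L.Qa_sub r').2 (L.pathChain_va_mem r')
    have hM : L.M r' ⊆ F.pieceFaces (.inl (F.disk r')) := fun t ht => (L.M_sub r' ht).1
    have hx := Chain1_mono hM (L.pathChain_hx_mem r')
    have hy := Chain1_mono hM (L.pathChain_hy_mem r')
    have hkb : r'.2.succ.castSucc = r'.2.castSucc.castSucc ∨
        r'.2.succ.castSucc = r'.2.castSucc.succ := Or.inr (Fin.succ_castSucc _).symm
    have hka : r'.2.succ.castSucc = r'.2.succ.castSucc ∨ r'.2.succ.castSucc = r'.2.succ.succ :=
      Or.inl rfl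
    have hne := before_ne_after r'
    simp only [ell, map_add]
    rw [F.flow_other hkb (p := .inr ⟨r'.1, r'.2.succ⟩) (fun e => hne e.symm) hva,
      F.flow_other hkb (by simp) hx, F.flow_other hkb (by simp) hy,
      F.flow_other hka (p := .inr ⟨r'.1, r'.2.castSucc⟩) hne hvb,
      F.flow_other hka (by simp) hx, F.flow_other hka (by simp) hy,
      flow_eq_neg_sum_bd1 hvb, flow_eq_neg_sum_bd1 hva,
      bd1_pathChain_of_ends pb.1 hb (L.vb_ends r').1,
      bd1_pathChain_of_ends pa.1 ha (L.va_ends r').1, sum_vert_sub, sum_vert_sub,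
      if_neg hbA, if_neg haA]
    ring
  · have : ∀ X, flow (F.arc r') X (L.ell r) = 0 := by
      intro X
      refine flow_eq_zero_of_forall fun u w hu _ _ => (L.ell_mem r).2 u w fun h => hr ?_
      exact L.nbhd_eq (L.arc_mem_openNbhd hu).1 ((L.nbhd_subcomplex r).left_mem h)
    rw [this, this]

theorem balanced_of_disoriented {c : ι → ι → ℤ} (hc : c ∈ L.disorientedChains F.space) :
    F.Balanced c := by
  intro r
  have : L.disorientedChains F.space ≤
      LinearMap.ker (flow (F.arc r) (F.before r) - flow (F.arc r) (F.after r)) := by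
    refine sup_le (Submodule.span_le.2 ?_) fun c hc => ?_
    · rintro _ ⟨r', rfl⟩
      exact LinearMap.mem_ker.2 (sub_eq_zero.2 (L.balanced_ell r' r))
    · refine LinearMap.mem_ker.2 ?_
      rw [LinearMap.sub_apply, L.flow_outside hc, L.flow_outside hc, sub_zero]
  exact sub_eq_zero.1 (LinearMap.mem_ker.1 (this hc))

/-! ### Realization by disoriented chains -/

/-- A point of each 0-handle, outside the neighbourhoods of the ribbon singularities. -/
noncomputable def base (i : Z) : ι := (L.exists_outside i).choose

theorem base_mem (i : Z) : ({L.base i} : Finset ι) ∈ F.m i := (L.exists_outside i).choose_spec.1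

theorem base_outside (i : Z) : L.Outside (L.base i) := (L.exists_outside i).choose_spec.2

/-- The 0-chain on the chosen points of the 0-handles. -/
noncomputable def lift : (Z →₀ ℤ) →ₗ[ℤ] (ι → ℤ) :=
  Finsupp.linearCombination ℤ fun i => vert (L.base i)

theorem lift_single (i : Z) : L.lift (Finsupp.single i 1) = vert (L.base i) := by
  rw [lift, Finsupp.linearCombination_single, one_smul]

variable {D : Type} {T : TwoHandles F D} (O : Disorientation T) [Fintype J]

/-- The neighbourhoods of the ribbon singularities avoid the boundaries of the 0-handles, where the
attaching arcs lie. -/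
theorem over_ell (r : F.Ribbon) : O.overHandles (L.ell r) = 0 := by
  refine (O.over_eq_zero_iff _).2 fun j => flow_eq_zero_of_forall fun u w hu _ _ =>
    (L.ell_mem r).2 u w fun h => ?_
  exact L.notMem_nbhd_of_mem_A_zero hu r ((L.nbhd_subcomplex r).left_mem h)

theorem exists_chain_disk {i : Z} {a b : ι} (ha : ({a} : Finset ι) ∈ F.m i)
    (hb : ({b} : Finset ι) ∈ F.m i) (ha' : L.Outside a) (hb' : L.Outside b) :
    ∃ c ∈ L.disorientedChains F.space, bd1 c = vert b - vert a ∧ O.overHandles c = 0 := by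
  obtain ⟨c, hc, hcp, hb⟩ := L.exists_chain (.inl i) ha hb ha' hb'
  exact ⟨c, hc, hb, O.over_of_mem_piece (by simp) hcp⟩

/-- By induction along the 1-handle, every point of a rectangle is joined to the class of that
rectangle. A disoriented chain cannot simply pass a ribbon singularity: it has to use the local
chain there, which reverses the part already built and adds two branches in the 0-handle. Points of
the initial arc are excluded because a chain ending there would not pass over the 1-handle. -/
theorem exists_chain_rectangle (j : J) (s : Fin (F.n j + 1)) : ∀ b, ({b} : Finset ι) ∈ F.R j s →
    L.Outside b → b ∉ F.A j 0 → ∃ c ∈ L.disorientedChains F.space,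
      bd1 c = vert b - L.lift (F.rhoR j s) ∧
      O.overHandles c = Finsupp.single j ((O.ε j : ℤ) * (-1) ^ (s : ℕ)) := by
  induction s using Fin.induction with
  | zero =>
    intro b hb hb' hA
    obtain ⟨a, -, ha⟩ := exists_head (F.A_arc j 0)
    have ham : ({a} : Finset ι) ∈ F.m (F.z j 0) := F.A_sub_m j 0 (F.vertex_A.2 ha)
    have haR : ({a} : Finset ι) ∈ F.R j 0 := F.A_left_R j 0 (F.vertex_A.2 ha)
    have hao := L.outside_of_mem_A_zero ha
    obtain ⟨c₁, h₁, hb₁, ho₁⟩ := L.exists_chain_disk O (L.base_mem _) ham (L.base_outside _) hao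
    obtain ⟨c₂, h₂, hp₂, hb₂⟩ := L.exists_chain (.inr ⟨j, 0⟩) haR hb hao hb'
    refine ⟨c₁ + c₂, add_mem h₁ h₂, ?_, ?_⟩
    · rw [map_add, hb₁, hb₂, F.rhoR_zero, lift_single]
      abel
    · rw [map_add, ho₁, zero_add, O.over_of_mem_first hp₂, hb₂, sum_vert_sub, if_neg hA, if_pos ha]
      congr 1
      simp
  | succ r ih =>
    intro b hb hb' hA
    obtain ⟨tb, ta, x, y, htb, hta, hx, hy, hell⟩ := L.bd1_ell ⟨j, r⟩
    have hTb := (singleton_mem_pathFaces (L.T_arc ⟨j, r⟩).1.2).2 htb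
    have hTa := (singleton_mem_pathFaces (L.T_arc ⟨j, r⟩).2.2).2 hta
    have hM : ∀ {x : ι}, ({x} : Finset ι) ∈ bdry (L.M ⟨j, r⟩) →
        ({x} : Finset ι) ∈ F.m (F.z j r.succ.castSucc) := fun h =>
      (L.M_sub ⟨j, r⟩ (bdry_subset (L.M_disk _).surface.subcomplex h)).1
    obtain ⟨c₀, h₀, hb₀, ho₀⟩ := ih tb ((L.Qb_sub ⟨j, r⟩).2 (L.Tb_sub _ hTb))
      (L.outside_of_frontier (Or.inl (Or.inr hTb)))
      (fun h => L.notMem_nbhd_of_mem_A_zero h ⟨j, r⟩ (L.Qb_sub_nbhd _ (L.Tb_sub _ hTb)))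
    obtain ⟨c₁, h₁, hb₁, ho₁⟩ := L.exists_chain_disk O (L.base_mem _) (hM hx) (L.base_outside _)
      (L.outside_of_frontier (Or.inl (Or.inl hx)))
    obtain ⟨c₂, h₂, hb₂, ho₂⟩ := L.exists_chain_disk O (L.base_mem _) (hM hy) (L.base_outside _)
      (L.outside_of_frontier (Or.inl (Or.inl hy)))
    obtain ⟨c₃, h₃, hp₃, hb₃⟩ := L.exists_chain (.inr ⟨j, r.succ⟩)
      ((L.Qa_sub ⟨j, r⟩).2 (L.Ta_sub _ hTa)) hb (L.outside_of_frontier (Or.inr hTa)) hb'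
    -- `c₁` and `c₂` run from the base point of the 0-handle to the two branches of the local chain,
    -- `c₀` is the chain up to the near strip, and `c₃` runs from the far strip to `b`. The boundary
    -- of the local chain cancels all intermediate ends, leaving the reflected class and the
    -- opposite passage number.
    refine ⟨c₁ + c₂ - c₀ - L.ell ⟨j, r⟩ + c₃, add_mem (sub_mem (sub_mem (add_mem h₁ h₂) h₀)
      (L.ell_mem_disorientedChains _ _)) h₃, ?_, ?_⟩
    · rw [map_add, map_sub, map_sub, map_add, hb₁, hb₂, hb₀, hb₃, hell, F.rhoR_succ, map_sub,
        map_smul, lift_single]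
      module
    · have hz : O.overHandles c₃ = 0 := by
        refine O.over_of_mem_piece (fun j' e => ?_) hp₃
        obtain ⟨rfl, h2⟩ := Sigma.mk.inj_iff.1 (Sum.inr_injective e)
        exact Fin.succ_ne_zero r (eq_of_heq h2)
      rw [map_add, map_sub, map_sub, map_add, ho₁, ho₂, ho₀, hz, L.over_ell O, Fin.val_succ, pow_succ]
      simp only [add_zero, zero_sub, sub_zero, Fin.val_castSucc]
      rw [← Finsupp.single_neg]
      congr 1
      ring

/-- A point of a piece is joined by a disoriented chain to its class. -/
theorem exists_chain_piece (p : F.Piece) {b : ι} (hb : ({b} : Finset ι) ∈ F.pieceFaces p)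
    (hb' : L.Outside b) : ∃ c ∈ L.disorientedChains F.space, bd1 c = vert b - L.lift (F.rho p) ∧
      ((∃ i, p = .inl i) → O.overHandles c = 0) := by
  rcases p with i | ⟨j, s⟩
  · obtain ⟨c, hc, hbc, hoc⟩ := L.exists_chain_disk O (L.base_mem i) hb (L.base_outside i) hb'
    exact ⟨c, hc, by rw [hbc, RibbonSurface.rho, lift_single], fun _ => hoc⟩
  -- A point of the initial arc also lies in the first 0-handle, which has the same class as the
  -- first rectangle, and is reached there.
  · by_cases hA : b ∈ F.A j 0
    · have hs : s = 0 := by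
        obtain ⟨s', e, h⟩ := F.eq_of_mem_A_R hA hb
        obtain rfl := eq_of_heq (Sigma.mk.inj_iff.1 e).2
        rcases h with h | h
        · exact Fin.castSucc_injective _ h.symm
        · exact absurd h.symm (Fin.succ_ne_zero s)
      subst hs
      obtain ⟨c, hc, hbc, hoc⟩ := L.exists_chain_disk O (L.base_mem _)
        (F.A_sub_m j 0 (F.vertex_A.2 hA)) (L.base_outside _) hb'
      refine ⟨c, hc, ?_, fun _ => hoc⟩
      rw [hbc, RibbonSurface.rho, F.rhoR_zero, lift_single]
    · obtain ⟨c, hc, hbc, -⟩ := L.exists_chain_rectangle O j s b hb hb' hA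
      exact ⟨c, hc, hbc, by rintro ⟨i, hi⟩; cases hi⟩

/-- The disoriented cores. -/
theorem exists_chain_core (x : J →₀ ℤ) : ∃ c ∈ L.disorientedChains F.space,
    bd1 c = L.lift (O.cell1 x) ∧ O.overHandles c = x := by
  have hsingle : ∀ j, ∃ c ∈ L.disorientedChains F.space,
      bd1 c = L.lift (O.cell1 (Finsupp.single j 1)) ∧ O.overHandles c = Finsupp.single j 1 := by
    intro j
    obtain ⟨b, -, hb⟩ := exists_head (F.A_arc j (Fin.last _))
    have hbo := L.outside_of_mem_A_last hb
    have hbR : ({b} : Finset ι) ∈ F.R j (Fin.last _) := by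
      have := F.A_right_R j (Fin.last _)
      rw [Fin.succ_last] at this
      exact this (F.vertex_A.2 hb)
    have hbm := F.A_sub_m j _ (F.vertex_A.2 hb)
    have hb0 : b ∉ F.A j 0 := fun h => by
      have := eq_of_heq (Sigma.mk.inj_iff.1 (F.eq_of_mem_A_A h hb)).2
      exact Fin.last_pos.ne this
    obtain ⟨c₀, h₀, hb₀, ho₀⟩ := L.exists_chain_rectangle O j _ b hbR hbo hb0
    obtain ⟨c₁, h₁, hb₁, ho₁⟩ := L.exists_chain_disk O (L.base_mem _) hbm (L.base_outside _) hbo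
    -- The chain through all rectangles is closed up inside the final 0-handle. The factor is the
    -- sign with which the chain passes over the 1-handle, so multiplying by it makes the passage
    -- number one.
    refine ⟨((O.ε j : ℤ) * (-1) ^ F.n j) • (c₀ - c₁), Submodule.smul_mem _ _ (sub_mem h₀ h₁),
      ?_, ?_⟩
    · rw [map_smul, map_sub, hb₀, hb₁, O.cell1_single, map_smul, map_sub, lift_single]
      congr 1
      abel
    · rw [map_smul, map_sub, ho₀, ho₁, sub_zero, Finsupp.smul_single, smul_eq_mul, Fin.val_last]
      congr 1
      have hε : (O.ε j : ℤ) * (O.ε j : ℤ) = 1 := by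
        rcases Int.units_eq_one_or (O.ε j) with h | h <;> simp [h]
      have hn : ((-1 : ℤ) ^ F.n j) * (-1) ^ F.n j = 1 := by
        rw [← mul_pow]; simp
      linear_combination ((-1 : ℤ) ^ F.n j * (-1) ^ F.n j) * hε + hn
  choose c hc hbc hoc using hsingle
  refine ⟨Finsupp.linearCombination ℤ c x, ?_, ?_, ?_⟩
  · rw [Finsupp.linearCombination_apply]
    exact Submodule.sum_mem _ fun j _ => Submodule.smul_mem _ _ (hc j)
  · have : bd1 ∘ₗ Finsupp.linearCombination ℤ c = L.lift ∘ₗ O.cell1 := by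
      ext j : 2
      simp only [LinearMap.comp_apply, Finsupp.lsingle_apply]
      rw [← hbc, Finsupp.linearCombination_single, one_smul]
    exact LinearMap.congr_fun this x
  · have : O.overHandles ∘ₗ Finsupp.linearCombination ℤ c = LinearMap.id := by
      ext j : 2
      simp only [LinearMap.comp_apply, Finsupp.lsingle_apply, LinearMap.id_apply]
      rw [Finsupp.linearCombination_single, one_smul, hoc]
    exact LinearMap.congr_fun this x

end LocalCharts

end

section

open scoped Classical

set_option linter.unusedSectionVars false

variable {ι : Type} [Fintype ι] [DecidableEq ι]

/-! ### Classes of disoriented cycles -/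

namespace LocalCharts

variable {K : Triangulation ι} {Z J : Type} {F : RibbonSurface K Z J} (L : LocalCharts F)

/-- The class of a disoriented cycle. -/
noncomputable def cls (G : Faces ι) : L.disorientedCycles G →ₗ[ℤ] L.DH1 G :=
  LinearMap.codRestrict (L.DH1 G) (H1.mk G ∘ₗ Submodule.inclusion inf_le_left) fun z =>
    ⟨_, z.2, rfl⟩

theorem cls_coe {G : Faces ι} (z : L.disorientedCycles G) :
    (L.cls G z : H1 G) = H1.mk G ⟨z, z.2.1⟩ := rfl

theorem cls_surjective (G : Faces ι) : Function.Surjective (L.cls G) := by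
  rintro ⟨_, z, hz, rfl⟩
  exact ⟨⟨z, hz⟩, rfl⟩

theorem mk_eq_zero_iff {G : Faces ι} {z : Z1 G} : H1.mk G z = 0 ↔ (z : ι → ι → ℤ) ∈ B1 G := by
  rw [H1.mk, Submodule.mkQ_apply, Submodule.Quotient.mk_eq_zero]
  rfl

theorem cls_eq_zero_iff {G : Faces ι} {z : L.disorientedCycles G} :
    L.cls G z = 0 ↔ (z : ι → ι → ℤ) ∈ B1 G := by
  rw [← Submodule.coe_eq_zero, cls_coe, mk_eq_zero_iff]

theorem cls_eq_iff {G : Faces ι} {z z' : L.disorientedCycles G} :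
    L.cls G z = L.cls G z' ↔ (z : ι → ι → ℤ) - z' ∈ B1 G := by
  rw [← sub_eq_zero, ← map_sub, cls_eq_zero_iff]
  rfl

theorem disorientedCycles_mono {G G' : Faces ι} (h : G ⊆ G') :
    L.disorientedCycles G ≤ L.disorientedCycles G' :=
  inf_le_inf (Z1_mono h) (L.disorientedChains_mono h)

/-- The map on homology induced by an inclusion. -/
noncomputable def inclH1 {G G' : Faces ι} (h : G ⊆ G') : H1 G →ₗ[ℤ] H1 G' :=
  Submodule.liftQ _ (H1.mk G' ∘ₗ Submodule.inclusion (Z1_mono h)) (by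
    intro z hz
    exact LinearMap.mem_ker.2 (mk_eq_zero_iff.2 (B1_mono h hz)))

/-- The map on disoriented homology induced by an inclusion. -/
noncomputable def inclDH1 {G G' : Faces ι} (h : G ⊆ G') : L.DH1 G →ₗ[ℤ] L.DH1 G' :=
  (inclH1 h).restrict (by
    rintro _ ⟨z, hz, rfl⟩
    exact ⟨Submodule.inclusion (Z1_mono h) z, L.disorientedCycles_mono h hz, rfl⟩)

theorem inclDH1_cls {G G' : Faces ι} (h : G ⊆ G') (z : L.disorientedCycles G) :
    L.inclDH1 h (L.cls G z) = L.cls G' ⟨z, L.disorientedCycles_mono h z.2⟩ := rfl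

variable {D : Type} {T : TwoHandles F D} (O : Disorientation T) [Fintype J] [Fintype Z]

/-- The combination of 1-handles over which a class passes. -/
noncomputable def overDH1 : L.DH1 F.space →ₗ[ℤ] (J →₀ ℤ) :=
  Submodule.liftQ _ (O.overHandles ∘ₗ (Z1 F.space).subtype) (by
    rintro z ⟨t, ht, htz⟩
    refine LinearMap.mem_ker.2 ?_
    rw [LinearMap.comp_apply, ← htz, O.over_bd2 ht]) ∘ₗ (L.DH1 F.space).subtype

theorem overDH1_cls (z : L.disorientedCycles F.space) :
    L.overDH1 O (L.cls F.space z) = O.overHandles z := rfl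

/-- Passage numbers determine all flows of a balanced cycle, and a cycle without flow bounds. -/
theorem overDH1_injective : Function.Injective (L.overDH1 O) := by
  rw [injective_iff_map_eq_zero]
  intro h h0
  obtain ⟨z, rfl⟩ := L.cls_surjective _ h
  rw [overDH1_cls] at h0
  exact L.cls_eq_zero_iff.2 (O.mem_B1_of_over_eq_zero z.2.1 (L.balanced_of_disoriented z.2.2) h0)

/-- The realized cores have as boundary the lift of their cellular boundary, so a vector in the
kernel is realized by a disoriented cycle. -/
theorem range_overDH1 : LinearMap.range (L.overDH1 O) = LinearMap.ker O.cell1 := by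
  ext x
  constructor
  · rintro ⟨h, rfl⟩
    obtain ⟨z, rfl⟩ := L.cls_surjective _ h
    exact LinearMap.mem_ker.2 (O.cell1_over z.2.1 (L.balanced_of_disoriented z.2.2))
  · intro hx
    obtain ⟨c, hc, hbc, hoc⟩ := L.exists_chain_core O x
    rw [LinearMap.mem_ker.1 hx, map_zero] at hbc
    exact ⟨L.cls _ ⟨c, ⟨L.disorientedChains_le hc, LinearMap.mem_ker.2 hbc⟩, hc⟩, hoc⟩

/-- A balanced cycle is homologous to a disoriented one. -/
theorem mk_mem_DH1_of_balanced (z : Z1 F.space) (hz : F.Balanced z) :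
    ∃ h : L.DH1 F.space, (h : H1 F.space) = H1.mk F.space z ∧
      L.overDH1 O h = O.overHandles z := by
  -- The passage vector lies in the kernel, so some disoriented cycle has the same one. The
  -- difference of the two cycles is balanced without passages, hence bounds.
  have h0 := O.cell1_over z.2 hz
  rw [← LinearMap.mem_ker, ← L.range_overDH1 O] at h0
  obtain ⟨h, hh⟩ := h0
  refine ⟨h, ?_, hh⟩
  obtain ⟨w, rfl⟩ := L.cls_surjective _ h
  rw [overDH1_cls] at hh
  rw [cls_coe, ← sub_eq_zero, ← map_sub, mk_eq_zero_iff]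
  refine O.mem_B1_of_over_eq_zero (sub_mem w.2.1 z.2) (fun r => ?_) ?_
  · have h1 := L.balanced_of_disoriented w.2.2 r
    have h2 := hz r
    simp only [AddSubgroupClass.coe_sub, map_sub, h1, h2]
  · simp only [AddSubgroupClass.coe_sub, map_sub, hh, sub_self]

/-! ### The potential of a point -/

/-- As `φ` is constant along edges, the chain splits according to the values of `φ`, and the total
boundary of each part is zero. -/
theorem sum_bd1_smul_eq_zero {M : Type} [AddCommGroup M] {X : Faces ι} {c : ι → ι → ℤ}
    (hc : c ∈ Chain1 X) (φ : ι → M) (h : ∀ u v, ({u, v} : Finset ι) ∈ X → φ u = φ v) :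
    ∑ a, bd1 c a • φ a = 0 := by
  rw [← Finset.sum_fiberwise_of_maps_to (t := Finset.univ.image φ) (g := φ)
    (fun a _ => Finset.mem_image_of_mem φ (Finset.mem_univ a))]
  refine Finset.sum_eq_zero fun m _ => ?_
  have h1 : ∑ a with φ a = m, bd1 c a • φ a = (∑ a with φ a = m, bd1 c a) • m := by
    rw [Finset.sum_smul]
    refine Finset.sum_congr rfl fun a ha => ?_
    rw [(Finset.mem_filter.1 ha).2]
  rw [h1]
  set c' : ι → ι → ℤ := fun u v => if φ u = m ∧ φ v = m then c u v else 0 with hc'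
  have h2 : ∑ a with φ a = m, bd1 c a = ∑ a, bd1 c' a := by
    rw [Finset.sum_filter]
    refine Finset.sum_congr rfl fun a _ => ?_
    split_ifs with ha
    · rw [bd1_apply, bd1_apply]
      refine Finset.sum_congr rfl fun u _ => ?_
      by_cases hu : φ u = m
      · simp [hc', ha, hu]
      · have : c u a = 0 := hc.2 u a fun hm => hu ((h u a hm).trans ha)
        simp [this, hc']
    · rw [bd1_apply]
      simp [hc', ha]
  rw [h2, sum_bd1, zero_smul]
  intro u v
  simp only [hc']
  rw [hc.1 u v]
  by_cases h3 : φ u = m <;> by_cases h4 : φ v = m <;> simp [h3, h4]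

/-- The class in the cokernel of `∂₁` of a point outside the neighbourhoods of the ribbon
singularities. -/
noncomputable def potential (a : ι) : (Z →₀ ℤ) ⧸ LinearMap.range O.cell1 :=
  if h : ∃ p, ({a} : Finset ι) ∈ F.pieceFaces p then Submodule.Quotient.mk (F.rho h.choose) else 0

/-- The telescoped formula for the boundary of the core: the last rectangle and the 0-handle to
which it is attached differ by ± that boundary. -/
theorem mk_rho_last (j : J) :
    (Submodule.Quotient.mk (F.rhoR j (Fin.last _)) : (Z →₀ ℤ) ⧸ LinearMap.range O.cell1) =
      Submodule.Quotient.mk (Finsupp.single (F.z j (Fin.last _)) 1) := by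
  symm
  rw [Submodule.Quotient.eq]
  refine ⟨((O.ε j : ℤ) * (-1) ^ F.n j) • Finsupp.single j 1, ?_⟩
  rw [map_smul, O.cell1_single, smul_smul]
  have hε : (O.ε j : ℤ) * (O.ε j : ℤ) = 1 := by
    rcases Int.units_eq_one_or (O.ε j) with h | h <;> simp [h]
  have hn : ((-1 : ℤ) ^ F.n j) * (-1) ^ F.n j = 1 := by
    rw [← mul_pow]; simp
  have : ((O.ε j : ℤ) * (-1) ^ F.n j) * ((O.ε j : ℤ) * (-1) ^ F.n j) = 1 := by
    linear_combination ((-1 : ℤ) ^ F.n j * (-1) ^ F.n j) * hε + hn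
  rw [this, one_smul]

/-- Outside the neighbourhoods two pieces can share a point only on an attaching arc. At an initial
arc the classes agree by definition, at a final arc modulo the image of ∂₁. So the choice of piece
in `potential` is harmless. -/
theorem mk_rho_eq {a : ι} (ha : L.Outside a) {p p' : F.Piece}
    (hp : ({a} : Finset ι) ∈ F.pieceFaces p) (hp' : ({a} : Finset ι) ∈ F.pieceFaces p') :
    (Submodule.Quotient.mk (F.rho p) : (Z →₀ ℤ) ⧸ LinearMap.range O.cell1) =
      Submodule.Quotient.mk (F.rho p') := by
  by_cases hne : p = p'
  · rw [hne]
  obtain ⟨j, k, hk⟩ := F.exists_A_of_mem hne hp hp'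
  have hak := F.vertex_A.1 hk
  have key : ∀ p, ({a} : Finset ι) ∈ F.pieceFaces p →
      (Submodule.Quotient.mk (F.rho p) : (Z →₀ ℤ) ⧸ LinearMap.range O.cell1) =
        Submodule.Quotient.mk (Finsupp.single (F.z j k) 1) := by
    rintro (i | ⟨j', s⟩) h
    · rw [F.eq_of_mem_A_m hak h]
      rfl
    · obtain ⟨s', e, hs'⟩ := F.eq_of_mem_A_R hak h
      obtain ⟨rfl, h2⟩ := Sigma.mk.inj_iff.1 e
      obtain rfl := eq_of_heq h2
      rcases RibbonSurface.fin_cases_A k with rfl | ⟨r, rfl⟩ | rfl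
      · rcases hs' with h | h
        · have hs0 : s = 0 := by
            apply Fin.castSucc_injective
            exact h.symm.trans Fin.castSucc_zero.symm
          rw [hs0]
          rfl
        · exact absurd h.symm (Fin.succ_ne_zero s)
      · exact absurd (L.arc_mem_openNbhd (r := ⟨_, r⟩) hak) (ha _)
      · rcases hs' with h | h
        · exact absurd h.symm (Fin.castSucc_lt_last s).ne
        · have hs0 : s = Fin.last _ := by
            apply Fin.succ_injective
            exact h.symm.trans (Fin.succ_last _).symm
          rw [hs0]
          exact mk_rho_last O _
  rw [key p hp, key p' hp']

theorem potential_eq {a : ι} (ha : L.Outside a) {p : F.Piece}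
    (hp : ({a} : Finset ι) ∈ F.pieceFaces p) :
    potential O a = Submodule.Quotient.mk (F.rho p) := by
  have h : ∃ p, ({a} : Finset ι) ∈ F.pieceFaces p := ⟨p, hp⟩
  rw [potential, dif_pos h]
  exact L.mk_rho_eq O ha h.choose_spec hp

theorem potential_eq_of_edge {u v : ι}
    (h : ({u, v} : Finset ι) ∈ F.space \ ⋃ r, L.openNbhd r) :
    potential O u = potential O v := by
  obtain ⟨p, hp⟩ := F.mem_space.1 h.1
  have hu : L.Outside u := fun r hr =>
    h.2 (Set.mem_iUnion.2 ⟨r, L.edge_mem_openNbhd hr h.1⟩)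
  have hv : L.Outside v := fun r hr => by
    have h1 := h.1
    have h2 := h.2
    rw [Finset.pair_comm] at h1 h2
    exact h2 (Set.mem_iUnion.2 ⟨r, L.edge_mem_openNbhd hr h1⟩)
  have hs := F.pieceFaces_subcomplex p
  rw [L.potential_eq O hu (hs.left_mem hp), L.potential_eq O hv (hs.right_mem hp)]

/-- The total potential of a 0-chain. -/
noncomputable def totalPotential : (ι → ℤ) →ₗ[ℤ] (Z →₀ ℤ) ⧸ LinearMap.range O.cell1 :=
  ∑ a, (LinearMap.toSpanSingleton ℤ _ (potential O a)) ∘ₗ LinearMap.proj a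

theorem totalPotential_apply (f : ι → ℤ) : totalPotential O f = ∑ a, f a • potential O a := by
  simp [totalPotential]

theorem totalPotential_vert (a : ι) : totalPotential O (vert a) = potential O a := by
  rw [totalPotential_apply, Finset.sum_eq_single a]
  · simp [vert]
  · intro u _ hu
    simp [vert, hu]
  · simp

/-- Two ends lie in the 0-handle and one in each adjacent rectangle; the reflection rule says that
the classes of the rectangles add up to twice that of the 0-handle. -/
theorem totalPotential_ell (r : F.Ribbon) : totalPotential O (bd1 (L.ell r)) = 0 := by
  obtain ⟨b, a, x, y, hb, ha, hx, hy, he⟩ := L.bd1_ell r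
  have hTb := (singleton_mem_pathFaces (L.T_arc r).1.2).2 hb
  have hTa := (singleton_mem_pathFaces (L.T_arc r).2.2).2 ha
  have hM : ∀ {x : ι}, ({x} : Finset ι) ∈ bdry (L.M r) →
      ({x} : Finset ι) ∈ F.pieceFaces (.inl (F.disk r)) := fun h =>
    (L.M_sub r (bdry_subset (L.M_disk _).surface.subcomplex h)).1
  rw [he, map_sub, map_sub, map_add]
  simp only [totalPotential_vert]
  rw [L.potential_eq O (L.outside_of_frontier (Or.inl (Or.inl hx))) (hM hx),
    L.potential_eq O (L.outside_of_frontier (Or.inl (Or.inl hy))) (hM hy),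
    L.potential_eq O (L.outside_of_frontier (Or.inl (Or.inr hTb)))
      (p := .inr ⟨r.1, r.2.castSucc⟩) ((L.Qb_sub r).2 (L.Tb_sub _ hTb)),
    L.potential_eq O (L.outside_of_frontier (Or.inr hTa))
      (p := .inr ⟨r.1, r.2.succ⟩) ((L.Qa_sub r).2 (L.Ta_sub _ hTa))]
  have := F.rhoR_succ r.1 r.2
  rw [← Submodule.Quotient.mk_add, ← Submodule.Quotient.mk_sub, ← Submodule.Quotient.mk_sub]
  rw [Submodule.Quotient.mk_eq_zero]
  have e : F.rho (.inl (F.disk r)) + F.rho (.inl (F.disk r)) - F.rho (.inr ⟨r.1, r.2.castSucc⟩) -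
      F.rho (.inr ⟨r.1, r.2.succ⟩) = 0 := by
    simp only [RibbonSurface.rho]
    rw [this]
    module
  rw [e]
  exact zero_mem _

/-- The boundary of a disoriented chain has no potential. -/
theorem totalPotential_bd1 {c : ι → ι → ℤ} (hc : c ∈ L.disorientedChains F.space) :
    totalPotential O (bd1 c) = 0 := by
  have : L.disorientedChains F.space ≤ LinearMap.ker (totalPotential O ∘ₗ bd1) := by
    refine sup_le (Submodule.span_le.2 ?_) fun c hc => ?_
    · rintro _ ⟨r, rfl⟩
      exact LinearMap.mem_ker.2 (L.totalPotential_ell O r)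
    · refine LinearMap.mem_ker.2 ?_
      rw [LinearMap.comp_apply, totalPotential_apply]
      exact sum_bd1_smul_eq_zero hc _ fun u v => L.potential_eq_of_edge O
  exact LinearMap.mem_ker.1 (this hc)

end LocalCharts

end

section

open scoped Classical

set_option linter.unusedSectionVars false

variable {ι : Type} [Fintype ι] [DecidableEq ι]

/-! ### Virtual bands -/

namespace VirtualBands

variable {K : Triangulation ι} {Z J V : Type} {F : RibbonSurface K Z J} {L : LocalCharts F}
  (B : VirtualBands F L V)

theorem W_subcomplex (v : V) : IsSubcomplex (B.W v) := (B.W_disk v).surface.subcomplex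

theorem subset_space : F.space ⊆ B.space := Set.subset_union_left

theorem W_subset_space (v : V) : B.W v ⊆ B.space :=
  (Set.subset_iUnion B.W v).trans Set.subset_union_right

theorem src_sub_W (v : V) : pathFaces (B.src v) ⊆ B.W v := fun _ h =>
  bdry_subset (B.W_subcomplex v) (B.src_sub v h).1

theorem tgt_sub_W (v : V) : pathFaces (B.tgt v) ⊆ B.W v := fun _ h =>
  bdry_subset (B.W_subcomplex v) (B.tgt_sub v h).1

theorem src_sub_space (v : V) : pathFaces (B.src v) ⊆ F.space := fun _ h =>
  bdry_subset F.space_subcomplex (B.src_sub v h).2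

theorem tgt_sub_space (v : V) : pathFaces (B.tgt v) ⊆ F.space := fun _ h =>
  bdry_subset F.space_subcomplex (B.tgt_sub v h).2

theorem vertex_src {v : V} {a : ι} : ({a} : Finset ι) ∈ pathFaces (B.src v) ↔ a ∈ B.src v :=
  singleton_mem_pathFaces (B.arcs v).1.2

theorem vertex_tgt {v : V} {a : ι} : ({a} : Finset ι) ∈ pathFaces (B.tgt v) ↔ a ∈ B.tgt v :=
  singleton_mem_pathFaces (B.arcs v).2.2

theorem mem_arc {v : V} {s : Finset ι} (h : s ∈ B.W v) (h' : s ∈ F.space) :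
    s ∈ pathFaces (B.src v) ∪ pathFaces (B.tgt v) := B.W_inter v ▸ ⟨h, h'⟩

theorem vertex_mem_arc {v : V} {a : ι} (h : ({a} : Finset ι) ∈ B.W v)
    (h' : ({a} : Finset ι) ∈ F.space) : a ∈ B.src v ∨ a ∈ B.tgt v := by
  rcases B.mem_arc h h' with h | h
  · exact Or.inl (B.vertex_src.1 h)
  · exact Or.inr (B.vertex_tgt.1 h)

theorem notMem_openNbhd {v : V} {s : Finset ι} (h : s ∈ B.W v) (r : F.Ribbon) :
    s ∉ L.openNbhd r := fun h' => by
  have : s ∈ B.W v ∩ L.nbhd r := ⟨h, h'.1⟩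
  rw [B.W_nbhd] at this
  exact this

theorem outside_of_mem_W {v : V} {a : ι} (h : ({a} : Finset ι) ∈ B.W v) : L.Outside a :=
  B.notMem_openNbhd h

theorem eq_of_mem_W {v v' : V} {s : Finset ι} (h : s ∈ B.W v) (h' : s ∈ B.W v') : v = v' := by
  by_contra hne
  have : s ∈ B.W v ∩ B.W v' := ⟨h, h'⟩
  rw [B.W_disj v v' hne] at this
  exact this

theorem W_subset_compl (v : V) : B.W v ⊆ B.space \ ⋃ r, L.openNbhd r := fun _ h =>
  ⟨B.W_subset_space v h, fun h' => by
    obtain ⟨r, hr⟩ := Set.mem_iUnion.1 h'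
    exact B.notMem_openNbhd h r hr⟩

theorem arcs_subset_compl (v : V) :
    pathFaces (B.src v) ∪ pathFaces (B.tgt v) ⊆ F.space \ ⋃ r, L.openNbhd r := by
  rintro s (h | h)
  · exact ⟨B.src_sub_space v h, (B.W_subset_compl v (B.src_sub_W v h)).2⟩
  · exact ⟨B.tgt_sub_space v h, (B.W_subset_compl v (B.tgt_sub_W v h)).2⟩

/-- Edges of a band that leave its initial arc are not in `F_r`, since the band meets `F_r` only
along two disjoint arcs. -/
theorem pass_eq_zero_of_space (v : V) {c : ι → ι → ℤ} (hc : c ∈ Chain1 F.space) :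
    B.pass v c = 0 := by
  refine flow_eq_zero_of_forall fun u w hu hw hW => hc.2 u w fun hF => ?_
  rcases B.mem_arc hW hF with h | h
  · exact hw (mem_of_mem_pathFaces h (by simp))
  · exact B.arcs_disj v hu (mem_of_mem_pathFaces h (by simp))

theorem pass_eq_zero_of_ne {v v' : V} (h : v ≠ v') {c : ι → ι → ℤ} (hc : c ∈ Chain1 (B.W v')) :
    B.pass v c = 0 :=
  flow_eq_zero_of_forall fun _ _ _ _ hW => hc.2 _ _ fun hF => h (B.eq_of_mem_W hW hF)

theorem pass_of_mem_W {v : V} {c : ι → ι → ℤ} (hc : c ∈ Chain1 (B.W v)) :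
    B.pass v c = -∑ u, if u ∈ B.src v then bd1 c u else 0 := flow_eq_neg_sum_bd1 hc

theorem boundary_apply [Fintype V] (h : L.DH1 B.space) (v : V) :
    B.boundary h v = B.passH1 v h := by
  simp only [boundary, LinearMap.comp_apply, LinearMap.sum_apply, Finsupp.lsingle_apply]
  rw [Finsupp.finsetSum_apply, Finset.sum_eq_single v]
  · simp
  · intro v' _ h
    simp [h]
  · simp

theorem boundary_cls [Fintype V] (z : L.disorientedCycles B.space) (v : V) :
    B.boundary (L.cls B.space z) v = B.pass v z := by
  rw [boundary_apply, LocalCharts.cls_coe]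
  rfl

/-- Cutting a chain on the banded surface into its part on the ribbon surface and its parts on the
bands. -/
theorem sub_sum_restrict1_mem [Fintype V] {X : Faces ι} {c : ι → ι → ℤ}
    (hc : c ∈ Chain1 (B.space \ X)) :
    c - ∑ v, restrict1 (B.W v \ F.space) c ∈ Chain1 (F.space \ X) := by
  refine ⟨fun u w => ?_, fun u w h => ?_⟩
  · have h1 : ∀ v, restrict1 (B.W v \ F.space) c u w = -restrict1 (B.W v \ F.space) c w u :=
      fun v => (restrict1_mem _ hc.1).1 u w
    simp only [Pi.sub_apply, Finset.sum_apply]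
    rw [hc.1 u w, Finset.sum_congr rfl fun v _ => h1 v, Finset.sum_neg_distrib]
    ring
  · simp only [Pi.sub_apply, Finset.sum_apply, restrict1_apply]
    by_cases h0 : c u w = 0
    · simp [h0]
    have hG : ({u, w} : Finset ι) ∈ B.space \ X := by
      by_contra hn
      exact h0 (hc.2 u w hn)
    have hF : ({u, w} : Finset ι) ∉ F.space := fun hF => h ⟨hF, hG.2⟩
    obtain ⟨v, hv⟩ : ∃ v, ({u, w} : Finset ι) ∈ B.W v := by
      rcases hG.1 with h' | h'
      · exact absurd h' hF
      · exact Set.mem_iUnion.1 h'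
    rw [Finset.sum_eq_single v, if_pos ⟨hv, hF⟩, sub_self]
    · intro v' _ hne
      exact if_neg fun h' => hne (B.eq_of_mem_W h'.1 hv)
    · simp

theorem sub_sum_restrict_mem [Fintype V] {t : ι → ι → ι → ℤ} (ht : t ∈ Chain2 B.space) :
    t - ∑ v, restrict t (B.W v \ F.space) ∈ Chain2 F.space := by
  have hr := fun v => restrict_mem ht (B.W v \ F.space)
  have hs := Submodule.sum_mem (Chain2 B.space) fun v (_ : v ∈ Finset.univ) =>
    Chain2_mono Set.inter_subset_left (hr v)
  have hd := sub_mem ht hs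
  refine ⟨hd.1, hd.2.1, fun u w x h => ?_⟩
  simp only [Pi.sub_apply, Finset.sum_apply, restrict]
  by_cases h0 : t u w x = 0
  · simp [h0]
  have hG : ({u, w, x} : Finset ι) ∈ B.space := by
    by_contra hn
    exact h0 (ht.2.2 u w x hn)
  obtain ⟨v, hv⟩ : ∃ v, ({u, w, x} : Finset ι) ∈ B.W v := by
    rcases hG with h' | h'
    · exact absurd h' h
    · exact Set.mem_iUnion.1 h'
  rw [Finset.sum_eq_single v, if_pos ⟨hv, h⟩, sub_self]
  · intro v' _ hne
    exact if_neg fun h' => hne (B.eq_of_mem_W h'.1 hv)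
  · simp

/-- A cycle on the ribbon surface that bounds on the banded surface bounds on the ribbon surface. -/
theorem mem_B1_of_mem_B1_space [Fintype V] {b : ι → ι → ℤ} (hb : b ∈ Chain1 F.space)
    (h : b ∈ B1 B.space) : b ∈ B1 F.space := by
  obtain ⟨t, ht, rfl⟩ := h
  have hF := B.sub_sum_restrict_mem ht
  have hW : ∀ v, restrict t (B.W v \ F.space) ∈ Chain2 (B.W v) := fun v =>
    Chain2_mono (Set.inter_subset_right.trans Set.sdiff_subset) (restrict_mem ht _)
  -- The boundary of the band part must vanish inside the band, so it is a cycle on the two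
  -- attaching arcs and therefore zero. The triangles in the bands can be discarded.
  have h0 : ∀ v, bd2 (restrict t (B.W v \ F.space)) = 0 := by
    intro v
    have hz := bd2_mem_Z1 (B.W_subcomplex v) (hW v)
    refine eq_zero_of_mem_Chain1_pathFaces_union (B.arcs v).1.1 (B.arcs v).2.1 (B.arcs_disj v)
      ⟨hz.1.1, fun u w huw => ?_⟩ hz.2
    by_cases hv : ({u, w} : Finset ι) ∈ B.W v
    swap
    · exact hz.1.2 u w hv
    have hn : ({u, w} : Finset ι) ∉ F.space := fun h' => huw (B.mem_arc hv h')
    have h1 := hb.2 u w hn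
    have h2 := (bd2_mem_Z1 F.space_subcomplex hF).1.2 u w hn
    rw [map_sub, map_sum, Pi.sub_apply, Pi.sub_apply, h1, Finset.sum_apply, Finset.sum_apply,
      Finset.sum_eq_single v] at h2
    · linarith
    · intro v' _ hne
      exact (bd2_mem_Z1 (B.W_subcomplex v') (hW v')).1.2 u w fun h' => hne (B.eq_of_mem_W h' hv)
    · simp
  refine ⟨_, hF, ?_⟩
  rw [map_sub, map_sum, Finset.sum_eq_zero fun v _ => h0 v, sub_zero]

theorem inclDH1_injective [Fintype V] : Function.Injective (L.inclDH1 B.subset_space) := by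
  rw [injective_iff_map_eq_zero]
  intro h h0
  obtain ⟨z, rfl⟩ := L.cls_surjective _ h
  rw [LocalCharts.inclDH1_cls, LocalCharts.cls_eq_zero_iff] at h0
  exact L.cls_eq_zero_iff.2 (B.mem_B1_of_mem_B1_space z.2.1.1 h0)

/-- Chosen ends of the virtual bands, and pieces of the cut surface that contain them. -/
structure EndPoints where
  s : V → ι
  t : V → ι
  sp : V → F.Piece
  tp : V → F.Piece
  s_mem : ∀ v, s v ∈ B.src v
  t_mem : ∀ v, t v ∈ B.tgt v
  s_piece : ∀ v, ({s v} : Finset ι) ∈ F.pieceFaces (sp v)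
  t_piece : ∀ v, ({t v} : Finset ι) ∈ F.pieceFaces (tp v)

theorem exists_endPoints : Nonempty B.EndPoints := by
  have hs : ∀ v, ∃ a p, a ∈ B.src v ∧ ({a} : Finset ι) ∈ F.pieceFaces p := by
    intro v
    obtain ⟨a, -, ha⟩ := LocalCharts.exists_head (B.arcs v).1
    obtain ⟨p, hp⟩ := F.mem_space.1 (B.src_sub_space v (B.vertex_src.2 ha))
    exact ⟨a, p, ha, hp⟩
  have ht : ∀ v, ∃ a p, a ∈ B.tgt v ∧ ({a} : Finset ι) ∈ F.pieceFaces p := by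
    intro v
    obtain ⟨a, -, ha⟩ := LocalCharts.exists_head (B.arcs v).2
    obtain ⟨p, hp⟩ := F.mem_space.1 (B.tgt_sub_space v (B.vertex_tgt.2 ha))
    exact ⟨a, p, ha, hp⟩
  choose s sp hs hsp using hs
  choose t tp ht htp using ht
  exact ⟨⟨s, t, sp, tp, hs, ht, hsp, htp⟩⟩

theorem exists_endPoints_of_isStar {i₀ : Z} {σ : V ≃ {i : Z // i ≠ i₀}} (h : B.IsStar i₀ σ) :
    ∃ e : B.EndPoints, (∀ v, e.sp v = .inl (σ v)) ∧ ∀ v, e.tp v = .inl i₀ := by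
  have hs : ∀ v, ∃ a, a ∈ B.src v := fun v => by
    obtain ⟨a, -, ha⟩ := LocalCharts.exists_head (B.arcs v).1
    exact ⟨a, ha⟩
  have ht : ∀ v, ∃ a, a ∈ B.tgt v := fun v => by
    obtain ⟨a, -, ha⟩ := LocalCharts.exists_head (B.arcs v).2
    exact ⟨a, ha⟩
  choose s hs using hs
  choose t ht using ht
  exact ⟨⟨s, t, fun v => .inl (σ v), fun _ => .inl i₀, hs, ht,
    fun v => (h v).1 (B.vertex_src.2 (hs v)), fun v => (h v).2 (B.vertex_tgt.2 (ht v))⟩,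
    fun _ => rfl, fun _ => rfl⟩

/-! ### Splitting cycles on the banded surface along the virtual bands -/

namespace EndPoints

variable {B} (e : B.EndPoints)

theorem s_W (v : V) : ({e.s v} : Finset ι) ∈ B.W v := B.src_sub_W v (B.vertex_src.2 (e.s_mem v))

theorem t_W (v : V) : ({e.t v} : Finset ι) ∈ B.W v := B.tgt_sub_W v (B.vertex_tgt.2 (e.t_mem v))

theorem s_outside (v : V) : L.Outside (e.s v) := B.outside_of_mem_W (e.s_W v)

theorem t_outside (v : V) : L.Outside (e.t v) := B.outside_of_mem_W (e.t_W v)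

theorem s_notMem (v : V) : e.s v ∉ B.tgt v := B.arcs_disj v (e.s_mem v)

theorem t_notMem (v : V) : e.t v ∉ B.src v := fun h => B.arcs_disj v h (e.t_mem v)

/-- The difference of the classes of the two ends of a virtual band. -/
noncomputable def ends : (V →₀ ℤ) →ₗ[ℤ] (Z →₀ ℤ) :=
  Finsupp.linearCombination ℤ fun v => F.rho (e.sp v) - F.rho (e.tp v)

theorem ends_single (v : V) : e.ends (Finsupp.single v 1) = F.rho (e.sp v) - F.rho (e.tp v) := by
  rw [ends, Finsupp.linearCombination_single, one_smul]

theorem ends_eq_sum [Fintype V] (y : V →₀ ℤ) :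
    e.ends y = ∑ v, y v • (F.rho (e.sp v) - F.rho (e.tp v)) := by
  rw [ends, Finsupp.linearCombination_apply, Finsupp.sum_fintype _ _ (by simp)]

/-- A disoriented cycle on the banded surface is a disoriented chain on the ribbon surface plus
chains running over the bands. -/
theorem exists_splitting [Fintype V] {z : ι → ι → ℤ} (hz : z ∈ L.disorientedCycles B.space) :
    ∃ z' ∈ L.disorientedChains F.space, ∃ u : V → ι → ι → ℤ, (∀ v, u v ∈ Chain1 (B.W v)) ∧
      z = z' + ∑ v, u v ∧ ∀ v, bd1 (u v) = B.pass v z • (vert (e.t v) - vert (e.s v)) := by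
  obtain ⟨l, hl, a, ha, hza⟩ := Submodule.mem_sup.1 (L.mem_disorientedCycles.1 hz).2
  set w : V → ι → ι → ℤ := fun v => restrict1 (B.W v \ F.space) a with hw
  have hwW : ∀ v, w v ∈ Chain1 (B.W v) := fun v =>
    Chain1_mono Set.sdiff_subset (restrict1_mem _ ha.1)
  have ha' := B.sub_sum_restrict1_mem ha
  have hz' : l + (a - ∑ v, w v) ∈ L.disorientedChains F.space :=
    add_mem (Submodule.mem_sup_left hl) (Submodule.mem_sup_right ha')
  have hz'F := L.disorientedChains_le hz'
  set z₀ := l + (a - ∑ v, w v) with hz₀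
  have hsum : z = z₀ + ∑ v, w v := by rw [← hza, hz₀]; abel
  have hbz : bd1 z₀ + ∑ v, bd1 (w v) = 0 := by
    rw [← map_sum, ← map_add, ← hsum]
    exact (L.mem_disorientedCycles.1 hz).1.2
  have hsupp : ∀ v x, x ∉ B.src v → x ∉ B.tgt v → bd1 (w v) x = 0 := by
    intro v x hs ht
    by_cases hx : ({x} : Finset ι) ∈ B.W v
    swap
    · exact Chain1_eq_zero_of_forall (hwW v) fun u h => hx ((B.W_subcomplex v).right_mem h)
    have hxF : ({x} : Finset ι) ∉ F.space := fun h => (B.vertex_mem_arc hx h).elim hs ht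
    have h1 := congrFun hbz x
    rwa [Pi.add_apply, Finset.sum_apply, Finset.sum_eq_single v,
      Chain1_eq_zero_of_forall hz'F fun u h => hxF (F.space_subcomplex.right_mem h), zero_add] at h1
    · intro v' _ hne
      exact Chain1_eq_zero_of_forall (hwW v') fun u h =>
        hne (B.eq_of_mem_W ((B.W_subcomplex v').right_mem h) hx)
    · simp
  have hpass : ∀ v, B.pass v z = B.pass v (w v) := by
    intro v
    rw [hsum, map_add, B.pass_eq_zero_of_space v hz'F, map_sum, zero_add]
    refine Finset.sum_eq_single v (fun v' _ hne => ?_) (by simp)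
    exact B.pass_eq_zero_of_ne hne.symm (hwW v')
  have hsrc : ∀ v, (∑ u, if u ∈ B.src v then bd1 (w v) u else 0) = -B.pass v z := by
    intro v
    rw [hpass, B.pass_of_mem_W (hwW v), neg_neg]
  have htgt : ∀ v, (∑ u, if u ∈ B.tgt v then bd1 (w v) u else 0) = B.pass v z := by
    intro v
    have h1 : (∑ u, if u ∈ B.src v then bd1 (w v) u else 0) +
        (∑ u, if u ∈ B.tgt v then bd1 (w v) u else 0) = 0 := by
      refine Eq.trans ?_ (sum_bd1 (hwW v).1)
      rw [← Finset.sum_add_distrib]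
      refine Finset.sum_congr rfl fun x _ => ?_
      by_cases hs : x ∈ B.src v
      · have ht : x ∉ B.tgt v := fun ht => B.arcs_disj v hs ht
        simp [hs, ht]
      · by_cases ht : x ∈ B.tgt v
        · simp [hs, ht]
        · simp [hs, ht, hsupp v x hs ht]
    rw [hsrc] at h1
    linarith
  -- A correction along the attaching arcs concentrates the boundary of the band part at the two
  -- chosen ends. It lies in `F_r`, away from the ribbon singularities, so it can be moved to the
  -- other summand.
  have hex : ∀ v, ∃ c ∈ Chain1 (pathFaces (B.src v) ∪ pathFaces (B.tgt v)),
      bd1 c = bd1 (w v) - B.pass v z • (vert (e.t v) - vert (e.s v)) := by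
    intro v
    have hsum' : ∀ A : List ι, (∑ u, if u ∈ A then
        (bd1 (w v) - B.pass v z • (vert (e.t v) - vert (e.s v))) u else 0) =
        (∑ u, if u ∈ A then bd1 (w v) u else 0) - B.pass v z *
          ((if e.t v ∈ A then 1 else 0) - if e.s v ∈ A then 1 else 0) := by
      intro A
      rw [← LocalCharts.sum_vert_sub, Finset.mul_sum, ← Finset.sum_sub_distrib]
      refine Finset.sum_congr rfl fun u _ => ?_
      split_ifs <;> simp
    refine exists_chain_on_arcs (B.arcs_disj v) (fun x hs ht => ?_) ?_ ?_
    · have h1 : x ≠ e.t v := fun h => ht (h ▸ e.t_mem v)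
      have h2 : x ≠ e.s v := fun h => hs (h ▸ e.s_mem v)
      simp [hsupp v x hs ht, vert, h1, h2]
    · rw [hsum', hsrc, if_neg (e.t_notMem v), if_pos (e.s_mem v)]
      ring
    · rw [hsum', htgt, if_neg (e.s_notMem v), if_pos (e.t_mem v)]
      ring
  choose c hc hbc using hex
  refine ⟨z₀ + ∑ v, c v, add_mem hz' (Submodule.sum_mem _ fun v _ =>
    L.mem_disorientedChains (Chain1_mono (B.arcs_subset_compl v) (hc v))), fun v => w v - c v,
    fun v => sub_mem (hwW v) (Chain1_mono (Set.union_subset (B.src_sub_W v) (B.tgt_sub_W v)) (hc v)),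
    ?_, fun v => ?_⟩
  · rw [Finset.sum_sub_distrib, hsum]
    abel
  · rw [map_sub, hbc]
    abel

theorem bd1_splitting [Fintype V] {z z' : ι → ι → ℤ} {u : V → ι → ι → ℤ} (hz : bd1 z = 0)
    (h : z = z' + ∑ v, u v)
    (hu : ∀ v, bd1 (u v) = B.pass v z • (vert (e.t v) - vert (e.s v))) :
    bd1 z' = ∑ v, B.pass v z • (vert (e.s v) - vert (e.t v)) := by
  have h1 : bd1 z = bd1 z' + ∑ v, bd1 (u v) := by
    conv_lhs => rw [h]
    rw [map_add, map_sum]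
  rw [hz] at h1
  rw [eq_neg_of_add_eq_zero_left h1.symm, ← Finset.sum_neg_distrib]
  refine Finset.sum_congr rfl fun v _ => ?_
  rw [hu]
  module

-- If no band is passed over algebraically, the normalized band parts are cycles in disks and bound,
-- so the class is already carried by `F_r`.
include e in
theorem range_inclDH1 [Fintype V] :
    LinearMap.range (L.inclDH1 B.subset_space) = LinearMap.ker B.boundary := by
  ext h
  constructor
  · rintro ⟨h, rfl⟩
    obtain ⟨z, rfl⟩ := L.cls_surjective _ h
    refine LinearMap.mem_ker.2 (Finsupp.ext fun v => ?_)
    rw [LocalCharts.inclDH1_cls, boundary_cls]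
    exact B.pass_eq_zero_of_space v z.2.1.1
  · intro h0
    obtain ⟨z, rfl⟩ := L.cls_surjective _ h
    have hp : ∀ v, B.pass v z = 0 := fun v => by
      rw [← B.boundary_cls, LinearMap.mem_ker.1 h0, Finsupp.zero_apply]
    obtain ⟨z', hz', u, hu, hzu, hbu⟩ := e.exists_splitting z.2
    have hb := e.bd1_splitting z.2.1.2 hzu hbu
    simp only [hp, zero_smul, Finset.sum_const_zero] at hb hbu
    refine ⟨L.cls _ ⟨z', ⟨L.disorientedChains_le hz', hb⟩, hz'⟩, ?_⟩
    rw [LocalCharts.inclDH1_cls, eq_comm, LocalCharts.cls_eq_iff]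
    change (z : ι → ι → ℤ) - z' ∈ B1 B.space
    rw [sub_eq_iff_eq_add'.2 hzu]
    exact Submodule.sum_mem _ fun v _ => B1_mono (B.W_subset_space v)
      ((B.W_disk v).Z1_le_B1 ⟨hu v, hbu v⟩)

variable {D : Type} {T : TwoHandles F D} (O : Disorientation T) [Fintype J] [Fintype Z]

/-- The part of the cycle on `F_r` is a disoriented chain whose boundary consists of the ends of the
bands passed over. Its total potential is zero, and that potential is the class of the left-hand
side modulo the image of ∂₁. -/
theorem ends_boundary_mem [Fintype V] (h : L.DH1 B.space) :
    e.ends (B.boundary h) ∈ LinearMap.range O.cell1 := by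
  obtain ⟨z, rfl⟩ := L.cls_surjective _ h
  obtain ⟨z', hz', u, hu, hzu, hbu⟩ := e.exists_splitting z.2
  have h0 := L.totalPotential_bd1 O hz'
  rw [e.bd1_splitting z.2.1.2 hzu hbu, map_sum] at h0
  rw [← Submodule.Quotient.mk_eq_zero, ← h0, e.ends_eq_sum, ← Submodule.mkQ_apply, map_sum]
  refine Finset.sum_congr rfl fun v _ => ?_
  rw [boundary_cls, map_smul, map_smul, map_sub, map_sub, LocalCharts.totalPotential_vert,
    LocalCharts.totalPotential_vert, L.potential_eq O (e.s_outside v) (e.s_piece v),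
    L.potential_eq O (e.t_outside v) (e.t_piece v)]
  rfl

/-- Run `y v` times over each band, continue inside `F_r` from its ends to their classes on the base
points, and close up with the realized core of `x`. The hypothesis makes the remaining boundary
cancel. -/
theorem exists_boundary_eq [Fintype V] (x : J →₀ ℤ) (y : V →₀ ℤ) (h : O.cell1 x = e.ends y) :
    ∃ a : L.DH1 B.space, B.boundary a = y := by
  have hu : ∀ v, ∃ c ∈ Chain1 (B.W v), bd1 c = vert (e.t v) - vert (e.s v) := fun v =>
    ((B.W_disk v).linked (e.s_W v) (e.t_W v)).exists_chain
  choose u hu hbu using hu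
  choose cs hcs hbcs _ using fun v => L.exists_chain_piece O _ (e.s_piece v) (e.s_outside v)
  choose ct hct hbct _ using fun v => L.exists_chain_piece O _ (e.t_piece v) (e.t_outside v)
  obtain ⟨C, hC, hbC, -⟩ := L.exists_chain_core O x
  have hF : C + ∑ v, y v • (cs v - ct v) ∈ L.disorientedChains F.space :=
    add_mem hC (Submodule.sum_mem _ fun v _ =>
      Submodule.smul_mem _ _ (sub_mem (hcs v) (hct v)))
  have hW : ∀ v, y v • u v ∈ Chain1 (B.W v) := fun v => Submodule.smul_mem _ _ (hu v)
  set z := (C + ∑ v, y v • (cs v - ct v)) + ∑ v, y v • u v with hz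
  have hbz : bd1 z = 0 := by
    rw [hz, map_add, map_add, map_sum, map_sum, hbC, h, e.ends_eq_sum, map_sum, add_assoc,
      ← Finset.sum_add_distrib, ← Finset.sum_add_distrib]
    refine Finset.sum_eq_zero fun v _ => ?_
    rw [map_smul, map_smul, map_smul, map_sub, map_sub, hbcs, hbct, hbu]
    module
  have hzm : z ∈ L.disorientedCycles B.space := by
    refine ⟨⟨add_mem (Chain1_mono B.subset_space (L.disorientedChains_le hF))
      (Submodule.sum_mem _ fun v _ => Chain1_mono (B.W_subset_space v) (hW v)), hbz⟩,
      add_mem (L.disorientedChains_mono B.subset_space hF) (Submodule.sum_mem _ fun v _ =>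
        L.mem_disorientedChains (Chain1_mono (B.W_subset_compl v) (hW v)))⟩
  refine ⟨L.cls _ ⟨z, hzm⟩, Finsupp.ext fun v => ?_⟩
  rw [boundary_cls]
  change B.pass v z = y v
  rw [hz, map_add, B.pass_eq_zero_of_space v (L.disorientedChains_le hF), zero_add, map_sum,
    Finset.sum_eq_single v (fun v' _ hne => B.pass_eq_zero_of_ne hne.symm (hW v')) (by simp),
    map_smul, B.pass_of_mem_W (hu v), hbu, LocalCharts.sum_vert_sub, if_neg (e.t_notMem v),
    if_pos (e.s_mem v)]
  simp

end EndPoints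

end VirtualBands

end

section

open scoped Classical

set_option linter.unusedSectionVars false

variable {ι : Type} [Fintype ι] [DecidableEq ι]

namespace VirtualBands

variable {K : Triangulation ι} {Z J V D : Type} {F : RibbonSurface K Z J} {L : LocalCharts F}
  {B : VirtualBands F L V} {T : TwoHandles F D} (O : Disorientation T) [Fintype J] [Fintype Z]

/-! ### Bands attached to 0-handles -/

variable (B) in
/-- All virtual bands are attached to 0-handles. -/
def OnDisks : Prop :=
  ∀ v, (∃ i, pathFaces (B.src v) ⊆ F.m i) ∧ ∃ i, pathFaces (B.tgt v) ⊆ F.m i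

/-- Such a band meets a rectangle only within a 0-handle, hence along the arcs of the rectangle, and
no edge counted as a passage lies there. Without this, passage numbers would not be defined on
classes in the banded surface. -/
theorem over_eq_zero_of_mem_W (hB : B.OnDisks) {v : V} {c : ι → ι → ℤ} (hc : c ∈ Chain1 (B.W v)) :
    O.overHandles c = 0 := by
  refine (O.over_eq_zero_iff _).2 fun j => flow_eq_zero_of_forall fun u w hu hw hR =>
    hc.2 u w fun hW => ?_
  have hl := F.notMem_of_leaves (s := 0) (Or.inl rfl) hu hw
  have hF : ({u, w} : Finset ι) ∈ F.space := F.mem_space.2 ⟨.inr ⟨j, 0⟩, hR⟩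
  have hm : ∃ i, ({u, w} : Finset ι) ∈ F.m i := by
    rcases B.mem_arc hW hF with h | h
    · obtain ⟨i, hi⟩ := (hB v).1
      exact ⟨i, hi h⟩
    · obtain ⟨i, hi⟩ := (hB v).2
      exact ⟨i, hi h⟩
  obtain ⟨i, hi⟩ := hm
  have h2 := F.mem_A_of_two (p := .inl i) (by simp) hR hi
  rcases h2 with h | h
  · exact hl.1 h
  · exact hl.2 h

theorem over_bd2_space [Fintype V] (hB : B.OnDisks) {t : ι → ι → ι → ℤ}
    (ht : t ∈ Chain2 B.space) : O.overHandles (bd2 t) = 0 := by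
  have hF := B.sub_sum_restrict_mem ht
  have hW : ∀ v, bd2 (restrict t (B.W v \ F.space)) ∈ Chain1 (B.W v) := fun v =>
    bd2_mem_Chain1 (B.W_subcomplex v)
      (Chain2_mono (Set.inter_subset_right.trans Set.sdiff_subset) (restrict_mem ht _))
  have h := O.over_bd2 hF
  rwa [map_sub, map_sub, map_sum, map_sum,
    Finset.sum_eq_zero fun v _ => over_eq_zero_of_mem_W O hB (hW v), sub_zero] at h

/-- The combination of 1-handles over which a class on the banded surface passes, if all bands are
attached to 0-handles. -/
noncomputable def overBanded [Fintype V] (hB : B.OnDisks) : L.DH1 B.space →ₗ[ℤ] (J →₀ ℤ) :=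
  Submodule.liftQ _ (O.overHandles ∘ₗ (Z1 B.space).subtype) (by
    rintro z ⟨t, ht, htz⟩
    refine LinearMap.mem_ker.2 ?_
    rw [LinearMap.comp_apply, ← htz, over_bd2_space O hB ht]) ∘ₗ (L.DH1 B.space).subtype

theorem overBanded_cls [Fintype V] (hB : B.OnDisks) (z : L.disorientedCycles B.space) :
    overBanded O hB (L.cls B.space z) = O.overHandles z := rfl

theorem overBanded_inclDH1 [Fintype V] (hB : B.OnDisks) (h : L.DH1 F.space) :
    overBanded O hB (L.inclDH1 B.subset_space h) = L.overDH1 O h := by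
  obtain ⟨z, rfl⟩ := L.cls_surjective _ h
  rfl

/-- The disoriented part of the cycle, joined to the base points and corrected by a realized core,
is a disoriented cycle on `F_r`. The joining chains stay in 0-handles and pass over nothing, so the
relation known modulo the image of ∂₁ becomes an exact identity. -/
theorem cell1_overBanded [Fintype V] (hB : B.OnDisks) (e : B.EndPoints)
    (hs : ∀ v, ∃ i, e.sp v = .inl i) (ht : ∀ v, ∃ i, e.tp v = .inl i) (h : L.DH1 B.space) :
    O.cell1 (overBanded O hB h) = e.ends (B.boundary h) := by
  obtain ⟨x, hx⟩ := e.ends_boundary_mem O h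
  obtain ⟨z, rfl⟩ := L.cls_surjective _ h
  obtain ⟨z', hz', u, hu, hzu, hbu⟩ := e.exists_splitting z.2
  have hbz' := e.bd1_splitting z.2.1.2 hzu hbu
  choose cs hcs hbcs hos using fun v => L.exists_chain_piece O _ (e.s_piece v) (e.s_outside v)
  choose ct hct hbct hot using fun v => L.exists_chain_piece O _ (e.t_piece v) (e.t_outside v)
  obtain ⟨C, hC, hbC, hoC⟩ := L.exists_chain_core O x
  have hover : O.overHandles (z : ι → ι → ℤ) = O.overHandles z' := by
    conv_lhs => rw [hzu]
    rw [map_add, map_sum, Finset.sum_eq_zero fun v _ => over_eq_zero_of_mem_W O hB (hu v),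
      add_zero]
  have hF : z' + ∑ v, B.pass v z • (ct v - cs v) - C ∈ L.disorientedChains F.space :=
    sub_mem (add_mem hz' (Submodule.sum_mem _ fun v _ =>
      Submodule.smul_mem _ _ (sub_mem (hct v) (hcs v)))) hC
  have hb0 : bd1 (z' + ∑ v, B.pass v z • (ct v - cs v) - C) = 0 := by
    rw [map_sub, map_add, map_sum, hbC, hx, e.ends_eq_sum, map_sum, hbz',
      ← Finset.sum_add_distrib, ← Finset.sum_sub_distrib]
    refine Finset.sum_eq_zero fun v _ => ?_
    rw [boundary_cls, map_smul, map_smul, map_sub, map_sub, hbcs, hbct]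
    module
  have h0 := O.cell1_over ⟨L.disorientedChains_le hF, hb0⟩ (L.balanced_of_disoriented hF)
  have hsum : O.overHandles (∑ v, B.pass v z • (ct v - cs v)) = 0 := by
    rw [map_sum]
    refine Finset.sum_eq_zero fun v _ => ?_
    rw [map_smul, map_sub, hos v (hs v), hot v (ht v), sub_zero, smul_zero]
  rw [map_sub, map_add, hsum, add_zero, hoC, map_sub, sub_eq_zero] at h0
  rw [overBanded_cls, hover, h0, hx]

/-! ### The zeroth homology -/

theorem potential_eq_of_linked {X : Faces ι} (hX : X ⊆ F.space \ ⋃ r, L.openNbhd r) {a b : ι}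
    (h : Linked X a b) : LocalCharts.potential O a = LocalCharts.potential O b := by
  induction h with
  | refl => rfl
  | tail _ hbc ih => exact ih.trans (L.potential_eq_of_edge O (hX hbc))

variable {N : Submodule ℤ (Z →₀ ℤ)} (hN : LinearMap.range O.cell1 ≤ N)

/-- The class of a component of the cut surface in a quotient of the zeroth cellular group. -/
noncomputable def classOf (hN : LinearMap.range O.cell1 ≤ N) : F.CutComponent → (Z →₀ ℤ) ⧸ N :=
  Quot.lift (fun p => Submodule.Quotient.mk (F.rho p)) (by
    rintro _ _ (j | j)
    · rfl
    · have h := LocalCharts.mk_rho_last O j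
      symm
      rw [Submodule.Quotient.eq] at h ⊢
      exact hN h)

theorem classOf_comp (p : F.Piece) :
    classOf O hN (F.comp p) = Submodule.Quotient.mk (F.rho p) := rfl

theorem classOf_of_meets {l : List ι} (hl : pathFaces l ⊆ F.space \ ⋃ r, L.openNbhd r)
    (h2 : 2 ≤ l.length) {κ : F.CutComponent} (hκ : F.Meets l κ) {b : ι} (hb : b ∈ l)
    {p : F.Piece} (hp : ({b} : Finset ι) ∈ F.pieceFaces p) :
    classOf O hN κ = Submodule.Quotient.mk (F.rho p) := by
  obtain ⟨p', rfl, a, ha, hp'⟩ := hκ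
  have hout : ∀ a ∈ l, L.Outside a := fun a ha r hr =>
    (hl ((singleton_mem_pathFaces h2).2 ha)).2 (Set.mem_iUnion.2 ⟨r, hr⟩)
  have h1 := potential_eq_of_linked O hl (linked_pathFaces ha hb)
  rw [L.potential_eq O (hout a ha) hp', L.potential_eq O (hout b hb) hp] at h1
  rw [classOf_comp]
  rw [Submodule.Quotient.eq] at h1 ⊢
  exact hN h1

theorem classOf_of_joined (e : B.EndPoints) (hN' : LinearMap.range e.ends ≤ N)
    {κ κ' : F.CutComponent} (h : B.Joined κ κ') : classOf O hN κ = classOf O hN κ' := by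
  obtain ⟨v, hs, ht⟩ := h
  rw [classOf_of_meets O hN (Set.subset_union_left.trans (B.arcs_subset_compl v)) (B.arcs v).1.2 hs
    (e.s_mem v) (e.s_piece v),
    classOf_of_meets O hN (Set.subset_union_right.trans (B.arcs_subset_compl v)) (B.arcs v).2.2 ht
    (e.t_mem v) (e.t_piece v), Submodule.Quotient.eq, ← e.ends_single]
  exact hN' ⟨_, rfl⟩

/-- The reflection rule once more. The component containing the interior arc is special by
definition. -/
theorem classOf_of_acrossCut {κ κ' : F.CutComponent} (h : F.AcrossCut κ κ') :
    ∃ κ'', F.Special κ'' ∧ classOf O hN κ + classOf O hN κ' = (2 : ℤ) • classOf O hN κ'' := by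
  obtain ⟨r, rfl, rfl⟩ := h
  refine ⟨F.comp (.inl (F.disk r)), Or.inr ⟨r, rfl⟩, ?_⟩
  simp only [classOf_comp, RibbonSurface.rho]
  rw [F.rhoR_succ, ← Submodule.Quotient.mk_smul, ← Submodule.Quotient.mk_add]
  congr 1
  abel

/-- Components with bands have equal classes by connectedness of the band graph, and special
components share this class. Across a cut the two classes add up to twice the common value, so one
takes that value if and only if the other does; no division by two is needed. Every component is
reached in this way from a good one. -/
theorem classOf_eq (hB : B.Admissible) (e : B.EndPoints) (hN' : LinearMap.range e.ends ≤ N)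
    (κ κ' : F.CutComponent) : classOf O hN κ = classOf O hN κ' := by
  have hatt : ∀ κ κ', B.Attached κ → B.Attached κ' → classOf O hN κ = classOf O hN κ' := by
    intro κ κ' h h'
    have := hB.connected κ κ' h h'
    clear h h'
    induction this with
    | rel _ _ h => exact classOf_of_joined O hN e hN' h
    | refl _ => rfl
    | symm _ _ _ ih => exact ih.symm
    | trans _ _ _ _ _ ih ih' => exact ih.trans ih'
  have hgood : ∀ κ κ', (F.Special κ ∨ B.Attached κ) → (F.Special κ' ∨ B.Attached κ') →
      classOf O hN κ = classOf O hN κ' := by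
    intro κ κ' h h'
    rcases isEmpty_or_nonempty V with hV | hV
    · have hn : ∀ κ, ¬B.Attached κ := fun κ ⟨v, _⟩ => hV.elim v
      rw [hB.empty hV κ κ' (h.resolve_right (hn κ)) (h'.resolve_right (hn κ'))]
    · exact hatt κ κ' (h.elim (hB.attached hV κ) id) (h'.elim (hB.attached hV κ') id)
  obtain ⟨κ₀, h₀, -⟩ := hB.reaches κ
  have key : ∀ κ₁ κ₂, Relation.EqvGen F.AcrossCut κ₁ κ₂ →
      (classOf O hN κ₁ = classOf O hN κ₀ ↔ classOf O hN κ₂ = classOf O hN κ₀) := by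
    intro κ₁ κ₂ h
    induction h with
    | rel _ _ h =>
      obtain ⟨κ', hs, h⟩ := classOf_of_acrossCut O hN h
      rw [hgood κ' κ₀ (Or.inl hs) h₀, two_smul] at h
      constructor <;> intro h'
      · rw [h'] at h
        exact add_left_cancel h
      · rw [h'] at h
        exact add_right_cancel h
    | refl _ => rfl
    | symm _ _ _ ih => exact ih.symm
    | trans _ _ _ _ _ ih ih' => exact ih.trans ih'
  have hall : ∀ κ, classOf O hN κ = classOf O hN κ₀ := by
    intro κ
    obtain ⟨κ', h', hκ⟩ := hB.reaches κ
    exact (key _ _ hκ).2 (hgood κ' κ₀ h' h₀)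
  rw [hall κ, hall κ']

/-- Modulo the images of `ends` and of ∂₁ all 0-handles have the same class, so the quotient map
factors through the augmentation. -/
theorem exists_of_cell0_eq_zero (hB : B.Admissible) (e : B.EndPoints) {x : Z →₀ ℤ}
    (hx : O.cell0 x = 0) : ∃ y w, e.ends y + O.cell1 w = x := by
  set N := LinearMap.range e.ends ⊔ LinearMap.range O.cell1 with hNdef
  have hN : LinearMap.range O.cell1 ≤ N := le_sup_right
  have hmk : (Submodule.Quotient.mk x : (Z →₀ ℤ) ⧸ N) = 0 := by
    rcases isEmpty_or_nonempty Z with hZ | ⟨⟨i₀⟩⟩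
    · rw [Subsingleton.elim x 0]
      rfl
    have hq : ∀ i, N.mkQ (Finsupp.single i 1) = N.mkQ (Finsupp.single i₀ 1) := fun i =>
      classOf_eq O hN hB e le_sup_left (F.comp (.inl i)) (F.comp (.inl i₀))
    have : N.mkQ = LinearMap.toSpanSingleton ℤ _ (N.mkQ (Finsupp.single i₀ 1)) ∘ₗ O.cell0 := by
      refine Finsupp.lhom_ext' fun i => LinearMap.ext_ring ?_
      simp only [LinearMap.comp_apply, Finsupp.lsingle_apply, Disorientation.cell0,
        Finsupp.linearCombination_single, LinearMap.toSpanSingleton_apply, hq i]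
      simp
    rw [← Submodule.mkQ_apply, this, LinearMap.comp_apply, hx, map_zero]
  rw [Submodule.Quotient.mk_eq_zero] at hmk
  obtain ⟨_, ⟨y, rfl⟩, _, ⟨w, rfl⟩, h⟩ := Submodule.mem_sup.1 hmk
  exact ⟨y, w, h⟩

/-- Reflection preserves the augmentation: 2 − 1 = 1. -/
theorem cell0_rho (p : F.Piece) : O.cell0 (F.rho p) = 1 := by
  have hs : ∀ i, O.cell0 (Finsupp.single i 1) = 1 := fun i => by
    rw [Disorientation.cell0, Finsupp.linearCombination_single, smul_eq_mul, mul_one]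
  rcases p with i | ⟨j, s⟩
  · exact hs i
  · change O.cell0 (F.rhoR j s) = 1
    induction s using Fin.induction with
    | zero => exact hs _
    | succ r ih =>
      rw [F.rhoR_succ, map_sub, map_smul, hs, ih]
      norm_num

theorem cell0_ends (e : B.EndPoints) (y : V →₀ ℤ) : O.cell0 (e.ends y) = 0 := by
  have : O.cell0 ∘ₗ e.ends = 0 := by
    refine Finsupp.lhom_ext' fun v => LinearMap.ext_ring ?_
    simp only [LinearMap.comp_apply, Finsupp.lsingle_apply, e.ends_single, map_sub, cell0_rho]
    simp
  exact LinearMap.congr_fun this y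

end VirtualBands

end

/-! ### Chain maps and homotopies of four-term complexes -/

section

open CategoryTheory

section Builder

variable {C₂ C₁ C₀ C' : Type} [AddCommGroup C₂] [AddCommGroup C₁] [AddCommGroup C₀]
  [AddCommGroup C'] {d₂ : C₂ →ₗ[ℤ] C₁} {d₁ : C₁ →ₗ[ℤ] C₀} {d₀ : C₀ →ₗ[ℤ] C'}
  {h₁ : d₁ ∘ₗ d₂ = 0} {h₀ : d₀ ∘ₗ d₁ = 0}
  {E₂ E₁ E₀ E' : Type} [AddCommGroup E₂] [AddCommGroup E₁] [AddCommGroup E₀]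
  [AddCommGroup E'] {e₂ : E₂ →ₗ[ℤ] E₁} {e₁ : E₁ →ₗ[ℤ] E₀} {e₀ : E₀ →ₗ[ℤ] E'}
  {k₁ : e₁ ∘ₗ e₂ = 0} {k₀ : e₀ ∘ₗ e₁ = 0}

theorem fourTerm_d (i : ℕ) : (fourTerm d₂ d₁ d₀ h₁ h₀).d (i + 1) i =
    fourTermD (ModuleCat.ofHom d₂) (ModuleCat.ofHom d₁) (ModuleCat.ofHom d₀) i :=
  ChainComplex.of_d _ _ _

/-- The components of a map of four-term complexes. -/
def fourTermF (f₂ : C₂ →ₗ[ℤ] E₂) (f₁ : C₁ →ₗ[ℤ] E₁) (f₀ : C₀ →ₗ[ℤ] E₀) (f' : C' →ₗ[ℤ] E') :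
    ∀ n, fourTermX (ModuleCat.of ℤ C₂) (ModuleCat.of ℤ C₁) (ModuleCat.of ℤ C₀)
      (ModuleCat.of ℤ C') n ⟶ fourTermX (ModuleCat.of ℤ E₂) (ModuleCat.of ℤ E₁)
      (ModuleCat.of ℤ E₀) (ModuleCat.of ℤ E') n
  | 0 => ModuleCat.ofHom f'
  | 1 => ModuleCat.ofHom f₀
  | 2 => ModuleCat.ofHom f₁
  | 3 => ModuleCat.ofHom f₂
  | _ + 4 => 0

/-- A map of four-term complexes. -/
noncomputable def fourTermHom (f₂ : C₂ →ₗ[ℤ] E₂) (f₁ : C₁ →ₗ[ℤ] E₁) (f₀ : C₀ →ₗ[ℤ] E₀)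
    (f' : C' →ₗ[ℤ] E') (w₂ : e₂ ∘ₗ f₂ = f₁ ∘ₗ d₂) (w₁ : e₁ ∘ₗ f₁ = f₀ ∘ₗ d₁)
    (w₀ : e₀ ∘ₗ f₀ = f' ∘ₗ d₀) : fourTerm d₂ d₁ d₀ h₁ h₀ ⟶ fourTerm e₂ e₁ e₀ k₁ k₀ :=
  ChainComplex.ofHom (fourTermF f₂ f₁ f₀ f') (by
    intro n
    rw [fourTerm_d, fourTerm_d]
    rcases n with _ | _ | _ | n
    · exact ModuleCat.hom_ext w₀
    · exact ModuleCat.hom_ext w₁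
    · exact ModuleCat.hom_ext w₂
    · exact Limits.zero_comp.trans Limits.zero_comp.symm)

/-- The components of a homotopy of maps of four-term complexes. -/
def fourTermS (s₁ : C₁ →ₗ[ℤ] E₂) (s₀ : C₀ →ₗ[ℤ] E₁) (s' : C' →ₗ[ℤ] E₀) :
    ∀ n, fourTermX (ModuleCat.of ℤ C₂) (ModuleCat.of ℤ C₁) (ModuleCat.of ℤ C₀)
      (ModuleCat.of ℤ C') n ⟶ fourTermX (ModuleCat.of ℤ E₂) (ModuleCat.of ℤ E₁)
      (ModuleCat.of ℤ E₀) (ModuleCat.of ℤ E') (n + 1)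
  | 0 => ModuleCat.ofHom s'
  | 1 => ModuleCat.ofHom s₀
  | 2 => ModuleCat.ofHom s₁
  | _ + 3 => 0

theorem exists_homotopy (f g : fourTerm d₂ d₁ d₀ h₁ h₀ ⟶ fourTerm e₂ e₁ e₀ k₁ k₀)
    (s₁ : C₁ →ₗ[ℤ] E₂) (s₀ : C₀ →ₗ[ℤ] E₁) (s' : C' →ₗ[ℤ] E₀)
    (w₂ : comp2 f - comp2 g = s₁ ∘ₗ d₂)
    (w₁ : comp1 f - comp1 g = s₀ ∘ₗ d₁ + e₂ ∘ₗ s₁)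
    (w₀ : comp0 f - comp0 g = s' ∘ₗ d₀ + e₁ ∘ₗ s₀)
    (w' : (show ModuleCat.of ℤ C' ⟶ ModuleCat.of ℤ E' from f.f 0).hom -
      (show ModuleCat.of ℤ C' ⟶ ModuleCat.of ℤ E' from g.f 0).hom = e₀ ∘ₗ s') :
    Nonempty (Homotopy f g) := by
  -- The relation provides the target degree only up to a propositional equality, hence the
  -- transport. It is the identity in the cases that occur.
  let h : ∀ i j, (ComplexShape.down ℕ).Rel j i →
      ((fourTerm d₂ d₁ d₀ h₁ h₀).X i ⟶ (fourTerm e₂ e₁ e₀ k₁ k₀).X j) := fun i j r =>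
    (show (fourTerm d₂ d₁ d₀ h₁ h₀).X i ⟶ (fourTerm e₂ e₁ e₀ k₁ k₀).X (i + 1) from
      fourTermS s₁ s₀ s' i) ≫ eqToHom (by rw [← show i + 1 = j from r])
  have hh : ∀ i, h i (i + 1) rfl = fourTermS s₁ s₀ s' i := fun i => Category.comp_id _
  have key : f - g = Homotopy.nullHomotopicMap' h := by
    ext n : 1
    cases n with
    | zero =>
      rw [Homotopy.nullHomotopicMap'_f_of_not_rel_left (k₁ := 1) rfl
        (fun l hl => Nat.succ_ne_zero l hl), hh, fourTerm_d]
      exact ModuleCat.hom_ext w'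
    | succ n =>
      rw [Homotopy.nullHomotopicMap'_f (k₂ := n + 2) (k₀ := n) rfl rfl, hh, hh, fourTerm_d, fourTerm_d]
      rcases n with _ | _ | _ | n
      · exact ModuleCat.hom_ext w₀
      · exact ModuleCat.hom_ext w₁
      · refine ModuleCat.hom_ext ?_
        refine w₂.trans (LinearMap.ext fun x => ?_)
        exact (add_zero (s₁ (d₂ x))).symm
      · exact ModuleCat.hom_ext (LinearMap.ext fun _ => rfl)
  exact ⟨Homotopy.equivSubZero.symm ((Homotopy.ofEq key).trans (Homotopy.nullHomotopy' h))⟩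

end Builder

/-! ### A criterion for a homotopy equivalence -/

section Algebra

variable {M H A X Y W : Type} [AddCommGroup M] [AddCommGroup H] [AddCommGroup A]
  [AddCommGroup X] [AddCommGroup Y] [AddCommGroup W]
  {a : M →ₗ[ℤ] H} {bd : H →ₗ[ℤ] Y} {b : M →ₗ[ℤ] X} {c : X →ₗ[ℤ] A} {g₀ : Y →ₗ[ℤ] A}
  {g₁ : H →ₗ[ℤ] X}

/-- Maps into `H` are the same as compatible pairs of maps into `X` and `Y`, if `H` is their fibre
product over `A`. -/
theorem exists_lift (ha : LinearMap.range a = LinearMap.ker bd) (hb : Function.Injective b)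
    (hc : LinearMap.range b = LinearMap.ker c) (hg : c ∘ₗ g₁ = g₀ ∘ₗ bd) (hg' : g₁ ∘ₗ a = b)
    (hex : ∀ x y, c x = g₀ y → ∃ h, bd h = y) (p : W →ₗ[ℤ] X) (q : W →ₗ[ℤ] Y)
    (hpq : c ∘ₗ p = g₀ ∘ₗ q) : ∃ f : W →ₗ[ℤ] H, g₁ ∘ₗ f = p ∧ bd ∘ₗ f = q := by
  have hinj : Function.Injective (g₁.prod bd) := by
    rw [injective_iff_map_eq_zero]
    intro h h0
    obtain ⟨h1, h2⟩ := Prod.mk_inj.1 (show (g₁ h, bd h) = (0, 0) from h0)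
    obtain ⟨m, rfl⟩ : h ∈ LinearMap.range a := ha ▸ LinearMap.mem_ker.2 h2
    have : b m = 0 := by rw [← hg']; exact h1
    rw [(injective_iff_map_eq_zero b).1 hb m this, map_zero]
  have hr : ∀ w, p.prod q w ∈ LinearMap.range (g₁.prod bd) := by
    intro w
    have hw : c (p w) = g₀ (q w) := LinearMap.congr_fun hpq w
    obtain ⟨h, hh⟩ := hex _ _ hw
    -- A preimage with the right second component is wrong in the first by an element of ker `c`,
    -- which can be corrected from `M` without changing the second.
    have : p w - g₁ h ∈ LinearMap.range b := by
      rw [hc, LinearMap.mem_ker, map_sub, hw, ← hh, sub_eq_zero]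
      exact (LinearMap.congr_fun hg h).symm
    obtain ⟨m, hm⟩ := this
    refine ⟨h + a m, Prod.ext ?_ ?_⟩
    · change g₁ (h + a m) = p w
      rw [map_add, ← LinearMap.comp_apply g₁ a, hg', hm]
      abel
    · change bd (h + a m) = q w
      have : bd (a m) = 0 := LinearMap.mem_ker.1 (ha ▸ ⟨m, rfl⟩)
      rw [map_add, hh, this, add_zero]
  let f : W →ₗ[ℤ] H := (LinearEquiv.ofInjective _ hinj).symm.toLinearMap ∘ₗ
    LinearMap.codRestrict _ (p.prod q) hr
  have hf : ∀ w, g₁.prod bd (f w) = p.prod q w := fun w =>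
    congrArg Subtype.val ((LinearEquiv.ofInjective _ hinj).apply_symm_apply
      (LinearMap.codRestrict _ (p.prod q) hr w))
  exact ⟨f, LinearMap.ext fun w => congrArg Prod.fst (hf w),
    LinearMap.ext fun w => congrArg Prod.snd (hf w)⟩

theorem eq_of_comp_eq (ha : LinearMap.range a = LinearMap.ker bd) (hb : Function.Injective b)
    (hg' : g₁ ∘ₗ a = b) {f f' : W →ₗ[ℤ] H} (h : g₁ ∘ₗ f = g₁ ∘ₗ f') (h' : bd ∘ₗ f = bd ∘ₗ f') :
    f = f' := by
  refine LinearMap.ext fun w => sub_eq_zero.1 ?_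
  have h1 : g₁ (f w - f' w) = 0 := by
    rw [map_sub, sub_eq_zero]; exact LinearMap.congr_fun h w
  have h2 : bd (f w - f' w) = 0 := by
    rw [map_sub, sub_eq_zero]; exact LinearMap.congr_fun h' w
  obtain ⟨m, hm⟩ : f w - f' w ∈ LinearMap.range a := ha ▸ LinearMap.mem_ker.2 h2
  have : b m = 0 := by rw [← hg', LinearMap.comp_apply, hm, h1]
  rw [← hm, (injective_iff_map_eq_zero b).1 hb m this, map_zero]

/-- A map into the fibre product `H` is given by its two components, so both `f₁` and the homotopy
on the side of `H` are prescribed through compatible pairs. The datum `θ`, together with `m₀`, is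
the homotopy on the cellular side; `s` absorbs the signs of the 2-handles. -/
theorem exists_homotopyEquiv {E : Type} [AddCommGroup E] {c₂ : E →ₗ[ℤ] X} {c₀ : A →ₗ[ℤ] ℤ}
    {β : E →ₗ[ℤ] H} {μ : E →ₗ[ℤ] M} {s : E →ₗ[ℤ] E} {f₀ : A →ₗ[ℤ] Y} {θ : A →ₗ[ℤ] X} {m₀ : A}
    (ha : LinearMap.range a = LinearMap.ker bd) (hb : Function.Injective b)
    (hc : LinearMap.range b = LinearMap.ker c) (hg : c ∘ₗ g₁ = g₀ ∘ₗ bd) (hg' : g₁ ∘ₗ a = b)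
    (hex : ∀ x y, c x = g₀ y → ∃ h, bd h = y) (hm : c₀ m₀ = 1) (hcg : c₀ ∘ₗ g₀ = 0)
    (hβ : β = a ∘ₗ μ) (hs : s ∘ₗ s = LinearMap.id) (hμ : b ∘ₗ μ = c₂ ∘ₗ s)
    (hθ : g₀ ∘ₗ f₀ + c ∘ₗ θ + LinearMap.toSpanSingleton ℤ A m₀ ∘ₗ c₀ = LinearMap.id)
    (h₁ : c ∘ₗ c₂ = 0) (h₀ : c₀ ∘ₗ c = 0) (k₁ : bd ∘ₗ β = 0)
    (k₀ : (0 : Y →ₗ[ℤ] PUnit) ∘ₗ bd = 0) :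
    ∃ e : HomotopyEquiv (fourTerm c₂ c c₀ h₁ h₀) (fourTerm β bd (0 : Y →ₗ[ℤ] PUnit) k₁ k₀),
      comp0 e.hom = f₀ ∧ comp0 e.inv = g₀ ∧ comp1 e.inv = g₁ ∧ comp2 e.hom = s ∧
      comp2 e.inv = s ∧ g₁ ∘ₗ comp1 e.hom = LinearMap.id - θ ∘ₗ c ∧
      bd ∘ₗ comp1 e.hom = f₀ ∘ₗ c := by
  have hθ' : ∀ x, c (θ x) = x - g₀ (f₀ x) - c₀ x • m₀ := by
    intro x
    have := LinearMap.congr_fun hθ x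
    simp only [LinearMap.add_apply, LinearMap.comp_apply, LinearMap.toSpanSingleton_apply,
      LinearMap.id_apply] at this
    calc c (θ x) = (g₀ (f₀ x) + c (θ x) + c₀ x • m₀) - g₀ (f₀ x) - c₀ x • m₀ := by abel
      _ = _ := by rw [this]
  have h₀' : ∀ x, c₀ (c x) = 0 := LinearMap.congr_fun h₀
  have h₁' : ∀ x, c (c₂ x) = 0 := LinearMap.congr_fun h₁
  have hcg' : ∀ y, c₀ (g₀ y) = 0 := LinearMap.congr_fun hcg
  have hgx : ∀ h, c (g₁ h) = g₀ (bd h) := LinearMap.congr_fun hg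
  have hμ' : ∀ x, b (μ x) = c₂ (s x) := LinearMap.congr_fun hμ
  have hs' : ∀ x, s (s x) = x := LinearMap.congr_fun hs
  have hga : ∀ x, g₁ (a x) = b x := LinearMap.congr_fun hg'
  have hba : ∀ x, bd (a x) = 0 := fun x => LinearMap.mem_ker.1 (ha ▸ ⟨x, rfl⟩)
  -- The first component is forced by the wish that `g₁ ∘ f₁` be the identity up to `θ ∘ c`; the
  -- second is the chain map condition.
  obtain ⟨f₁, hf₁, hf₁'⟩ := exists_lift ha hb hc hg hg' hex (LinearMap.id - θ ∘ₗ c) (f₀ ∘ₗ c)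
    (by
      refine LinearMap.ext fun x => ?_
      simp only [LinearMap.comp_apply, LinearMap.sub_apply, LinearMap.id_apply, map_sub, hθ', h₀',
        zero_smul]
      abel)
  -- Likewise `κ` must have boundary `id − f₀ g₀`, and its first component is chosen so that `κ ∘
  -- bd` measures the failure of `f₁ g₁` to be the identity.
  obtain ⟨κ, hκ, hκ'⟩ := exists_lift ha hb hc hg hg' hex (θ ∘ₗ g₀) (LinearMap.id - f₀ ∘ₗ g₀)
    (by
      refine LinearMap.ext fun x => ?_
      simp only [LinearMap.comp_apply, LinearMap.sub_apply, LinearMap.id_apply, map_sub, hθ', hcg',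
        zero_smul]
      abel)
  have w₂ : β ∘ₗ s = f₁ ∘ₗ c₂ := by
    refine eq_of_comp_eq ha hb hg' ?_ ?_
    · rw [← LinearMap.comp_assoc, hβ, ← LinearMap.comp_assoc, ← LinearMap.comp_assoc, hf₁]
      refine LinearMap.ext fun x => ?_
      simp [hga, hμ', hs', h₁']
    · rw [← LinearMap.comp_assoc, hβ, ← LinearMap.comp_assoc, ← LinearMap.comp_assoc, hf₁']
      refine LinearMap.ext fun x => ?_
      simp [hba, h₁']
  have v₂ : c₂ ∘ₗ s = g₁ ∘ₗ β := by
    rw [hβ, ← hμ, ← LinearMap.comp_assoc, hg']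
  let f : fourTerm c₂ c c₀ h₁ h₀ ⟶ fourTerm β bd (0 : Y →ₗ[ℤ] PUnit) k₁ k₀ :=
    fourTermHom s f₁ f₀ 0 w₂ hf₁' rfl
  let g : fourTerm β bd (0 : Y →ₗ[ℤ] PUnit) k₁ k₀ ⟶ fourTerm c₂ c c₀ h₁ h₀ :=
    fourTermHom s g₁ g₀ 0 v₂ hg hcg
  have H₁ : Nonempty (Homotopy (𝟙 _) (f ≫ g)) := by
    refine exists_homotopy _ _ 0 θ (LinearMap.toSpanSingleton ℤ A m₀) ?_ ?_ ?_ ?_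
    · change LinearMap.id - s ∘ₗ s = _
      rw [hs]; simp
    · change LinearMap.id - g₁ ∘ₗ f₁ = _
      rw [hf₁]; simp
    · change LinearMap.id - g₀ ∘ₗ f₀ = _
      rw [← hθ]; abel
    · change LinearMap.id - 0 = _
      refine LinearMap.ext_ring ?_
      simp [hm]
  have H₂ : Nonempty (Homotopy (𝟙 _) (g ≫ f)) := by
    refine exists_homotopy _ _ 0 κ 0 ?_ ?_ ?_ ?_
    · change LinearMap.id - s ∘ₗ s = _
      rw [hs]; simp
    · change LinearMap.id - f₁ ∘ₗ g₁ = _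
      rw [LinearMap.comp_zero, add_zero]
      refine eq_of_comp_eq ha hb hg' ?_ ?_
      · rw [LinearMap.comp_sub, ← LinearMap.comp_assoc, hf₁, ← LinearMap.comp_assoc, hκ]
        refine LinearMap.ext fun x => ?_
        simp [hgx]
      · rw [LinearMap.comp_sub, ← LinearMap.comp_assoc, hf₁', ← LinearMap.comp_assoc, hκ']
        refine LinearMap.ext fun x => ?_
        simp [hgx]
    · change LinearMap.id - f₀ ∘ₗ g₀ = _
      rw [hκ']; simp
    · exact LinearMap.ext fun _ => rfl
  exact ⟨⟨f, g, H₁.some.symm, H₂.some.symm⟩, rfl, rfl, rfl, rfl, rfl, hf₁, hf₁'⟩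

end Algebra

end

section

/-! ### Liftings and splittings over free abelian groups -/

section Algebra

variable {M H A X Y : Type} [AddCommGroup M] [AddCommGroup H] [AddCommGroup A]
  [AddCommGroup X] [AddCommGroup Y]
  {a : M →ₗ[ℤ] H} {bd : H →ₗ[ℤ] Y} {b : M →ₗ[ℤ] X} {c : X →ₗ[ℤ] A} {g₀ : Y →ₗ[ℤ] A}

theorem exists_lift_of_range_le [Module.Free ℤ Y] {f : Y →ₗ[ℤ] A}
    (h : LinearMap.range f ≤ LinearMap.range c) : ∃ t : Y →ₗ[ℤ] X, c ∘ₗ t = f := by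
  obtain ⟨t, ht⟩ := Module.projective_lifting_property c.rangeRestrict
    (f.codRestrict (LinearMap.range c) fun y => h ⟨y, rfl⟩) c.surjective_rangeRestrict
  exact ⟨t, LinearMap.ext fun y => congrArg Subtype.val (LinearMap.congr_fun ht y)⟩

/-- The image of `bd` is a subgroup of a free abelian group of finite rank, hence free, so `H`
splits as the image of `a` plus a complement. On the first summand `g₁` is prescribed by `b`; on the
second it is a lift of `g₀` through `c`. -/
theorem exists_extension [Module.Free ℤ Y] [Module.Finite ℤ Y] (hinj : Function.Injective a)
    (ha : LinearMap.range a = LinearMap.ker bd) (hc : LinearMap.range b = LinearMap.ker c)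
    (hbd : ∀ h, g₀ (bd h) ∈ LinearMap.range c) :
    ∃ g₁ : H →ₗ[ℤ] X, c ∘ₗ g₁ = g₀ ∘ₗ bd ∧ g₁ ∘ₗ a = b := by
  have : Module.Free ℤ (LinearMap.range bd) :=
    Module.Free.of_basis (Submodule.basisOfPid (Module.Free.chooseBasis ℤ Y) _).2
  obtain ⟨t, ht⟩ := exists_lift_of_range_le (c := c)
    (f := g₀ ∘ₗ (LinearMap.range bd).subtype) (by
      rintro _ ⟨⟨_, h, rfl⟩, rfl⟩
      exact hbd h)
  obtain ⟨σ, hσ⟩ := Module.projective_lifting_property bd.rangeRestrict LinearMap.id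
    bd.surjective_rangeRestrict
  have hσ' : ∀ h, bd (σ (bd.rangeRestrict h)) = bd h := fun h =>
    congrArg Subtype.val (LinearMap.congr_fun hσ (bd.rangeRestrict h))
  let p : H →ₗ[ℤ] LinearMap.range a :=
    (LinearMap.id - σ ∘ₗ bd.rangeRestrict).codRestrict _ fun h => by
      rw [ha, LinearMap.mem_ker, LinearMap.sub_apply, map_sub, sub_eq_zero]
      exact (hσ' h).symm
  let r : H →ₗ[ℤ] M := (LinearEquiv.ofInjective a hinj).symm.toLinearMap ∘ₗ p
  have hr : ∀ h, a (r h) = h - σ (bd.rangeRestrict h) := fun h =>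
    congrArg Subtype.val ((LinearEquiv.ofInjective a hinj).apply_symm_apply (p h))
  refine ⟨b ∘ₗ r + t ∘ₗ bd.rangeRestrict, LinearMap.ext fun h => ?_, LinearMap.ext fun m => ?_⟩
  · have h1 : c (b (r h)) = 0 := LinearMap.mem_ker.1 (hc ▸ ⟨r h, rfl⟩)
    have h2 : c (t (bd.rangeRestrict h)) = g₀ (bd h) := LinearMap.congr_fun ht _
    change c (b (r h) + t (bd.rangeRestrict h)) = g₀ (bd h)
    rw [map_add, h1, h2, zero_add]
  · have h0 : bd.rangeRestrict (a m) = 0 :=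
      Subtype.ext (LinearMap.mem_ker.1 (ha ▸ ⟨m, rfl⟩))
    have h1 : r (a m) = m := hinj (by rw [hr, h0, map_zero, sub_zero])
    change b (r (a m)) + t (bd.rangeRestrict (a m)) = b m
    rw [h0, h1, map_zero, add_zero]

/-- The element `x − c₀(x) m₀` has augmentation zero, so it is a sum of a value of `g₀` and one of
`c`. Freeness of `A` lets the two preimages be chosen linearly in `x`. -/
theorem exists_contraction [Module.Free ℤ A] {c₀ : A →ₗ[ℤ] ℤ} {m₀ : A} (hm : c₀ m₀ = 1)
    (hex : ∀ x, c₀ x = 0 → ∃ y w, g₀ y + c w = x) :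
    ∃ (f₀ : A →ₗ[ℤ] Y) (θ : A →ₗ[ℤ] X),
      g₀ ∘ₗ f₀ + c ∘ₗ θ + LinearMap.toSpanSingleton ℤ A m₀ ∘ₗ c₀ = LinearMap.id := by
  obtain ⟨t, ht⟩ := exists_lift_of_range_le (c := g₀.coprod c)
    (f := LinearMap.id - LinearMap.toSpanSingleton ℤ A m₀ ∘ₗ c₀) (by
      rintro _ ⟨x, rfl⟩
      obtain ⟨y, w, h⟩ := hex ((LinearMap.id - LinearMap.toSpanSingleton ℤ A m₀ ∘ₗ c₀ : A →ₗ[ℤ] A) x)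
        (by simp [hm])
      exact ⟨(y, w), h⟩)
  refine ⟨LinearMap.fst ℤ Y X ∘ₗ t, LinearMap.snd ℤ Y X ∘ₗ t, LinearMap.ext fun x => ?_⟩
  have h1 : g₀ (t x).1 + c (t x).2 = x - c₀ x • m₀ := LinearMap.congr_fun ht x
  change g₀ (t x).1 + c (t x).2 + c₀ x • m₀ = x
  rw [h1, sub_add_cancel]

end Algebra

/-! ### The cellular complex -/

section

open scoped Classical

set_option linter.unusedSectionVars false

variable {ι : Type} [Fintype ι] [DecidableEq ι] {K : Triangulation ι} {Z J D V : Type}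
  {F : RibbonSurface K Z J} {T : TwoHandles F D} [Fintype Z] [Fintype J]

namespace Disorientation

variable (O : Disorientation T)

theorem cell2_single (i : D) : O.cell2 (Finsupp.single i 1) = O.overHandles (O.bflat i) := by
  rw [cell2, Finsupp.linearCombination_single, one_smul, overHandles, LinearMap.sum_apply]
  rfl

theorem cell0_cell1 : O.cell0 ∘ₗ O.cell1 = 0 := by
  refine Finsupp.lhom_ext' fun j => LinearMap.ext_ring ?_
  simp only [LinearMap.comp_apply, Finsupp.lsingle_apply, cell1, cell0,
    Finsupp.linearCombination_single, map_smul, map_sum, map_sub]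
  simp

theorem cell0_single (i : Z) : O.cell0 (Finsupp.single i 1) = 1 := by
  rw [cell0, Finsupp.linearCombination_single, smul_eq_mul, mul_one]

end Disorientation

variable (O : Disorientation T) (S : SphereData T) (L : LocalCharts F)

/-- The class of the cycle `b i` in the disoriented homology of the ribbon surface. -/
theorem exists_class_b (i : D) : ∃ s : ℤˣ, ∃ h : L.DH1 F.space,
    (h : H1 F.space) = H1.mk F.space ⟨S.b i, S.b_mem_Z1 i⟩ ∧
      L.overDH1 O h = O.cell2 ((s : ℤ) • Finsupp.single i 1) := by
  obtain ⟨s, φ, hφ, hb⟩ := S.exists_b_eq i O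
  obtain ⟨h, hh, ho⟩ := L.mk_mem_DH1_of_balanced O ⟨S.b i, S.b_mem_Z1 i⟩ (S.flow_b i)
  refine ⟨s, h, hh, ?_⟩
  change _ = O.overHandles (S.b i) at ho
  rw [ho, hb, map_add, O.over_bd2 hφ, add_zero, map_smul, map_smul, O.cell2_single]

variable {L} in
theorem VirtualBands.IsStar.onDisks {B : VirtualBands F L V} {i₀ : Z} {σ : V ≃ {i : Z // i ≠ i₀}}
    (h : B.IsStar i₀ σ) : B.OnDisks := fun v => ⟨⟨_, (h v).1⟩, ⟨_, (h v).2⟩⟩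

end

end

end DisorientedHomology

/-! ### Assembly of the homotopy equivalences -/

theorem mainTheorem9 {ι Z J D V : Type} [Fintype ι] [DecidableEq ι] [Fintype Z] [DecidableEq Z]
    [Nonempty Z] [Fintype J] [DecidableEq J] [Fintype D] [Fintype V]
    (K : Triangulation ι) (F : RibbonSurface K Z J) (T : TwoHandles F D)
    (O : Disorientation T) (S : SphereData T) (L : LocalCharts F)
    (B : VirtualBands F L V) (hB : B.Admissible) :
    ∃ (h₁ : O.cell1 ∘ₗ O.cell2 = 0) (h₀ : O.cell0 ∘ₗ O.cell1 = 0)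
      (β : D → L.DH1 B.space) (hβ : B.boundary ∘ₗ Finsupp.linearCombination ℤ β = 0),
      -- `β i` is the class of `b_i`, which is a cycle on `F_r` with class in `DH_1(F_r)`
      (∀ i, ∃ b : Z1 F.space, (b : ι → ι → ℤ) = S.b i ∧ H1.mk F.space b ∈ L.DH1 F.space ∧
        ∃ b' : Z1 B.space, (b' : ι → ι → ℤ) = S.b i ∧ H1.mk B.space b' = β i) ∧
      -- the two complexes have isomorphic homology, and are homotopy equivalent
      (∀ k, Nonempty ((cellularComplex O h₁ h₀).homology k ≅ (virtualComplex B β hβ).homology k)) ∧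
      Nonempty (HomotopyEquiv (cellularComplex O h₁ h₀) (virtualComplex B β hβ)) ∧
      -- for the star-shaped collections of bands there is an explicit homotopy equivalence
      ∀ (i₀ : Z) (σ : V ≃ {i : Z // i ≠ i₀}), B.IsStar i₀ σ →
        ∃ e : HomotopyEquiv (cellularComplex O h₁ h₀) (virtualComplex B β hβ),
          (∀ i, comp0 e.hom (Finsupp.single i 1) =
            if h : i ≠ i₀ then Finsupp.single (σ.symm ⟨i, h⟩) 1 else 0) ∧
          (∀ j, ∃ z : Z1 B.space, (z : ι → ι → ℤ) ∈ L.disorientedCycles B.space ∧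
            (∀ k, passOver F O.ε k z = if k = j then 1 else 0) ∧
            H1.mk B.space z = comp1 e.hom (Finsupp.single j 1)) ∧
          (∀ i, comp2 e.hom (Finsupp.single i 1) = Finsupp.single i 1 ∨
            comp2 e.hom (Finsupp.single i 1) = - Finsupp.single i 1) ∧
          (∀ v, comp0 e.inv (Finsupp.single v 1) =
            Finsupp.single (σ v : Z) 1 - Finsupp.single i₀ 1) ∧
          comp1 e.inv ∘ₗ comp1 e.hom = LinearMap.id ∧ comp1 e.hom ∘ₗ comp1 e.inv = LinearMap.id ∧
          comp2 e.inv ∘ₗ comp2 e.hom = LinearMap.id ∧ comp2 e.hom ∘ₗ comp2 e.inv = LinearMap.id := by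
  classical
  obtain ⟨i₁⟩ := ‹Nonempty Z›
  choose s m hm hms using exists_class_b O S L
  let μ : (D →₀ ℤ) →ₗ[ℤ] L.DH1 F.space := Finsupp.linearCombination ℤ m
  -- The orientations and colourings of the spheres and of the disks are chosen independently; `sg`
  -- records the resulting sign for each 2-handle.
  let sg : (D →₀ ℤ) →ₗ[ℤ] (D →₀ ℤ) :=
    Finsupp.linearCombination ℤ fun i => (s i : ℤ) • Finsupp.single i 1
  have hsg : ∀ i, sg (Finsupp.single i 1) = (s i : ℤ) • Finsupp.single i 1 := fun i => by
    simp only [sg, Finsupp.linearCombination_single, one_smul]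
  have hsg2 : sg ∘ₗ sg = LinearMap.id := by
    refine Finsupp.lhom_ext' fun i => LinearMap.ext_ring ?_
    have : (s i : ℤ) * (s i : ℤ) = 1 := by rw [← Units.val_mul, Int.units_mul_self, Units.val_one]
    simp only [LinearMap.comp_apply, Finsupp.lsingle_apply, hsg, map_smul, smul_smul, this,
      one_smul, LinearMap.id_apply]
  have hμ : L.overDH1 O ∘ₗ μ = O.cell2 ∘ₗ sg := by
    refine Finsupp.lhom_ext' fun i => LinearMap.ext_ring ?_
    simp only [LinearMap.comp_apply, Finsupp.lsingle_apply, hsg, μ,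
      Finsupp.linearCombination_single, one_smul, hms]
  have hc := L.range_overDH1 O
  have hbinj := L.overDH1_injective O
  have h₁ : O.cell1 ∘ₗ O.cell2 = 0 := by
    -- As `sg` is an involution, ∂₂♭ factors through passage numbers of disoriented cycles, and
    -- these lie in the kernel of ∂₁♭.
    have h : O.cell1 ∘ₗ O.cell2 = (O.cell1 ∘ₗ L.overDH1 O) ∘ₗ μ ∘ₗ sg := by
      rw [LinearMap.comp_assoc, ← LinearMap.comp_assoc sg, hμ, LinearMap.comp_assoc, hsg2,
        LinearMap.comp_id]
    rw [h, LinearMap.range_le_ker_iff.1 hc.le, LinearMap.zero_comp]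
  have h₀ := O.cell0_cell1
  obtain ⟨e₀⟩ := B.exists_endPoints
  have ha := e₀.range_inclDH1
  let β : D → L.DH1 B.space := fun i => L.inclDH1 B.subset_space (m i)
  have hβμ : Finsupp.linearCombination ℤ β = L.inclDH1 B.subset_space ∘ₗ μ := by
    refine Finsupp.lhom_ext' fun i => LinearMap.ext_ring ?_
    simp only [LinearMap.comp_apply, Finsupp.lsingle_apply, μ, β,
      Finsupp.linearCombination_single, one_smul]
  have hβ : B.boundary ∘ₗ Finsupp.linearCombination ℤ β = 0 := by
    rw [hβμ, ← LinearMap.comp_assoc, LinearMap.range_le_ker_iff.1 ha.le, LinearMap.zero_comp]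
  -- For general bands `g₁`, `f₀` and `θ` exist only by freeness of the groups involved; no
  -- canonical choice is made.
  have hequiv : Nonempty (HomotopyEquiv (cellularComplex O h₁ h₀) (virtualComplex B β hβ)) := by
    obtain ⟨g₁, hg, hg'⟩ := exists_extension B.inclDH1_injective ha hc (e₀.ends_boundary_mem O)
    obtain ⟨f₀, θ, hθ⟩ := exists_contraction (O.cell0_single i₁)
      (fun x hx => VirtualBands.exists_of_cell0_eq_zero O hB e₀ hx)
    obtain ⟨e, -⟩ := exists_homotopyEquiv ha hbinj hc hg hg' (e₀.exists_boundary_eq O)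
      (O.cell0_single i₁) (LinearMap.ext (VirtualBands.cell0_ends O e₀)) hβμ hsg2 hμ hθ h₁ h₀ hβ
      (LinearMap.zero_comp _)
    exact ⟨e⟩
  refine ⟨h₁, h₀, β, hβ, fun i => ?_, fun k => ?_, hequiv, fun i₀ σ hσ => ?_⟩
  · refine ⟨⟨S.b i, S.b_mem_Z1 i⟩, rfl, hm i ▸ (m i).2,
      ⟨S.b i, Z1_mono B.subset_space (S.b_mem_Z1 i)⟩, rfl, ?_⟩
    change _ = LocalCharts.inclH1 B.subset_space (m i : H1 F.space)
    rw [hm]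
    rfl
  · exact ⟨hequiv.some.toHomologyIso k⟩
  · obtain ⟨e', hsp, htp⟩ := B.exists_endPoints_of_isStar hσ
    have hends : ∀ v, e'.ends (Finsupp.single v 1) =
        Finsupp.single (σ v : Z) 1 - Finsupp.single i₀ 1 := fun v => by
      rw [e'.ends_single, hsp, htp]
      rfl
    let f₀ : (Z →₀ ℤ) →ₗ[ℤ] (V →₀ ℤ) := Finsupp.linearCombination ℤ fun i =>
      if h : i ≠ i₀ then Finsupp.single (σ.symm ⟨i, h⟩) 1 else 0
    have hf₀ : ∀ i, f₀ (Finsupp.single i 1) =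
        if h : i ≠ i₀ then Finsupp.single (σ.symm ⟨i, h⟩) 1 else 0 := fun i => by
      simp only [f₀, Finsupp.linearCombination_single, one_smul]
    have hfg : f₀ ∘ₗ e'.ends = LinearMap.id := by
      refine Finsupp.lhom_ext' fun v => LinearMap.ext_ring ?_
      simp only [LinearMap.comp_apply, Finsupp.lsingle_apply, hends, map_sub, hf₀,
        LinearMap.id_apply]
      rw [dif_pos (σ v).2, dif_neg (by simp), sub_zero, Subtype.coe_eta, σ.symm_apply_apply]
    -- For a star `g₀ f₀` is exactly the projection `m_i ↦ m_i − m_0`, so `θ = 0` works. This is why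
    -- `g₁ f₁` will be the identity and not merely homotopic to it.
    have hθ : e'.ends ∘ₗ f₀ + O.cell1 ∘ₗ (0 : (Z →₀ ℤ) →ₗ[ℤ] (J →₀ ℤ)) +
        LinearMap.toSpanSingleton ℤ _ (Finsupp.single i₀ 1) ∘ₗ O.cell0 = LinearMap.id := by
      refine Finsupp.lhom_ext' fun i => LinearMap.ext_ring ?_
      simp only [LinearMap.comp_apply, LinearMap.add_apply, Finsupp.lsingle_apply, hf₀,
        LinearMap.id_apply, LinearMap.toSpanSingleton_apply, O.cell0_single, LinearMap.zero_apply,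
        map_zero, add_zero, one_smul]
      by_cases h : i = i₀
      · rw [dif_neg (by simpa using h), map_zero, zero_add, h]
      · rw [dif_pos h, hends, σ.apply_symm_apply, sub_add_cancel]
    have hD := hσ.onDisks
    have hg : O.cell1 ∘ₗ VirtualBands.overBanded O hD = e'.ends ∘ₗ B.boundary :=
      -- All bands lie on 0-handles, so passage numbers are defined on DH₁(G_r) and replace the
      -- non-canonical extension `g₁`. They also give the description of `f₁` on the cores.
      LinearMap.ext (VirtualBands.cell1_overBanded O hD e' (fun v => ⟨_, hsp v⟩)
        fun v => ⟨_, htp v⟩)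
    have hg' : VirtualBands.overBanded O hD ∘ₗ L.inclDH1 B.subset_space = L.overDH1 O :=
      LinearMap.ext (VirtualBands.overBanded_inclDH1 O hD)
    obtain ⟨e, he0, hi0, hi1, he2, hi2, hgf, hbf⟩ := exists_homotopyEquiv ha hbinj hc hg hg'
      (e'.exists_boundary_eq O) (O.cell0_single i₀)
      (LinearMap.ext (VirtualBands.cell0_ends O e')) hβμ hsg2 hμ hθ h₁ h₀ hβ
      (LinearMap.zero_comp _)
    rw [LinearMap.zero_comp, sub_zero] at hgf
    refine ⟨e, fun i => ?_, fun j => ?_, fun i => ?_, fun v => ?_, ?_, ?_, ?_, ?_⟩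
    · exact (LinearMap.congr_fun he0 _).trans (hf₀ i)
    · obtain ⟨z, hz⟩ := L.cls_surjective B.space (comp1 e.hom (Finsupp.single j 1))
      refine ⟨⟨z, z.2.1⟩, z.2, fun k => ?_, congrArg Subtype.val hz⟩
      have h := LinearMap.congr_fun hgf (Finsupp.single j 1)
      rw [LinearMap.comp_apply, ← hz, VirtualBands.overBanded_cls, LinearMap.id_apply] at h
      change passOver F O.ε k (z : ι → ι → ℤ) = _
      rw [← O.over_apply, h, Finsupp.single_apply]
      simp only [eq_comm]
    · have h : comp2 e.hom (Finsupp.single i 1) = (s i : ℤ) • Finsupp.single i 1 :=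
        (LinearMap.congr_fun he2 _).trans (hsg i)
      rcases Int.units_eq_one_or (s i) with hs | hs
      · exact Or.inl (by rw [h, hs, Units.val_one, one_smul])
      · exact Or.inr (by rw [h, hs, Units.val_neg, Units.val_one, neg_smul, one_smul])
    · exact (LinearMap.congr_fun hi0 _).trans (hends v)
    · rw [hi1]
      exact hgf
    · rw [hi1]
      -- The other composite is checked on both components of the fibre product, the second one
      -- using `f₀ g₀ = id`.
      refine eq_of_comp_eq ha hbinj hg' ?_ ?_
      · rw [← LinearMap.comp_assoc, hgf]
        rfl
      · rw [← LinearMap.comp_assoc, hbf, LinearMap.comp_assoc, hg, ← LinearMap.comp_assoc, hfg]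
        rfl
    · rw [hi2, he2]
      exact hsg2
    · rw [hi2, he2]
      exact hsg2
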